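/- **Setting.** Let $r\ge 2$ and $\gamma>0$. Let $\Omega\subset\mathbb R^2$ be a polygonal domain with a conforming partition into closed convex quadrilaterals $K_1,\dots,K_N$ (coarse elements), $H=\max_i \operatorname{diam}K_i$, quasi-uniform in the sense that every triangle formed by three vertices of a $K_i$ has area at least $\gamma H^2/2$. Let $\mathcal T_h$ be a conforming partition of $\Omega$ into triangles that refines the coarse one and is shape regular: the area of $T$ is at least $\gamma\operatorname{diam}(T)^2/2$ for $T\in\mathcal T_h$. Let the Lamé coefficients $\lambda\ge 0$, $\mu>0$ be constant on every $T\in\mathcal T_h$, and put $$\mathcal A\tau=\frac1{2\mu}\Big(\tau-\frac{\operatorname{tr}\tau}{2}I\Big)+\frac{\operatorname{tr}\tau}{2(2\lambda+2\mu)}I,\qquad \tilde k=(\lambda+2\mu)H^{-2}.$$ Join the barycenter of each $T$ to its vertices, which splits $T$ into $t_1,t_2,t_3$. Let $$\Sigma_h=\{\tau\in H(\operatorname{div};\Omega,\mathbb S):\ \tau|_{t_m}\in P_r(t_m,\mathbb S),\ \operatorname{div}\tau|_T\in P_{r-1}(T,\mathbb R^2)\ \ \forall\, T\in\mathcal T_h,\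 \tau n=0\text{ on }\partial\Omega\},$$ $$U_h=\{v\in L^2(\Omega)^2:\ v|_T\in P_{r-1}(T,\mathbb R^2)\ \ \forall\, T\in\mathcal T_h\},$$ where $\mathbb S$ is the space of symmetric $2\times2$ matrices. For a union $R$ of coarse elements let $U_h(R)$ be the restrictions of $U_h$ to $R$ and $\Sigma_h(R)$ the fields of $\Sigma_h$ on $R$ with $\tau n=0$ on $\partial R$, both extended by zero. Let $(\cdot,\cdot)$ be the $L^2(\Omega)$ product and $$s_i(p,q)=\int_{K_i}\tilde k\,p\cdot q,\quad s=\sum_i s_i,\quad \|q\|_s^2=s(q,q),\quad \|\tau\|_\Sigma^2=(\mathcal A\tau,\tau)+\int_\Omega\tilde k^{-1}|\operatorname{div}\tau|^2 .$$ **Auxiliary space.** For each $i$ let $(\phi^i_j,p^i_j,\lambda^i_j)_{1\le j\le L_i}$, with $L_i=\dim U_h(K_i)$ and $\lambda^i_1\le\dots\le\lambda^i_{L_i}$, be a complete system of eigensolutions in $\Sigma_h(K_i)\times U_h(K_i)\times\mathbb R$ of $$(\mathcal A\phi^i_j,\tau)+(\operatorname{div}\tau,p^i_j)=0\ \ \forall\tau\in\Sigma_h(K_i),\qquad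 -(\operatorname{div}\phi^i_j,v)=\lambda^i_j\,s_i(p^i_j,v)\ \ \forall v\in U_h(K_i),$$ where $(p^i_j)_j$ is an $s_i$-orthonormal basis of $U_h(K_i)$. Choose $1\le l_i<L_i$, let $\pi q=\sum_i\sum_{j\le l_i}s_i(q,p^i_j)p^i_j$ and $\Lambda=\min_i\lambda^i_{l_i+1}$, and assume $\Lambda>0$. **Basis functions.** Let $K_{i,0}=K_i$ and let $K_{i,m+1}$ be the union of the coarse elements that meet $K_{i,m}$ (at least in a vertex). For $j\le l_i$ let $(\psi^i_j,q^i_j)\in\Sigma_h\times U_h$ solve $$(\mathcal A\psi,\tau)+(\operatorname{div}\tau,q)=0\ \ \forall\tau\in\Sigma_h,\qquad s(\pi q,\pi v)-(\operatorname{div}\psi,v)=s(p^i_j,v)\ \ \forall v\in U_h,$$ and let $(\psi^i_{j,\mathrm{ms}},q^i_{j,\mathrm{ms}})\in\Sigma_h(K_{i,l})\times U_h(K_{i,l})$ solve the same problem with $\Sigma_h,U_h$ replaced by $\Sigma_h(K_{i,l}),U_h(K_{i,l})$. **Claim.** There is a constant $C>0$, depending only on $r$ and $\gamma$ (in particular not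 on $h$, $H$, the Lamé coefficients or the numbers $l_i$), such that for all $i$, all $j\le l_i$ and all $l\ge2$ $$\|\psi^i_j-\psi^i_{j,\mathrm{ms}}\|_\Sigma^2+\|q^i_j-q^i_{j,\mathrm{ms}}\|_s^2\le C_\#\,\|p^i_j\|_s^2,\qquad C_\#=C\Big(1+\frac1\Lambda\Big)\Big(1+C^{-1}\Big(1+\frac1\Lambda\Big)^{-1/2}\Big)^{1-l}.$$ -/

import Mathlib

open scoped ContDiff

noncomputable section

/-- The plane `ℝ²` with its Euclidean norm. -/
abbrev Plane := EuclideanSpace ℝ (Fin 2)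

namespace Elast

/-- Twice the signed area of the triangle with vertices `a`, `b`, `c`. -/
def cross (a b c : Plane) : ℝ :=
  (b 0 - a 0) * (c 1 - a 1) - (b 1 - a 1) * (c 0 - a 0)

/-- The vertices of a coarse partition into quadrilaterals and of a fine partition into
triangles (the conditions on them are collected in `TwoScaleMesh.IsRegular`). -/
structure TwoScaleMesh where
  /-- number of coarse elements -/
  N : ℕ
  /-- number of fine elements -/
  Nh : ℕ
  /-- vertices of the coarse quadrilaterals, in counterclockwise order -/
  quad : Fin N → Fin 4 → Plane
  /-- vertices of the fine triangles -/
  tri : Fin Nh → Fin 3 → Plane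

namespace TwoScaleMesh

variable (M : TwoScaleMesh)

/-- The closed coarse element `K_i`. -/
def K (i : Fin M.N) : Set Plane := convexHull ℝ (Set.range (M.quad i))

/-- The closed fine triangle `T_t`. -/
def T (t : Fin M.Nh) : Set Plane := convexHull ℝ (Set.range (M.tri t))

/-- The barycenter of the fine triangle `T_t`. -/
def bary (t : Fin M.Nh) : Plane := (1 / 3 : ℝ) • ∑ c, M.tri t c

/-- The three closed sub-triangles of `T_t` obtained by joining the barycenter to the vertices:
in the sub-triangle number `c` the barycenter replaces the vertex number `c`. -/
def subT (t : Fin M.Nh) (c : Fin 3) : Set Plane :=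
  convexHull ℝ (Set.range (Function.update (M.tri t) c (M.bary t)))

/-- The coarse mesh size `H`. -/
def H : ℝ := ⨆ i, Metric.diam (M.K i)

/-- The (open, polygonal) domain covered by the mesh. -/
def Ω : Set Plane := interior (⋃ i, M.K i)

/-- `γ` bounds the quasi-uniformity of the coarse mesh and the shape regularity of the fine mesh,
both meshes are conforming, and the fine mesh is a refinement of the coarse one. -/
structure IsRegular (γ : ℝ) : Prop where
  /-- All corners of a coarse element are convex, and all triangles formed by three of its
  vertices have area comparable with `H ^ 2`. -/
  coarse_quasiUniform : ∀ i a,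
    γ * M.H ^ 2 ≤ cross (M.quad i a) (M.quad i (a + 1)) (M.quad i (a + 2))
  coarse_disjoint : ∀ i j, i ≠ j → Disjoint (interior (M.K i)) (interior (M.K j))
  /-- Two coarse elements meet in nothing, in a common vertex or in a common edge. -/
  coarse_conforming : ∀ i j, i ≠ j →
    M.K i ∩ M.K j = convexHull ℝ (Set.range (M.quad i) ∩ Set.range (M.quad j))
  fine_nondegenerate : ∀ t, cross (M.tri t 0) (M.tri t 1) (M.tri t 2) ≠ 0
  fine_shapeRegular : ∀ t,
    γ * Metric.diam (M.T t) ^ 2 ≤ |cross (M.tri t 0) (M.tri t 1) (M.tri t 2)|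
  fine_disjoint : ∀ t u, t ≠ u → Disjoint (interior (M.T t)) (interior (M.T u))
  fine_conforming : ∀ t u, t ≠ u →
    M.T t ∩ M.T u = convexHull ℝ (Set.range (M.tri t) ∩ Set.range (M.tri u))
  fine_refines : ∀ t, ∃ i, M.T t ⊆ M.K i
  fine_covers : (⋃ t, M.T t) = ⋃ i, M.K i

/-- Indices of the coarse elements in `K_i` enlarged by `m` coarse layers. A layer consists of all
coarse elements that share at least a vertex with what is already there. -/
def layer (i : Fin M.N) : ℕ → Set (Fin M.N)
  | 0 => {i}
  | m + 1 => {k | ∃ k' ∈ layer i m, (M.K k ∩ M.K k').Nonempty}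

/-- The oversampling region `K_{i,m}`. -/
def region (i : Fin M.N) (m : ℕ) : Set Plane := ⋃ k ∈ M.layer i m, M.K k

/-- `f` is constant on every fine triangle. -/
def IsPiecewiseConst (f : Plane → ℝ) : Prop :=
  ∀ t, ∃ c : ℝ, ∀ x ∈ interior (M.T t), f x = c

end TwoScaleMesh

/-- `f` agrees on `D` with a polynomial of total degree at most `d`. -/
def IsPolyOn (d : ℕ) (D : Set Plane) (f : Plane → ℝ) : Prop :=
  ∃ P : MvPolynomial (Fin 2) ℝ, P.totalDegree ≤ d ∧
    ∀ x ∈ D, f x = MvPolynomial.eval (fun b => x b) P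

/-- The partial derivative `∂_b f`. -/
def partialD (b : Fin 2) (f : Plane → ℝ) (x : Plane) : ℝ :=
  fderiv ℝ f x (EuclideanSpace.single b 1)

/-- The row-wise divergence of a tensor field. -/
def divT (τ : Plane → Matrix (Fin 2) (Fin 2) ℝ) (x : Plane) : Plane :=
  WithLp.toLp 2 (fun a => ∑ b, partialD b (fun y => τ y a b) x)

/-- `τ : σ`. -/
def ddot (σ τ : Matrix (Fin 2) (Fin 2) ℝ) : ℝ := ∑ a, ∑ b, σ a b * τ a b

/-- The compliance tensor `𝒜 τ = τᴰ / (2 μ) + (tr τ) I / (n (n λ + 2 μ))` for `n = 2`. -/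
def compliance (lam mu : ℝ) (τ : Matrix (Fin 2) (Fin 2) ℝ) : Matrix (Fin 2) (Fin 2) ℝ :=
  (1 / (2 * mu)) • (τ - (τ.trace / 2) • (1 : Matrix (Fin 2) (Fin 2) ℝ)) +
    (τ.trace / (2 * (2 * lam + 2 * mu))) • (1 : Matrix (Fin 2) (Fin 2) ℝ)

section Spaces

variable (M : TwoScaleMesh)

/-- `τ` has a divergence in `L²(Ω)`, and `τ n = 0` on `∂Ω`: for piecewise smooth `τ` this is Green's
formula without boundary term, against test fields that need not vanish on `∂Ω`. (The weak
divergence of a piecewise polynomial field is its piecewise divergence, and the formula contains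
the continuity of `τ n` across the interior edges.) -/
def IsHdivNeumann (τ : Plane → Matrix (Fin 2) (Fin 2) ℝ) : Prop :=
  ∀ φ : Plane → Plane, ContDiff ℝ ∞ φ → HasCompactSupport φ →
    ∫ x in M.Ω, ∑ a, ∑ b, τ x a b * partialD b (fun y => φ y a) x =
      - ∫ x in M.Ω, inner ℝ (divT τ x) (φ x)

/-- The stress space `Σ_h`: symmetric fields in `H(div; Ω)` with `τ n = 0` on `∂Ω`, of degree at
most `r` on each of the three parts of every fine triangle `T`, and with `div τ` of degree at most
`r - 1` on the whole of `T`. -/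
structure MemSigma (r : ℕ) (τ : Plane → Matrix (Fin 2) (Fin 2) ℝ) : Prop where
  symm : ∀ t c, ∀ x ∈ interior (M.subT t c), (τ x).IsSymm
  poly : ∀ t c a b, IsPolyOn r (interior (M.subT t c)) (fun x => τ x a b)
  div_poly : ∀ t a, IsPolyOn (r - 1) (⋃ c, interior (M.subT t c)) (fun x => divT τ x a)
  hdiv : IsHdivNeumann M τ

/-- The displacement space `U_h`. -/
def MemU (r : ℕ) (v : Plane → Plane) : Prop :=
  ∀ t a, IsPolyOn (r - 1) (interior (M.T t)) (fun x => v x a)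

/-- `Σ_h(R)`, for a union `R` of coarse elements (or `R = univ`, which gives `Σ_h`). Fields on `R`
with `τ n = 0` on `∂R` are the fields of `Σ_h` that vanish outside `R`. -/
def MemSigmaOn (r : ℕ) (R : Set Plane) (τ : Plane → Matrix (Fin 2) (Fin 2) ℝ) : Prop :=
  MemSigma M r τ ∧ ∀ᵐ x ∂(MeasureTheory.volume.restrict M.Ω), x ∉ R → τ x = 0

/-- `U_h(R)`, for a union `R` of coarse elements (or `R = univ`, which gives `U_h`). The restrictions
of fields in `U_h` to `R` are extended by zero. -/
def MemUOn (r : ℕ) (R : Set Plane) (v : Plane → Plane) : Prop :=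
  MemU M r v ∧ ∀ᵐ x ∂(MeasureTheory.volume.restrict M.Ω), x ∉ R → v x = 0

/-- `(𝒜 σ, τ)`. -/
def formA (lam mu : Plane → ℝ) (σ τ : Plane → Matrix (Fin 2) (Fin 2) ℝ) : ℝ :=
  ∫ x in M.Ω, ddot (compliance (lam x) (mu x) (σ x)) (τ x)

/-- The `L²(Ω)` product. -/
def formL2 (u v : Plane → Plane) : ℝ := ∫ x in M.Ω, inner ℝ (u x) (v x)

/-- The weight `k̃ = (λ + 2 μ) / H ^ 2`. -/
def ktilde (lam mu : Plane → ℝ) (x : Plane) : ℝ := (lam x + 2 * mu x) / M.H ^ 2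

/-- The bilinear form `s_i` on the coarse element `K_i`. -/
def sLoc (lam mu : Plane → ℝ) (i : Fin M.N) (u v : Plane → Plane) : ℝ :=
  ∫ x in M.K i, ktilde M lam mu x * inner ℝ (u x) (v x)

/-- The bilinear form `s`. -/
def sForm (lam mu : Plane → ℝ) (u v : Plane → Plane) : ℝ := ∑ i, sLoc M lam mu i u v

/-- `‖v‖_s ^ 2`. -/
def sNormSq (lam mu : Plane → ℝ) (v : Plane → Plane) : ℝ := sForm M lam mu v v

/-- `‖σ‖_Σ ^ 2`. -/
def sigmaNormSq (lam mu : Plane → ℝ) (σ : Plane → Matrix (Fin 2) (Fin 2) ℝ) : ℝ :=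
  formA M lam mu σ σ +
    ∫ x in M.Ω, (ktilde M lam mu x)⁻¹ * inner ℝ (divT σ x) (divT σ x)

/-- A complete system of solutions of the local spectral problem on `K_i`: an `s_i`-orthonormal
basis `p 0, …, p (L - 1)` of `U_h(K_i)`, with stresses `φ j` in `Σ_h(K_i)` and eigenvalues
`ev 0 ≤ … ≤ ev (L - 1)`. Only the indices below `L` matter. -/
structure IsSpectralBasis (r : ℕ) (lam mu : Plane → ℝ) (i : Fin M.N) (L : ℕ)
    (φ : ℕ → Plane → Matrix (Fin 2) (Fin 2) ℝ) (p : ℕ → Plane → Plane) (ev : ℕ → ℝ) : Prop where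
  memSigma : ∀ j < L, MemSigmaOn M r (M.K i) (φ j)
  memU : ∀ j < L, MemUOn M r (M.K i) (p j)
  eq_stress : ∀ j < L, ∀ τ, MemSigmaOn M r (M.K i) τ →
    formA M lam mu (φ j) τ + formL2 M (divT τ) (p j) = 0
  eq_disp : ∀ j < L, ∀ v, MemUOn M r (M.K i) v →
    - formL2 M (divT (φ j)) v = ev j * sLoc M lam mu i (p j) v
  orthonormal : ∀ j < L, ∀ k < L, sLoc M lam mu i (p j) (p k) = if j = k then 1 else 0
  spans : ∀ v, MemUOn M r (M.K i) v → ∃ c : ℕ → ℝ,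
    ∀ᵐ x ∂(MeasureTheory.volume.restrict M.Ω), v x = ∑ j ∈ Finset.range L, c j • p j x
  sorted : ∀ j k, j ≤ k → k < L → ev j ≤ ev k

/-- The projection `π` onto the auxiliary space spanned by the first `ℓ i` eigenfunctions of every
coarse element `K_i`. -/
def auxProj (lam mu : Plane → ℝ) (ℓ : Fin M.N → ℕ) (p : Fin M.N → ℕ → Plane → Plane)
    (q : Plane → Plane) (x : Plane) : Plane :=
  ∑ i, ∑ j ∈ Finset.range (ℓ i), sLoc M lam mu i q (p i j) • p i j x

/-- `(ψ, q) ∈ Σ_h(R) × U_h(R)` solves the basis problem with datum `p₀`, posed on `R`; the global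
problem is the case `R = univ`. -/
structure SolvesBasis (r : ℕ) (lam mu : Plane → ℝ) (ℓ : Fin M.N → ℕ)
    (p : Fin M.N → ℕ → Plane → Plane) (R : Set Plane) (p₀ : Plane → Plane)
    (ψ : Plane → Matrix (Fin 2) (Fin 2) ℝ) (q : Plane → Plane) : Prop where
  memSigma : MemSigmaOn M r R ψ
  memU : MemUOn M r R q
  eq_stress : ∀ τ, MemSigmaOn M r R τ → formA M lam mu ψ τ + formL2 M (divT τ) q = 0
  eq_disp : ∀ v, MemUOn M r R v →
    sForm M lam mu (auxProj M lam mu ℓ p q) (auxProj M lam mu ℓ p v) - formL2 M (divT ψ) v =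
      sForm M lam mu p₀ v

end Spaces

end Elast

end

namespace Elast

/-! ### Semidefinite bilinear forms and orthogonal families. -/

section Forms

variable {V : Type*} [AddCommGroup V] [Module ℝ V] {b : V →ₗ[ℝ] V →ₗ[ℝ] ℝ}

/-! The proof separates an abstract decay argument from the construction of one operator, a cutoff
for finite element stresses.

Decay. Let D be k̃⁻¹ div and let W be the stresses for which Dτ has no component along the
eigenfunctions beyond the first ℓ k on each K_k. Testing the displacement equation with those
eigenfunctions puts ψ and ψms into W (`Solves.memW`). Testing it with Dτ for τ in W eliminates the
displacement (`Solves.energy_eq`): ψ solves a symmetric problem on W for the energy product (𝒜σ, τ)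
+ s(Dσ, Dτ), with a datum living on K_i, and ψms solves the same problem on the fields of W
supported in K_{i,l}. Suppose that ψ can be multiplied, inside W, by f(d), where d is the layer
number, with an error on K_k of the size |f(d) - f(d - 1)| times the local energy norm. Taking f(n)
= ρ^n as a weight gives a bound of the sum of ρ^d times the local energies
(`Solves.weighted_energy_le`). Taking f truncated at layer l gives a competitor that vanishes
outside K_{i,l}, and Galerkin orthogonality bounds the stress error by the tail of ψ
(`Solves.error_le`). The displacement error is then read off mode by mode (`Solves.disp_error_le`).

Staying in W. A cutoff leaves W only through the high modes of its divergence. On each K_k these are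
removed by the eigenstresses, since Dφ_j = -λ_j p_j while φ_j has energy λ_j + λ_j²; the price is a
factor 1 + 1/Λ (`exists_correction`, `exists_cutoff_memW`). Hence ρ - 1 may be of the order (1 +
1/Λ)^(-1/2), which is the rate claimed.

Cutoff. Multiplication by a piecewise linear function would raise the degree. Instead a polynomial g
of degree r is split as the sum over the vertices of J_c g, where J_c is r⁻¹ λ_c ∂/∂λ_c on
homogeneous polynomials in barycentric coordinates. On an edge J_c g depends only on g restricted to
that edge, so that J_c can be applied to normal traces without destroying their continuity, and the
sum of χ(v_c) J_c is a multiplication by χ that keeps the degree. In the composite element all edge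
traces of degree r are attained (`exists_memLoc_trace`), so every stress on a triangle is a sum of
three vertex parts Q_c with the traces given by J_c (`exists_localParts`), and its cutoff is the sum
of χ(v_c) Q_c (`EdgeCond.comb`, `exists_cutoff`). If χ has slope 1/H, its oscillation h/H on a
triangle of diameter h compensates the h⁻¹ of the inverse inequality, and H⁻² is the scaling of k̃;
so no mesh size remains.

Robustness in λ. The trace of a stress has the small weight 1/(λ + μ), so the deviator of the cutoff
must be bounded by the deviator alone. This holds because, on a composite triangle, normal
continuity and the common divergence control a stress by its deviator up to one isotropic polynomial
field (`exists_nrm_sub_isoField_le`), and isotropic fields are split with no deviator at all.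

The remaining work identifies the fields of the theorem with families of polynomials: by Green's
formula and localization of test functions, the weak divergence condition with τn = 0 on ∂Ω is
equivalent to the cancellation of normal traces on every edge and every inner spoke. -/

theorem form_sq_le (hs : ∀ x y, b x y = b y x) (hn : ∀ x, 0 ≤ b x x) (x y : V) :
    b x y ^ 2 ≤ b x x * b y y := by
  have h : ∀ t : ℝ, 0 ≤ b x x * (t * t) + 2 * b x y * t + b y y := by
    intro t
    have h0 := hn (t • x + y)
    simp only [map_add, map_smul, LinearMap.add_apply, LinearMap.smul_apply, smul_eq_mul,
      hs y x] at h0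
    linarith
  have := discrim_le_zero h
  rw [discrim] at this
  nlinarith

/-- The forms used below see one coarse element only, hence are merely semidefinite. A vector of
zero seminorm lies in the kernel by Cauchy-Schwarz; this is how supports enter all later arguments.
-/
theorem form_eq_zero (hs : ∀ x y, b x y = b y x) (hn : ∀ x, 0 ≤ b x x) {x : V}
    (hx : b x x = 0) (y : V) : b x y = 0 := by
  have := form_sq_le hs hn x y
  rw [hx, zero_mul] at this
  exact pow_eq_zero_iff two_ne_zero |>.1 (le_antisymm this (sq_nonneg _))

theorem form_eq_zero' (hs : ∀ x y, b x y = b y x) (hn : ∀ x, 0 ≤ b x x) {x : V}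
    (hx : b x x = 0) (y : V) : b y x = 0 := by
  rw [hs, form_eq_zero hs hn hx]

theorem form_add_le (hs : ∀ x y, b x y = b y x) (hn : ∀ x, 0 ≤ b x x) (x y : V) :
    b (x + y) (x + y) ≤ 2 * b x x + 2 * b y y := by
  have h0 := hn (x - y)
  simp only [map_add, map_sub, LinearMap.add_apply, LinearMap.sub_apply, hs y x] at h0 ⊢
  linarith

theorem form_sum_smul {J : Finset ℕ} {e : ℕ → V} {w : ℕ → ℝ}
    (ho : ∀ j ∈ J, ∀ m ∈ J, b (e j) (e m) = if j = m then w j else 0) (c : ℕ → ℝ)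
    {m : ℕ} (hm : m ∈ J) : b (∑ j ∈ J, c j • e j) (e m) = c m * w m := by
  simp only [map_sum, map_smul, LinearMap.sum_apply, LinearMap.smul_apply, smul_eq_mul]
  rw [Finset.sum_eq_single m]
  · rw [ho m hm m hm, if_pos rfl]
  · intro j hj hjm
    rw [ho j hj m hm, if_neg hjm, mul_zero]
  · exact fun h => absurd hm h

theorem form_sum_self {J : Finset ℕ} {e : ℕ → V} {w : ℕ → ℝ}
    (ho : ∀ j ∈ J, ∀ m ∈ J, b (e j) (e m) = if j = m then w j else 0) (c : ℕ → ℝ) :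
    b (∑ j ∈ J, c j • e j) (∑ j ∈ J, c j • e j) = ∑ j ∈ J, c j ^ 2 * w j := by
  rw [map_sum]
  refine Finset.sum_congr rfl fun m hm => ?_
  rw [map_smul, form_sum_smul ho c hm, smul_eq_mul]
  ring

/-- Nonnegativity of the form on x minus its projection. The weights are 1 for the
eigendisplacements and the eigenvalues for the eigenstresses. -/
theorem form_bessel (hs : ∀ x y, b x y = b y x) (hn : ∀ x, 0 ≤ b x x) {J : Finset ℕ}
    {e : ℕ → V} {w : ℕ → ℝ}
    (ho : ∀ j ∈ J, ∀ m ∈ J, b (e j) (e m) = if j = m then w j else 0)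
    (hw : ∀ j ∈ J, 0 < w j) (x : V) : ∑ j ∈ J, b x (e j) ^ 2 / w j ≤ b x x := by
  set c : ℕ → ℝ := fun j => b x (e j) / w j with hc
  set y := ∑ j ∈ J, c j • e j with hy
  have h0 := hn (x - y)
  have h1 : b y y = ∑ j ∈ J, b x (e j) ^ 2 / w j := by
    rw [hy, form_sum_self ho c]
    refine Finset.sum_congr rfl fun j hj => ?_
    have := (hw j hj).ne'
    simp only [hc]; field_simp
  have h2 : b x y = ∑ j ∈ J, b x (e j) ^ 2 / w j := by
    rw [hy, map_sum]
    refine Finset.sum_congr rfl fun j hj => ?_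
    have := (hw j hj).ne'
    simp only [hc, map_smul, smul_eq_mul]; field_simp
  simp only [map_sub, LinearMap.sub_apply, hs y x, h1, h2] at h0
  linarith

end Forms

/-- Bilinear forms, divergence and local spectral bases of a mixed multiscale method, as abstract
data. The divergence `D` is measured in the form `s`. -/
structure MixedSystem (S U : Type*) [AddCommGroup S] [Module ℝ S] [AddCommGroup U] [Module ℝ U]
    (N : ℕ) where
  a : Fin N → S →ₗ[ℝ] S →ₗ[ℝ] ℝ
  s : Fin N → U →ₗ[ℝ] U →ₗ[ℝ] ℝ
  D : S →ₗ[ℝ] U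
  a_symm : ∀ k x y, a k x y = a k y x
  a_nonneg : ∀ k x, 0 ≤ a k x x
  s_symm : ∀ k x y, s k x y = s k y x
  s_nonneg : ∀ k x, 0 ≤ s k x x
  restrict : ∀ k v, ∃ v', (∀ m, m ≠ k → s m v' v' = 0) ∧ s k (v - v') (v - v') = 0
  L : Fin N → ℕ
  φ : Fin N → ℕ → S
  p : Fin N → ℕ → U
  ev : Fin N → ℕ → ℝ
  φ_supp : ∀ k, ∀ j < L k, ∀ m, m ≠ k → a m (φ k j) (φ k j) = 0
  Dφ_supp : ∀ k, ∀ j < L k, ∀ m, m ≠ k → s m (D (φ k j)) (D (φ k j)) = 0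
  p_supp : ∀ k, ∀ j < L k, ∀ m, m ≠ k → s m (p k j) (p k j) = 0
  eq_stress : ∀ k, ∀ j < L k, ∀ τ, (∀ m, m ≠ k → a m τ τ = 0 ∧ s m (D τ) (D τ) = 0) →
    ∑ m, a m (φ k j) τ + ∑ m, s m (D τ) (p k j) = 0
  eq_disp : ∀ k, ∀ j < L k, ∀ v, (∀ m, m ≠ k → s m v v = 0) →
    - ∑ m, s m (D (φ k j)) v = ev k j * s k (p k j) v
  orthonormal : ∀ k, ∀ j < L k, ∀ m < L k, s k (p k j) (p k m) = if j = m then 1 else 0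
  spans : ∀ k v, (∀ m, m ≠ k → s m v v = 0) → ∃ c : ℕ → ℝ,
    s k (v - ∑ j ∈ Finset.range (L k), c j • p k j)
      (v - ∑ j ∈ Finset.range (L k), c j • p k j) = 0

/-! ### Abstract mixed systems: spectral identities, correction into W, exponential decay. -/

namespace MixedSystem

variable {S U : Type*} [AddCommGroup S] [Module ℝ S] [AddCommGroup U] [Module ℝ U] {N : ℕ}
  (X : MixedSystem S U N)

theorem sum_a_of_supp {k : Fin N} {x : S} (hx : ∀ m, m ≠ k → X.a m x x = 0) (y : S) :
    ∑ m, X.a m x y = X.a k x y :=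
  Fintype.sum_eq_single k fun m hm =>
    form_eq_zero (X.a_symm m) (X.a_nonneg m) (hx m hm) y

theorem sum_s_of_supp {k : Fin N} {x : U} (hx : ∀ m, m ≠ k → X.s m x x = 0) (y : U) :
    ∑ m, X.s m x y = X.s k x y :=
  Fintype.sum_eq_single k fun m hm =>
    form_eq_zero (X.s_symm m) (X.s_nonneg m) (hx m hm) y

theorem s_congr {k : Fin N} {v v' : U} (h : X.s k (v - v') (v - v') = 0) (u : U) :
    X.s k u v = X.s k u v' := by
  have := form_eq_zero' (X.s_symm k) (X.s_nonneg k) h u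
  rw [map_sub] at this
  linarith

/-- Displacements may jump between coarse elements, so `restrict` replaces v by a field supported on
K_k, which the local eigenfunctions span. -/
theorem parseval (k : Fin N) (u v : U) :
    X.s k u v = ∑ j ∈ Finset.range (X.L k), X.s k u (X.p k j) * X.s k v (X.p k j) := by
  obtain ⟨v', hv', hvv⟩ := X.restrict k v
  obtain ⟨c, hc⟩ := X.spans k v' hv'
  have ho : ∀ j ∈ Finset.range (X.L k), ∀ m ∈ Finset.range (X.L k),
      X.s k (X.p k j) (X.p k m) = if j = m then 1 else 0 := fun j hj m hm =>
    X.orthonormal k j (Finset.mem_range.1 hj) m (Finset.mem_range.1 hm)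
  have h1 : ∀ w, X.s k w v = X.s k w (∑ j ∈ Finset.range (X.L k), c j • X.p k j) := fun w => by
    rw [X.s_congr hvv, X.s_congr hc]
  rw [h1 u, map_sum]
  refine Finset.sum_congr rfl fun j hj => ?_
  rw [X.s_symm k v, h1, X.s_symm k (X.p k j), form_sum_smul ho c hj, map_smul, smul_eq_mul]
  ring

/-- The weighted divergence of an eigenstress is -λ_j p_j. The spectral equation tests only with
fields supported on K_k; `restrict` removes this limitation. -/
theorem s_Dφ (k : Fin N) {j : ℕ} (hj : j < X.L k) (v : U) :
    X.s k (X.D (X.φ k j)) v = - (X.ev k j * X.s k (X.p k j) v) := by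
  obtain ⟨v', hv', hvv⟩ := X.restrict k v
  have h := X.eq_disp k j hj v' hv'
  rw [X.sum_s_of_supp (X.Dφ_supp k j hj)] at h
  rw [X.s_congr hvv, X.s_congr hvv, ← h, neg_neg]

theorem s_Dφ_Dφ (k : Fin N) {j m : ℕ} (hj : j < X.L k) (hm : m < X.L k) :
    X.s k (X.D (X.φ k j)) (X.D (X.φ k m)) = if j = m then X.ev k j ^ 2 else 0 := by
  rw [X.s_Dφ k hj, X.s_symm k (X.p k j), X.s_Dφ k hm, X.orthonormal k m hm j hj]
  rcases eq_or_ne j m with rfl | h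
  · simp; ring
  · simp [h, h.symm]

/-- Take φ_m as test field in the stress equation for φ_j and insert `s_Dφ`. The eigenstresses are
thus orthogonal, with their eigenvalues as squared norms. -/
theorem a_φ_φ (k : Fin N) {j m : ℕ} (hj : j < X.L k) (hm : m < X.L k) :
    X.a k (X.φ k j) (X.φ k m) = if j = m then X.ev k j else 0 := by
  have h := X.eq_stress k j hj (X.φ k m) fun n hn =>
    ⟨X.φ_supp k m hm n hn, X.Dφ_supp k m hm n hn⟩
  rw [X.sum_a_of_supp (X.φ_supp k j hj), X.sum_s_of_supp (X.Dφ_supp k m hm), X.s_Dφ k hm,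
    X.orthonormal k m hm j hj] at h
  rcases eq_or_ne j m with rfl | h'
  · simp at h ⊢; linarith
  · simp [h', h'.symm] at h ⊢; linarith

/-- The energy product as a bilinear form. -/
def BB (k : Fin N) : S →ₗ[ℝ] S →ₗ[ℝ] ℝ :=
  X.a k + ((X.s k).compl₁₂ X.D X.D)

theorem BB_apply (k : Fin N) (σ τ : S) :
    X.BB k σ τ = X.a k σ τ + X.s k (X.D σ) (X.D τ) := rfl

theorem BB_symm (k : Fin N) (σ τ : S) : X.BB k σ τ = X.BB k τ σ := by
  rw [BB_apply, BB_apply, X.a_symm, X.s_symm]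

theorem BB_nonneg (k : Fin N) (σ : S) : 0 ≤ X.BB k σ σ :=
  add_nonneg (X.a_nonneg k σ) (X.s_nonneg k _)

/-- The divergence of `τ` is a combination of the first `ℓ k` eigenfunctions on each `K_k`. -/
def MemW (ℓ : Fin N → ℕ) (τ : S) : Prop :=
  ∀ k j, ℓ k ≤ j → j < X.L k → X.s k (X.D τ) (X.p k j) = 0

/-- Stresses can be cut off: multiplication of a stress by `f ∘ d` is possible up to an error
controlled by the variation of `f`. -/
def HasCutoff (C₀ : ℝ) (d : Fin N → ℕ) : Prop :=
  ∀ (f : ℕ → ℝ) (τ : S), ∃ τ' : S, ∀ k,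
    X.a k (τ' - f (d k) • τ) (τ' - f (d k) • τ) ≤
        C₀ * (f (d k) - f (d k - 1)) ^ 2 * X.a k τ τ ∧
    X.s k (X.D (τ' - f (d k) • τ)) (X.D (τ' - f (d k) • τ)) ≤
        C₀ * (f (d k) - f (d k - 1)) ^ 2 * X.BB k τ τ

variable {X} {ℓ : Fin N → ℕ} {Λ : ℝ}

/-- The eigenstresses with coefficients -s(w, p_j)/λ_j reproduce the high modes of w in the
divergence. A mode costs (λ_j + λ_j²)/λ_j² = 1 + 1/λ_j in energy. The local corrections are added up
to one global stress, and each is invisible on the other elements. -/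
theorem exists_correction (hΛ : 0 < Λ) (hev : ∀ k j, ℓ k ≤ j → j < X.L k → Λ ≤ X.ev k j)
    (w : U) : ∃ σ : S, ∀ k,
      (∀ j, ℓ k ≤ j → j < X.L k → X.s k (X.D σ) (X.p k j) = X.s k w (X.p k j)) ∧
      X.BB k σ σ ≤ (1 + 1 / Λ) * ∑ j ∈ Finset.Ico (ℓ k) (X.L k), X.s k w (X.p k j) ^ 2 := by
  set c : Fin N → ℕ → ℝ := fun k j => - (X.s k w (X.p k j) / X.ev k j) with hc
  set σk : Fin N → S := fun k => ∑ j ∈ Finset.Ico (ℓ k) (X.L k), c k j • X.φ k j with hσk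
  have hevp : ∀ k j, ℓ k ≤ j → j < X.L k → 0 < X.ev k j := fun k j h1 h2 =>
    hΛ.trans_le (hev k j h1 h2)
  have hBB0 : ∀ k m, m ≠ k → X.BB m (σk k) (σk k) = 0 := by
    intro k m hmk
    have hz : ∀ j ∈ Finset.Ico (ℓ k) (X.L k), ∀ y, X.BB m (X.φ k j) y = 0 := by
      intro j hj y
      have hjL := (Finset.mem_Ico.1 hj).2
      refine form_eq_zero (X.BB_symm m) (X.BB_nonneg m) ?_ y
      rw [BB_apply, X.φ_supp k j hjL m hmk, X.Dφ_supp k j hjL m hmk, add_zero]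
    simp only [hσk, map_sum, map_smul, LinearMap.sum_apply, LinearMap.smul_apply]
    refine Finset.sum_eq_zero fun j hj => ?_
    rw [Finset.sum_eq_zero, smul_zero]
    intro i hi
    rw [hz i hi, smul_zero]
  have hsplit : ∀ k y, X.BB k (∑ m, σk m) y = X.BB k (σk k) y := by
    intro k y
    rw [map_sum, LinearMap.sum_apply]
    exact Fintype.sum_eq_single k fun m hm =>
      form_eq_zero (X.BB_symm k) (X.BB_nonneg k) (hBB0 m k hm.symm) y
  have hsplitD : ∀ k u, X.s k (X.D (∑ m, σk m)) u = X.s k (X.D (σk k)) u := by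
    intro k u
    rw [map_sum, map_sum, LinearMap.sum_apply]
    refine Fintype.sum_eq_single k fun m hm =>
      form_eq_zero (X.s_symm k) (X.s_nonneg k) ?_ u
    have h := hBB0 m k hm.symm
    rw [BB_apply] at h
    linarith [X.a_nonneg k (σk m), X.s_nonneg k (X.D (σk m))]
  refine ⟨∑ m, σk m, fun k => ⟨fun j hj1 hj2 => ?_, ?_⟩⟩
  · rw [hsplitD]
    simp only [hσk, map_sum, map_smul, LinearMap.sum_apply, LinearMap.smul_apply, smul_eq_mul]
    rw [Finset.sum_eq_single j]
    · rw [X.s_Dφ k hj2, X.orthonormal k j hj2 j hj2, if_pos rfl]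
      have := (hevp k j hj1 hj2).ne'
      simp only [hc]; field_simp
    · intro m hm hmj
      rw [X.s_Dφ k (Finset.mem_Ico.1 hm).2, X.orthonormal k m (Finset.mem_Ico.1 hm).2 j hj2,
        if_neg hmj]
      ring
    · exact fun h => absurd (Finset.mem_Ico.2 ⟨hj1, hj2⟩) h
  · rw [hsplit, X.BB_symm, hsplit]
    have ho : ∀ j ∈ Finset.Ico (ℓ k) (X.L k), ∀ m ∈ Finset.Ico (ℓ k) (X.L k),
        X.BB k (X.φ k j) (X.φ k m) = if j = m then X.ev k j + X.ev k j ^ 2 else 0 := by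
      intro j hj m hm
      rw [BB_apply, X.a_φ_φ k (Finset.mem_Ico.1 hj).2 (Finset.mem_Ico.1 hm).2,
        X.s_Dφ_Dφ k (Finset.mem_Ico.1 hj).2 (Finset.mem_Ico.1 hm).2]
      split_ifs <;> simp
    simp only [hσk]
    rw [form_sum_self ho, Finset.mul_sum]
    refine Finset.sum_le_sum fun j hj => ?_
    obtain ⟨h1, h2⟩ := Finset.mem_Ico.1 hj
    have hp := hevp k j h1 h2
    have h3 : c k j ^ 2 * (X.ev k j + X.ev k j ^ 2) =
        (1 + 1 / X.ev k j) * X.s k w (X.p k j) ^ 2 := by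
      simp only [hc]; field_simp; ring
    rw [h3]
    have h4 : 1 / X.ev k j ≤ 1 / Λ := one_div_le_one_div_of_le hΛ (hev k j h1 h2)
    gcongr

/-- Since τ is in W, the high modes of the divergence of its cutoff are those of the cutoff error.
The correction that removes them is therefore controlled by the same variation of f as the error
itself. -/
theorem exists_cutoff_memW {C₀ : ℝ} (hC₀ : 0 ≤ C₀) {d : Fin N → ℕ} (hcut : X.HasCutoff C₀ d)
    (hΛ : 0 < Λ) (hev : ∀ k j, ℓ k ≤ j → j < X.L k → Λ ≤ X.ev k j) (f : ℕ → ℝ) {τ : S}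
    (hτ : X.MemW ℓ τ) : ∃ τ' : S, X.MemW ℓ τ' ∧ ∀ k,
      X.BB k (τ' - f (d k) • τ) (τ' - f (d k) • τ) ≤
        6 * C₀ * (1 + 1 / Λ) * (f (d k) - f (d k - 1)) ^ 2 * X.BB k τ τ := by
  obtain ⟨τ₁, h₁⟩ := hcut f τ
  obtain ⟨σ, hσ⟩ := exists_correction hΛ hev (X.D τ₁)
  refine ⟨τ₁ - σ, fun k j h1 h2 => ?_, fun k => ?_⟩
  · rw [map_sub, map_sub, LinearMap.sub_apply, (hσ k).1 j h1 h2, sub_self]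
  · set η := τ₁ - f (d k) • τ with hη
    set Δ := (f (d k) - f (d k - 1)) ^ 2 with hΔ
    have hΔ0 : 0 ≤ Δ := sq_nonneg _
    -- Replacing τ₁ by the error η does not change the high modes; Bessel then applies to η.
    have e1 : ∑ j ∈ Finset.Ico (ℓ k) (X.L k), X.s k (X.D τ₁) (X.p k j) ^ 2 ≤
        X.s k (X.D η) (X.D η) := by
      have : ∀ j ∈ Finset.Ico (ℓ k) (X.L k),
          X.s k (X.D τ₁) (X.p k j) ^ 2 = X.s k (X.D η) (X.p k j) ^ 2 / 1 := by
        intro j hj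
        obtain ⟨h1, h2⟩ := Finset.mem_Ico.1 hj
        rw [hη, map_sub, map_sub, map_smul, map_smul, LinearMap.sub_apply, LinearMap.smul_apply,
          hτ k j h1 h2, smul_zero, sub_zero, div_one]
      rw [Finset.sum_congr rfl this]
      refine form_bessel (w := fun _ => 1) (X.s_symm k) (X.s_nonneg k) ?_
        (fun _ _ => one_pos) _
      intro j hj m hm
      exact X.orthonormal k j (Finset.mem_Ico.1 hj).2 m (Finset.mem_Ico.1 hm).2
    have e2 := (hσ k).2
    have e3 := h₁ k
    have e4 : X.a k τ τ ≤ X.BB k τ τ := by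
      rw [BB_apply]; linarith [X.s_nonneg k (X.D τ)]
    have e5 : X.BB k η η ≤ 2 * (C₀ * Δ * X.BB k τ τ) := by
      rw [X.BB_apply k η η]
      have : C₀ * Δ * X.a k τ τ ≤ C₀ * Δ * X.BB k τ τ := by gcongr
      linarith [e3.1, e3.2]
    have hΛ' : 0 ≤ 1 / Λ := by positivity
    have e6 : X.BB k σ σ ≤ (1 + 1 / Λ) * (C₀ * Δ * X.BB k τ τ) :=
      e2.trans (mul_le_mul_of_nonneg_left (e1.trans e3.2) (by positivity))
    have e7 : X.BB k (-σ) (-σ) = X.BB k σ σ := by simp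
    -- The constant is 2 · 2 for the cutoff error plus 2(1 + 1/Λ) for the correction, at most 6(1 +
    -- 1/Λ).
    have e8 := form_add_le (X.BB_symm k) (X.BB_nonneg k) η (-σ)
    have e9 : τ₁ - σ - f (d k) • τ = η + -σ := by rw [hη]; abel
    rw [e9]
    have h0 : 0 ≤ C₀ * Δ * X.BB k τ τ := by
      have := X.BB_nonneg k τ; positivity
    have h1 : 0 ≤ 1 / Λ * (C₀ * Δ * X.BB k τ τ) := mul_nonneg hΛ' h0
    rw [e7] at e8
    nlinarith

/-- The basis problem posed on the elements in `R`. -/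
structure Solves (X : MixedSystem S U N) (ℓ : Fin N → ℕ) (R : Set (Fin N)) (p₀ : U) (ψ : S)
    (q : U) : Prop where
  supp : ∀ k ∉ R, X.BB k ψ ψ = 0 ∧ X.s k q q = 0
  eq_stress : ∀ τ, (∀ k ∉ R, X.BB k τ τ = 0) →
    ∑ k, X.a k ψ τ + ∑ k, X.s k (X.D τ) q = 0
  eq_disp : ∀ v, (∀ k ∉ R, X.s k v v = 0) →
    ∑ k, ∑ j ∈ Finset.range (ℓ k), X.s k q (X.p k j) * X.s k v (X.p k j) -
      ∑ k, X.s k (X.D ψ) v = ∑ k, X.s k p₀ v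

theorem BB_eq_zero_iff {k : Fin N} {τ : S} :
    X.BB k τ τ = 0 ↔ X.a k τ τ = 0 ∧ X.s k (X.D τ) (X.D τ) = 0 := by
  rw [BB_apply]
  constructor
  · intro h
    constructor <;> linarith [X.a_nonneg k τ, X.s_nonneg k (X.D τ)]
  · rintro ⟨h1, h2⟩
    rw [h1, h2, add_zero]

namespace Solves

variable {R : Set (Fin N)} {i : Fin N} {j₀ : ℕ} {p₀ q : U} {ψ : S}

/-- Testing the displacement equation with an eigenfunction. -/
theorem test_p (h : X.Solves ℓ R p₀ ψ q) (hℓ : ∀ k, ℓ k < X.L k) {k : Fin N} (hk : k ∈ R)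
    {j : ℕ} (hj : j < X.L k) :
    (if j < ℓ k then X.s k q (X.p k j) else 0) - X.s k (X.D ψ) (X.p k j) =
      X.s k p₀ (X.p k j) := by
  have hp := X.p_supp k j hj
  have h1 := h.eq_disp (X.p k j) fun m hm => hp m fun hmk => hm (hmk ▸ hk)
  have h2 : ∀ x, ∑ m, X.s m x (X.p k j) = X.s k x (X.p k j) := fun x =>
    Fintype.sum_eq_single k fun m hm =>
      form_eq_zero' (X.s_symm m) (X.s_nonneg m) (hp m hm) x
  rw [h2, h2, Fintype.sum_eq_single k] at h1
  · rw [← h1]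
    congr 1
    by_cases hjl : j < ℓ k
    · rw [if_pos hjl, Finset.sum_eq_single j]
      · rw [X.orthonormal k j hj j hj, if_pos rfl, mul_one]
      · intro m hm hmj
        rw [X.orthonormal k j hj m ((Finset.mem_range.1 hm).trans (hℓ k)), if_neg hmj.symm,
          mul_zero]
      · exact fun h => absurd (Finset.mem_range.2 hjl) h
    · rw [if_neg hjl]
      refine (Finset.sum_eq_zero fun m hm => ?_).symm
      have hml := Finset.mem_range.1 hm
      rw [X.orthonormal k j hj m (hml.trans (hℓ k)), if_neg (by omega), mul_zero]
  · intro m hm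
    refine Finset.sum_eq_zero fun n _ => ?_
    rw [form_eq_zero (X.s_symm m) (X.s_nonneg m) (hp m hm), mul_zero]

/-- Against a high mode the term with π drops out, and the datum is a low mode on K_i and zero
elsewhere; so the divergence has no high mode. Outside R the stress vanishes anyway. -/
theorem memW (h : X.Solves ℓ R (X.p i j₀) ψ q) (hℓ : ∀ k, ℓ k < X.L k) (hj₀ : j₀ < ℓ i) :
    X.MemW ℓ ψ := by
  intro k j h1 h2
  by_cases hk : k ∈ R
  · have h3 := h.test_p hℓ hk h2
    rw [if_neg (by omega)] at h3
    have h4 : X.s k (X.p i j₀) (X.p k j) = 0 := by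
      by_cases hki : k = i
      · subst hki
        rw [X.orthonormal k j₀ (hj₀.trans (hℓ k)) j h2, if_neg (by omega)]
      · exact form_eq_zero (X.s_symm k) (X.s_nonneg k)
          (X.p_supp i j₀ (hj₀.trans (hℓ i)) k hki) _
    rw [h4] at h3
    linarith
  · exact form_eq_zero (X.s_symm k) (X.s_nonneg k) (BB_eq_zero_iff.1 (h.supp k hk).1).2 _

/-- For τ in W the field Dτ is fixed by π, so testing the displacement equation with Dτ produces
exactly the term s(Dτ, q) of the stress equation, and q can be eliminated. -/
theorem energy_eq (h : X.Solves ℓ R p₀ ψ q) (hℓ : ∀ k, ℓ k < X.L k) {τ : S}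
    (hτ : X.MemW ℓ τ) (hτR : ∀ k ∉ R, X.BB k τ τ = 0) :
    ∑ k, X.BB k ψ τ = - ∑ k, X.s k (X.D τ) p₀ := by
  have h1 := h.eq_stress τ hτR
  have h2 := h.eq_disp (X.D τ) fun k hk => (BB_eq_zero_iff.1 (hτR k hk)).2
  -- The sum over low modes is the full Parseval sum because Dτ has no high modes.
  have h3 : ∀ k, ∑ j ∈ Finset.range (ℓ k), X.s k q (X.p k j) * X.s k (X.D τ) (X.p k j) =
      X.s k (X.D τ) q := by
    intro k
    rw [X.s_symm, X.parseval k q (X.D τ)]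
    refine Finset.sum_subset (Finset.range_mono (hℓ k).le) fun j hj1 hj2 => ?_
    rw [hτ k j (by simpa using hj2) (Finset.mem_range.1 hj1), mul_zero]
  simp only [h3] at h2
  simp only [BB_apply, Finset.sum_add_distrib]
  have h4 : ∑ k, X.s k p₀ (X.D τ) = ∑ k, X.s k (X.D τ) p₀ :=
    Finset.sum_congr rfl fun k _ => X.s_symm k _ _
  linarith

/-- Eigenstresses are admissible test fields because they live on one element of R. The displacement
equation contains q only through π, so this is what determines the high modes of q. -/
theorem test_φ (h : X.Solves ℓ R p₀ ψ q) {k : Fin N} (hk : k ∈ R) {j : ℕ} (hj : j < X.L k) :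
    X.a k ψ (X.φ k j) = X.ev k j * X.s k q (X.p k j) := by
  have h1 := h.eq_stress (X.φ k j) fun m hm => BB_eq_zero_iff.2
    ⟨X.φ_supp k j hj m fun h => hm (h ▸ hk), X.Dφ_supp k j hj m fun h => hm (h ▸ hk)⟩
  rw [X.sum_s_of_supp (X.Dφ_supp k j hj), X.s_Dφ k hj, X.s_symm k (X.p k j)] at h1
  have h2 : ∑ m, X.a m ψ (X.φ k j) = X.a k ψ (X.φ k j) :=
    Fintype.sum_eq_single k fun m hm =>
      form_eq_zero' (X.a_symm m) (X.a_nonneg m) (X.φ_supp k j hj m hm) ψ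
  linarith

/-- The displacement error is controlled by the stress error. -/
theorem disp_error_le {ψ' : S} {q' : U} (h : X.Solves ℓ Set.univ (X.p i j₀) ψ q)
    (h' : X.Solves ℓ R (X.p i j₀) ψ' q') (hi : i ∈ R) (hℓ : ∀ k, ℓ k < X.L k)
    (hj₀ : j₀ < ℓ i) (hΛ : 0 < Λ) (hev : ∀ k j, ℓ k ≤ j → j < X.L k → Λ ≤ X.ev k j)
    (k : Fin N) :
    X.s k (q - q') (q - q') ≤ (1 + 1 / Λ) * X.BB k (ψ - ψ') (ψ - ψ') := by
  -- Low modes come from the displacement equation. Outside R the local solution vanishes, and so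
  -- does the datum, because K_i belongs to R.
  have hlow : ∀ j < ℓ k, X.s k (q - q') (X.p k j) = X.s k (X.D (ψ - ψ')) (X.p k j) := by
    intro j hj
    have hjL := hj.trans (hℓ k)
    have e1 := h.test_p hℓ (Set.mem_univ k) hjL
    rw [if_pos hj] at e1
    simp only [map_sub, LinearMap.sub_apply]
    by_cases hk : k ∈ R
    · have e2 := h'.test_p hℓ hk hjL
      rw [if_pos hj] at e2
      linarith
    · have hki : k ≠ i := fun hki => hk (hki ▸ hi)
      rw [form_eq_zero (X.s_symm k) (X.s_nonneg k) (h'.supp k hk).2,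
        form_eq_zero (X.s_symm k) (X.s_nonneg k) (BB_eq_zero_iff.1 (h'.supp k hk).1).2]
      rw [form_eq_zero (X.s_symm k) (X.s_nonneg k)
        (X.p_supp i j₀ (hj₀.trans (hℓ i)) k hki)] at e1
      linarith
  -- High modes come from the stress equation tested with eigenstresses.
  have hhigh : ∀ j, j < X.L k →
      X.ev k j * X.s k (q - q') (X.p k j) = X.a k (ψ - ψ') (X.φ k j) := by
    intro j hj
    have e1 := h.test_φ (Set.mem_univ k) hj
    simp only [map_sub, LinearMap.sub_apply]
    by_cases hk : k ∈ R
    · have e2 := h'.test_φ hk hj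
      linarith
    · rw [form_eq_zero (X.s_symm k) (X.s_nonneg k) (h'.supp k hk).2,
        form_eq_zero (X.a_symm k) (X.a_nonneg k) (BB_eq_zero_iff.1 (h'.supp k hk).1).1]
      linarith
  have ho : ∀ j < X.L k, ∀ m < X.L k, X.s k (X.p k j) (X.p k m) = if j = m then 1 else 0 :=
    X.orthonormal k
  have b1 : ∑ j ∈ Finset.range (ℓ k), X.s k (q - q') (X.p k j) ^ 2 ≤
      X.s k (X.D (ψ - ψ')) (X.D (ψ - ψ')) := by
    have : ∀ j ∈ Finset.range (ℓ k), X.s k (q - q') (X.p k j) ^ 2 =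
        X.s k (X.D (ψ - ψ')) (X.p k j) ^ 2 / 1 := fun j hj => by
      rw [hlow j (Finset.mem_range.1 hj), div_one]
    rw [Finset.sum_congr rfl this]
    exact form_bessel (w := fun _ => 1) (X.s_symm k) (X.s_nonneg k)
      (fun j hj m hm => ho j ((Finset.mem_range.1 hj).trans (hℓ k)) m
        ((Finset.mem_range.1 hm).trans (hℓ k))) (fun _ _ => one_pos) _
  -- Bessel in the form a, with the eigenvalues as weights, bounds the sum of λ_j times the squared
  -- modes; then λ_j ≥ Λ.
  have b2 : ∑ j ∈ Finset.Ico (ℓ k) (X.L k), X.s k (q - q') (X.p k j) ^ 2 ≤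
      1 / Λ * X.a k (ψ - ψ') (ψ - ψ') := by
    have hb := form_bessel (w := X.ev k) (X.a_symm k) (X.a_nonneg k)
      (J := Finset.Ico (ℓ k) (X.L k)) (e := X.φ k)
      (fun j hj m hm => X.a_φ_φ k (Finset.mem_Ico.1 hj).2 (Finset.mem_Ico.1 hm).2)
      (fun j hj => hΛ.trans_le (hev k j (Finset.mem_Ico.1 hj).1 (Finset.mem_Ico.1 hj).2))
      (ψ - ψ')
    refine le_trans ?_ (mul_le_mul_of_nonneg_left hb (by positivity))
    rw [Finset.mul_sum]
    refine Finset.sum_le_sum fun j hj => ?_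
    obtain ⟨h1, h2⟩ := Finset.mem_Ico.1 hj
    have hl := hev k j h1 h2
    have hp := hΛ.trans_le hl
    rw [← hhigh j h2]
    have : 1 / Λ * ((X.ev k j * X.s k (q - q') (X.p k j)) ^ 2 / X.ev k j) =
        (X.ev k j / Λ) * X.s k (q - q') (X.p k j) ^ 2 := by
      field_simp
    rw [this]
    have h1 : 1 ≤ X.ev k j / Λ := (one_le_div hΛ).2 hl
    nlinarith [sq_nonneg (X.s k (q - q') (X.p k j))]
  have hsum : X.s k (q - q') (q - q') =
      ∑ j ∈ Finset.range (ℓ k), X.s k (q - q') (X.p k j) ^ 2 +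
        ∑ j ∈ Finset.Ico (ℓ k) (X.L k), X.s k (q - q') (X.p k j) ^ 2 := by
    rw [Finset.sum_range_add_sum_Ico _ (hℓ k).le, X.parseval]
    exact Finset.sum_congr rfl fun j _ => (sq _).symm
  rw [hsum, BB_apply]
  have h1 := X.a_nonneg k (ψ - ψ')
  have h2 := X.s_nonneg k (X.D (ψ - ψ'))
  have h3 : 0 ≤ 1 / Λ := by positivity
  nlinarith [mul_nonneg h3 h2]

/-- Weighted energy estimate for the solution of the global problem. -/
theorem weighted_energy_le {C₀ : ℝ} (hC₀ : 0 ≤ C₀) {d : Fin N → ℕ} (hcut : X.HasCutoff C₀ d)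
    (h : X.Solves ℓ Set.univ (X.p i j₀) ψ q) (hdi : d i = 0) (hℓ : ∀ k, ℓ k < X.L k)
    (hj₀ : j₀ < ℓ i) (hΛ : 0 < Λ) (hev : ∀ k j, ℓ k ≤ j → j < X.L k → Λ ≤ X.ev k j)
    {α : ℝ} (hα : 0 ≤ α) (hα' : 6 * C₀ * (1 + 1 / Λ) * α ^ 2 ≤ 1 / 4) :
    ∑ k, (1 + α) ^ d k * X.BB k ψ ψ ≤ 4 * X.s i (X.p i j₀) (X.p i j₀) := by
  set ρ := 1 + α with hρ
  have hρ1 : 1 ≤ ρ := by linarith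
  have hW := h.memW hℓ hj₀
  obtain ⟨τ, hτW, hτ⟩ := exists_cutoff_memW hC₀ hcut hΛ hev (fun n => ρ ^ n) hW
  -- At n = 0 truncated subtraction makes the increment zero; otherwise it equals α ρ^(n-1).
  have hD : ∀ n : ℕ, (ρ ^ n - ρ ^ (n - 1)) ^ 2 ≤ α ^ 2 * (ρ ^ n) ^ 2 := by
    intro n
    rcases n with _ | n
    · simp; positivity
    · have : ρ ^ (n + 1) - ρ ^ (n + 1 - 1) = α * ρ ^ n := by
        rw [Nat.add_sub_cancel, hρ]; ring
      rw [this, mul_pow]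
      have : ρ ^ n ≤ ρ ^ (n + 1) := pow_le_pow_right₀ hρ1 (Nat.le_succ n)
      gcongr
  -- The smallness condition on α makes the error of the weighted test field at most half of the
  -- main term, by Cauchy-Schwarz.
  have hlow : ∀ k, 1 / 2 * (ρ ^ d k * X.BB k ψ ψ) ≤ X.BB k ψ τ := by
    intro k
    set η := τ - ρ ^ d k • ψ with hη
    have e1 := hτ k
    have hE := X.BB_nonneg k ψ
    have e2 : X.BB k η η ≤ (1 / 2 * ρ ^ d k) ^ 2 * X.BB k ψ ψ := by
      refine e1.trans ?_
      have h1 : 6 * C₀ * (1 + 1 / Λ) * (ρ ^ d k - ρ ^ (d k - 1)) ^ 2 ≤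
          6 * C₀ * (1 + 1 / Λ) * (α ^ 2 * (ρ ^ d k) ^ 2) :=
        mul_le_mul_of_nonneg_left (hD (d k)) (by positivity)
      have h2 : 6 * C₀ * (1 + 1 / Λ) * (α ^ 2 * (ρ ^ d k) ^ 2) ≤ (1 / 2 * ρ ^ d k) ^ 2 := by
        nlinarith [sq_nonneg (ρ ^ d k)]
      exact mul_le_mul_of_nonneg_right (h1.trans h2) hE
    have e3 := form_sq_le (X.BB_symm k) (X.BB_nonneg k) ψ η
    have e4 : |X.BB k ψ η| ≤ 1 / 2 * ρ ^ d k * X.BB k ψ ψ := by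
      refine abs_le_of_sq_le_sq ?_ (by positivity)
      calc X.BB k ψ η ^ 2 ≤ X.BB k ψ ψ * X.BB k η η := e3
        _ ≤ X.BB k ψ ψ * ((1 / 2 * ρ ^ d k) ^ 2 * X.BB k ψ ψ) := by gcongr
        _ = _ := by ring
    have e5 : X.BB k ψ τ = ρ ^ d k * X.BB k ψ ψ + X.BB k ψ η := by
      rw [hη, map_sub, map_smul, smul_eq_mul]; ring
    rw [e5]
    linarith [(abs_le.1 e4).1]
  have hen := h.energy_eq hℓ hτW (fun k hk => absurd (Set.mem_univ k) hk)
  have hps := X.p_supp i j₀ (hj₀.trans (hℓ i))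
  -- As d i = 0, the increment of the weight vanishes on K_i. There the test field has the same
  -- divergence as ψ, and the datum sees only K_i.
  have e6 : ∑ k, X.s k (X.D τ) (X.p i j₀) = X.s i (X.D ψ) (X.p i j₀) := by
    rw [Fintype.sum_eq_single i fun k hk =>
      form_eq_zero' (X.s_symm k) (X.s_nonneg k) (hps k hk) _]
    have e7 := hτ i
    rw [hdi] at e7
    simp only [pow_zero, one_smul, Nat.zero_sub, sub_self, ne_eq, OfNat.ofNat_ne_zero,
      not_false_eq_true, zero_pow, mul_zero, zero_mul] at e7
    have e8 := (BB_eq_zero_iff.1 (le_antisymm e7 (X.BB_nonneg i _))).2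
    have e9 := form_eq_zero (X.s_symm i) (X.s_nonneg i) e8 (X.p i j₀)
    rw [map_sub, map_sub, LinearMap.sub_apply] at e9
    linarith
  set Y := ∑ k, ρ ^ d k * X.BB k ψ ψ with hY
  set P := X.s i (X.p i j₀) (X.p i j₀) with hP
  have hP0 : 0 ≤ P := X.s_nonneg i _
  have hYi : X.s i (X.D ψ) (X.D ψ) ≤ Y := by
    have h1 : X.s i (X.D ψ) (X.D ψ) ≤ ρ ^ d i * X.BB i ψ ψ := by
      rw [hdi, pow_zero, one_mul, BB_apply]; linarith [X.a_nonneg i ψ]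
    refine h1.trans (Finset.single_le_sum (f := fun k => ρ ^ d k * X.BB k ψ ψ)
      (fun k _ => ?_) (Finset.mem_univ i))
    have := X.BB_nonneg k ψ
    positivity
  have hY0 : 0 ≤ Y := (X.s_nonneg i _).trans hYi
  have e10 : 1 / 2 * Y ≤ |X.s i (X.D ψ) (X.p i j₀)| := by
    calc 1 / 2 * Y = ∑ k, 1 / 2 * (ρ ^ d k * X.BB k ψ ψ) := by rw [hY, Finset.mul_sum]
      _ ≤ ∑ k, X.BB k ψ τ := Finset.sum_le_sum fun k _ => hlow k
      _ = - X.s i (X.D ψ) (X.p i j₀) := by rw [hen, e6]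
      _ ≤ _ := neg_le_abs _
  have e11 := form_sq_le (X.s_symm i) (X.s_nonneg i) (X.D ψ) (X.p i j₀)
  -- The weighted energy Y satisfies Y/2 ≤ √(Y P), whence Y ≤ 4P.
  have e12 : (1 / 2 * Y) ^ 2 ≤ Y * P := by
    calc (1 / 2 * Y) ^ 2 ≤ |X.s i (X.D ψ) (X.p i j₀)| ^ 2 := by gcongr
      _ = X.s i (X.D ψ) (X.p i j₀) ^ 2 := sq_abs _
      _ ≤ X.s i (X.D ψ) (X.D ψ) * P := e11
      _ ≤ Y * P := by gcongr
  rcases hY0.eq_or_lt with h0 | h0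
  · rw [← h0]; positivity
  · have : Y * Y ≤ Y * (4 * P) := by nlinarith
    exact le_of_mul_le_mul_left this h0

/-- Exponentially small difference of the global and the localized solution. -/
theorem error_le {C₀ : ℝ} (hC₀ : 0 ≤ C₀) {d : Fin N → ℕ} (hcut : X.HasCutoff C₀ d) {l : ℕ}
    (hd : ∀ k ∉ R, d k = l + 1) {ψ' : S} {q' : U}
    (h : X.Solves ℓ Set.univ (X.p i j₀) ψ q) (h' : X.Solves ℓ R (X.p i j₀) ψ' q')
    (hi : i ∈ R) (hdi : d i = 0) (hℓ : ∀ k, ℓ k < X.L k)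
    (hj₀ : j₀ < ℓ i) (hΛ : 0 < Λ) (hev : ∀ k j, ℓ k ≤ j → j < X.L k → Λ ≤ X.ev k j)
    {α : ℝ} (hα : 0 ≤ α) (hα' : 6 * C₀ * (1 + 1 / Λ) * α ^ 2 ≤ 1 / 4) :
    ∑ k, X.BB k (ψ - ψ') (ψ - ψ') + ∑ k, X.s k (q - q') (q - q') ≤
      20 * (1 + 1 / Λ) * ((1 + α) ^ l)⁻¹ * X.s i (X.p i j₀) (X.p i j₀) := by
  have hwt := h.weighted_energy_le hC₀ hcut hdi hℓ hj₀ hΛ hev hα hα'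
  set ρ := 1 + α with hρ
  have hρ1 : 1 ≤ ρ := by linarith
  have hρ0 : 0 < ρ := by linarith
  have hW := h.memW hℓ hj₀
  have hW' := h'.memW hℓ hj₀
  -- The exponential weight, truncated at layer l and normalized to be 1 from there on.
  set f : ℕ → ℝ := fun n => ρ ^ (min n l) / ρ ^ l with hf
  have hf0 : ∀ n, 0 ≤ f n := fun n => by positivity
  have hf1 : ∀ n, f n ≤ 1 := fun n =>
    (div_le_one (by positivity)).2 (pow_le_pow_right₀ hρ1 (min_le_right _ _))
  have hf2 : ∀ n, f n ≤ ρ ^ n / ρ ^ l := fun n => by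
    have := pow_le_pow_right₀ hρ1 (min_le_left n l)
    simp only [hf]
    gcongr
  have hD : ∀ n : ℕ, (f n - f (n - 1)) ^ 2 ≤ α ^ 2 * f n ^ 2 := by
    intro n
    have hn : 0 ≤ f n - f (n - 1) := by
      have := pow_le_pow_right₀ hρ1 (min_le_min_right l (Nat.sub_le n 1))
      simp only [hf, sub_nonneg]
      gcongr
    have hn' : f n - f (n - 1) ≤ α * f n := by
      have hm : min n l ≤ min (n - 1) l + 1 := by omega
      have h1 : f n ≤ ρ * f (n - 1) := by
        simp only [hf]
        rw [mul_div_assoc', ← pow_succ']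
        have := pow_le_pow_right₀ hρ1 hm
        gcongr
      have h2 : f (n - 1) ≤ f n := by linarith
      nlinarith
    calc (f n - f (n - 1)) ^ 2 ≤ (α * f n) ^ 2 := by gcongr
      _ = _ := by ring
  obtain ⟨τ, hτW, hτ⟩ := exists_cutoff_memW hC₀ hcut hΛ hev f hW
  -- Outside R both d k = l + 1 and d k - 1 = l give f = 1, so the cutoff is exact there and ψ - τ
  -- is supported in R. The value l + 1 rather than l is needed for this.
  have hζR : ∀ k ∉ R, X.BB k (ψ - τ) (ψ - τ) = 0 := by
    intro k hk
    have e := hτ k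
    have e1 : f (d k) = 1 := by
      simp only [hf, hd k hk]
      rw [min_eq_right (Nat.le_succ l), div_self (by positivity)]
    have e2 : f (d k - 1) = 1 := by
      simp only [hf, hd k hk, Nat.add_sub_cancel, min_self]
      rw [div_self (by positivity)]
    rw [e1, e2, one_smul, sub_self] at e
    simp only [ne_eq, OfNat.ofNat_ne_zero, not_false_eq_true, zero_pow, mul_zero, zero_mul] at e
    rw [← neg_sub τ ψ]
    simp only [map_neg, LinearMap.neg_apply, neg_neg]
    exact le_antisymm e (X.BB_nonneg k _)
  have hζW : X.MemW ℓ (ψ - τ) := fun k j h1 h2 => by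
    rw [map_sub, map_sub, LinearMap.sub_apply, hW k j h1 h2, hτW k j h1 h2, sub_self]
  -- Galerkin orthogonality on the fields of W supported in R.
  have horth : ∀ ζ, X.MemW ℓ ζ → (∀ k ∉ R, X.BB k ζ ζ = 0) →
      ∑ k, X.BB k (ψ - ψ') ζ = 0 := by
    intro ζ h1 h2
    have e1 := h.energy_eq hℓ h1 (fun k hk => absurd (Set.mem_univ k) hk)
    have e2 := h'.energy_eq hℓ h1 h2
    simp only [map_sub, LinearMap.sub_apply, Finset.sum_sub_distrib]
    linarith
  -- Best approximation: ψ - τ is a competitor for ψ', and its distance from ψ is the energy norm of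
  -- τ.
  have hbest : ∑ k, X.BB k (ψ - ψ') (ψ - ψ') ≤ ∑ k, X.BB k τ τ := by
    have e1 := horth (ψ - τ) hζW hζR
    have e2 := horth ψ' hW' (fun k hk => (h'.supp k hk).1)
    have e3 : ∀ k, X.BB k τ τ = X.BB k (ψ - ψ') (ψ - ψ') + X.BB k (ψ' - (ψ - τ)) (ψ' - (ψ - τ))
        + 2 * (X.BB k (ψ - ψ') ψ' - X.BB k (ψ - ψ') (ψ - τ)) := by
      intro k
      have := X.BB_symm k ψ ψ'
      have := X.BB_symm k ψ τ
      have := X.BB_symm k ψ' τ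
      simp only [map_sub, LinearMap.sub_apply]
      linarith
    have e4 : 0 ≤ ∑ k, X.BB k (ψ' - (ψ - τ)) (ψ' - (ψ - τ)) :=
      Finset.sum_nonneg fun k _ => X.BB_nonneg k _
    simp only [e3, Finset.sum_add_distrib, ← Finset.mul_sum, Finset.sum_sub_distrib, e1, e2]
    linarith
  set P := X.s i (X.p i j₀) (X.p i j₀) with hP
  have hP0 : 0 ≤ P := X.s_nonneg i _
  -- Write τ as the cutoff error plus f ψ. The factor 5/2 is 2 · 1/4 + 2, the decay comes from f² ≤
  -- f ≤ ρ^(d-l), and the weighted estimate contributes a further factor 4.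
  have hτE : ∑ k, X.BB k τ τ ≤ 10 * (ρ ^ l)⁻¹ * P := by
    have e1 : ∀ k, X.BB k τ τ ≤ 5 / 2 * (ρ ^ l)⁻¹ * (ρ ^ d k * X.BB k ψ ψ) := by
      intro k
      have hE := X.BB_nonneg k ψ
      have e2 := form_add_le (X.BB_symm k) (X.BB_nonneg k) (τ - f (d k) • ψ) (f (d k) • ψ)
      rw [sub_add_cancel] at e2
      have e3 := hτ k
      have e4 : 6 * C₀ * (1 + 1 / Λ) * (f (d k) - f (d k - 1)) ^ 2 ≤ 1 / 4 * f (d k) ^ 2 := by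
        calc _ ≤ 6 * C₀ * (1 + 1 / Λ) * (α ^ 2 * f (d k) ^ 2) :=
              mul_le_mul_of_nonneg_left (hD _) (by positivity)
          _ = (6 * C₀ * (1 + 1 / Λ) * α ^ 2) * f (d k) ^ 2 := by ring
          _ ≤ _ := by gcongr
      have e5 := mul_le_mul_of_nonneg_right e4 hE
      have e6 : X.BB k (f (d k) • ψ) (f (d k) • ψ) = f (d k) ^ 2 * X.BB k ψ ψ := by
        simp only [map_smul, LinearMap.smul_apply, smul_eq_mul]; ring
      have e7 : f (d k) ^ 2 ≤ (ρ ^ l)⁻¹ * ρ ^ d k := by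
        have := hf2 (d k)
        have h1 := hf1 (d k)
        have h0 := hf0 (d k)
        rw [div_eq_inv_mul] at this
        nlinarith
      have e8 := mul_le_mul_of_nonneg_right e7 hE
      rw [e6] at e2
      linarith
    calc ∑ k, X.BB k τ τ ≤ ∑ k, 5 / 2 * (ρ ^ l)⁻¹ * (ρ ^ d k * X.BB k ψ ψ) :=
          Finset.sum_le_sum fun k _ => e1 k
      _ = 5 / 2 * (ρ ^ l)⁻¹ * ∑ k, ρ ^ d k * X.BB k ψ ψ := by rw [Finset.mul_sum]
      _ ≤ 5 / 2 * (ρ ^ l)⁻¹ * (4 * P) := by gcongr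
      _ = _ := by ring
  have hq : ∑ k, X.s k (q - q') (q - q') ≤
      (1 + 1 / Λ) * ∑ k, X.BB k (ψ - ψ') (ψ - ψ') := by
    rw [Finset.mul_sum]
    exact Finset.sum_le_sum fun k _ => h.disp_error_le h' hi hℓ hj₀ hΛ hev k
  have hT := hbest.trans hτE
  have hT0 : 0 ≤ ∑ k, X.BB k (ψ - ψ') (ψ - ψ') :=
    Finset.sum_nonneg fun k _ => X.BB_nonneg k _
  have hΛ' : 0 ≤ 1 / Λ := by positivity
  calc _ ≤ (2 + 1 / Λ) * ∑ k, X.BB k (ψ - ψ') (ψ - ψ') := by linarith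
    _ ≤ (2 * (1 + 1 / Λ)) * (10 * (ρ ^ l)⁻¹ * P) := by
      gcongr
      linarith
    _ = _ := by ring

end Solves

end MixedSystem

end Elast

/-! ### Polynomials in two variables, affine substitution, comparison of forms in finite dimension.
-/

namespace Elast

open MvPolynomial

/-- Real polynomials in two variables. -/
abbrev Poly2 := MvPolynomial (Fin 2) ℝ

/-- The value of a polynomial at a point of the plane. -/
noncomputable def pev (x : Plane) : Poly2 →+* ℝ := MvPolynomial.eval (fun b => x b)

@[simp] theorem pev_C (x : Plane) (c : ℝ) : pev x (C c) = c := by simp [pev]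

@[simp] theorem pev_X (x : Plane) (i : Fin 2) : pev x (X i) = x i := by simp [pev]

@[simp] theorem pev_smul (x : Plane) (c : ℝ) (p : Poly2) : pev x (c • p) = c * pev x p := by
  simp [pev, MvPolynomial.smul_eval]

theorem contDiff_pev (p : Poly2) : ContDiff ℝ ∞ (fun x => pev x p) := by
  induction p using MvPolynomial.induction_on with
  | C a => simpa using contDiff_const
  | add p q hp hq => simpa using hp.add hq
  | mul_X p i hp =>
    simp only [map_mul, pev_X]
    exact hp.mul (contDiff_piLp_apply 2)

theorem continuous_pev (p : Poly2) : Continuous (fun x => pev x p) := (contDiff_pev p).continuous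

theorem differentiable_pev (p : Poly2) : Differentiable ℝ (fun x => pev x p) :=
  (contDiff_pev p).differentiable (by simp)

theorem hasFDerivAt_pev (p : Poly2) (x : Plane) :
    HasFDerivAt (fun x => pev x p)
      (∑ b, pev x (pderiv b p) • (EuclideanSpace.proj b : Plane →L[ℝ] ℝ)) x := by
  induction p using MvPolynomial.induction_on with
  | C a => simpa using hasFDerivAt_const a x
  | add p q hp hq =>
    simp only [map_add, add_smul, Finset.sum_add_distrib]
    exact hp.add hq
  | mul_X p i hp =>
    have h2 : HasFDerivAt (fun x : Plane => x i) (EuclideanSpace.proj i : Plane →L[ℝ] ℝ) x :=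
      (EuclideanSpace.proj i : Plane →L[ℝ] ℝ).hasFDerivAt
    have h := hp.mul h2
    simp only [map_mul, pev_X]
    refine h.congr_fderiv ?_
    ext v
    fin_cases i <;> simp [Derivation.leibniz, pderiv_X, Pi.single_apply] <;> ring

theorem partialD_pev (b : Fin 2) (p : Poly2) (x : Plane) :
    partialD b (fun x => pev x p) x = pev x (pderiv b p) := by
  rw [partialD, (hasFDerivAt_pev p x).fderiv]
  fin_cases b <;> simp

/-- An open set contains a product of two infinite sets, and a polynomial that vanishes on such a
product is zero. -/
theorem poly_eq_zero_of_isOpen {U : Set Plane} (hU : IsOpen U) (hne : U.Nonempty) {p : Poly2}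
    (h : ∀ x ∈ U, pev x p = 0) : p = 0 := by
  obtain ⟨x, hx⟩ := hne
  have hc : Continuous (fun w : Fin 2 → ℝ => (WithLp.toLp 2 w : Plane)) :=
    PiLp.continuous_toLp 2 _
  have hV : IsOpen ((fun w : Fin 2 → ℝ => (WithLp.toLp 2 w : Plane)) ⁻¹' U) := hU.preimage hc
  obtain ⟨u, hu, hsub⟩ := isOpen_pi_iff'.1 hV (fun b => x b) hx
  refine MvPolynomial.funext_set u (fun i => ?_) fun w hw => ?_
  · exact infinite_of_mem_nhds (x i) ((hu i).1.mem_nhds (hu i).2)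
  · have := h _ (hsub hw)
    simpa [pev] using this

theorem poly_ext_of_isOpen {U : Set Plane} (hU : IsOpen U) (hne : U.Nonempty) {p q : Poly2}
    (h : ∀ x ∈ U, pev x p = pev x q) : p = q :=
  sub_eq_zero.1 (poly_eq_zero_of_isOpen hU hne fun x hx => by rw [map_sub, h x hx, sub_self])

theorem totalDegree_pderiv_le {p : Poly2} {d : ℕ} (hp : p.totalDegree ≤ d) (b : Fin 2) :
    (pderiv b p).totalDegree ≤ d - 1 := by
  rw [MvPolynomial.as_sum p, map_sum]
  refine totalDegree_finsetSum_le fun m hm => ?_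
  rw [pderiv_monomial]
  by_cases h0 : m b = 0
  · simp [h0]
  refine (totalDegree_monomial_le _ _).trans ?_
  have h1 := (le_totalDegree hm).trans hp
  rw [Finsupp.sum_fintype _ _ (by simp)] at h1 ⊢
  simp only [Fin.sum_univ_two] at h1 ⊢
  fin_cases b <;> simp at h0 ⊢ <;> omega

theorem totalDegree_sum_C_mul_X_add_C_le (w : Fin 2 → ℝ) (c : ℝ) :
    (C c + ∑ j, C (w j) * X j : Poly2).totalDegree ≤ 1 := by
  refine (totalDegree_add _ _).trans (max_le (by simp) ?_)
  refine totalDegree_finsetSum_le fun j _ => (totalDegree_mul _ _).trans ?_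
  simp

/-- Substitution of the affine map `y ↦ z + B y` in a polynomial. -/
noncomputable def affSubst (z : Plane) (B : Matrix (Fin 2) (Fin 2) ℝ) : Poly2 →ₐ[ℝ] Poly2 :=
  bind₁ (fun i => C (z i) + ∑ j, C (B i j) * X j)

/-- The affine map `y ↦ z + B y`. -/
noncomputable def affMap (z : Plane) (B : Matrix (Fin 2) (Fin 2) ℝ) (y : Plane) : Plane :=
  z + Matrix.toLpLin 2 2 B y

theorem affMap_apply (z : Plane) (B : Matrix (Fin 2) (Fin 2) ℝ) (y : Plane) (i : Fin 2) :
    affMap z B y i = z i + ∑ j, B i j * y j := by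
  fin_cases i <;> simp [affMap, Matrix.toLpLin_apply]

theorem pev_affSubst (z : Plane) (B : Matrix (Fin 2) (Fin 2) ℝ) (p : Poly2) (y : Plane) :
    pev y (affSubst z B p) = pev (affMap z B y) p := by
  induction p using MvPolynomial.induction_on with
  | C a => simp [affSubst]
  | add p q hp hq => simp [hp, hq]
  | mul_X p i hp =>
    rw [map_mul, map_mul, map_mul, hp]
    simp [affSubst, affMap_apply]

theorem totalDegree_affSubst_le (z : Plane) (B : Matrix (Fin 2) (Fin 2) ℝ) {p : Poly2} {d : ℕ}
    (hp : p.totalDegree ≤ d) : (affSubst z B p).totalDegree ≤ d := by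
  rw [MvPolynomial.as_sum p, map_sum]
  refine totalDegree_finsetSum_le fun m hm => ?_
  have h1 := (le_totalDegree hm).trans hp
  rw [Finsupp.sum_fintype _ _ (by simp)] at h1
  rw [affSubst, bind₁_monomial]
  refine (totalDegree_mul _ _).trans ?_
  rw [totalDegree_C, zero_add]
  refine (totalDegree_finsetProd _ _).trans (le_trans ?_ h1)
  refine (Finset.sum_le_sum (g := fun i => m i) fun i _ => ?_).trans
    (Finset.sum_le_sum_of_subset (Finset.subset_univ _))
  refine (totalDegree_pow _ _).trans ?_
  have := totalDegree_sum_C_mul_X_add_C_le (B i) (z i)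
  nlinarith

theorem pderiv_affSubst (z : Plane) (B : Matrix (Fin 2) (Fin 2) ℝ) (p : Poly2) (k : Fin 2) :
    pderiv k (affSubst z B p) = ∑ b, C (B b k) * affSubst z B (pderiv b p) := by
  induction p using MvPolynomial.induction_on with
  | C a => simp [affSubst]
  | add p q hp hq => simp [hp, hq, mul_add, Finset.sum_add_distrib]
  | mul_X p i hp =>
    rw [map_mul, Derivation.leibniz, hp]
    fin_cases i <;> fin_cases k <;>
      simp [affSubst, Derivation.leibniz, pderiv_X, Pi.single_apply] <;> try ring

section FiniteDimensional

variable {V : Type*} [AddCommGroup V] [Module ℝ V] [FiniteDimensional ℝ V]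

/-- The quotient of the two forms is continuous on the compact unit sphere in coordinates and
homogeneous of degree zero. All constants that depend on r alone originate here. -/
theorem exists_form_le (b c : V →ₗ[ℝ] V →ₗ[ℝ] ℝ) (hb : ∀ x, x ≠ 0 → 0 < b x x) :
    ∃ K : ℝ, 0 ≤ K ∧ ∀ x, c x x ≤ K * b x x := by
  let e := (Module.finBasis ℝ V)
  have hcont : ∀ f : V →ₗ[ℝ] V →ₗ[ℝ] ℝ, Continuous
      (fun y : Fin (Module.finrank ℝ V) → ℝ => f (e.equivFun.symm y) (e.equivFun.symm y)) := by
    intro f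
    have : (fun y : Fin (Module.finrank ℝ V) → ℝ =>
        f (e.equivFun.symm y) (e.equivFun.symm y)) =
        fun y => ∑ i, ∑ j, y i * (y j * f (e j) (e i)) := by
      funext y
      simp [Module.Basis.equivFun_symm_apply, Finset.mul_sum]
    rw [this]
    fun_prop
  have hpos : ∀ y : Fin (Module.finrank ℝ V) → ℝ, y ≠ 0 →
      0 < b (e.equivFun.symm y) (e.equivFun.symm y) := fun y hy =>
    hb _ (by rwa [ne_eq, LinearEquiv.map_eq_zero_iff])
  have hS : IsCompact (Metric.sphere (0 : Fin (Module.finrank ℝ V) → ℝ) 1) := isCompact_sphere _ _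
  have hne : ∀ y ∈ Metric.sphere (0 : Fin (Module.finrank ℝ V) → ℝ) 1, y ≠ 0 := by
    rintro y hy rfl
    simp at hy
  obtain ⟨K, hK⟩ := (hS.image_of_continuousOn (f := fun y =>
    c (e.equivFun.symm y) (e.equivFun.symm y) / b (e.equivFun.symm y) (e.equivFun.symm y))
    ((hcont c).continuousOn.div (hcont b).continuousOn
      fun y hy => (hpos y (hne y hy)).ne')).bddAbove
  refine ⟨max K 0, le_max_right _ _, fun x => ?_⟩
  rcases eq_or_ne x 0 with rfl | hx
  · simp
  set y := e.equivFun x with hy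
  have hy0 : y ≠ 0 := by simpa [hy] using hx
  have hn : 0 < ‖y‖ := norm_pos_iff.2 hy0
  have h1 : ‖y‖⁻¹ • y ∈ Metric.sphere (0 : Fin (Module.finrank ℝ V) → ℝ) 1 := by
    simp [norm_smul, hn.ne']
  have h2 := hK (Set.mem_image_of_mem _ h1)
  have h3 : e.equivFun.symm y = x := by simp [hy]
  simp only [map_smul, h3, LinearMap.smul_apply, smul_eq_mul] at h2
  have hbx := hb x hx
  have h4 : c x x / b x x ≤ K := by
    have : ‖y‖⁻¹ * (‖y‖⁻¹ * (c x) x) / (‖y‖⁻¹ * (‖y‖⁻¹ * (b x) x)) = c x x / b x x := by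
      field_simp
    rwa [this] at h2
  rw [div_le_iff₀ hbx] at h4
  exact h4.trans (mul_le_mul_of_nonneg_right (le_max_left _ _) hbx.le)

end FiniteDimensional

section PolyForm

open MeasureTheory

theorem integrableOn_pev {S : Set Plane} (hS : IsCompact S) (p : Poly2) :
    IntegrableOn (fun x => pev x p) S :=
  (continuous_pev p).continuousOn.integrableOn_compact hS

/-- The `L²(S)` product of polynomials, for a compact set `S`. -/
noncomputable def polyForm {S : Set Plane} (hS : IsCompact S) : Poly2 →ₗ[ℝ] Poly2 →ₗ[ℝ] ℝ :=
  LinearMap.mk₂ ℝ (fun p q => ∫ x in S, pev x (p * q))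
    (fun p p' q => by
      simp only [add_mul, map_add]
      exact integral_add (integrableOn_pev hS _) (integrableOn_pev hS _))
    (fun c p q => by
      simp only [smul_mul_assoc, pev_smul, integral_const_mul, smul_eq_mul])
    (fun p q q' => by
      simp only [mul_add, map_add]
      exact integral_add (integrableOn_pev hS _) (integrableOn_pev hS _))
    (fun c p q => by
      simp only [mul_smul_comm, pev_smul, integral_const_mul, smul_eq_mul])

theorem polyForm_self {S : Set Plane} (hS : IsCompact S) (p : Poly2) :
    polyForm hS p p = ∫ x in S, pev x p ^ 2 := by
  simp [polyForm, sq]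

theorem integral_pev_sq_nonneg (S : Set Plane) (p : Poly2) : 0 ≤ ∫ x in S, pev x p ^ 2 :=
  integral_nonneg fun _ => sq_nonneg _

/-- A vanishing integral of the square forces the continuous integrand to vanish on the interior,
hence the polynomial to be zero. -/
theorem polyForm_pos {S : Set Plane} (hS : IsCompact S) (hi : (interior S).Nonempty) {p : Poly2}
    (hp : p ≠ 0) : 0 < polyForm hS p p := by
  rw [polyForm_self]
  refine lt_of_le_of_ne (integral_pev_sq_nonneg S p) fun h0 => hp ?_
  refine poly_eq_zero_of_isOpen isOpen_interior hi ?_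
  have hc : Continuous (fun x => pev x p ^ 2) := (continuous_pev p).pow 2
  have hint : IntegrableOn (fun x => pev x p ^ 2) S := hc.continuousOn.integrableOn_compact hS
  have h1 : (fun x => pev x p ^ 2) =ᵐ[volume.restrict S] 0 :=
    (integral_eq_zero_iff_of_nonneg (fun _ => sq_nonneg _) hint).1 h0.symm
  have h2 : (fun x => pev x p ^ 2) =ᵐ[volume.restrict (interior S)] 0 :=
    ae_restrict_of_ae_restrict_of_subset interior_subset h1
  have h3 : Set.EqOn (fun x => pev x p ^ 2) 0 (interior S) :=
    Measure.eqOn_open_of_ae_eq h2 isOpen_interior hc.continuousOn continuousOn_const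
  intro x hx
  have := h3 hx
  simpa using this

end PolyForm

end Elast

/-! ### The composite stress element on the reference triangle and explicit quadratic lifts. -/

namespace Elast

open MvPolynomial

/-- The vector `u` turned clockwise by a right angle. -/
def rotv (u : Plane) : Fin 2 → ℝ := ![u 1, -u 0]

@[simp] theorem rotv_zero (u : Plane) : rotv u 0 = u 1 := rfl

@[simp] theorem rotv_one (u : Plane) : rotv u 1 = -u 0 := rfl

/-- The barycenter of a triangle. -/
noncomputable def centroid (v : Fin 3 → Plane) : Plane := (1 / 3 : ℝ) • ∑ c, v c

/-- The weights of the point with parameter `s` on the edge opposite to the vertex `m`. -/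
def edgeW (m : Fin 3) (s : ℝ) (c : Fin 3) : ℝ :=
  if c = m + 1 then 1 - s else if c = m + 2 then s else 0

/-- The point with parameter `s` on the edge opposite to the vertex `m`. -/
noncomputable def edgePt (v : Fin 3 → Plane) (m : Fin 3) (s : ℝ) : Plane :=
  (1 - s) • v (m + 1) + s • v (m + 2)

/-- The scaled normal of the edge opposite to the vertex `m`. -/
def edgeN (v : Fin 3 → Plane) (m : Fin 3) : Fin 2 → ℝ := rotv (v (m + 2) - v (m + 1))

/-- A tensor field that is a polynomial on each of the three parts of a triangle. -/
abbrev TriField := Fin 3 → Fin 2 → Fin 2 → Poly2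

/-- The composite stress space on a triangle with vertices `v`: symmetric fields of degree at
most `r` on the three parts, with continuous normal component and with one polynomial as
divergence. -/
structure MemLoc (r : ℕ) (v : Fin 3 → Plane) (P : TriField) : Prop where
  deg : ∀ c a b, (P c a b).totalDegree ≤ r
  symm : ∀ c a b, P c a b = P c b a
  div : ∀ c c' a, ∑ b, pderiv b (P c a b) = ∑ b, pderiv b (P c' a b)
  inner : ∀ m a, ∀ s ∈ Set.Icc (0 : ℝ) 1,
    ∑ b, pev (centroid v + s • (v m - centroid v)) (P (m + 1) a b - P (m + 2) a b) *
      rotv (v m - centroid v) b = 0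

/-- The normal trace on the edge opposite to the vertex `m`. -/
noncomputable def trace (v : Fin 3 → Plane) (P : TriField) (m : Fin 3) (a : Fin 2) : Poly2 :=
  ∑ b, C (edgeN v m b) * P m a b

/-- The composite stress space as a subspace. -/
def locSigma (r : ℕ) (v : Fin 3 → Plane) : Submodule ℝ TriField where
  carrier := {P | MemLoc r v P}
  zero_mem' := by
    refine ⟨fun c a b => by simp, fun c a b => rfl, fun c c' a => rfl, fun m a s _ => by simp⟩
  add_mem' := by
    intro P Q hP hQ
    refine ⟨fun c a b => ?_, fun c a b => ?_, fun c c' a => ?_, fun m a s hs => ?_⟩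
    · exact (totalDegree_add _ _).trans (max_le (hP.deg c a b) (hQ.deg c a b))
    · simp only [Pi.add_apply, hP.symm c a b, hQ.symm c a b]
    · simp only [Pi.add_apply, map_add, Finset.sum_add_distrib, hP.div c c' a, hQ.div c c' a]
    · have h1 := hP.inner m a s hs
      have h2 := hQ.inner m a s hs
      simp only [Fin.sum_univ_two, Pi.add_apply, map_add, map_sub] at h1 h2 ⊢
      linear_combination h1 + h2
  smul_mem' := by
    intro t P hP
    refine ⟨fun c a b => ?_, fun c a b => ?_, fun c c' a => ?_, fun m a s hs => ?_⟩
    · exact (totalDegree_smul_le _ _).trans (hP.deg c a b)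
    · simp only [Pi.smul_apply, hP.symm c a b]
    · simp only [Pi.smul_apply, Derivation.map_smul, ← Finset.smul_sum, hP.div c c' a]
    · have h1 := hP.inner m a s hs
      simp only [Fin.sum_univ_two, Pi.smul_apply, map_sub, pev_smul] at h1 ⊢
      linear_combination t * h1

theorem mem_locSigma {r : ℕ} {v : Fin 3 → Plane} {P : TriField} :
    P ∈ locSigma r v ↔ MemLoc r v P := Iff.rfl

instance (r : ℕ) (v : Fin 3 → Plane) : FiniteDimensional ℝ (locSigma r v) := by
  let f : locSigma r v →ₗ[ℝ] (Fin 3 → Fin 2 → Fin 2 → restrictTotalDegree (Fin 2) ℝ r) :=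
    { toFun := fun P c a b => ⟨P.1 c a b, (mem_restrictTotalDegree _ _ _).2 (P.2.deg c a b)⟩
      map_add' := fun _ _ => rfl
      map_smul' := fun _ _ => rfl }
  refine FiniteDimensional.of_injective f fun P Q h => ?_
  ext1
  funext c a b
  exact congrArg Subtype.val (congrFun (congrFun (congrFun h c) a) b)

/-- The vertices of the reference triangle. Its barycenter is the origin. -/
noncomputable def refV : Fin 3 → Plane := ![!₂[1, 0], !₂[0, 1], !₂[-1, -1]]

@[simp] theorem refV_zero : refV 0 = !₂[1, 0] := rfl

@[simp] theorem refV_one : refV 1 = !₂[0, 1] := rfl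

@[simp] theorem refV_two : refV 2 = !₂[-1, -1] := rfl

@[simp] theorem centroid_refV : centroid refV = 0 := by
  ext i; fin_cases i <;> simp [centroid, Fin.sum_univ_three]

/-- The gradients of the barycentric coordinates of the reference triangle. -/
noncomputable def refG : Fin 3 → Fin 2 → ℝ :=
  ![![2 / 3, -1 / 3], ![-1 / 3, 2 / 3], ![-1 / 3, -1 / 3]]

/-- The barycentric coordinates of the reference triangle. -/
noncomputable def refLam (c : Fin 3) : Poly2 := C (1 / 3) + ∑ j, C (refG c j) * X j

theorem pev_refLam' (c : Fin 3) (x : Plane) :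
    pev x (refLam c) = 1 / 3 + (refG c 0 * x 0 + refG c 1 * x 1) := by
  simp [refLam]

theorem sum_refLam : ∑ c, refLam c = 1 := by
  apply MvPolynomial.funext
  intro x
  simp [Fin.sum_univ_three, refLam, refG]
  ring

theorem pev_refLam (m c : Fin 3) (s : ℝ) : pev (edgePt refV m s) (refLam c) = edgeW m s c := by
  rw [pev_refLam']
  fin_cases m <;> fin_cases c <;> simp [edgePt, refG, edgeW] <;> ring

theorem totalDegree_refLam_le (c : Fin 3) : (refLam c).totalDegree ≤ 1 :=
  totalDegree_sum_C_mul_X_add_C_le _ _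

/-- The part of a polynomial of degree `r` that belongs to the vertex `c`. In terms of the
homogeneous polynomial of degree `r` in barycentric coordinates this is `r⁻¹ λ_c ∂_{λ_c}`. -/
noncomputable def refJ (r : ℕ) (c : Fin 3) (p : Poly2) : Poly2 :=
  refLam c * (p + C (1 / r : ℝ) * ∑ b, (C (refV c b) - X b) * pderiv b p)

theorem refJ_add (r : ℕ) (c : Fin 3) (p q : Poly2) :
    refJ r c (p + q) = refJ r c p + refJ r c q := by
  simp only [refJ, map_add, Fin.sum_univ_two]; ring

theorem refJ_smul (r : ℕ) (c : Fin 3) (t : ℝ) (p : Poly2) :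
    refJ r c (t • p) = t • refJ r c p := by
  simp only [refJ, Derivation.map_smul, Fin.sum_univ_two]
  simp only [smul_eq_C_mul]; ring

/-- `refJ` as a linear map. -/
noncomputable def refJL (r : ℕ) (c : Fin 3) : Poly2 →ₗ[ℝ] Poly2 where
  toFun := refJ r c
  map_add' := refJ_add r c
  map_smul' := refJ_smul r c

/-- The barycentric coordinates sum to 1, and the sum of λ_c (v_c - x) is zero, so the derivative
terms cancel. -/
theorem sum_refJ (r : ℕ) (p : Poly2) : ∑ c, refJ r c p = p := by
  have h1 : ∀ b, ∑ c, refLam c * (C (refV c b) - X b) = 0 := by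
    intro b
    apply MvPolynomial.funext
    intro x
    fin_cases b <;> simp [Fin.sum_univ_three, refLam, refG] <;> ring
  calc ∑ c, refJ r c p = (∑ c, refLam c) * p + C (1 / r : ℝ) *
        ∑ b, (∑ c, refLam c * (C (refV c b) - X b)) * pderiv b p := by
        simp only [refJ, Fin.sum_univ_two, Fin.sum_univ_three]; ring
    _ = p := by simp only [h1, sum_refLam]; simp

/-- By Euler's identity, on a monomial of degree d the part of degree d + 1 carries the factor 1 -
d/r. It vanishes for d = r, the only case in which the factor λ_c could raise the degree above r. -/
theorem totalDegree_refJ_le {r : ℕ} (hr : 0 < r) (c : Fin 3) {p : Poly2}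
    (hp : p.totalDegree ≤ r) : (refJ r c p).totalDegree ≤ r := by
  rw [MvPolynomial.as_sum p]
  change (refJL r c _).totalDegree ≤ r
  rw [map_sum]
  refine totalDegree_finsetSum_le fun m hm => ?_
  change (refJ r c _).totalDegree ≤ r
  set t := coeff m p
  set μ : Poly2 := monomial m t with hμ
  have hd : m 0 + m 1 ≤ r := by
    have h1 := (le_totalDegree hm).trans hp
    rw [Finsupp.sum_fintype _ _ (by simp)] at h1
    simpa using h1
  have hμd : μ.totalDegree ≤ m 0 + m 1 := by
    refine (totalDegree_monomial_le _ _).trans ?_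
    rw [Finsupp.sum_fintype _ _ (by simp)]
    simp
  have he : ∑ b, X b * pderiv b μ = C ((m 0 + m 1 : ℕ) : ℝ) * μ := by
    rw [Fin.sum_univ_two, hμ, X_mul_pderiv_monomial, X_mul_pderiv_monomial, ← add_smul,
      ← Nat.cast_smul_eq_nsmul ℝ, smul_eq_C_mul]
  have hJ : refJ r c μ = C (1 - (m 0 + m 1 : ℕ) / r : ℝ) * (refLam c * μ) +
      C (1 / r : ℝ) * ∑ b, C (refV c b) * (refLam c * pderiv b μ) := by
    have h2 : (C (1 - (m 0 + m 1 : ℕ) / r : ℝ) : Poly2) =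
        1 - C (1 / r : ℝ) * C ((m 0 + m 1 : ℕ) : ℝ) := by
      rw [← C_mul, ← C_1, ← C_sub]
      congr 1
      ring
    rw [h2]
    simp only [refJ, Fin.sum_univ_two] at he ⊢
    linear_combination (- refLam c * C (1 / r : ℝ)) * he
  rw [hJ]
  have hlam := totalDegree_refLam_le c
  have hC : ∀ (z : ℝ) (q : Poly2), (C z * q).totalDegree ≤ q.totalDegree := fun z q => by
    refine (totalDegree_mul _ _).trans ?_
    simp
  refine (totalDegree_add _ _).trans (max_le ?_ ?_)
  · rcases hd.eq_or_lt with h | h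
    · rw [h, div_self (by positivity), sub_self, C_0, zero_mul]
      simp
    · refine (hC _ _).trans ((totalDegree_mul _ _).trans ?_)
      omega
  · refine (hC _ _).trans (totalDegree_finsetSum_le fun b _ => (hC _ _).trans ?_)
    refine (totalDegree_mul _ _).trans ?_
    rcases Nat.eq_zero_or_pos (m 0 + m 1) with h0 | h0
    · have : m b = 0 := by fin_cases b <;> simp <;> omega
      rw [hμ, pderiv_monomial, this]
      simp
      omega
    · have := totalDegree_pderiv_le hμd b
      omega

/-- The quadratic polynomial with given coefficients. -/
noncomputable def quadP (k : Fin 6 → ℝ) : Poly2 :=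
  C (k 0) + C (k 1) * X 0 + C (k 2) * X 1 + C (k 3) * X 0 ^ 2 + C (k 4) * (X 0 * X 1) +
    C (k 5) * X 1 ^ 2

theorem pev_quadP (k : Fin 6 → ℝ) (x : Plane) : pev x (quadP k) =
    k 0 + k 1 * x 0 + k 2 * x 1 + k 3 * x 0 ^ 2 + k 4 * (x 0 * x 1) + k 5 * x 1 ^ 2 := by
  simp [quadP]

theorem pderiv_zero_quadP (k : Fin 6 → ℝ) :
    pderiv 0 (quadP k) = C (k 1) + C (2 * k 3) * X 0 + C (k 4) * X 1 := by
  apply MvPolynomial.funext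
  intro x
  simp [quadP, Derivation.leibniz, Derivation.leibniz_pow, pderiv_X]; ring

theorem pderiv_one_quadP (k : Fin 6 → ℝ) :
    pderiv 1 (quadP k) = C (k 2) + C (k 4) * X 0 + C (2 * k 5) * X 1 := by
  apply MvPolynomial.funext
  intro x
  simp [quadP, Derivation.leibniz, Derivation.leibniz_pow, pderiv_X]; ring

theorem totalDegree_quadP_le (k : Fin 6 → ℝ) : (quadP k).totalDegree ≤ 2 := by
  have h : ∀ (z : ℝ) (q : Poly2), q.totalDegree ≤ 2 → (C z * q).totalDegree ≤ 2 :=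
    fun z q hq => by
      refine (totalDegree_mul _ _).trans ?_
      simpa using hq
  have h2 : ∀ p q : Poly2, p.totalDegree ≤ 2 → q.totalDegree ≤ 2 → (p + q).totalDegree ≤ 2 :=
    fun p q hp hq => (totalDegree_add _ _).trans (max_le hp hq)
  have h3 : ∀ i : Fin 2, (X i ^ 2 : Poly2).totalDegree ≤ 2 := fun i => by
    rw [totalDegree_X_pow]
  unfold quadP
  refine h2 _ _ (h2 _ _ (h2 _ _ (h2 _ _ (h2 _ _ (by simp) (h _ _ (by simp)))
    (h _ _ (by simp))) (h _ _ (h3 0))) (h _ _ ?_)) (h _ _ (h3 1))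
  refine (totalDegree_mul _ _).trans ?_
  simp

/-- Coefficients of a stress field on the reference triangle with normal trace `(1 - s) u + s w` on
the edge opposite to the vertex 0, and `0` on the other edges. For each of the three parts the
table has the entries `00`, `01`, `11` of the tensor. -/
noncomputable def liftCoef0 (u w : Fin 2 → ℝ) : Fin 3 → Fin 3 → Fin 6 → ℝ :=
  ![![![-7/36 * u 0 - 1/12 * u 1 - 1/36 * w 0 - 7/18 * w 1, -5/36 * u 0 - 1/4 * u 1 + 13/36 * w 0 - 5/18 * w 1, -5/36 * u 0 + 1/12 * u 1 + 1/36 * w 0 + 7/18 * w 1, -5/12 * u 0 - 5/12 * u 1 + 5/12 * w 0 - 5/6 * w 1, 1/3 * u 0 + 1/3 * u 1 - 1/3 * w 0 + 2/3 * w 1, 0],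
      ![-5/36 * u 0 - 1/4 * u 1 + 1/36 * w 0 - 5/18 * w 1, -29/18 * u 0 - 3/2 * u 1 + 13/18 * w 0 - 11/9 * w 1, 17/36 * u 0 + 1/4 * u 1 - 1/36 * w 0 + 5/18 * w 1, -5/2 * u 0 - 5/2 * u 1 + 5/2 * w 0 - 5 * w 1, 3/2 * u 0 + 3/2 * u 1 - 3/2 * w 0 + 3 * w 1, 0],
      ![-7/36 * u 0 - 1/12 * u 1 - 1/36 * w 0 - 1/18 * w 1, -32/9 * u 0 - 11/3 * u 1 + 16/9 * w 0 - 31/9 * w 1, 29/18 * u 0 + 11/6 * u 1 - 13/18 * w 0 + 14/9 * w 1, -6 * u 0 - 6 * u 1 + 6 * w 0 - 12 * w 1, 5 * u 0 + 5 * u 1 - 5 * w 0 + 10 * w 1, -3/4 * u 0 - 3/4 * u 1 + 3/4 * w 0 - 3/2 * w 1]],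
    ![![-7/36 * u 0 - 1/12 * u 1 - 1/36 * w 0 - 7/18 * w 1, -7/18 * u 0 - 1/2 * u 1 + 11/18 * w 0 - 7/9 * w 1, 19/9 * u 0 + 7/3 * u 1 - 11/9 * w 0 + 26/9 * w 1, 7/12 * u 0 + 7/12 * u 1 - 7/12 * w 0 + 7/6 * w 1, -8/3 * u 0 - 8/3 * u 1 + 8/3 * w 0 - 16/3 * w 1, 4 * u 0 + 4 * u 1 - 4 * w 0 + 8 * w 1],
      ![-5/36 * u 0 - 1/4 * u 1 + 1/36 * w 0 - 5/18 * w 1, 5/36 * u 0 + 1/4 * u 1 - 1/36 * w 0 + 5/18 * w 1, 13/18 * u 0 + 1/2 * u 1 - 5/18 * w 0 + 7/9 * w 1, 0, -1/2 * u 0 - 1/2 * u 1 + 1/2 * w 0 - w 1, 3/2 * u 0 + 3/2 * u 1 - 3/2 * w 0 + 3 * w 1],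
      ![-7/36 * u 0 - 1/12 * u 1 - 1/36 * w 0 - 1/18 * w 1, 7/36 * u 0 + 1/12 * u 1 + 1/36 * w 0 + 1/18 * w 1, -5/36 * u 0 + 1/12 * u 1 + 1/36 * w 0 + 1/18 * w 1, 0, 0, 1/4 * u 0 + 1/4 * u 1 - 1/4 * w 0 + 1/2 * w 1]],
    ![![-7/36 * u 0 - 1/12 * u 1 - 1/36 * w 0 - 7/18 * w 1, -5/36 * u 0 - 1/4 * u 1 + 13/36 * w 0 - 5/18 * w 1, -5/36 * u 0 + 1/12 * u 1 + 1/36 * w 0 + 7/18 * w 1, 1/3 * u 0 + 1/3 * u 1 - 1/3 * w 0 + 2/3 * w 1, 1/3 * u 0 + 1/3 * u 1 - 1/3 * w 0 + 2/3 * w 1, 0],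
      ![-5/36 * u 0 - 1/4 * u 1 + 1/36 * w 0 - 5/18 * w 1, 5/36 * u 0 + 1/4 * u 1 - 1/36 * w 0 + 5/18 * w 1, 17/36 * u 0 + 1/4 * u 1 - 1/36 * w 0 + 5/18 * w 1, 0, 0, 0],
      ![-7/36 * u 0 - 1/12 * u 1 - 1/36 * w 0 - 1/18 * w 1, 7/36 * u 0 + 1/12 * u 1 + 1/36 * w 0 + 1/18 * w 1, -5/36 * u 0 + 1/12 * u 1 + 1/36 * w 0 + 1/18 * w 1, 0, 0, 0]]]

/-- Coefficients of a stress field on the reference triangle with normal trace `(1 - s) u + s w` on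
the edge opposite to the vertex 1, and `0` on the other edges. For each of the three parts the
table has the entries `00`, `01`, `11` of the tensor. -/
noncomputable def liftCoef1 (u w : Fin 2 → ℝ) : Fin 3 → Fin 3 → Fin 6 → ℝ :=
  ![![![5/18 * u 0 - 7/36 * u 1 + 1/12 * w 0 - 1/36 * w 1, 7/18 * u 0 - 5/36 * u 1 + 1/4 * w 0 + 1/36 * w 1, -5/18 * u 0 + 7/36 * u 1 - 1/12 * w 0 + 1/36 * w 1, 5/6 * u 0 - 5/12 * u 1 + 5/12 * w 0 + 5/12 * w 1, -2/3 * u 0 + 1/3 * u 1 - 1/3 * w 0 - 1/3 * w 1, 0],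
      ![1/18 * u 0 - 5/36 * u 1 - 1/12 * w 0 + 1/36 * w 1, 13/9 * u 0 - 11/18 * u 1 + 5/6 * w 0 + 19/18 * w 1, -1/18 * u 0 + 5/36 * u 1 + 1/12 * w 0 - 1/36 * w 1, 5 * u 0 - 5/2 * u 1 + 5/2 * w 0 + 5/2 * w 1, -3 * u 0 + 3/2 * u 1 - 3/2 * w 0 - 3/2 * w 1, 0],
      ![-1/18 * u 0 - 7/36 * u 1 + 1/12 * w 0 - 1/36 * w 1, 32/9 * u 0 - 14/9 * u 1 + 8/3 * w 0 + 22/9 * w 1, -13/9 * u 0 + 17/18 * u 1 - 5/6 * w 0 - 13/18 * w 1, 12 * u 0 - 6 * u 1 + 6 * w 0 + 6 * w 1, -10 * u 0 + 5 * u 1 - 5 * w 0 - 5 * w 1, 3/2 * u 0 - 3/4 * u 1 + 3/4 * w 0 + 3/4 * w 1]],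
    ![![5/18 * u 0 - 7/36 * u 1 + 1/12 * w 0 - 1/36 * w 1, 8/9 * u 0 - 7/18 * u 1 + 3/2 * w 0 + 23/18 * w 1, -25/9 * u 0 + 13/9 * u 1 - 10/3 * w 0 - 29/9 * w 1, -7/6 * u 0 + 7/12 * u 1 - 7/12 * w 0 - 7/12 * w 1, 16/3 * u 0 - 8/3 * u 1 + 8/3 * w 0 + 8/3 * w 1, -8 * u 0 + 4 * u 1 - 4 * w 0 - 4 * w 1],
      ![1/18 * u 0 - 5/36 * u 1 - 1/12 * w 0 + 1/36 * w 1, -1/18 * u 0 + 5/36 * u 1 + 1/12 * w 0 + 11/36 * w 1, -5/9 * u 0 + 7/18 * u 1 - 7/6 * w 0 - 23/18 * w 1, 0, u 0 - 1/2 * u 1 + 1/2 * w 0 + 1/2 * w 1, -3 * u 0 + 3/2 * u 1 - 3/2 * w 0 - 3/2 * w 1],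
      ![-1/18 * u 0 - 7/36 * u 1 + 1/12 * w 0 - 1/36 * w 1, 1/18 * u 0 + 7/36 * u 1 - 1/12 * w 0 - 11/36 * w 1, 1/18 * u 0 + 7/36 * u 1 - 1/12 * w 0 + 1/36 * w 1, 0, 0, -1/2 * u 0 + 1/4 * u 1 - 1/4 * w 0 - 1/4 * w 1]],
    ![![5/18 * u 0 - 7/36 * u 1 + 1/12 * w 0 - 1/36 * w 1, 7/18 * u 0 - 5/36 * u 1 + 1/4 * w 0 + 1/36 * w 1, -5/18 * u 0 + 7/36 * u 1 - 1/12 * w 0 + 1/36 * w 1, -2/3 * u 0 + 1/3 * u 1 - 1/3 * w 0 - 1/3 * w 1, -2/3 * u 0 + 1/3 * u 1 - 1/3 * w 0 - 1/3 * w 1, 0],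
      ![1/18 * u 0 - 5/36 * u 1 - 1/12 * w 0 + 1/36 * w 1, -1/18 * u 0 + 5/36 * u 1 + 1/12 * w 0 + 11/36 * w 1, -1/18 * u 0 + 5/36 * u 1 + 1/12 * w 0 - 1/36 * w 1, 0, 0, 0],
      ![-1/18 * u 0 - 7/36 * u 1 + 1/12 * w 0 - 1/36 * w 1, 1/18 * u 0 + 7/36 * u 1 - 1/12 * w 0 - 11/36 * w 1, 1/18 * u 0 + 7/36 * u 1 - 1/12 * w 0 + 1/36 * w 1, 0, 0, 0]]]

/-- Coefficients of a stress field on the reference triangle with normal trace `(1 - s) u + s w` on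
the edge opposite to the vertex 2, and `0` on the other edges. For each of the three parts the
table has the entries `00`, `01`, `11` of the tensor. -/
noncomputable def liftCoef2 (u w : Fin 2 → ℝ) : Fin 3 → Fin 3 → Fin 6 → ℝ :=
  ![![![1/4 * u 0 - 1/18 * u 1 - 1/18 * w 0 + 1/12 * w 1, 5/12 * u 0 + 1/18 * u 1 - 11/18 * w 0 + 1/4 * w 1, -1/4 * u 0 + 1/18 * u 1 + 7/18 * w 0 - 1/12 * w 1, -5/12 * u 0 + 5/6 * u 1 - 5/6 * w 0 + 5/12 * w 1, 1/3 * u 0 - 2/3 * u 1 + 2/3 * w 0 - 1/3 * w 1, 0],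
      ![1/12 * u 0 + 1/18 * u 1 - 5/18 * w 0 + 1/4 * w 1, -5/6 * u 0 + 19/9 * u 1 - 29/9 * w 0 + 3/2 * w 1, -1/12 * u 0 - 1/18 * u 1 + 17/18 * w 0 - 1/4 * w 1, -5/2 * u 0 + 5 * u 1 - 5 * w 0 + 5/2 * w 1, 3/2 * u 0 - 3 * u 1 + 3 * w 0 - 3/2 * w 1, 0],
      ![-1/12 * u 0 + 5/18 * u 1 - 7/18 * w 0 + 5/12 * w 1, -8/3 * u 0 + 50/9 * u 1 - 64/9 * w 0 + 10/3 * w 1, 5/6 * u 0 - 16/9 * u 1 + 29/9 * w 0 - 7/6 * w 1, -6 * u 0 + 12 * u 1 - 12 * w 0 + 6 * w 1, 5 * u 0 - 10 * u 1 + 10 * w 0 - 5 * w 1, -3/4 * u 0 + 3/2 * u 1 - 3/2 * w 0 + 3/4 * w 1]],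
    ![![1/4 * u 0 - 1/18 * u 1 - 1/18 * w 0 + 1/12 * w 1, -5/6 * u 0 + 23/9 * u 1 - 10/9 * w 0 + 1/2 * w 1, 3 * u 0 - 58/9 * u 1 + 44/9 * w 0 - 7/3 * w 1, 7/12 * u 0 - 7/6 * u 1 + 7/6 * w 0 - 7/12 * w 1, -8/3 * u 0 + 16/3 * u 1 - 16/3 * w 0 + 8/3 * w 1, 4 * u 0 - 8 * u 1 + 8 * w 0 - 4 * w 1],
      ![1/12 * u 0 + 1/18 * u 1 - 5/18 * w 0 + 1/4 * w 1, -1/12 * u 0 + 11/18 * u 1 + 5/18 * w 0 - 1/4 * w 1, 7/6 * u 0 - 23/9 * u 1 + 13/9 * w 0 - 1/2 * w 1, 0, -1/2 * u 0 + u 1 - w 0 + 1/2 * w 1, 3/2 * u 0 - 3 * u 1 + 3 * w 0 - 3/2 * w 1],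
      ![-1/12 * u 0 + 5/18 * u 1 - 7/18 * w 0 + 5/12 * w 1, 1/12 * u 0 + 1/18 * u 1 + 7/18 * w 0 - 5/12 * w 1, 1/12 * u 0 - 5/18 * u 1 - 5/18 * w 0 + 7/12 * w 1, 0, 0, 1/4 * u 0 - 1/2 * u 1 + 1/2 * w 0 - 1/4 * w 1]],
    ![![1/4 * u 0 - 1/18 * u 1 - 1/18 * w 0 + 1/12 * w 1, 5/12 * u 0 + 1/18 * u 1 - 11/18 * w 0 + 1/4 * w 1, -1/4 * u 0 + 1/18 * u 1 + 7/18 * w 0 - 1/12 * w 1, 1/3 * u 0 - 2/3 * u 1 + 2/3 * w 0 - 1/3 * w 1, 1/3 * u 0 - 2/3 * u 1 + 2/3 * w 0 - 1/3 * w 1, 0],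
      ![1/12 * u 0 + 1/18 * u 1 - 5/18 * w 0 + 1/4 * w 1, -1/12 * u 0 + 11/18 * u 1 + 5/18 * w 0 - 1/4 * w 1, -1/12 * u 0 - 1/18 * u 1 + 17/18 * w 0 - 1/4 * w 1, 0, 0, 0],
      ![-1/12 * u 0 + 5/18 * u 1 - 7/18 * w 0 + 5/12 * w 1, 1/12 * u 0 + 1/18 * u 1 + 7/18 * w 0 - 5/12 * w 1, 1/12 * u 0 - 5/18 * u 1 - 5/18 * w 0 + 7/12 * w 1, 0, 0, 0]]]

/-- The piecewise quadratic field with given coefficients. -/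
noncomputable def quadField (k : Fin 3 → Fin 3 → Fin 6 → ℝ) : TriField := fun c =>
  ![![quadP (k c 0), quadP (k c 1)], ![quadP (k c 1), quadP (k c 2)]]

theorem memLoc_quadField {r : ℕ} (hr : 2 ≤ r) {k : Fin 3 → Fin 3 → Fin 6 → ℝ}
    (hdiv : ∀ c c' x, pev x (∑ b, pderiv b (quadField k c 0 b)) =
        pev x (∑ b, pderiv b (quadField k c' 0 b)) ∧
      pev x (∑ b, pderiv b (quadField k c 1 b)) = pev x (∑ b, pderiv b (quadField k c' 1 b)))
    (hinner : ∀ m a (s : ℝ), ∑ b, pev (s • refV m) (quadField k (m + 1) a b -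
      quadField k (m + 2) a b) * rotv (refV m) b = 0) :
    MemLoc r refV (quadField k) where
  deg c a b := by
    fin_cases a <;> fin_cases b <;> exact (totalDegree_quadP_le _).trans hr
  symm c a b := by
    fin_cases a <;> fin_cases b <;> rfl
  div c c' a := by
    apply poly_ext_of_isOpen isOpen_univ Set.univ_nonempty
    intro x _
    fin_cases a
    · exact (hdiv c c' x).1
    · exact (hdiv c c' x).2
  inner n a s _ := by
    rw [centroid_refV]
    simpa using hinner n a s

/-- The coefficients solve the linear system made of a common divergence, normal continuity on the
three spokes and the prescribed traces; only the verification is needed. Splitting the triangle is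
essential: on an unsplit one, symmetry gives (τν)·μ = (τμ)·ν at a vertex with edge normals ν and μ,
so the traces on adjacent edges would not be independent. -/
theorem exists_lift0 {r : ℕ} (hr : 2 ≤ r) (u w : Fin 2 → ℝ) :
    ∃ P, MemLoc r refV P ∧ ∀ n a s, pev (edgePt refV n s) (trace refV P n a) =
      if n = 0 then (1 - s) * u a + s * w a else 0 := by
  refine ⟨quadField (liftCoef0 u w), memLoc_quadField hr ?_ ?_, ?_⟩
  · have h : ∀ c x, pev x (∑ b, pderiv b (quadField (liftCoef0 u w) c 0 b)) =
        pev x (∑ b, pderiv b (quadField (liftCoef0 u w) 0 0 b)) ∧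
        pev x (∑ b, pderiv b (quadField (liftCoef0 u w) c 1 b)) =
        pev x (∑ b, pderiv b (quadField (liftCoef0 u w) 0 1 b)) := by
      intro c x
      simp only [Fin.sum_univ_two, quadField, Matrix.cons_val, pderiv_zero_quadP,
        pderiv_one_quadP, map_add, map_mul, pev_C, pev_X]
      fin_cases c <;> simp [liftCoef0] <;> constructor <;> ring
    intro c c' x
    rw [(h c x).1, (h c' x).1, (h c x).2, (h c' x).2]
    exact ⟨rfl, rfl⟩
  · intro m a s
    fin_cases m <;> fin_cases a <;>
      simp [Fin.sum_univ_two, quadField, liftCoef0, pev_quadP] <;> ring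
  · intro n a s
    fin_cases n <;> fin_cases a <;>
      simp [trace, edgeN, edgePt, Fin.sum_univ_two, quadField, liftCoef0, pev_quadP] <;> ring

theorem exists_lift1 {r : ℕ} (hr : 2 ≤ r) (u w : Fin 2 → ℝ) :
    ∃ P, MemLoc r refV P ∧ ∀ n a s, pev (edgePt refV n s) (trace refV P n a) =
      if n = 1 then (1 - s) * u a + s * w a else 0 := by
  refine ⟨quadField (liftCoef1 u w), memLoc_quadField hr ?_ ?_, ?_⟩
  · have h : ∀ c x, pev x (∑ b, pderiv b (quadField (liftCoef1 u w) c 0 b)) =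
        pev x (∑ b, pderiv b (quadField (liftCoef1 u w) 0 0 b)) ∧
        pev x (∑ b, pderiv b (quadField (liftCoef1 u w) c 1 b)) =
        pev x (∑ b, pderiv b (quadField (liftCoef1 u w) 0 1 b)) := by
      intro c x
      simp only [Fin.sum_univ_two, quadField, Matrix.cons_val, pderiv_zero_quadP,
        pderiv_one_quadP, map_add, map_mul, pev_C, pev_X]
      fin_cases c <;> simp [liftCoef1] <;> constructor <;> ring
    intro c c' x
    rw [(h c x).1, (h c' x).1, (h c x).2, (h c' x).2]
    exact ⟨rfl, rfl⟩
  · intro m a s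
    fin_cases m <;> fin_cases a <;>
      simp [Fin.sum_univ_two, quadField, liftCoef1, pev_quadP] <;> ring
  · intro n a s
    fin_cases n <;> fin_cases a <;>
      simp [trace, edgeN, edgePt, Fin.sum_univ_two, quadField, liftCoef1, pev_quadP] <;> ring

theorem exists_lift2 {r : ℕ} (hr : 2 ≤ r) (u w : Fin 2 → ℝ) :
    ∃ P, MemLoc r refV P ∧ ∀ n a s, pev (edgePt refV n s) (trace refV P n a) =
      if n = 2 then (1 - s) * u a + s * w a else 0 := by
  refine ⟨quadField (liftCoef2 u w), memLoc_quadField hr ?_ ?_, ?_⟩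
  · have h : ∀ c x, pev x (∑ b, pderiv b (quadField (liftCoef2 u w) c 0 b)) =
        pev x (∑ b, pderiv b (quadField (liftCoef2 u w) 0 0 b)) ∧
        pev x (∑ b, pderiv b (quadField (liftCoef2 u w) c 1 b)) =
        pev x (∑ b, pderiv b (quadField (liftCoef2 u w) 0 1 b)) := by
      intro c x
      simp only [Fin.sum_univ_two, quadField, Matrix.cons_val, pderiv_zero_quadP,
        pderiv_one_quadP, map_add, map_mul, pev_C, pev_X]
      fin_cases c <;> simp [liftCoef2] <;> constructor <;> ring
    intro c c' x
    rw [(h c x).1, (h c' x).1, (h c x).2, (h c' x).2]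
    exact ⟨rfl, rfl⟩
  · intro m a s
    fin_cases m <;> fin_cases a <;>
      simp [Fin.sum_univ_two, quadField, liftCoef2, pev_quadP] <;> ring
  · intro n a s
    fin_cases n <;> fin_cases a <;>
      simp [trace, edgeN, edgePt, Fin.sum_univ_two, quadField, liftCoef2, pev_quadP] <;> ring

end Elast

/-! ### Surjectivity of the normal traces and vertex operators on the reference triangle. -/

namespace Elast

open MvPolynomial

theorem edgeW_mul_eq_zero {m n : Fin 3} (h : n ≠ m) (s : ℝ) :
    edgeW n s (m + 1) * edgeW n s (m + 2) = 0 := by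
  fin_cases m <;> fin_cases n <;> simp [edgeW] at h ⊢

theorem edgeN_refV_sq_pos (m : Fin 3) : 0 < edgeN refV m 0 ^ 2 + edgeN refV m 1 ^ 2 := by
  fin_cases m <;> simp [edgeN] <;> norm_num

theorem edgeW_self (m : Fin 3) (s : ℝ) : edgeW m s (m + 1) = 1 - s ∧ edgeW m s (m + 2) = s := by
  fin_cases m <;> simp [edgeW]

/-- The product of the coordinates of the end points vanishes on the other two edges. One polynomial
tensor on all three parts makes normal continuity and the divergence condition automatic. -/
theorem exists_bubble {r : ℕ} (hr : 2 ≤ r) (m : Fin 3) {q : Fin 2 → Poly2}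
    (hq : ∀ a, (q a).totalDegree ≤ r - 2) :
    ∃ P, MemLoc r refV P ∧ ∀ n a s, pev (edgePt refV n s) (trace refV P n a) =
      if n = m then (1 - s) * s * pev (edgePt refV n s) (q a) else 0 := by
  set ν := edgeN refV m with hν
  have hpos := edgeN_refV_sq_pos m
  rw [← hν] at hpos
  set Z := ν 0 ^ 2 + ν 1 ^ 2 with hZ
  -- A symmetric solution of Aν = q: (q⊗ν + ν⊗q)/|ν|² - (q·ν) ν⊗ν/|ν|⁴.
  set A : Fin 2 → Fin 2 → Poly2 := fun a b => C (ν b / Z) * q a + C (ν a / Z) * q b -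
    C (ν a * ν b / Z ^ 2) * (C (ν 0) * q 0 + C (ν 1) * q 1) with hA
  have hAd : ∀ a b, (A a b).totalDegree ≤ r - 2 := by
    intro a b
    have h1 : ∀ (z : ℝ) (p : Poly2), p.totalDegree ≤ r - 2 → (C z * p).totalDegree ≤ r - 2 :=
      fun z p hp => by
        refine (totalDegree_mul _ _).trans ?_
        simpa using hp
    have h2 : ∀ p p' : Poly2, p.totalDegree ≤ r - 2 → p'.totalDegree ≤ r - 2 →
        (p + p').totalDegree ≤ r - 2 :=
      fun p p' hp hp' => (totalDegree_add _ _).trans (max_le hp hp')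
    refine (totalDegree_sub _ _).trans (max_le (h2 _ _ (h1 _ _ (hq a)) (h1 _ _ (hq b)))
      (h1 _ _ (h2 _ _ (h1 _ _ (hq 0)) (h1 _ _ (hq 1)))))
  refine ⟨fun _ a b => refLam (m + 1) * refLam (m + 2) * A a b, ⟨?_, ?_, ?_, ?_⟩, ?_⟩
  · intro c a b
    refine (totalDegree_mul _ _).trans ?_
    have h1 := totalDegree_mul (refLam (m + 1)) (refLam (m + 2))
    have h2 := totalDegree_refLam_le (m + 1)
    have h3 := totalDegree_refLam_le (m + 2)
    have h4 := hAd a b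
    omega
  · intro c a b
    congr 1
    simp only [hA]
    rw [mul_comm (ν a) (ν b)]
    ring
  · exact fun _ _ _ => rfl
  · intro m a s _
    simp
  · intro n a s
    have h1 : pev (edgePt refV n s) (refLam (m + 1) * refLam (m + 2)) =
        edgeW n s (m + 1) * edgeW n s (m + 2) := by
      rw [map_mul, pev_refLam, pev_refLam]
    simp only [trace, map_sum, map_mul (pev (edgePt refV n s)) (C _), map_mul (pev (edgePt refV n s))
      (refLam (m + 1) * refLam (m + 2)), h1]
    split_ifs with h
    · subst h
      rw [(edgeW_self n s).1, (edgeW_self n s).2]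
      have h2 : ∑ b, ν b * pev (edgePt refV n s) (A a b) = pev (edgePt refV n s) (q a) := by
        simp only [Fin.sum_univ_two, hA, map_add, map_sub, map_mul, pev_C]
        have hZ0 : Z ≠ 0 := hpos.ne'
        have : ν 0 ^ 2 = Z - ν 1 ^ 2 := by rw [hZ]; ring
        field_simp
        fin_cases a <;> simp [hZ] <;> ring
      calc _ = (1 - s) * s * ∑ b, ν b * pev (edgePt refV n s) (A a b) := by
            rw [Finset.mul_sum]
            refine Finset.sum_congr rfl fun b _ => ?_
            rw [pev_C]; ring
        _ = _ := by rw [h2]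
    · rw [edgeW_mul_eq_zero h]
      simp

theorem edgePt_refV_eq (m : Fin 3) (s : ℝ) (b : Fin 2) :
    edgePt refV m s b = refV (m + 1) b + (refV (m + 2) b - refV (m + 1) b) * s := by
  simp [edgePt]; ring

/-- Restricted to the edge, g is a polynomial in the parameter s. Its difference from the linear
interpolant of the end values is divisible by s(1 - s). -/
theorem exists_edge_decomp {r : ℕ} (m : Fin 3) {g : Poly2} (hg : g.totalDegree ≤ r) :
    ∃ (u w : ℝ) (q : Poly2), q.totalDegree ≤ r - 2 ∧ ∀ s, pev (edgePt refV m s) g =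
      (1 - s) * u + s * w + (1 - s) * s * pev (edgePt refV m s) q := by
  set line : Fin 2 → Polynomial ℝ := fun b =>
    Polynomial.C (refV (m + 1) b) + Polynomial.C (refV (m + 2) b - refV (m + 1) b) * Polynomial.X
    with hline
  set f : Polynomial ℝ := aeval line g with hf
  have hdeg : f.natDegree < r + 1 := by
    have h1 : f.natDegree ≤ r * 1 := by
      refine MvPolynomial.aeval_natDegree_le g hg line fun b => ?_
      simp only [hline]
      compute_degree
    omega
  have hev : ∀ s, pev (edgePt refV m s) g = f.eval s := by
    intro s
    have h1 : f.eval s = eval (fun b => (line b).eval s) g := by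
      rw [hf, ← Polynomial.coe_evalRingHom, MvPolynomial.aeval_def, MvPolynomial.hom_eval₂]
      simp only [MvPolynomial.eval, MvPolynomial.coe_eval₂Hom]
      congr 1
      ext a
      simp
    rw [h1, pev]
    congr 2
    funext b
    rw [edgePt_refV_eq]
    simp [hline]
  -- On this edge the coordinate of the vertex m + 2 is s. The inner range is empty for k = 0 and k
  -- = 1, whose powers are already linear.
  set q : Poly2 := - ∑ k ∈ Finset.range (r + 1), ∑ i ∈ Finset.range (k - 1),
    C (f.coeff k) * refLam (m + 2) ^ i with hq
  refine ⟨f.coeff 0, ∑ k ∈ Finset.range (r + 1), f.coeff k, q, ?_, fun s => ?_⟩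
  · rw [hq, totalDegree_neg]
    refine totalDegree_finsetSum_le fun k hk => totalDegree_finsetSum_le fun i hi => ?_
    refine (totalDegree_mul _ _).trans ?_
    have h1 := totalDegree_pow (refLam (m + 2)) i
    have h2 := totalDegree_refLam_le (m + 2)
    have h3 := Finset.mem_range.1 hk
    have h4 := Finset.mem_range.1 hi
    rw [totalDegree_C, zero_add]
    refine h1.trans ?_
    calc i * (refLam (m + 2)).totalDegree ≤ i * 1 := Nat.mul_le_mul_left _ h2
      _ ≤ r - 2 := by omega
  · have hqe : pev (edgePt refV m s) q = - ∑ k ∈ Finset.range (r + 1),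
        f.coeff k * ∑ i ∈ Finset.range (k - 1), s ^ i := by
      simp only [hq, map_neg, map_sum, map_mul, map_pow, pev_C, pev_refLam, (edgeW_self m s).2,
        Finset.mul_sum]
    -- The geometric sum gives s^k - s as a multiple of s(1 - s) for k ≥ 1; for k = 0 one has 1 = (1
    -- - s) + s.
    have hk : ∀ k, s ^ k = (if k = 0 then 1 - s else 0) + s -
        (1 - s) * s * ∑ i ∈ Finset.range (k - 1), s ^ i := by
      intro k
      rcases k with _ | k
      · simp
      · have := mul_neg_geom_sum s k
        simp only [Nat.add_sub_cancel, Nat.add_eq_zero_iff, one_ne_zero, and_false, if_false]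
        linear_combination s * this
    have hz : ∑ k ∈ Finset.range (r + 1), f.coeff k * (if k = 0 then 1 - s else 0) =
        f.coeff 0 * (1 - s) := by
      rw [Finset.sum_eq_single 0]
      · simp
      · intro k _ hk
        simp [hk]
      · simp
    rw [hev, Polynomial.eval_eq_sum_range' hdeg, hqe]
    calc ∑ k ∈ Finset.range (r + 1), f.coeff k * s ^ k
        = ∑ k ∈ Finset.range (r + 1), (f.coeff k * (if k = 0 then 1 - s else 0) +
            f.coeff k * s - (1 - s) * s * (f.coeff k * ∑ i ∈ Finset.range (k - 1), s ^ i)) := by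
          refine Finset.sum_congr rfl fun k _ => ?_
          rw [hk k]; ring
      _ = _ := by
          rw [Finset.sum_sub_distrib, Finset.sum_add_distrib, hz, ← Finset.sum_mul,
            ← Finset.mul_sum]
          ring

/-- Every normal trace of degree at most `r` is attained. -/
theorem exists_memLoc_trace {r : ℕ} (hr : 2 ≤ r) {g : Fin 3 → Fin 2 → Poly2}
    (hg : ∀ m a, (g m a).totalDegree ≤ r) :
    ∃ P, MemLoc r refV P ∧ ∀ n a s,
      pev (edgePt refV n s) (trace refV P n a) = pev (edgePt refV n s) (g n a) := by
  choose u w q hq hdec using fun m a => exists_edge_decomp m (hg m a)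
  have hlift : ∀ m, ∃ P, MemLoc r refV P ∧ ∀ n a s,
      pev (edgePt refV n s) (trace refV P n a) =
        if n = m then (1 - s) * u m a + s * w m a else 0 := by
    intro m
    fin_cases m
    · exact exists_lift0 hr _ _
    · exact exists_lift1 hr _ _
    · exact exists_lift2 hr _ _
  choose P hP hPt using hlift
  choose Q hQ hQt using fun m => exists_bubble hr m (hq m)
  refine ⟨∑ m, (P m + Q m), ?_, fun n a s => ?_⟩
  · exact (locSigma r refV).sum_mem fun m _ => (locSigma r refV).add_mem (hP m) (hQ m)
  · have h1 : trace refV (∑ m, (P m + Q m)) n a =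
        ∑ m, (trace refV (P m) n a + trace refV (Q m) n a) := by
      simp only [trace, Finset.sum_apply, Pi.add_apply, Fin.sum_univ_two, Fin.sum_univ_three]
      ring
    rw [h1, map_sum]
    simp only [map_add, hPt, hQt]
    rw [Finset.sum_eq_single n]
    · rw [if_pos rfl, if_pos rfl, hdec]
    · intro m _ hm
      simp [hm.symm]
    · simp

/-- A linear operator on the composite space that acts on normal traces like `refJ`. -/
theorem exists_refG {r : ℕ} (hr : 2 ≤ r) (c : Fin 3) :
    ∃ G : locSigma r refV →ₗ[ℝ] locSigma r refV, ∀ P n a s,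
      pev (edgePt refV n s) (trace refV (G P).1 n a) =
        pev (edgePt refV n s) (refJ r c (trace refV P.1 n a)) := by
  have htd : ∀ P : locSigma r refV, ∀ n a, (trace refV P.1 n a).totalDegree ≤ r := by
    intro P n a
    refine totalDegree_finsetSum_le fun b _ => (totalDegree_mul _ _).trans ?_
    simpa using P.2.deg n a b
  have h : ∀ P : locSigma r refV, ∃ Q : locSigma r refV, ∀ n a s,
      pev (edgePt refV n s) (trace refV Q.1 n a) =
        pev (edgePt refV n s) (refJ r c (trace refV P.1 n a)) := by
    intro P
    obtain ⟨Q, hQ, h⟩ := exists_memLoc_trace hr (g := fun n a => refJ r c (trace refV P.1 n a))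
      fun n a => totalDegree_refJ_le (by omega) c (htd P n a)
    exact ⟨⟨Q, hQ⟩, h⟩
  choose G₀ hG₀ using h
  let e := Module.finBasis ℝ (locSigma r refV)
  let tr : Fin 3 → Fin 2 → (locSigma r refV →ₗ[ℝ] Poly2) := fun n a =>
    { toFun := fun P => trace refV P.1 n a
      map_add' := fun P Q => by
        simp only [trace, Submodule.coe_add, Pi.add_apply, Fin.sum_univ_two]; ring
      map_smul' := fun t P => by
        simp only [trace, Submodule.coe_smul, Pi.smul_apply, Fin.sum_univ_two, smul_eq_C_mul,
          RingHom.id_apply]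
        ring }
  let ev : Plane → (Poly2 →ₗ[ℝ] ℝ) := fun x =>
    { toFun := pev x
      map_add' := map_add (pev x)
      map_smul' := fun t p => pev_smul x t p }
  -- The chosen lifts need not be linear. Fixing them on a basis yields a linear operator, and the
  -- trace identity extends because both of its sides are linear.
  refine ⟨e.constr ℝ fun i => G₀ (e i), fun P n a s => ?_⟩
  have h1 : (ev (edgePt refV n s)) ∘ₗ (tr n a) ∘ₗ (e.constr ℝ fun i => G₀ (e i)) =
      (ev (edgePt refV n s)) ∘ₗ (refJL r c) ∘ₗ (tr n a) := by
    refine e.ext fun i => ?_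
    simp only [LinearMap.comp_apply, Module.Basis.constr_basis]
    exact hG₀ (e i) n a s
  exact LinearMap.congr_fun h1 P

end Elast

/-! ### Barycentric coordinates, the barycentric split, affine transport and L² norms on the parts.
-/

namespace Elast

open MvPolynomial MeasureTheory

/-- Twice the signed area of the triangle with vertices `v`. -/
def cross3 (v : Fin 3 → Plane) : ℝ := cross (v 0) (v 1) (v 2)

/-- The closed triangle with vertices `v`. -/
def triangle (v : Fin 3 → Plane) : Set Plane := convexHull ℝ (Set.range v)

/-- The vertices of the part of a triangle opposite to the vertex `c`. -/
noncomputable def subV (v : Fin 3 → Plane) (c : Fin 3) : Fin 3 → Plane :=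
  Function.update v c (centroid v)

/-- The barycentric coordinates of a point with respect to a triangle. -/
noncomputable def bc (v : Fin 3 → Plane) (a : Fin 3) (x : Plane) : ℝ :=
  cross3 (Function.update v a x) / cross3 v

theorem bc_zero (v : Fin 3 → Plane) (x : Plane) : bc v 0 x = cross x (v 1) (v 2) / cross3 v := by
  simp [bc, cross3]

theorem bc_one (v : Fin 3 → Plane) (x : Plane) : bc v 1 x = cross (v 0) x (v 2) / cross3 v := by
  simp [bc, cross3]

theorem bc_two (v : Fin 3 → Plane) (x : Plane) : bc v 2 x = cross (v 0) (v 1) x / cross3 v := by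
  simp [bc, cross3]

section

variable {v : Fin 3 → Plane}

theorem isCompact_triangle (v : Fin 3 → Plane) : IsCompact (triangle v) :=
  (Set.finite_range v).isCompact_convexHull ℝ

theorem convex_triangle (v : Fin 3 → Plane) : Convex ℝ (triangle v) := convex_convexHull ℝ _

theorem vertex_mem_triangle (v : Fin 3 → Plane) (a : Fin 3) : v a ∈ triangle v :=
  subset_convexHull ℝ _ (Set.mem_range_self a)

theorem continuous_bc (v : Fin 3 → Plane) (a : Fin 3) : Continuous (bc v a) := by
  have h : ∀ i : Fin 2, Continuous fun x : Plane => x i := fun i => by fun_prop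
  fin_cases a
  · simp only [Fin.zero_eta, funext (bc_zero v), cross]; fun_prop
  · simp only [Fin.mk_one, funext (bc_one v), cross]; fun_prop
  · simp only [Fin.reduceFinMk, funext (bc_two v), cross]; fun_prop

theorem sum_bc (hv : cross3 v ≠ 0) (x : Plane) : ∑ a, bc v a x = 1 := by
  rw [Fin.sum_univ_three, bc_zero, bc_one, bc_two, ← add_div, ← add_div, div_eq_one_iff_eq hv]
  simp only [cross3, cross]
  ring

theorem sum_bc_smul (hv : cross3 v ≠ 0) (x : Plane) : ∑ a, bc v a x • v a = x := by
  ext i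
  rw [Fin.sum_univ_three, bc_zero, bc_one, bc_two]
  simp only [PiLp.add_apply, PiLp.smul_apply, smul_eq_mul]
  rw [div_mul_eq_mul_div, div_mul_eq_mul_div, div_mul_eq_mul_div, ← add_div, ← add_div,
    div_eq_iff hv]
  fin_cases i <;> simp only [cross3, cross, Fin.zero_eta, Fin.mk_one] <;> ring

theorem bc_sum_smul (hv : cross3 v ≠ 0) {w : Fin 3 → ℝ} (hw : ∑ c, w c = 1) (a : Fin 3) :
    bc v a (∑ c, w c • v c) = w a := by
  rw [Fin.sum_univ_three] at hw ⊢
  have h0 : w 0 = 1 - w 1 - w 2 := by linarith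
  fin_cases a
  · simp only [Fin.zero_eta]
    rw [bc_zero, div_eq_iff hv]
    simp only [cross3, cross, PiLp.add_apply, PiLp.smul_apply, smul_eq_mul, h0]; ring
  · simp only [Fin.mk_one]
    rw [bc_one, div_eq_iff hv]
    simp only [cross3, cross, PiLp.add_apply, PiLp.smul_apply, smul_eq_mul, h0]; ring
  · simp only [Fin.reduceFinMk]
    rw [bc_two, div_eq_iff hv]
    simp only [cross3, cross, PiLp.add_apply, PiLp.smul_apply, smul_eq_mul, h0]; ring

theorem bc_vertex (hv : cross3 v ≠ 0) (a b : Fin 3) : bc v a (v b) = if a = b then 1 else 0 := by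
  have h := bc_sum_smul hv (w := fun c => if c = b then 1 else 0) (by simp) a
  simpa using h

theorem bc_comb (v : Fin 3 → Plane) (a : Fin 3) (s : ℝ) (x y : Plane) :
    bc v a ((1 - s) • x + s • y) = (1 - s) * bc v a x + s * bc v a y := by
  fin_cases a
  · simp only [Fin.zero_eta, bc_zero, cross, PiLp.add_apply, PiLp.smul_apply, smul_eq_mul]; ring
  · simp only [Fin.mk_one, bc_one, cross, PiLp.add_apply, PiLp.smul_apply, smul_eq_mul]; ring
  · simp only [Fin.reduceFinMk, bc_two, cross, PiLp.add_apply, PiLp.smul_apply, smul_eq_mul]; ring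

theorem convex_bc_nonneg (v : Fin 3 → Plane) (a : Fin 3) : Convex ℝ {x | 0 ≤ bc v a x} := by
  intro x hx y hy s t hs ht hst
  have h : s = 1 - t := by linarith
  simp only [Set.mem_ofPred_eq, h, bc_comb] at hx hy ⊢
  have := mul_nonneg hs hx
  rw [h] at this
  exact add_nonneg this (mul_nonneg ht hy)

theorem convex_bc_eq_zero (v : Fin 3 → Plane) (a : Fin 3) : Convex ℝ {x | bc v a x = 0} := by
  intro x hx y hy s t hs ht hst
  have h : s = 1 - t := by linarith
  simp only [Set.mem_ofPred_eq, h, bc_comb] at hx hy ⊢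
  rw [hx, hy]; ring

theorem mem_triangle_iff (hv : cross3 v ≠ 0) {x : Plane} :
    x ∈ triangle v ↔ ∀ a, 0 ≤ bc v a x := by
  constructor
  · intro hx a
    refine convexHull_min ?_ (convex_bc_nonneg v a) hx
    rintro _ ⟨b, rfl⟩
    simp only [Set.mem_ofPred_eq, bc_vertex hv]
    split_ifs <;> norm_num
  · intro h
    rw [← sum_bc_smul hv x]
    exact (convex_triangle v).sum_mem (fun a _ => h a) (sum_bc hv x)
      fun a _ => vertex_mem_triangle v a

/-- At an interior point with a vanishing coordinate, a small step away from the corresponding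
vertex would make this coordinate negative inside the triangle. -/
theorem mem_interior_triangle_iff (hv : cross3 v ≠ 0) {x : Plane} :
    x ∈ interior (triangle v) ↔ ∀ a, 0 < bc v a x := by
  constructor
  · intro hx a
    have h0 := (mem_triangle_iff hv).1 (interior_subset hx) a
    refine h0.lt_of_ne fun h => ?_
    have hcont : Continuous fun s : ℝ => (1 - s) • x + s • v a := by fun_prop
    have hnhds : ∀ᶠ s : ℝ in nhds 0, (1 - s) • x + s • v a ∈ triangle v := by
      refine hcont.continuousAt.eventually (p := fun y => y ∈ triangle v) ?_
      simpa using mem_interior_iff_mem_nhds.1 hx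
    obtain ⟨ε, hε, hball⟩ := Metric.eventually_nhds_iff.1 hnhds
    have h1 := (mem_triangle_iff hv).1 (hball (y := -(ε / 2)) (by
      rw [Real.dist_eq]; rw [sub_zero, abs_neg, abs_of_pos (by positivity)]; linarith)) a
    rw [bc_comb, bc_vertex hv, if_pos rfl, ← h] at h1
    linarith
  · intro h
    have hopen : IsOpen {y | ∀ a, 0 < bc v a y} := by
      simp only [Set.ofPred_forall]
      exact isOpen_iInter_of_finite fun a => isOpen_lt continuous_const (continuous_bc v a)
    exact interior_maximal (fun y hy => (mem_triangle_iff hv).2 fun a => (hy a).le) hopen h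

theorem bc_centroid (hv : cross3 v ≠ 0) (a : Fin 3) : bc v a (centroid v) = 1 / 3 := by
  have h := bc_sum_smul hv (w := fun _ => 1 / 3) (by norm_num [Fin.sum_univ_three]) a
  rwa [← Finset.smul_sum] at h

theorem interior_triangle_nonempty (hv : cross3 v ≠ 0) : (interior (triangle v)).Nonempty :=
  ⟨centroid v, (mem_interior_triangle_iff hv).2 fun a => by rw [bc_centroid hv]; norm_num⟩

theorem cross3_subV (v : Fin 3 → Plane) (c : Fin 3) : cross3 (subV v c) = cross3 v / 3 := by
  fin_cases c <;>
    simp [cross3, subV, cross, centroid, Fin.sum_univ_three] <;> ring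

theorem cross3_subV_ne (hv : cross3 v ≠ 0) (c : Fin 3) : cross3 (subV v c) ≠ 0 := by
  rw [cross3_subV]; exact div_ne_zero hv (by norm_num)

theorem bc_subV (v : Fin 3 → Plane) (c a : Fin 3) (x : Plane) :
    bc (subV v c) a x = if a = c then 3 * bc v c x else bc v a x - bc v c x := by
  by_cases hv : cross3 v = 0
  · simp [bc, cross3_subV, hv]
  have h3 : cross3 (subV v c) = cross3 v / 3 := cross3_subV v c
  unfold bc
  rw [h3]
  split_ifs with h
  · subst h
    rw [subV, Function.update_idem]
    field_simp
  · rw [div_sub_div_same, div_div_eq_mul_div, div_left_inj' hv]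
    fin_cases c <;> fin_cases a <;> simp at h <;>
      simp [cross3, subV, cross, centroid, Fin.sum_univ_three, Function.update] <;> ring

theorem mem_interior_subV_iff (hv : cross3 v ≠ 0) {c : Fin 3} {x : Plane} :
    x ∈ interior (triangle (subV v c)) ↔ 0 < bc v c x ∧ ∀ a, a ≠ c → bc v c x < bc v a x := by
  rw [mem_interior_triangle_iff (cross3_subV_ne hv c)]
  constructor
  · intro h
    refine ⟨by have := h c; rw [bc_subV, if_pos rfl] at this; linarith, fun a ha => ?_⟩
    have := h a
    rw [bc_subV, if_neg ha] at this
    linarith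
  · rintro ⟨h1, h2⟩ a
    rw [bc_subV]
    split_ifs with h
    · linarith
    · linarith [h2 a h]

/-- Relative to the part c the coordinates are 3λ_c and λ_a - λ_c, because the barycenter has all
coordinates 1/3. So this part is where λ_c is the smallest coordinate, which makes covering and
disjointness of the parts evident. -/
theorem mem_subV_iff (hv : cross3 v ≠ 0) {c : Fin 3} {x : Plane} :
    x ∈ triangle (subV v c) ↔ 0 ≤ bc v c x ∧ ∀ a, bc v c x ≤ bc v a x := by
  rw [mem_triangle_iff (cross3_subV_ne hv c)]
  constructor
  · intro h
    refine ⟨by have := h c; rw [bc_subV, if_pos rfl] at this; linarith, fun a => ?_⟩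
    have := h a
    rw [bc_subV] at this
    split_ifs at this with ha
    · rw [ha]
    · linarith
  · rintro ⟨h1, h2⟩ a
    rw [bc_subV]
    split_ifs with h
    · linarith
    · linarith [h2 a]

theorem triangle_eq_iUnion_subV (hv : cross3 v ≠ 0) :
    triangle v = ⋃ c, triangle (subV v c) := by
  ext x
  simp only [Set.mem_iUnion, mem_subV_iff hv, mem_triangle_iff hv]
  constructor
  · intro h
    obtain ⟨c, hc⟩ := Finite.exists_min fun a => bc v a x
    exact ⟨c, h c, hc⟩
  · rintro ⟨c, h1, h2⟩ a
    exact h1.trans (h2 a)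

theorem interior_subV_subset (hv : cross3 v ≠ 0) (c : Fin 3) :
    interior (triangle (subV v c)) ⊆ interior (triangle v) := by
  refine interior_mono ?_
  rw [triangle_eq_iUnion_subV hv]
  exact Set.subset_iUnion (fun c => triangle (subV v c)) c

theorem disjoint_interior_subV (hv : cross3 v ≠ 0) {c c' : Fin 3} (h : c ≠ c') :
    Disjoint (interior (triangle (subV v c))) (interior (triangle (subV v c'))) := by
  rw [Set.disjoint_left]
  intro x hx hx'
  have h1 := ((mem_interior_subV_iff hv).1 hx).2 c' h.symm
  have h2 := ((mem_interior_subV_iff hv).1 hx').2 c h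
  linarith

theorem measure_frontier_triangle (v : Fin 3 → Plane) : volume (frontier (triangle v)) = 0 :=
  (convex_triangle v).addHaar_frontier volume

theorem interior_triangle_ae_eq (v : Fin 3 → Plane) :
    interior (triangle v) =ᵐ[volume] triangle v :=
  interior_ae_eq_of_null_frontier (measure_frontier_triangle v)

end

section AffineMap

variable {z : Plane} {B : Matrix (Fin 2) (Fin 2) ℝ}

theorem affMap_comb (z : Plane) (B : Matrix (Fin 2) (Fin 2) ℝ) (s : ℝ) (x y : Plane) :
    affMap z B ((1 - s) • x + s • y) = (1 - s) • affMap z B x + s • affMap z B y := by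
  simp only [affMap, map_add, map_smul, smul_add]
  module

theorem affMap_image_triangle {v w : Fin 3 → Plane} (h : ∀ c, affMap z B (w c) = v c) :
    affMap z B '' triangle w = triangle v := by
  let f : Plane →ᵃ[ℝ] Plane :=
    (Matrix.toLpLin 2 2 B).toAffineMap + AffineMap.const ℝ Plane z
  have hf : ∀ y, f y = affMap z B y := fun y => by simp [f, affMap, add_comm]
  have h1 : affMap z B = f := funext fun y => (hf y).symm
  rw [triangle, triangle, h1, f.image_convexHull, ← Set.range_comp]
  congr 2
  funext c
  rw [Function.comp_apply, hf, h]

theorem affMap_injective (hB : B.det ≠ 0) : Function.Injective (affMap z B) := by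
  intro x y hxy
  have h1 : Matrix.toLpLin 2 2 B x = Matrix.toLpLin 2 2 B y := by simpa [affMap] using hxy
  have h2 : Function.Injective (Matrix.toLpLin 2 2 B) := by
    have hu : IsUnit B.det := hB.isUnit
    intro a b hab
    have := congrArg (Matrix.toLpLin 2 2 B⁻¹) hab
    rw [← LinearMap.comp_apply, ← LinearMap.comp_apply, ← Matrix.toLpLin_mul,
      Matrix.nonsing_inv_mul _ hu, Matrix.toLpLin_one] at this
    exact this
  exact h2 h1

theorem hasFDerivAt_affMap (z : Plane) (B : Matrix (Fin 2) (Fin 2) ℝ) (x : Plane) :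
    HasFDerivAt (affMap z B) (LinearMap.toContinuousLinearMap (Matrix.toLpLin 2 2 B)) x := by
  have h := (LinearMap.toContinuousLinearMap (Matrix.toLpLin 2 2 B)).hasFDerivAt (x := x)
  exact h.const_add z

theorem integral_affMap_image (hB : B.det ≠ 0) {S : Set Plane} (hS : MeasurableSet S)
    (f : Plane → ℝ) :
    ∫ x in affMap z B '' S, f x = |B.det| * ∫ y in S, f (affMap z B y) := by
  rw [integral_image_eq_integral_abs_det_fderiv_smul volume hS
    (fun x _ => (hasFDerivAt_affMap z B x).hasFDerivWithinAt) (affMap_injective hB).injOn f]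
  have h : (LinearMap.toContinuousLinearMap (Matrix.toLpLin 2 2 B)).det = B.det := by
    rw [LinearMap.det_toContinuousLinearMap, LinearMap.det_toLpLin]
  simp only [h, smul_eq_mul]
  rw [integral_const_mul]

theorem affMap_affMap {A : Matrix (Fin 2) (Fin 2) ℝ} (hA : A * B = 1) (z y : Plane) :
    affMap (- Matrix.toLpLin 2 2 A z) A (affMap z B y) = y := by
  have h : Matrix.toLpLin 2 2 A (Matrix.toLpLin 2 2 B y) = y := by
    rw [← LinearMap.comp_apply, ← Matrix.toLpLin_mul, hA, Matrix.toLpLin_one, LinearMap.id_apply]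
  simp [affMap, h]

theorem affSubst_affSubst {A : Matrix (Fin 2) (Fin 2) ℝ} (hA : A * B = 1) (z : Plane)
    (p : Poly2) : affSubst z B (affSubst (- Matrix.toLpLin 2 2 A z) A p) = p := by
  refine poly_ext_of_isOpen isOpen_univ Set.univ_nonempty fun y _ => ?_
  rw [pev_affSubst, pev_affSubst, affMap_affMap hA]

/-- The matrix of the affine map from the reference triangle to the triangle with vertices `v`. -/
noncomputable def triMat (v : Fin 3 → Plane) : Matrix (Fin 2) (Fin 2) ℝ :=
  fun i j => v j.castSucc i - centroid v i

theorem affMap_refV (v : Fin 3 → Plane) (c : Fin 3) :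
    affMap (centroid v) (triMat v) (refV c) = v c := by
  ext i
  rw [affMap_apply]
  fin_cases c <;> simp [triMat, centroid, Fin.sum_univ_three] <;> ring

theorem det_triMat (v : Fin 3 → Plane) : (triMat v).det = cross3 v / 3 := by
  rw [Matrix.det_fin_two]
  simp [triMat, centroid, Fin.sum_univ_three, cross3, cross]
  ring

theorem affMap_centroid {v w : Fin 3 → Plane} (h : ∀ c, affMap z B (w c) = v c) :
    affMap z B (centroid w) = centroid v := by
  have h1 : centroid v = (1 / 3 : ℝ) • ∑ c, affMap z B (w c) := by
    simp only [h]; rfl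
  rw [h1]
  simp only [affMap, centroid, Fin.sum_univ_three, map_smul, map_add]
  module

theorem affMap_subV {v w : Fin 3 → Plane} (h : ∀ c, affMap z B (w c) = v c) (c a : Fin 3) :
    affMap z B (subV w c a) = subV v c a := by
  by_cases hac : a = c
  · subst hac
    simp [subV, affMap_centroid h]
  · simp [subV, hac, h]

theorem affMap_edgePt {v w : Fin 3 → Plane} (h : ∀ c, affMap z B (w c) = v c) (m : Fin 3)
    (s : ℝ) : affMap z B (edgePt w m s) = edgePt v m s := by
  rw [edgePt, affMap_comb, h, h, edgePt]

end AffineMap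

theorem norm_coord_le (x : Plane) (i : Fin 2) : |x i| ≤ ‖x‖ := by
  simpa using PiLp.norm_apply_le x i

theorem cross3_refV : cross3 refV = 3 := by
  simp [cross3, cross]; norm_num

theorem abs_triMat_le (v : Fin 3 → Plane) (i j : Fin 2) :
    |triMat v i j| ≤ Metric.diam (triangle v) := by
  have hb : Bornology.IsBounded (triangle v) := (isCompact_triangle v).isBounded
  have hz : centroid v ∈ triangle v := by
    have := (convex_triangle v).sum_mem (t := Finset.univ) (w := fun _ => (1 / 3 : ℝ)) (z := v)
      (fun _ _ => by norm_num) (by norm_num [Fin.sum_univ_three])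
      (fun a _ => vertex_mem_triangle v a)
    rwa [← Finset.smul_sum] at this
  have h1 := norm_coord_le (v j.castSucc - centroid v) i
  refine h1.trans ?_
  rw [← dist_eq_norm]
  exact Metric.dist_le_diam_of_mem hb (vertex_mem_triangle v _) hz

/-- Cramer's rule: the entries of the adjugate are at most the diameter h, and shape regularity
bounds the determinant below by γh²/3. -/
theorem abs_triMat_inv_le {v : Fin 3 → Plane} {γ : ℝ} (hγ : 0 < γ)
    (hs : γ * Metric.diam (triangle v) ^ 2 ≤ |cross3 v|) (hd : 0 < Metric.diam (triangle v))
    (i j : Fin 2) :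
    |(triMat v)⁻¹ i j| ≤ 3 / γ * (Metric.diam (triangle v))⁻¹ := by
  set h := Metric.diam (triangle v) with hh
  have hdet : |(triMat v).det|⁻¹ ≤ 3 / γ * h⁻¹ * h⁻¹ := by
    rw [det_triMat, abs_div, abs_of_pos (by norm_num : (0 : ℝ) < 3), inv_div]
    have : 3 / |cross3 v| ≤ 3 / (γ * h ^ 2) := by gcongr
    refine this.trans (le_of_eq ?_)
    field_simp
  rw [Matrix.inv_def, Ring.inverse_eq_inv', Matrix.adjugate_fin_two, Matrix.smul_apply,
    smul_eq_mul, abs_mul, abs_inv]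
  have hent : |(!![triMat v 1 1, -triMat v 0 1; -triMat v 1 0, triMat v 0 0] : Matrix _ _ ℝ) i j|
      ≤ h := by
    fin_cases i <;> fin_cases j <;> simp <;> exact abs_triMat_le v _ _
  calc _ ≤ (3 / γ * h⁻¹ * h⁻¹) * h := mul_le_mul hdet hent (abs_nonneg _) (by positivity)
    _ = _ := by field_simp

theorem diam_triangle_pos {v : Fin 3 → Plane} (hv : cross3 v ≠ 0) :
    0 < Metric.diam (triangle v) := by
  have hne : v 0 ≠ v 1 := by
    intro h
    apply hv
    simp [cross3, cross, h]
  have h1 := Metric.dist_le_diam_of_mem (isCompact_triangle v).isBounded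
    (vertex_mem_triangle v 0) (vertex_mem_triangle v 1)
  exact (dist_pos.2 hne).trans_le h1

/-- The square of the `L²` norm of a polynomial on a part of a triangle. -/
noncomputable def sqI (v : Fin 3 → Plane) (c : Fin 3) (p : Poly2) : ℝ :=
  ∫ x in triangle (subV v c), pev x p ^ 2

theorem sqI_nonneg (v : Fin 3 → Plane) (c : Fin 3) (p : Poly2) : 0 ≤ sqI v c p :=
  integral_pev_sq_nonneg _ _

theorem sqI_eq_polyForm (v : Fin 3 → Plane) (c : Fin 3) (p : Poly2) :
    sqI v c p = polyForm (isCompact_triangle (subV v c)) p p := (polyForm_self _ p).symm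

theorem sqI_affSubst {v w : Fin 3 → Plane} {z : Plane} {B : Matrix (Fin 2) (Fin 2) ℝ}
    (h : ∀ c, affMap z B (w c) = v c) (hB : B.det ≠ 0) (c : Fin 3) (p : Poly2) :
    sqI v c p = |B.det| * sqI w c (affSubst z B p) := by
  rw [sqI, ← affMap_image_triangle (affMap_subV h c),
    integral_affMap_image hB (isCompact_triangle _).isClosed.measurableSet]
  simp only [sqI, pev_affSubst]

theorem det_triMat_ne {v : Fin 3 → Plane} (hv : cross3 v ≠ 0) : (triMat v).det ≠ 0 := by
  rw [det_triMat]; exact div_ne_zero hv (by norm_num)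

theorem sqI_add_le (v : Fin 3 → Plane) (c : Fin 3) (p q : Poly2) :
    sqI v c (p + q) ≤ 2 * sqI v c p + 2 * sqI v c q := by
  simp only [sqI_eq_polyForm]
  refine form_add_le (fun x y => ?_) (fun x => ?_) p q
  · simp [polyForm, mul_comm]
  · rw [polyForm_self]; exact integral_pev_sq_nonneg _ _

theorem sqI_C_mul (v : Fin 3 → Plane) (c : Fin 3) (t : ℝ) (p : Poly2) :
    sqI v c (C t * p) = t ^ 2 * sqI v c p := by
  simp only [sqI, map_mul, pev_C, mul_pow]
  rw [integral_const_mul]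

theorem sqI_neg (v : Fin 3 → Plane) (c : Fin 3) (p : Poly2) : sqI v c (-p) = sqI v c p := by
  simp [sqI]

end Elast

/-! ### Inverse, trace and Poincaré type inequalities for polynomials on shape regular triangles. -/

namespace Elast

open MvPolynomial MeasureTheory

theorem exists_uniform_bound {ι X : Type*} [Finite ι] {f g : ι → X → ℝ}
    (hg : ∀ i x, 0 ≤ g i x) (h : ∀ i, ∃ K : ℝ, 0 ≤ K ∧ ∀ x, f i x ≤ K * g i x) :
    ∃ K : ℝ, 0 ≤ K ∧ ∀ i x, f i x ≤ K * g i x := by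
  choose K _ hK using h
  obtain ⟨M, hM⟩ := Set.finite_range K |>.bddAbove
  refine ⟨max M 0, le_max_right _ _, fun i x => (hK i x).trans ?_⟩
  exact mul_le_mul_of_nonneg_right ((hM (Set.mem_range_self i)).trans (le_max_left _ _)) (hg i x)

section Reference

variable (r : ℕ)

/-- Evaluation of polynomials as a linear map. -/
noncomputable def pevL (x : Plane) : Poly2 →ₗ[ℝ] ℝ where
  toFun := pev x
  map_add' := map_add (pev x)
  map_smul' t p := pev_smul x t p

theorem polyForm_refV_pos (b : Fin 3) (p : Poly2) (hp : p ≠ 0) :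
    0 < polyForm (isCompact_triangle (subV refV b)) p p :=
  polyForm_pos _ (interior_triangle_nonempty
    (cross3_subV_ne (by rw [cross3_refV]; norm_num) b)) hp

theorem exists_sqI_refV_le (f : Poly2 →ₗ[ℝ] Poly2) (a b : Fin 3) :
    ∃ K : ℝ, 0 ≤ K ∧ ∀ p : restrictTotalDegree (Fin 2) ℝ r,
      sqI refV a (f p) ≤ K * sqI refV b p := by
  let V := restrictTotalDegree (Fin 2) ℝ r
  obtain ⟨K, hK, h⟩ := exists_form_le (V := V)
    ((polyForm (isCompact_triangle (subV refV b))).compl₁₂ V.subtype V.subtype)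
    ((polyForm (isCompact_triangle (subV refV a))).compl₁₂ (f ∘ₗ V.subtype) (f ∘ₗ V.subtype))
    (fun x hx => polyForm_refV_pos b _ (by simpa using hx))
  refine ⟨K, hK, fun p => ?_⟩
  rw [sqI_eq_polyForm, sqI_eq_polyForm]
  exact h p

theorem exists_pev_refV_le (b : Fin 3) :
    ∃ K : ℝ, 0 ≤ K ∧ ∀ p : restrictTotalDegree (Fin 2) ℝ r,
      pev 0 p.1 ^ 2 ≤ K * sqI refV b p := by
  let V := restrictTotalDegree (Fin 2) ℝ r
  obtain ⟨K, hK, h⟩ := exists_form_le (V := V)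
    ((polyForm (isCompact_triangle (subV refV b))).compl₁₂ V.subtype V.subtype)
    ((LinearMap.mul ℝ ℝ).compl₁₂ (pevL 0 ∘ₗ V.subtype) (pevL 0 ∘ₗ V.subtype))
    (fun x hx => polyForm_refV_pos b _ (by simpa using hx))
  refine ⟨K, hK, fun p => ?_⟩
  rw [sqI_eq_polyForm, sq]
  exact h p

theorem eq_zero_of_pderiv_eq_zero {p : Poly2} (h0 : pev 0 p = 0) (h : ∀ k, pderiv k p = 0) :
    p = 0 := by
  refine poly_eq_zero_of_isOpen isOpen_univ Set.univ_nonempty fun x _ => ?_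
  rw [← h0]
  refine is_const_of_fderiv_eq_zero (𝕜 := ℝ) (f := fun x => pev x p) (differentiable_pev p)
    (fun y => ?_) x 0
  rw [(hasFDerivAt_pev p y).fderiv]
  simp [h]

/-- A Poincaré inequality normalized by a point value: the right-hand side is definite, since zero
gradient and zero value at the barycenter force the polynomial to vanish. -/
theorem exists_sqI_refV_le_pderiv (a : Fin 3) :
    ∃ K : ℝ, 0 ≤ K ∧ ∀ p : restrictTotalDegree (Fin 2) ℝ r,
      sqI refV a p ≤ K * (pev 0 p.1 ^ 2 + ∑ k, sqI refV a (pderiv k p.1)) := by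
  let V := restrictTotalDegree (Fin 2) ℝ r
  let F := polyForm (isCompact_triangle (subV refV a))
  let d : Fin 2 → (V →ₗ[ℝ] Poly2) := fun k => (pderiv k : Derivation ℝ Poly2 Poly2).toLinearMap
    ∘ₗ V.subtype
  have e1 : ∀ x, (((LinearMap.mul ℝ ℝ).compl₁₂ (pevL 0 ∘ₗ V.subtype) (pevL 0 ∘ₗ V.subtype) +
      ∑ k, F.compl₁₂ (d k) (d k)) x) x =
        pev 0 x.1 ^ 2 + ∑ k, sqI refV a (pderiv k x.1) := by
    intro x
    simp only [sqI_eq_polyForm, sq]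
    simp [F, d, pevL]
  have hpos : ∀ x, x ≠ 0 → 0 < (((LinearMap.mul ℝ ℝ).compl₁₂ (pevL 0 ∘ₗ V.subtype)
      (pevL 0 ∘ₗ V.subtype) + ∑ k, F.compl₁₂ (d k) (d k)) x) x := by
    intro x hx
    rw [e1]
    have hn : ∀ k, 0 ≤ sqI refV a (pderiv k x.1) := fun k => sqI_nonneg _ _ _
    have hs : 0 ≤ ∑ k, sqI refV a (pderiv k x.1) := Finset.sum_nonneg fun k _ => hn k
    refine lt_of_le_of_ne (add_nonneg (sq_nonneg _) hs) fun h0 => hx ?_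
    have h1 : pev 0 x.1 = 0 := pow_eq_zero_iff two_ne_zero |>.1
      (by linarith [sq_nonneg (pev 0 x.1)])
    have h2 : ∑ k, sqI refV a (pderiv k x.1) = 0 := by linarith [sq_nonneg (pev 0 x.1)]
    have h3 : ∀ k, pderiv k x.1 = 0 := by
      intro k
      by_contra hk
      have h4 := polyForm_refV_pos a _ hk
      rw [← sqI_eq_polyForm] at h4
      have h5 := Finset.single_le_sum (fun k _ => hn k) (Finset.mem_univ k)
      linarith
    exact Subtype.ext (eq_zero_of_pderiv_eq_zero h1 h3)
  obtain ⟨K, hK, h⟩ := exists_form_le _ (F.compl₁₂ V.subtype V.subtype) hpos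
  refine ⟨K, hK, fun p => ?_⟩
  have := h p
  rw [e1] at this
  rw [sqI_eq_polyForm refV a p.1]
  exact this

/-- Norm equivalences for polynomials of degree at most `r` on the reference triangle. -/
theorem exists_refV_bounds : ∃ κ : ℝ, 1 ≤ κ ∧ ∀ p : Poly2, p.totalDegree ≤ r →
    (∀ a b, sqI refV a p ≤ κ * sqI refV b p) ∧
    (∀ a k, sqI refV a (pderiv k p) ≤ κ * sqI refV a p) ∧
    (∀ a, pev 0 p ^ 2 ≤ κ * sqI refV a p) ∧
    (∀ a, sqI refV a p ≤ κ * (pev 0 p ^ 2 + ∑ k, sqI refV a (pderiv k p))) ∧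
    (∀ a c, sqI refV a (refJ r c p) ≤ κ * sqI refV a p) := by
  obtain ⟨K1, h1, H1⟩ := exists_uniform_bound (ι := Fin 3 × Fin 3)
    (f := fun i (p : restrictTotalDegree (Fin 2) ℝ r) => sqI refV i.1 p.1)
    (g := fun i p => sqI refV i.2 p.1) (fun i x => sqI_nonneg _ _ _)
    (fun i => exists_sqI_refV_le r LinearMap.id i.1 i.2)
  obtain ⟨K2, h2, H2⟩ := exists_uniform_bound (ι := Fin 3 × Fin 2)
    (f := fun i (p : restrictTotalDegree (Fin 2) ℝ r) => sqI refV i.1 (pderiv i.2 p.1))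
    (g := fun i p => sqI refV i.1 p.1) (fun i x => sqI_nonneg _ _ _)
    (fun i => exists_sqI_refV_le r (pderiv i.2 : Derivation ℝ Poly2 Poly2).toLinearMap i.1 i.1)
  obtain ⟨K3, h3, H3⟩ := exists_uniform_bound (ι := Fin 3)
    (f := fun _ (p : restrictTotalDegree (Fin 2) ℝ r) => pev 0 p.1 ^ 2)
    (g := fun i p => sqI refV i p.1) (fun i x => sqI_nonneg _ _ _)
    (fun i => exists_pev_refV_le r i)
  obtain ⟨K4, h4, H4⟩ := exists_uniform_bound (ι := Fin 3)
    (f := fun i (p : restrictTotalDegree (Fin 2) ℝ r) => sqI refV i p.1)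
    (g := fun i p => pev 0 p.1 ^ 2 + ∑ k, sqI refV i (pderiv k p.1))
    (fun i x => add_nonneg (sq_nonneg _) (Finset.sum_nonneg fun _ _ => sqI_nonneg _ _ _))
    (fun i => exists_sqI_refV_le_pderiv r i)
  obtain ⟨K5, h5, H5⟩ := exists_uniform_bound (ι := Fin 3 × Fin 3)
    (f := fun i (p : restrictTotalDegree (Fin 2) ℝ r) => sqI refV i.1 (refJ r i.2 p.1))
    (g := fun i p => sqI refV i.1 p.1) (fun i x => sqI_nonneg _ _ _)
    (fun i => exists_sqI_refV_le r (refJL r i.2) i.1 i.1)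
  refine ⟨1 + K1 + K2 + K3 + K4 + K5, by linarith, fun p hp => ?_⟩
  let q : restrictTotalDegree (Fin 2) ℝ r := ⟨p, (mem_restrictTotalDegree _ _ _).2 hp⟩
  refine ⟨fun a b => (H1 (a, b) q).trans ?_, fun a k => (H2 (a, k) q).trans ?_,
    fun a => (H3 a q).trans ?_, fun a => (H4 a q).trans ?_, fun a c => (H5 (a, c) q).trans ?_⟩
  · exact mul_le_mul_of_nonneg_right (by linarith) (sqI_nonneg _ _ _)
  · exact mul_le_mul_of_nonneg_right (by linarith) (sqI_nonneg _ _ _)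
  · exact mul_le_mul_of_nonneg_right (by linarith) (sqI_nonneg _ _ _)
  · exact mul_le_mul_of_nonneg_right (by linarith)
      (add_nonneg (sq_nonneg _) (Finset.sum_nonneg fun _ _ => sqI_nonneg _ _ _))
  · exact mul_le_mul_of_nonneg_right (by linarith) (sqI_nonneg _ _ _)

end Reference

theorem affSubst_pderiv {z : Plane} {A B : Matrix (Fin 2) (Fin 2) ℝ} (hA : B * A = 1)
    (p : Poly2) (k : Fin 2) :
    affSubst z B (pderiv k p) = ∑ j, C (A j k) * pderiv j (affSubst z B p) := by
  have h : ∀ b, B b 0 * A 0 k + B b 1 * A 1 k = if b = k then 1 else 0 := fun b => by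
    have := congrFun (congrFun hA b) k
    rw [Matrix.mul_apply, Fin.sum_univ_two, Matrix.one_apply] at this
    exact this
  have h' : ∀ b, (C (B b 0) * C (A 0 k) + C (B b 1) * C (A 1 k) : Poly2) =
      if b = k then 1 else 0 := fun b => by
    rw [← C_mul, ← C_mul, ← C_add, h]
    split_ifs <;> simp
  simp only [pderiv_affSubst, Fin.sum_univ_two]
  have h0 := h' 0
  have h1 := h' 1
  fin_cases k
  · simp at h0 h1 ⊢
    linear_combination (-affSubst z B (pderiv 0 p)) * h0 - affSubst z B (pderiv 1 p) * h1
  · simp at h0 h1 ⊢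
    linear_combination (-affSubst z B (pderiv 0 p)) * h0 - affSubst z B (pderiv 1 p) * h1

/-- Shape regularity of a triangle. -/
structure IsShapeRegular (γ : ℝ) (v : Fin 3 → Plane) : Prop where
  ne : cross3 v ≠ 0
  le : γ * Metric.diam (triangle v) ^ 2 ≤ |cross3 v|

theorem sqI_two_le (v : Fin 3 → Plane) (c : Fin 3) {s t S : ℝ} (hs : |s| ≤ S) (ht : |t| ≤ S)
    (p q : Poly2) : sqI v c (C s * p + C t * q) ≤ 2 * S ^ 2 * (sqI v c p + sqI v c q) := by
  have h1 := sqI_add_le v c (C s * p) (C t * q)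
  rw [sqI_C_mul, sqI_C_mul] at h1
  have h2 : s ^ 2 ≤ S ^ 2 := sq_le_sq' (abs_le.1 hs).1 (abs_le.1 hs).2
  have h3 : t ^ 2 ≤ S ^ 2 := sq_le_sq' (abs_le.1 ht).1 (abs_le.1 ht).2
  have h4 := sqI_nonneg v c p
  have h5 := sqI_nonneg v c q
  nlinarith

set_option maxHeartbeats 1000000 in
/-- Norm equivalences for polynomials on a shape regular triangle. -/
theorem exists_bounds (r : ℕ) {γ : ℝ} (hγ : 0 < γ) : ∃ κ : ℝ, 1 ≤ κ ∧
    ∀ v, IsShapeRegular γ v → ∀ p : Poly2, p.totalDegree ≤ r →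
    (∀ a b, sqI v a p ≤ κ * sqI v b p) ∧
    (∀ a k, sqI v a (pderiv k p) ≤
      κ * (Metric.diam (triangle v) ^ 2)⁻¹ * sqI v a p) ∧
    (∀ a, |(triMat v).det| * pev (centroid v) p ^ 2 ≤ κ * sqI v a p) ∧
    (∀ a, sqI v a p ≤ κ * (|(triMat v).det| * pev (centroid v) p ^ 2 +
      Metric.diam (triangle v) ^ 2 * ∑ k, sqI v a (pderiv k p))) ∧
    (∀ a c, sqI v a (affSubst (-Matrix.toLpLin 2 2 (triMat v)⁻¹ (centroid v)) (triMat v)⁻¹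
      (refJ r c (affSubst (centroid v) (triMat v) p))) ≤ κ * sqI v a p) := by
  obtain ⟨κ, hκ, H⟩ := exists_refV_bounds r
  -- The scale free bounds keep κ. The inverse inequality picks up 4(3/γ)² from the entries of B⁻¹,
  -- at most 3/(γh), and the Poincaré inequality a factor 4 from the entries of B, at most h.
  refine ⟨κ + 4 * (3 / γ) ^ 2 * κ + 4 * κ, by nlinarith [sq_nonneg (3 / γ)],
    fun v hv p hp => ?_⟩
  have hκ0 : 0 ≤ κ := by linarith
  have hx : 0 ≤ 4 * (3 / γ) ^ 2 * κ := by positivity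
  have hκ1 : κ ≤ κ + 4 * (3 / γ) ^ 2 * κ + 4 * κ := by linarith
  have hκ2 : 4 * (3 / γ) ^ 2 * κ ≤ κ + 4 * (3 / γ) ^ 2 * κ + 4 * κ := by linarith
  have hκ3 : 4 * κ ≤ κ + 4 * (3 / γ) ^ 2 * κ + 4 * κ := by linarith
  set κ' := κ + 4 * (3 / γ) ^ 2 * κ + 4 * κ with hκ'
  have hdet := det_triMat_ne hv.ne
  set B := triMat v with hB
  set h := Metric.diam (triangle v) with hh
  have hh0 : 0 < h := diam_triangle_pos hv.ne
  set z := centroid v with hz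
  have hBA : B * B⁻¹ = 1 := Matrix.mul_nonsing_inv _ hdet.isUnit
  have hAB : B⁻¹ * B = 1 := Matrix.nonsing_inv_mul _ hdet.isUnit
  set J := |B.det| with hJ
  have hJ0 : 0 ≤ J := abs_nonneg _
  have hS : ∀ a q, sqI v a q = J * sqI refV a (affSubst z B q) := fun a q =>
    sqI_affSubst (affMap_refV v) hdet a q
  obtain ⟨H1, H2, H3, H4, H5⟩ := H (affSubst z B p) (totalDegree_affSubst_le z B hp)
  have hp0 : pev 0 (affSubst z B p) = pev z p := by
    rw [pev_affSubst]; simp [affMap]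
  refine ⟨fun a b => ?_, fun a k => ?_, fun a => ?_, fun a => ?_, fun a c => ?_⟩
  · rw [hS, hS]
    calc _ ≤ J * (κ * sqI refV b (affSubst z B p)) := mul_le_mul_of_nonneg_left (H1 a b) hJ0
      _ = κ * (J * sqI refV b (affSubst z B p)) := by ring
      _ ≤ _ := mul_le_mul_of_nonneg_right hκ1 (mul_nonneg hJ0 (sqI_nonneg _ _ _))
  · rw [hS, hS, affSubst_pderiv hBA, Fin.sum_univ_two]
    have e1 : ∀ j, |B⁻¹ j k| ≤ 3 / γ * h⁻¹ := fun j => abs_triMat_inv_le hγ hv.le hh0 j k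
    have e2 := sqI_two_le refV a (e1 0) (e1 1) (pderiv 0 (affSubst z B p))
      (pderiv 1 (affSubst z B p))
    have e3 := H2 a 0
    have e4 := H2 a 1
    have e5 : sqI refV a (C (B⁻¹ 0 k) * pderiv 0 (affSubst z B p) +
        C (B⁻¹ 1 k) * pderiv 1 (affSubst z B p)) ≤
        4 * (3 / γ) ^ 2 * κ * (h ^ 2)⁻¹ * sqI refV a (affSubst z B p) := by
      refine e2.trans ?_
      calc _ ≤ 2 * (3 / γ * h⁻¹) ^ 2 * (κ * sqI refV a (affSubst z B p) +
            κ * sqI refV a (affSubst z B p)) := by gcongr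
        _ = _ := by field_simp; ring
    have e6 := sqI_nonneg refV a (affSubst z B p)
    calc _ ≤ J * (4 * (3 / γ) ^ 2 * κ * (h ^ 2)⁻¹ * sqI refV a (affSubst z B p)) := by gcongr
      _ ≤ J * (κ' * (h ^ 2)⁻¹ * sqI refV a (affSubst z B p)) := by gcongr
      _ = _ := by ring
  · rw [hS, ← hp0]
    calc _ ≤ J * (κ * sqI refV a (affSubst z B p)) := mul_le_mul_of_nonneg_left (H3 a) hJ0
      _ = κ * (J * sqI refV a (affSubst z B p)) := by ring
      _ ≤ _ := mul_le_mul_of_nonneg_right hκ1 (mul_nonneg hJ0 (sqI_nonneg _ _ _))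
  · rw [← hp0]
    simp only [hS, Fin.sum_univ_two] at H4 ⊢
    set s0 := sqI refV a (affSubst z B (pderiv 0 p)) with hs0
    set s1 := sqI refV a (affSubst z B (pderiv 1 p)) with hs1
    have n0 : 0 ≤ s0 := sqI_nonneg _ _ _
    have n1 : 0 ≤ s1 := sqI_nonneg _ _ _
    have e1 : ∀ j, sqI refV a (pderiv j (affSubst z B p)) ≤ 2 * h ^ 2 * (s0 + s1) := by
      intro j
      rw [pderiv_affSubst, Fin.sum_univ_two]
      exact sqI_two_le refV a (abs_triMat_le v 0 j) (abs_triMat_le v 1 j) _ _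
    have e0 := e1 0
    have e1 := e1 1
    calc _ ≤ J * (κ * (pev 0 (affSubst z B p) ^ 2 + (2 * h ^ 2 * (s0 + s1) +
          2 * h ^ 2 * (s0 + s1)))) := by
          refine mul_le_mul_of_nonneg_left ((H4 a).trans ?_) hJ0
          gcongr
      _ ≤ J * (4 * κ * (pev 0 (affSubst z B p) ^ 2 + h ^ 2 * (s0 + s1))) := by
          refine mul_le_mul_of_nonneg_left ?_ hJ0
          have := mul_nonneg hκ0 (sq_nonneg (pev 0 (affSubst z B p)))
          linarith
      _ = 4 * κ * (J * pev 0 (affSubst z B p) ^ 2 + h ^ 2 * (J * s0 + J * s1)) := by ring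
      _ ≤ κ' * (J * pev 0 (affSubst z B p) ^ 2 + h ^ 2 * (J * s0 + J * s1)) :=
          mul_le_mul_of_nonneg_right hκ3 (add_nonneg (mul_nonneg hJ0 (sq_nonneg _))
            (mul_nonneg (sq_nonneg _) (add_nonneg (mul_nonneg hJ0 n0) (mul_nonneg hJ0 n1))))
  · rw [hS, hS, affSubst_affSubst hAB]
    calc _ ≤ J * (κ * sqI refV a (affSubst z B p)) := mul_le_mul_of_nonneg_left (H5 a c) hJ0
      _ = κ * (J * sqI refV a (affSubst z B p)) := by ring
      _ ≤ _ := mul_le_mul_of_nonneg_right hκ1 (mul_nonneg hJ0 (sqI_nonneg _ _ _))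

end Elast

/-! ### The Piola transform of symmetric tensor fields. -/

namespace Elast

open MvPolynomial MeasureTheory

section Piola

variable {z : Plane} {A B : Matrix (Fin 2) (Fin 2) ℝ}

/-- The Piola transform of a tensor field under the affine map `y ↦ z + B y`, with `A` the inverse
of `B`. -/
noncomputable def pio (A : Matrix (Fin 2) (Fin 2) ℝ) (z : Plane) (B : Matrix (Fin 2) (Fin 2) ℝ)
    (P : TriField) : TriField := fun c a b =>
  ∑ i, ∑ j, C (A a i * A b j) * affSubst z B (P c i j)

theorem mul_eq_one_apply (h : A * B = 1) (a b : Fin 2) :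
    A a 0 * B 0 b + A a 1 * B 1 b = if a = b then 1 else 0 := by
  have := congrFun (congrFun h a) b
  rwa [Matrix.mul_apply, Fin.sum_univ_two, Matrix.one_apply] at this

/-- In two dimensions the quarter turn intertwines the transpose of A with its adjugate. This is the
transformation law of scaled edge normals. -/
theorem sum_mul_rotv (h : A * B = 1) (z x y : Plane) (j : Fin 2) :
    ∑ b, A b j * rotv (x - y) b = A.det * rotv (affMap z B x - affMap z B y) j := by
  have h00 := mul_eq_one_apply h 0 0
  have h01 := mul_eq_one_apply h 0 1
  have h10 := mul_eq_one_apply h 1 0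
  have h11 := mul_eq_one_apply h 1 1
  simp only [if_true, Fin.isValue, zero_ne_one, one_ne_zero, if_false] at h00 h01 h10 h11
  rw [Matrix.det_fin_two, Fin.sum_univ_two]
  fin_cases j <;> simp [affMap_apply, Fin.sum_univ_two]
  · linear_combination (A 1 0 * (x 0 - y 0)) * h00 - (A 0 0 * (x 0 - y 0)) * h10 +
      (A 1 0 * (x 1 - y 1)) * h01 - (A 0 0 * (x 1 - y 1)) * h11
  · linear_combination (A 1 1 * (x 0 - y 0)) * h00 - (A 0 1 * (x 0 - y 0)) * h10 +
      (A 1 1 * (x 1 - y 1)) * h01 - (A 0 1 * (x 1 - y 1)) * h11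

/-- The second factor A cancels the B of the chain rule, so the divergence is only multiplied by the
first factor A. -/
theorem sum_pderiv_pio (h : B * A = 1) (P : TriField) (c : Fin 3) (a : Fin 2) :
    ∑ b, pderiv b (pio A z B P c a b) =
      ∑ i, C (A a i) * affSubst z B (∑ j, pderiv j (P c i j)) := by
  have h' : ∀ i j, (C (B i 0) * C (A 0 j) + C (B i 1) * C (A 1 j) : Poly2) =
      if i = j then 1 else 0 := fun i j => by
    rw [← C_mul, ← C_mul, ← C_add, mul_eq_one_apply h]
    split_ifs <;> simp
  have h00 := h' 0 0
  have h01 := h' 0 1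
  have h10 := h' 1 0
  have h11 := h' 1 1
  simp only [if_true, Fin.isValue, zero_ne_one, one_ne_zero, if_false] at h00 h01 h10 h11
  simp only [pio, Fin.sum_univ_two, map_add, pderiv_C_mul, pderiv_affSubst]
  simp only [C_mul]
  generalize affSubst z B (pderiv 0 (P c 0 0)) = p000
  generalize affSubst z B (pderiv 1 (P c 0 0)) = p100
  generalize affSubst z B (pderiv 0 (P c 0 1)) = p001
  generalize affSubst z B (pderiv 1 (P c 0 1)) = p101
  generalize affSubst z B (pderiv 0 (P c 1 0)) = p010
  generalize affSubst z B (pderiv 1 (P c 1 0)) = p110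
  generalize affSubst z B (pderiv 0 (P c 1 1)) = p011
  generalize affSubst z B (pderiv 1 (P c 1 1)) = p111
  linear_combination (C (A a 0) * p000 + C (A a 1) * p010) * h00 +
    (C (A a 0) * p001 + C (A a 1) * p011) * h01 +
    (C (A a 0) * p100 + C (A a 1) * p110) * h10 +
    (C (A a 0) * p101 + C (A a 1) * p111) * h11

variable {v w : Fin 3 → Plane}

/-- Congruence by A keeps symmetry, divergences are mapped by one fixed matrix and so stay common to
the three parts, and by `sum_mul_rotv` the normal jumps are mapped by det A times A. -/
theorem memLoc_pio {r : ℕ} (hw : ∀ c, affMap z B (w c) = v c) (hA : A * B = 1) {P : TriField}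
    (hP : MemLoc r v P) : MemLoc r w (pio A z B P) := by
  refine ⟨fun c a b => ?_, fun c a b => ?_, fun c c' a => ?_, fun m a s hs => ?_⟩
  · refine totalDegree_finsetSum_le fun i _ => totalDegree_finsetSum_le fun j _ => ?_
    refine (totalDegree_mul _ _).trans ?_
    rw [totalDegree_C, zero_add]
    exact totalDegree_affSubst_le z B (hP.deg c i j)
  · rw [pio, pio, Finset.sum_comm]
    refine Finset.sum_congr rfl fun i _ => Finset.sum_congr rfl fun j _ => ?_
    rw [hP.symm c j i, mul_comm (A a j)]
  · rw [sum_pderiv_pio (mul_eq_one_comm.1 hA), sum_pderiv_pio (mul_eq_one_comm.1 hA)]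
    simp only [hP.div c c']
  · have hz := affMap_centroid hw
    have hy : affMap z B (centroid w + s • (w m - centroid w)) =
        centroid v + s • (v m - centroid v) := by
      have e : centroid w + s • (w m - centroid w) = (1 - s) • centroid w + s • w m := by module
      rw [e, affMap_comb, hz, hw]; module
    have hr := fun j => sum_mul_rotv hA z (w m) (centroid w) j
    simp only [hw, hz, Fin.sum_univ_two] at hr
    have h0 := hP.inner m 0 s hs
    have h1 := hP.inner m 1 s hs
    have hr0 := hr 0
    have hr1 := hr 1
    simp only [pio, Fin.sum_univ_two, map_add, map_sub, map_mul, pev_C, pev_affSubst, hy]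
      at h0 h1 ⊢
    linear_combination (A a 0 * A.det) * h0 + (A a 1 * A.det) * h1 +
      (A a 0 * (pev (centroid v + s • (v m - centroid v)) (P (m + 1) 0 0) -
        pev (centroid v + s • (v m - centroid v)) (P (m + 2) 0 0)) +
       A a 1 * (pev (centroid v + s • (v m - centroid v)) (P (m + 1) 1 0) -
        pev (centroid v + s • (v m - centroid v)) (P (m + 2) 1 0))) * hr0 +
      (A a 0 * (pev (centroid v + s • (v m - centroid v)) (P (m + 1) 0 1) -
        pev (centroid v + s • (v m - centroid v)) (P (m + 2) 0 1)) +
       A a 1 * (pev (centroid v + s • (v m - centroid v)) (P (m + 1) 1 1) -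
        pev (centroid v + s • (v m - centroid v)) (P (m + 2) 1 1))) * hr1

theorem trace_pio (hw : ∀ c, affMap z B (w c) = v c) (hA : A * B = 1) (P : TriField) (n : Fin 3)
    (a : Fin 2) :
    trace w (pio A z B P) n a = C A.det * ∑ i, C (A a i) * affSubst z B (trace v P n i) := by
  have hr : ∀ j, (C (A 0 j) * C (edgeN w n 0) + C (A 1 j) * C (edgeN w n 1) : Poly2) =
      C A.det * C (edgeN v n j) := fun j => by
    have := sum_mul_rotv hA z (w (n + 2)) (w (n + 1)) j
    simp only [hw, Fin.sum_univ_two] at this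
    rw [← C_mul, ← C_mul, ← C_mul, ← C_add]
    exact congrArg C this
  have hr0 := hr 0
  have hr1 := hr 1
  have hC : ∀ t, affSubst z B (C t) = C t := fun t => (affSubst z B).commutes t
  simp only [trace, pio, Fin.sum_univ_two, map_add, map_mul, hC]
  linear_combination
    (C (A a 0) * affSubst z B (P n 0 0) + C (A a 1) * affSubst z B (P n 1 0)) * hr0 +
    (C (A a 0) * affSubst z B (P n 0 1) + C (A a 1) * affSubst z B (P n 1 1)) * hr1

/-- The squared norm of a composite tensor field. -/
noncomputable def nrm (v : Fin 3 → Plane) (P : TriField) : ℝ := ∑ c, ∑ a, ∑ b, sqI v c (P c a b)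

theorem sqI_le_nrm (v : Fin 3 → Plane) (P : TriField) (c : Fin 3) (a b : Fin 2) :
    sqI v c (P c a b) ≤ nrm v P := by
  have h1 := Finset.single_le_sum (f := fun b => sqI v c (P c a b))
    (fun b _ => sqI_nonneg v c _) (Finset.mem_univ b)
  have h2 := Finset.single_le_sum (f := fun a => ∑ b, sqI v c (P c a b))
    (fun a _ => Finset.sum_nonneg fun b _ => sqI_nonneg v c _) (Finset.mem_univ a)
  have h3 := Finset.single_le_sum (f := fun c => ∑ a, ∑ b, sqI v c (P c a b))
    (fun c _ => Finset.sum_nonneg fun a _ => Finset.sum_nonneg fun b _ => sqI_nonneg v c _)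
    (Finset.mem_univ c)
  exact h1.trans (h2.trans h3)

theorem nrm_nonneg (v : Fin 3 → Plane) (P : TriField) : 0 ≤ nrm v P :=
  Finset.sum_nonneg fun _ _ => Finset.sum_nonneg fun _ _ => Finset.sum_nonneg fun _ _ =>
    sqI_nonneg _ _ _

theorem nrm_le_of_entries {v : Fin 3 → Plane} {P Q : TriField} {K : ℝ}
    (h : ∀ c a b, sqI v c (P c a b) ≤ K * ∑ a, ∑ b, sqI v c (Q c a b)) :
    nrm v P ≤ 4 * K * nrm v Q := by
  rw [nrm, nrm, Finset.mul_sum]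
  refine Finset.sum_le_sum fun c _ => ?_
  calc _ ≤ ∑ a : Fin 2, ∑ b : Fin 2, K * ∑ a, ∑ b, sqI v c (Q c a b) :=
        Finset.sum_le_sum fun a _ => Finset.sum_le_sum fun b _ => h c a b
    _ = _ := by simp only [Finset.sum_const, Finset.card_univ, Fintype.card_fin]; ring

theorem nrm_add_le (v : Fin 3 → Plane) (P Q : TriField) :
    nrm v (P + Q) ≤ 2 * nrm v P + 2 * nrm v Q := by
  simp only [nrm, Finset.mul_sum, ← Finset.sum_add_distrib]
  exact Finset.sum_le_sum fun c _ => Finset.sum_le_sum fun a _ => Finset.sum_le_sum fun b _ =>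
    sqI_add_le v c _ _

theorem nrm_neg (v : Fin 3 → Plane) (P : TriField) : nrm v (-P) = nrm v P := by
  simp only [nrm, Pi.neg_apply, sqI_neg]

theorem sqI_smul (v : Fin 3 → Plane) (c : Fin 3) (t : ℝ) (p : Poly2) :
    sqI v c (t • p) = t ^ 2 * sqI v c p := by rw [smul_eq_C_mul, sqI_C_mul]

theorem nrm_smul (v : Fin 3 → Plane) (t : ℝ) (P : TriField) : nrm v (t • P) = t ^ 2 * nrm v P := by
  simp only [nrm, Pi.smul_apply, sqI_smul, Finset.mul_sum]

theorem nrm_sub_le (v : Fin 3 → Plane) (P Q : TriField) :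
    nrm v (P - Q) ≤ 2 * nrm v P + 2 * nrm v Q := by
  rw [sub_eq_add_neg]
  exact (nrm_add_le v P (-Q)).trans_eq (by rw [nrm_neg])

/-- Every transformed entry is a sum of four terms with coefficients at most α², and the factor |det
B| is that of the change of variables. -/
theorem nrm_pio_le (hw : ∀ c, affMap z B (w c) = v c) (hB : B.det ≠ 0) {α : ℝ}
    (hα : ∀ i j, |A i j| ≤ α) (P : TriField) :
    |B.det| * nrm w (pio A z B P) ≤ 16 * α ^ 4 * nrm v P := by
  have hα0 : 0 ≤ α := (abs_nonneg _).trans (hα 0 0)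
  have h2 : ∀ a b i j, |A a i * A b j| ≤ α ^ 2 := fun a b i j => by
    rw [abs_mul, sq]; exact mul_le_mul (hα _ _) (hα _ _) (abs_nonneg _) hα0
  have h : ∀ c a b, sqI w c (pio A z B P c a b) ≤ 4 * α ^ 4 *
      ∑ i, ∑ j, sqI w c (affSubst z B (P c i j)) := by
    intro c a b
    simp only [pio, Fin.sum_univ_two]
    have e1 := sqI_add_le w c
      (C (A a 0 * A b 0) * affSubst z B (P c 0 0) + C (A a 0 * A b 1) * affSubst z B (P c 0 1))
      (C (A a 1 * A b 0) * affSubst z B (P c 1 0) + C (A a 1 * A b 1) * affSubst z B (P c 1 1))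
    have e2 := sqI_two_le w c (h2 a b 0 0) (h2 a b 0 1) (affSubst z B (P c 0 0))
      (affSubst z B (P c 0 1))
    have e3 := sqI_two_le w c (h2 a b 1 0) (h2 a b 1 1) (affSubst z B (P c 1 0))
      (affSubst z B (P c 1 1))
    linarith
  have h3 := nrm_le_of_entries (Q := fun c i j => affSubst z B (P c i j)) h
  calc _ ≤ |B.det| * (4 * (4 * α ^ 4) * nrm w fun c i j => affSubst z B (P c i j)) :=
        mul_le_mul_of_nonneg_left h3 (abs_nonneg _)
    _ = _ := by
      simp only [nrm, sqI_affSubst hw hB, Finset.mul_sum]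
      refine Finset.sum_congr rfl fun c _ => Finset.sum_congr rfl fun a _ =>
        Finset.sum_congr rfl fun b _ => by ring

end Piola

section Reference

/-- The scalar product of composite tensor fields. -/
noncomputable def nrmForm (v : Fin 3 → Plane) : TriField →ₗ[ℝ] TriField →ₗ[ℝ] ℝ :=
  ∑ c, ∑ a, ∑ b, (polyForm (isCompact_triangle (subV v c))).compl₁₂
    (LinearMap.proj b ∘ₗ LinearMap.proj a ∘ₗ LinearMap.proj c)
    (LinearMap.proj b ∘ₗ LinearMap.proj a ∘ₗ LinearMap.proj c)

theorem nrmForm_self (v : Fin 3 → Plane) (P : TriField) : nrmForm v P P = nrm v P := by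
  simp [nrmForm, nrm, LinearMap.sum_apply, sqI_eq_polyForm]

theorem nrm_refV_pos {P : TriField} (hP : P ≠ 0) : 0 < nrm refV P := by
  refine (nrm_nonneg _ _).lt_of_ne fun h => hP ?_
  funext c a b
  by_contra hne
  have h1 := sqI_le_nrm refV P c a b
  have h2 := polyForm_refV_pos c _ hne
  rw [← sqI_eq_polyForm] at h2
  linarith

theorem exists_nrm_refV_le {r : ℕ} (G : locSigma r refV →ₗ[ℝ] locSigma r refV) :
    ∃ K : ℝ, 0 ≤ K ∧ ∀ P, nrm refV (G P).1 ≤ K * nrm refV P.1 := by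
  obtain ⟨K, hK, h⟩ := exists_form_le
    ((nrmForm refV).compl₁₂ (locSigma r refV).subtype (locSigma r refV).subtype)
    ((nrmForm refV).compl₁₂ ((locSigma r refV).subtype ∘ₗ G) ((locSigma r refV).subtype ∘ₗ G))
    (fun P hP => by
      have : nrmForm refV P.1 P.1 = _ := nrmForm_self _ _
      exact (nrm_refV_pos (P := P.1) (by simpa using hP)).trans_eq this.symm)
  refine ⟨K, hK, fun P => ?_⟩
  rw [← nrmForm_self, ← nrmForm_self]
  exact h P

/-- A localization operator on the reference triangle that is bounded. -/
theorem exists_refG_bounded {r : ℕ} (hr : 2 ≤ r) (c : Fin 3) : ∃ K : ℝ, 0 ≤ K ∧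
    ∀ P, MemLoc r refV P → ∃ Q, MemLoc r refV Q ∧ nrm refV Q ≤ K * nrm refV P ∧
      ∀ n a s, pev (edgePt refV n s) (trace refV Q n a) =
        pev (edgePt refV n s) (refJ r c (trace refV P n a)) := by
  obtain ⟨G, hG⟩ := exists_refG hr c
  obtain ⟨K, hK, h⟩ := exists_nrm_refV_le G
  exact ⟨K, hK, fun P hP => ⟨_, (G ⟨P, hP⟩).2, h ⟨P, hP⟩, hG ⟨P, hP⟩⟩⟩

end Reference

end Elast

/-! ### Splitting a composite stress into vertex parts, with control of the deviator. -/

namespace Elast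

open MvPolynomial MeasureTheory

/-- The part of a polynomial of degree `r` that belongs to the vertex `v c` of a triangle. -/
noncomputable def locJ (r : ℕ) (v : Fin 3 → Plane) (c : Fin 3) (p : Poly2) : Poly2 :=
  affSubst (-Matrix.toLpLin 2 2 (triMat v)⁻¹ (centroid v)) (triMat v)⁻¹
    (refJ r c (affSubst (centroid v) (triMat v) p))

/-- The isotropic field with the pressure `p`. -/
noncomputable def isoField (p : Poly2) : TriField := fun _ a b => if a = b then p else 0

/-- Half of the trace of a composite tensor field. -/
noncomputable def halfTr (P : TriField) (c : Fin 3) : Poly2 := C (1 / 2 : ℝ) * (P c 0 0 + P c 1 1)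

/-- The deviatoric part of a composite tensor field. -/
noncomputable def devF (P : TriField) : TriField := fun c a b =>
  P c a b - if a = b then halfTr P c else 0

section

variable {r : ℕ} {v : Fin 3 → Plane} {P : TriField}

theorem triMat_mul_inv (hv : cross3 v ≠ 0) : triMat v * (triMat v)⁻¹ = 1 :=
  Matrix.mul_nonsing_inv _ (det_triMat_ne hv).isUnit

theorem triMat_inv_mul (hv : cross3 v ≠ 0) : (triMat v)⁻¹ * triMat v = 1 :=
  Matrix.nonsing_inv_mul _ (det_triMat_ne hv).isUnit

theorem affMap_triMat_inv (hv : cross3 v ≠ 0) (y : Plane) :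
    affMap (-Matrix.toLpLin 2 2 (triMat v)⁻¹ (centroid v)) (triMat v)⁻¹
      (affMap (centroid v) (triMat v) y) = y :=
  affMap_affMap (triMat_inv_mul hv) _ _

theorem locJ_add (c : Fin 3) (p q : Poly2) : locJ r v c (p + q) = locJ r v c p + locJ r v c q := by
  simp only [locJ, map_add, refJ_add]

theorem locJ_C_mul (c : Fin 3) (t : ℝ) (p : Poly2) :
    locJ r v c (C t * p) = C t * locJ r v c p := by
  rw [← smul_eq_C_mul, ← smul_eq_C_mul]
  simp only [locJ, map_smul, refJ_smul]

theorem totalDegree_locJ_le (hr : 0 < r) (c : Fin 3) {p : Poly2} (hp : p.totalDegree ≤ r) :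
    (locJ r v c p).totalDegree ≤ r :=
  totalDegree_affSubst_le _ _ (totalDegree_refJ_le hr c (totalDegree_affSubst_le _ _ hp))

theorem pev_locJ_affMap (hv : cross3 v ≠ 0) (c : Fin 3) (p : Poly2) (y : Plane) :
    pev (affMap (centroid v) (triMat v) y) (locJ r v c p) =
      pev y (refJ r c (affSubst (centroid v) (triMat v) p)) := by
  rw [locJ, pev_affSubst, affMap_triMat_inv hv]

theorem sum_locJ (hv : cross3 v ≠ 0) (p : Poly2) : ∑ c, locJ r v c p = p := by
  simp only [locJ]
  rw [← map_sum, sum_refJ]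
  refine poly_ext_of_isOpen isOpen_univ Set.univ_nonempty fun x _ => ?_
  rw [pev_affSubst, pev_affSubst]
  have h := affMap_affMap (B := (triMat v)⁻¹) (triMat_mul_inv hv)
    (-Matrix.toLpLin 2 2 (triMat v)⁻¹ (centroid v)) x
  have e : -Matrix.toLpLin 2 2 (triMat v) (-Matrix.toLpLin 2 2 (triMat v)⁻¹ (centroid v)) =
      centroid v := by
    rw [map_neg, neg_neg, ← LinearMap.comp_apply, ← Matrix.toLpLin_mul, triMat_mul_inv hv,
      Matrix.toLpLin_one, LinearMap.id_apply]
  rw [e] at h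
  rw [h]

/-- The weight is zero for the vertex opposite to the edge, and for the end points v_c - x is
tangential. So the vertex operator on an edge sees only the restriction of p to this edge; on this
the continuity of normal traces after cutoff rests. -/
theorem pev_locJ_edgePt (hv : cross3 v ≠ 0) (c m : Fin 3) (s : ℝ) (p : Poly2) :
    pev (edgePt v m s) (locJ r v c p) = edgeW m s c * (pev (edgePt v m s) p +
      1 / r * ∑ b, (v c b - edgePt v m s b) * pev (edgePt v m s) (pderiv b p)) := by
  have hx := affMap_edgePt (affMap_refV v) m s
  rw [← hx, pev_locJ_affMap hv, ← affMap_refV v c]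
  simp only [refJ, map_mul, map_add, pev_refLam, pev_C, map_sub, pev_X, pderiv_affSubst,
    pev_affSubst, Fin.sum_univ_two, affMap_apply]
  ring

theorem memLoc_isoField {p : Poly2} (hp : p.totalDegree ≤ r) : MemLoc r v (isoField p) := by
  refine ⟨fun c a b => ?_, fun c a b => ?_, fun c c' a => rfl, fun m a s _ => by simp [isoField]⟩
  · unfold isoField; split_ifs <;> simp [hp]
  · simp only [isoField, eq_comm]

theorem trace_isoField (p : Poly2) (m : Fin 3) (a : Fin 2) :
    trace v (isoField p) m a = C (edgeN v m a) * p := by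
  fin_cases a <;> simp [trace, isoField]

theorem trace_add (P Q : TriField) (m : Fin 3) (a : Fin 2) :
    trace v (P + Q) m a = trace v P m a + trace v Q m a := by
  simp only [trace, Pi.add_apply, mul_add, Finset.sum_add_distrib]

theorem trace_sub (P Q : TriField) (m : Fin 3) (a : Fin 2) :
    trace v (P - Q) m a = trace v P m a - trace v Q m a := by
  simp only [trace, Pi.sub_apply, mul_sub, Finset.sum_sub_distrib]

theorem devF_sub (P Q : TriField) : devF (P - Q) = devF P - devF Q := by
  funext c a b
  simp only [devF, halfTr, Pi.sub_apply]
  split_ifs <;> ring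

theorem devF_smul (t : ℝ) (P : TriField) : devF (t • P) = t • devF P := by
  funext c a b
  simp only [devF, halfTr, Pi.smul_apply, smul_eq_C_mul]
  split_ifs <;> ring

theorem devF_add (P Q : TriField) : devF (P + Q) = devF P + devF Q := by
  funext c a b
  simp only [devF, halfTr, Pi.add_apply]
  split_ifs <;> ring

theorem devF_isoField (p : Poly2) : devF (isoField p) = 0 := by
  have h : (C (1 / 2 : ℝ) : Poly2) * (p + p) = p := by
    rw [← smul_eq_C_mul, smul_add, ← add_smul]; norm_num
  funext c a b
  simp only [devF, halfTr, isoField, if_true, h, sub_self, Pi.zero_apply]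

theorem nrm_devF_le (P : TriField) : nrm v (devF P) ≤ 12 * nrm v P := by
  refine (nrm_le_of_entries (K := 3) fun c a b => ?_).trans_eq (by ring)
  have h00 := sqI_nonneg v c (P c 0 0)
  have h01 := sqI_nonneg v c (P c 0 1)
  have h10 := sqI_nonneg v c (P c 1 0)
  have h11 := sqI_nonneg v c (P c 1 1)
  have h1 := sqI_add_le v c (P c 0 0) (P c 1 1)
  have h2 : ∀ p, sqI v c (p - halfTr P c) ≤ 2 * sqI v c p + 1 / 2 * sqI v c (P c 0 0 + P c 1 1) :=
    fun p => by
      have := sqI_add_le v c p (-halfTr P c)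
      rw [sqI_neg, halfTr, sqI_C_mul, ← sub_eq_add_neg] at this
      rw [halfTr]
      linarith
  have h3 := h2 (P c 0 0)
  have h4 := h2 (P c 1 1)
  fin_cases a <;> fin_cases b <;> simp [devF, Fin.sum_univ_two] <;> linarith

theorem totalDegree_halfTr_le (hP : MemLoc r v P) (c : Fin 3) : (halfTr P c).totalDegree ≤ r := by
  refine (totalDegree_mul _ _).trans ?_
  rw [totalDegree_C, zero_add]
  exact (totalDegree_add _ _).trans (max_le (hP.deg _ _ _) (hP.deg _ _ _))

theorem totalDegree_devF_le (hP : MemLoc r v P) (c : Fin 3) (a b : Fin 2) :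
    (devF P c a b).totalDegree ≤ r := by
  refine (totalDegree_sub _ _).trans (max_le (hP.deg _ _ _) ?_)
  split_ifs
  · exact totalDegree_halfTr_le hP c
  · simp

/-- The divergence is that of the deviator plus the gradient of half the trace, and it is the same
polynomial on all three parts. Hence jumps of the pressure gradient are jumps of the divergence of
the deviator. -/
theorem pderiv_halfTr_sub (hP : MemLoc r v P) (c c' : Fin 3) (k : Fin 2) :
    pderiv k (halfTr P c - halfTr P c') =
      ∑ b, pderiv b (devF P c' k b) - ∑ b, pderiv b (devF P c k b) := by
  have h := hP.div c c' k
  fin_cases k <;> simp [devF, Fin.sum_univ_two] at h ⊢ <;> linear_combination h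

theorem centroid_ne (hv : cross3 v ≠ 0) (m : Fin 3) :
    0 < rotv (v m - centroid v) 0 ^ 2 + rotv (v m - centroid v) 1 ^ 2 := by
  have h0 : v m ≠ centroid v := fun h => by
    have h1 := bc_vertex hv m m
    rw [if_pos rfl, h, bc_centroid hv] at h1
    norm_num at h1
  by_contra hn
  apply h0
  simp only [rotv_zero, rotv_one, PiLp.sub_apply] at hn
  have h1 : (v m 1 - centroid v 1) ^ 2 = 0 := by
    nlinarith [sq_nonneg (v m 1 - centroid v 1), sq_nonneg (v m 0 - centroid v 0)]
  have h2 : (v m 0 - centroid v 0) ^ 2 = 0 := by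
    nlinarith [sq_nonneg (v m 1 - centroid v 1), sq_nonneg (v m 0 - centroid v 0)]
  have h1 := pow_eq_zero_iff two_ne_zero |>.1 h1
  have h2 := pow_eq_zero_iff two_ne_zero |>.1 h2
  ext i
  fin_cases i <;> simp <;> linarith

/-- At the barycenter normal continuity across a spoke with normal ν reads [dev]ν + [tr/2]ν = 0.
Taking lengths and cancelling |ν| gives the bound. -/
theorem sq_jump_halfTr_le (hv : cross3 v ≠ 0) (hP : MemLoc r v P) (m : Fin 3) :
    pev (centroid v) (halfTr P (m + 1) - halfTr P (m + 2)) ^ 2 ≤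
      ∑ a, ∑ b, pev (centroid v) (devF P (m + 1) a b - devF P (m + 2) a b) ^ 2 := by
  have h0 := hP.inner m 0 0 ⟨le_rfl, zero_le_one⟩
  have h1 := hP.inner m 1 0 ⟨le_rfl, zero_le_one⟩
  have hν := centroid_ne hv m
  generalize rotv (v m - centroid v) = ν at h0 h1 hν
  rw [zero_smul, add_zero] at h0 h1
  have e : ∀ a b, pev (centroid v) (P (m + 1) a b - P (m + 2) a b) =
      pev (centroid v) (devF P (m + 1) a b - devF P (m + 2) a b) +
        if a = b then pev (centroid v) (halfTr P (m + 1) - halfTr P (m + 2)) else 0 := by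
    intro a b
    simp only [devF]
    split_ifs
    · rw [← map_add]; congr 1; ring
    · rw [add_zero]; congr 1; ring
  simp only [Fin.sum_univ_two, e] at h0 h1 ⊢
  generalize pev (centroid v) (halfTr P (m + 1) - halfTr P (m + 2)) = τ at *
  generalize pev (centroid v) (devF P (m + 1) 0 0 - devF P (m + 2) 0 0) = e00 at *
  generalize pev (centroid v) (devF P (m + 1) 0 1 - devF P (m + 2) 0 1) = e01 at *
  generalize pev (centroid v) (devF P (m + 1) 1 0 - devF P (m + 2) 1 0) = e10 at *
  generalize pev (centroid v) (devF P (m + 1) 1 1 - devF P (m + 2) 1 1) = e11 at *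
  simp only [Fin.isValue, if_true, zero_ne_one, one_ne_zero, if_false, add_zero] at h0 h1
  have k0 : τ * ν 0 = -(e00 * ν 0 + e01 * ν 1) := by linear_combination h0
  have k1 : τ * ν 1 = -(e10 * ν 0 + e11 * ν 1) := by linear_combination h1
  have k2 : τ ^ 2 * (ν 0 ^ 2 + ν 1 ^ 2) = (e00 * ν 0 + e01 * ν 1) ^ 2 +
      (e10 * ν 0 + e11 * ν 1) ^ 2 := by
    linear_combination (τ * ν 0 - (e00 * ν 0 + e01 * ν 1)) * k0 +
      (τ * ν 1 - (e10 * ν 0 + e11 * ν 1)) * k1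
  refine le_of_mul_le_mul_right (k2.le.trans ?_) hν
  nlinarith [sq_nonneg (e00 * ν 1 - e01 * ν 0), sq_nonneg (e10 * ν 1 - e11 * ν 0)]

end

/-- On a composite triangle the stress is controlled by its deviatoric part, up to an isotropic
field with polynomial pressure. -/
theorem exists_nrm_sub_isoField_le (r : ℕ) {γ : ℝ} (hγ : 0 < γ) : ∃ K : ℝ, 0 ≤ K ∧
    ∀ v, IsShapeRegular γ v → ∀ P, MemLoc r v P →
      nrm v (P - isoField (halfTr P 0)) ≤ K * nrm v (devF P) := by
  obtain ⟨κ, hκ, H⟩ := exists_bounds r hγ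
  have hκ0 : 0 ≤ κ := by linarith
  refine ⟨2 + 8 * (κ * (16 * κ + 32 * κ ^ 2)), by positivity, fun v hv P hP => ?_⟩
  set D := devF P with hD
  set h := Metric.diam (triangle v) with hh
  have hh0 : 0 < h := diam_triangle_pos hv.ne
  have hN : 0 ≤ nrm v D := nrm_nonneg _ _
  have hdeg := totalDegree_devF_le hP
  -- Poincaré inequality for the difference of the pressures on two parts: its value at the
  -- barycenter and its gradient are both controlled by the deviator.
  have hq : ∀ c, sqI v c (halfTr P c - halfTr P 0) ≤ κ * (16 * κ + 32 * κ ^ 2) * nrm v D := by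
    intro c
    have hpt : |(triMat v).det| * pev (centroid v) (halfTr P c - halfTr P 0) ^ 2 ≤
        16 * κ * nrm v D := by
      have hj : ∀ m, |(triMat v).det| *
          pev (centroid v) (halfTr P (m + 1) - halfTr P (m + 2)) ^ 2 ≤ 16 * κ * nrm v D := by
        intro m
        have hc : ∀ c a b, |(triMat v).det| * pev (centroid v) (D c a b) ^ 2 ≤ κ * nrm v D :=
          fun c a b => ((H v hv _ (hdeg c a b)).2.2.1 c).trans
            (mul_le_mul_of_nonneg_left (sqI_le_nrm v D c a b) hκ0)
        have hd : ∀ a b, |(triMat v).det| *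
            pev (centroid v) (D (m + 1) a b - D (m + 2) a b) ^ 2 ≤ 4 * κ * nrm v D := by
          intro a b
          have h1 := hc (m + 1) a b
          have h2 := hc (m + 2) a b
          have h3 : pev (centroid v) (D (m + 1) a b - D (m + 2) a b) ^ 2 ≤
              2 * pev (centroid v) (D (m + 1) a b) ^ 2 +
              2 * pev (centroid v) (D (m + 2) a b) ^ 2 := by
            rw [map_sub]
            linarith [sq_nonneg (pev (centroid v) (D (m + 1) a b) +
              pev (centroid v) (D (m + 2) a b))]
          have h4 := mul_le_mul_of_nonneg_left h3 (abs_nonneg (triMat v).det)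
          linarith
        have h5 := mul_le_mul_of_nonneg_left (sq_jump_halfTr_le hv.ne hP m)
          (abs_nonneg (triMat v).det)
        simp only [Fin.sum_univ_two] at h5
        have := hd 0 0
        have := hd 0 1
        have := hd 1 0
        have := hd 1 1
        linarith
      -- The parts 0 and 1 meet along the spoke to the vertex 2, the parts 0 and 2 along the spoke
      -- to the vertex 1.
      fin_cases c
      · simp; positivity
      · have := hj 2
        rw [← neg_sub, map_neg, neg_sq] at this
        exact this
      · exact hj 1
    -- The polynomial of part c' is measured on part c, which costs one more factor from the
    -- comparison of norms on different parts.
    have hgr : ∀ k, sqI v c (pderiv k (halfTr P c - halfTr P 0)) ≤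
        16 * κ ^ 2 * (h ^ 2)⁻¹ * nrm v D := by
      intro k
      have hx : ∀ c' b, sqI v c (pderiv b (D c' k b)) ≤ κ ^ 2 * (h ^ 2)⁻¹ * nrm v D := by
        intro c' b
        calc _ ≤ κ * (h ^ 2)⁻¹ * sqI v c (D c' k b) := (H v hv _ (hdeg c' k b)).2.1 c b
          _ ≤ κ * (h ^ 2)⁻¹ * (κ * sqI v c' (D c' k b)) :=
            mul_le_mul_of_nonneg_left ((H v hv _ (hdeg c' k b)).1 c c') (by positivity)
          _ ≤ κ * (h ^ 2)⁻¹ * (κ * nrm v D) := by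
            gcongr; exact sqI_le_nrm v D c' k b
          _ = _ := by ring
      rw [pderiv_halfTr_sub hP, sub_eq_add_neg]
      simp only [Fin.sum_univ_two]
      have e1 := sqI_add_le v c (pderiv 0 (D 0 k 0) + pderiv 1 (D 0 k 1))
        (-(pderiv 0 (D c k 0) + pderiv 1 (D c k 1)))
      have e2 := sqI_add_le v c (pderiv 0 (D 0 k 0)) (pderiv 1 (D 0 k 1))
      have e3 := sqI_add_le v c (pderiv 0 (D c k 0)) (pderiv 1 (D c k 1))
      rw [sqI_neg] at e1
      have := hx 0 0
      have := hx 0 1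
      have := hx c 0
      have := hx c 1
      linarith
    have hdq : (halfTr P c - halfTr P 0).totalDegree ≤ r :=
      (totalDegree_sub _ _).trans (max_le (totalDegree_halfTr_le hP _) (totalDegree_halfTr_le hP _))
    refine ((H v hv _ hdq).2.2.2.1 c).trans ?_
    rw [Fin.sum_univ_two, mul_assoc]
    refine mul_le_mul_of_nonneg_left ?_ hκ0
    calc _ ≤ 16 * κ * nrm v D + h ^ 2 * (16 * κ ^ 2 * (h ^ 2)⁻¹ * nrm v D +
          16 * κ ^ 2 * (h ^ 2)⁻¹ * nrm v D) := by
          gcongr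
          · exact hgr 0
          · exact hgr 1
      _ = _ := by field_simp; ring
  have e : P - isoField (halfTr P 0) =
      D + fun c a b => if a = b then halfTr P c - halfTr P 0 else 0 := by
    funext c a b
    simp only [hD, devF, isoField, Pi.sub_apply, Pi.add_apply]
    split_ifs <;> ring
  rw [e]
  refine (nrm_add_le _ _ _).trans ?_
  have hz : ∀ c, sqI v c (0 : Poly2) = 0 := fun c => by simp [sqI]
  have e2 : nrm v (fun c a b => if a = b then halfTr P c - halfTr P 0 else 0) =
      ∑ c, 2 * sqI v c (halfTr P c - halfTr P 0) := by
    refine Finset.sum_congr rfl fun c _ => ?_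
    simp [Fin.sum_univ_two, hz]; ring
  rw [e2, Fin.sum_univ_three]
  have h0 : sqI v 0 (halfTr P 0 - halfTr P 0) = 0 := by rw [sub_self, hz]
  have := hq 1
  have := hq 2
  rw [h0]
  linarith

/-- The localization of a composite stress to a vertex of the triangle. -/
theorem exists_localPart {r : ℕ} (hr : 2 ≤ r) {γ : ℝ} (hγ : 0 < γ) (c : Fin 3) :
    ∃ K : ℝ, 0 ≤ K ∧ ∀ v, IsShapeRegular γ v → ∀ P, MemLoc r v P → ∃ Q, MemLoc r v Q ∧
      (∀ n a s, pev (edgePt v n s) (trace v Q n a) =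
        pev (edgePt v n s) (locJ r v c (trace v P n a))) ∧
      nrm v Q ≤ K * nrm v P ∧ nrm v (devF Q) ≤ K * nrm v (devF P) := by
  obtain ⟨κ, hκ, H⟩ := exists_bounds r hγ
  obtain ⟨K₁, hK₁, H₁⟩ := exists_nrm_sub_isoField_le r hγ
  obtain ⟨K₂, hK₂, H₂⟩ := exists_refG_bounded hr c
  have hκ0 : 0 ≤ κ := by linarith
  set K₃ := 256 * (3 / γ) ^ 4 * K₂ * K₁ with hK₃
  have hK₃0 : 0 ≤ K₃ := by positivity
  refine ⟨12 * κ ^ 2 + 24 * K₃, by positivity, fun v hv P hP => ?_⟩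
  set B := triMat v with hB
  set z := centroid v with hz
  set z' := -Matrix.toLpLin 2 2 B⁻¹ z with hz'
  set p := halfTr P 0 with hp
  set h := Metric.diam (triangle v) with hh
  have hh0 : 0 < h := diam_triangle_pos hv.ne
  have hBA : B * B⁻¹ = 1 := triMat_mul_inv hv.ne
  have hAB : B⁻¹ * B = 1 := triMat_inv_mul hv.ne
  have hBd : B.det ≠ 0 := det_triMat_ne hv.ne
  have hAd : B⁻¹.det ≠ 0 := fun h0 => by
    have := congrArg Matrix.det hAB
    rw [Matrix.det_mul, h0, zero_mul, Matrix.det_one] at this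
    exact zero_ne_one this
  have hw : ∀ c, affMap z B (refV c) = v c := affMap_refV v
  have hw' : ∀ c, affMap z' B⁻¹ (v c) = refV c := fun c => by
    rw [← hw c]; exact affMap_triMat_inv hv.ne _
  have hpd : p.totalDegree ≤ r := totalDegree_halfTr_le hP 0
  -- After removal of one pressure the rest is bounded by the deviator, so the operator of the
  -- reference triangle is applied to this rest only.
  have hS : MemLoc r v (P - isoField p) :=
    (locSigma r v).sub_mem (mem_locSigma.2 hP) (mem_locSigma.2 (memLoc_isoField hpd))
  obtain ⟨R, hR, hRn, hRt⟩ := H₂ _ (memLoc_pio hw hAB hS)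
  set W := pio B z' B⁻¹ R with hW
  have hWm : MemLoc r v W := memLoc_pio hw' hBA hR
  -- The transforms to the reference triangle and back contribute 16(3/(γh))⁴ and 16h⁴; the powers
  -- of h and the determinants cancel.
  have hWn : nrm v W ≤ K₃ * nrm v (devF P) := by
    have h1 := nrm_pio_le hw' hAd (abs_triMat_le v) R
    have h2 := nrm_pio_le hw hBd (abs_triMat_inv_le hγ hv.le hh0) (P - isoField p)
    have h3 := H₁ v hv P hP
    have hdd : |B.det| * |B⁻¹.det| = 1 := by
      rw [← abs_mul, ← Matrix.det_mul, hBA, Matrix.det_one, abs_one]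
    calc nrm v W = |B.det| * (|B⁻¹.det| * nrm v W) := by rw [← mul_assoc, hdd, one_mul]
      _ ≤ |B.det| * (16 * h ^ 4 * (K₂ * nrm refV (pio B⁻¹ z B (P - isoField p)))) := by
        refine mul_le_mul_of_nonneg_left (h1.trans ?_) (abs_nonneg _)
        gcongr
      _ = 16 * h ^ 4 * K₂ * (|B.det| * nrm refV (pio B⁻¹ z B (P - isoField p))) := by ring
      _ ≤ 16 * h ^ 4 * K₂ * (16 * (3 / γ * h⁻¹) ^ 4 * (K₁ * nrm v (devF P))) := by
        refine mul_le_mul_of_nonneg_left (h2.trans ?_) (by positivity)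
        gcongr
      _ = _ := by rw [hK₃]; field_simp; ring
  have hJn : nrm v (isoField (locJ r v c p)) ≤ 6 * κ ^ 2 * nrm v P := by
    have hz0 : ∀ c, sqI v c (0 : Poly2) = 0 := fun c => by simp [sqI]
    have e1 : nrm v (isoField (locJ r v c p)) = ∑ a, 2 * sqI v a (locJ r v c p) := by
      refine Finset.sum_congr rfl fun a _ => ?_
      simp [Fin.sum_univ_two, hz0, isoField]; ring
    have e2 : ∀ a, sqI v a (locJ r v c p) ≤ κ ^ 2 * nrm v P := by
      intro a
      have h1 : sqI v 0 p ≤ nrm v P := by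
        have h2 := sqI_add_le v 0 (P 0 0 0) (P 0 1 1)
        have h3 := sqI_le_nrm v P 0 0 0
        have h4 := sqI_le_nrm v P 0 1 1
        rw [hp, halfTr, sqI_C_mul]
        linarith
      calc _ ≤ κ * sqI v a p := (H v hv p hpd).2.2.2.2 a c
        _ ≤ κ * (κ * sqI v 0 p) := mul_le_mul_of_nonneg_left ((H v hv p hpd).1 a 0) hκ0
        _ ≤ κ * (κ * nrm v P) := by gcongr
        _ = _ := by ring
    rw [e1, Fin.sum_univ_three]
    have := e2 0
    have := e2 1
    have := e2 2
    linarith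
  have hJd : (locJ r v c p).totalDegree ≤ r := totalDegree_locJ_le (by omega) c hpd
  have hDP : nrm v (devF P) ≤ 12 * nrm v P := nrm_devF_le P
  have hP0 := nrm_nonneg v P
  have hD0 := nrm_nonneg v (devF P)
  -- The removed pressure is split directly: its isotropic vertex part has the right normal trace
  -- and no deviator.
  refine ⟨isoField (locJ r v c p) + W, (locSigma r v).add_mem
    (mem_locSigma.2 (memLoc_isoField hJd)) (mem_locSigma.2 hWm), fun n a s => ?_, ?_, ?_⟩
  · have hdd : B.det * B⁻¹.det = 1 := by rw [← Matrix.det_mul, hBA, Matrix.det_one]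
    have hx : affMap z' B⁻¹ (edgePt v n s) = edgePt refV n s := affMap_edgePt hw' n s
    have hx' : affMap z B (edgePt refV n s) = edgePt v n s := affMap_edgePt hw n s
    have hJ : ∀ q, pev (edgePt v n s) (locJ r v c q) =
        pev (edgePt refV n s) (refJ r c (affSubst z B q)) := fun q => by
      rw [← hx']; exact pev_locJ_affMap hv.ne c q _
    have hRt' : ∀ i, pev (edgePt refV n s) (trace refV R n i) =
        B⁻¹.det * ∑ k, B⁻¹ i k * pev (edgePt v n s)
          (locJ r v c (trace v (P - isoField p) n k)) := by
      intro i
      rw [hRt, trace_pio hw hAB, ← smul_eq_C_mul, refJ_smul, pev_smul]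
      simp only [Fin.sum_univ_two, refJ_add, ← smul_eq_C_mul, refJ_smul, pev_smul, map_add, hJ]
    rw [trace_add, trace_isoField, map_add, hW, trace_pio hw' hBA]
    simp only [map_mul, map_sum, pev_C, pev_affSubst, hx, hRt']
    have hlin : locJ r v c (trace v P n a) = locJ r v c (trace v (P - isoField p) n a) +
        C (edgeN v n a) * locJ r v c p := by
      rw [← locJ_C_mul, ← locJ_add, trace_sub, trace_isoField, sub_add_cancel]
    rw [hlin, map_add, map_mul, pev_C]
    have m0 := mul_eq_one_apply hBA a 0
    have m1 := mul_eq_one_apply hBA a 1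
    simp only [Fin.sum_univ_two]
    obtain ⟨f, hf⟩ : ∃ f : Fin 2 → ℝ, ∀ k, pev (edgePt v n s)
      (locJ r v c (trace v (P - isoField p) n k)) = f k := ⟨_, fun _ => rfl⟩
    simp only [hf]
    have hfa : f a = (if a = 0 then 1 else 0) * f 0 + (if a = 1 then 1 else 0) * f 1 := by
      fin_cases a <;> simp
    rw [hfa, ← m0, ← m1]
    linear_combination ((B a 0 * B⁻¹ 0 0 + B a 1 * B⁻¹ 1 0) * f 0 +
      (B a 0 * B⁻¹ 0 1 + B a 1 * B⁻¹ 1 1) * f 1) * hdd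
  · refine (nrm_add_le _ _ _).trans ?_
    have : K₃ * nrm v (devF P) ≤ K₃ * (12 * nrm v P) := by gcongr
    nlinarith
  · rw [devF_add, devF_isoField, zero_add]
    have h1 := nrm_devF_le (v := v) W
    have : 0 ≤ κ ^ 2 * nrm v (devF P) := by positivity
    have : 0 ≤ K₃ * nrm v (devF P) := by positivity
    nlinarith

/-- The decomposition of a composite stress into parts that belong to the vertices. -/
theorem exists_localParts {r : ℕ} (hr : 2 ≤ r) {γ : ℝ} (hγ : 0 < γ) :
    ∃ K : ℝ, 0 ≤ K ∧ ∀ v, IsShapeRegular γ v → ∀ P, MemLoc r v P → ∃ Q : Fin 3 → TriField,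
      (∀ c, MemLoc r v (Q c)) ∧ ∑ c, Q c = P ∧
      (∀ c n a s, pev (edgePt v n s) (trace v (Q c) n a) =
        pev (edgePt v n s) (locJ r v c (trace v P n a))) ∧
      (∀ c, nrm v (Q c) ≤ K * nrm v P) ∧ ∀ c, nrm v (devF (Q c)) ≤ K * nrm v (devF P) := by
  obtain ⟨K₀, hK₀, H₀⟩ := exists_localPart hr hγ 0
  obtain ⟨K₁, hK₁, H₁⟩ := exists_localPart hr hγ 1
  refine ⟨2 + 4 * K₀ + 4 * K₁, by linarith, fun v hv P hP => ?_⟩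
  obtain ⟨Q₀, m₀, t₀, b₀, d₀⟩ := H₀ v hv P hP
  obtain ⟨Q₁, m₁, t₁, b₁, d₁⟩ := H₁ v hv P hP
  -- Used for the identity and for the deviator; only additivity matters.
  have e : ∀ (f : TriField → TriField), (∀ X Y, f (X - Y) = f X - f Y) →
      nrm v (f Q₀) ≤ K₀ * nrm v (f P) → nrm v (f Q₁) ≤ K₁ * nrm v (f P) →
      ∀ c, nrm v (f ((![Q₀, Q₁, P - Q₀ - Q₁] : Fin 3 → TriField) c)) ≤
        (2 + 4 * K₀ + 4 * K₁) * nrm v (f P) := by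
    intro f hf h0 h1 c
    have hn := nrm_nonneg v (f P)
    have n0 := mul_nonneg hK₀ hn
    have n1 := mul_nonneg hK₁ hn
    fin_cases c
    · change nrm v (f Q₀) ≤ _; linarith
    · change nrm v (f Q₁) ≤ _; linarith
    · change nrm v (f (P - Q₀ - Q₁)) ≤ _
      rw [sub_sub, hf]
      have k1 := nrm_sub_le v (f P) (f (Q₀ + Q₁))
      have k2 := nrm_sub_le v (f Q₀) (-(f Q₁))
      have k3 : f (Q₀ + Q₁) = f Q₀ - -(f Q₁) := by
        have := hf (Q₀ + Q₁) Q₁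
        rw [add_sub_cancel_right] at this
        rw [this]; abel
      rw [nrm_neg, ← k3] at k2
      linarith
  -- The last part is defined by difference, so the sum is exactly P; its traces are right because
  -- the three vertex operators add up to the identity.
  refine ⟨![Q₀, Q₁, P - Q₀ - Q₁], fun c => ?_, ?_, fun c n a s => ?_,
    e id (fun _ _ => rfl) b₀ b₁, e devF devF_sub d₀ d₁⟩
  · fin_cases c
    · exact m₀
    · exact m₁
    · exact (locSigma r v).sub_mem ((locSigma r v).sub_mem hP m₀) m₁
  · rw [Fin.sum_univ_three]
    change Q₀ + Q₁ + (P - Q₀ - Q₁) = P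
    abel
  · fin_cases c
    · exact t₀ n a s
    · exact t₁ n a s
    · change pev _ (trace v (P - Q₀ - Q₁) n a) = pev _ (locJ r v 2 _)
      simp only [trace_sub, map_sub, t₀, t₁]
      have := congrArg (pev (edgePt v n s)) (sum_locJ (r := r) hv.ne (trace v P n a))
      rw [Fin.sum_univ_three, map_add, map_add] at this
      linarith

end Elast

/-! ### Green's formula on a triangle. -/

namespace Elast

open MvPolynomial MeasureTheory

section UnitTriangle

/-- The vertices of the unit triangle. -/
noncomputable def unitV : Fin 3 → Plane := ![0, !₂[1, 0], !₂[0, 1]]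

theorem cross3_unitV : cross3 unitV = 1 := by simp [cross3, cross, unitV]

theorem mem_triangle_unitV {x : Plane} :
    x ∈ triangle unitV ↔ 0 ≤ x 0 ∧ 0 ≤ x 1 ∧ x 0 + x 1 ≤ 1 := by
  have h : ∀ a, bc unitV a x = ![1 - x 0 - x 1, x 0, x 1] a := fun a => by
    fin_cases a <;> simp [bc, cross3, cross, unitV, Function.update]; ring
  rw [mem_triangle_iff (by rw [cross3_unitV]; exact one_ne_zero)]
  simp only [h]
  constructor
  · intro h
    have h0 := h 0
    have h1 := h 1
    have h2 := h 2
    simp at h0 h1 h2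
    exact ⟨h1, h2, by linarith⟩
  · rintro ⟨h0, h1, h2⟩ a
    fin_cases a <;> simp <;> linarith

/-- Points of the plane as pairs. -/
noncomputable def planeEquiv : Plane ≃ᵐ ℝ × ℝ :=
  (MeasurableEquiv.toLp 2 (Fin 2 → ℝ)).symm.trans MeasurableEquiv.finTwoArrow

theorem measurePreserving_planeEquiv : MeasurePreserving planeEquiv volume volume :=
  (EuclideanSpace.volume_preserving_symm_measurableEquiv_toLp (Fin 2)).trans
    (volume_preserving_finTwoArrow ℝ)

/-- The unit triangle as a set of pairs. -/
def unitT : Set (ℝ × ℝ) := {p | 0 ≤ p.1 ∧ 0 ≤ p.2 ∧ p.1 + p.2 ≤ 1}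

theorem isCompact_unitT : IsCompact unitT := by
  have hc : IsClosed unitT := by
    refine IsClosed.inter (isClosed_le continuous_const continuous_fst)
      (IsClosed.inter (isClosed_le continuous_const continuous_snd)
        (isClosed_le (continuous_fst.add continuous_snd) continuous_const))
  refine (isCompact_Icc (a := ((0 : ℝ), (0 : ℝ))) (b := (1, 1))).of_isClosed_subset hc ?_
  rintro ⟨x, y⟩ ⟨h1, h2, h3⟩
  simp only at h1 h2 h3
  exact ⟨⟨h1, h2⟩, ⟨by simp; linarith, by simp; linarith⟩⟩

theorem integral_triangle_unitV (g : Plane → ℝ) :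
    ∫ x in triangle unitV, g x = ∫ p in unitT, g !₂[p.1, p.2] := by
  have h := measurePreserving_planeEquiv.setIntegral_preimage_emb
    planeEquiv.measurableEmbedding (fun p => g !₂[p.1, p.2]) unitT
  rw [← h]
  have e : planeEquiv ⁻¹' unitT = triangle unitV := by
    ext x
    rw [mem_triangle_unitV]
    rfl
  rw [e]
  congr 1
  funext x
  congr 1
  ext i
  fin_cases i <;> rfl

theorem integral_section {g : ℝ → ℝ} {S : Set ℝ} {x : ℝ}
    (hS : ∀ y, y ∈ S ↔ 0 ≤ x ∧ 0 ≤ y ∧ x + y ≤ 1) :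
    ∫ y, S.indicator g y = (Set.Icc 0 1).indicator (fun x => ∫ y in (0)..(1 - x), g y) x := by
  by_cases hx : x ∈ Set.Icc (0 : ℝ) 1
  · rw [Set.indicator_of_mem hx, intervalIntegral.integral_of_le (by linarith [hx.2]),
      ← integral_Icc_eq_integral_Ioc, ← integral_indicator measurableSet_Icc]
    have : S = Set.Icc 0 (1 - x) := by
      ext y
      rw [hS]
      exact ⟨fun h => ⟨h.2.1, by linarith [h.2.2]⟩, fun h => ⟨hx.1, h.1, by linarith [h.2]⟩⟩
    rw [this]
  · rw [Set.indicator_of_notMem hx]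
    have : S = ∅ := by
      ext y
      rw [hS]
      simp only [Set.mem_empty_iff_false, iff_false]
      rintro ⟨h1, h2, h3⟩
      exact hx ⟨h1, by linarith⟩
    simp [this]

theorem integral_unitT {g : ℝ × ℝ → ℝ} (hg : Continuous g) :
    ∫ p in unitT, g p = ∫ x in (0 : ℝ)..1, ∫ y in (0)..(1 - x), g (x, y) := by
  have hi : Integrable (unitT.indicator g) (volume.prod volume) :=
    (integrable_indicator_iff isCompact_unitT.isClosed.measurableSet).2
      (hg.continuousOn.integrableOn_compact isCompact_unitT)
  rw [← integral_indicator isCompact_unitT.isClosed.measurableSet, Measure.volume_eq_prod,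
    integral_prod _ hi, intervalIntegral.integral_of_le zero_le_one,
    ← integral_Icc_eq_integral_Ioc, ← integral_indicator measurableSet_Icc]
  congr 1
  funext x
  have h := integral_section (g := fun y => g (x, y)) (S := {y | (x, y) ∈ unitT}) (x := x)
    fun y => Iff.rfl
  rw [show (Set.Icc (0 : ℝ) 1).indicator (fun x => ∫ y in (0)..(1 - x), g (x, y)) x =
    (Set.Icc (0 : ℝ) 1).indicator (fun x' => ∫ y in (0)..(1 - x'), g (x, y)) x by
      simp only [Set.indicator]]
  rw [← h]
  rfl

theorem integral_unitT_symm {g : ℝ × ℝ → ℝ} (hg : Continuous g) :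
    ∫ p in unitT, g p = ∫ y in (0 : ℝ)..1, ∫ x in (0)..(1 - y), g (x, y) := by
  have h0 := integral_unitT (g := fun p => g p.swap) (hg.comp continuous_swap)
  simp only [Prod.swap_prod_mk] at h0
  rw [← h0]
  have h := (Measure.measurePreserving_swap (μ := (volume : Measure ℝ))
    (ν := (volume : Measure ℝ))).setIntegral_preimage_emb
    MeasurableEquiv.prodComm.measurableEmbedding g unitT
  rw [← Measure.volume_eq_prod] at h
  rw [← h]
  congr 2
  ext p
  simp only [unitT, Set.mem_preimage, Set.mem_ofPred_eq, Prod.fst_swap, Prod.snd_swap]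
  constructor <;> rintro ⟨h1, h2, h3⟩ <;> exact ⟨h2, h1, by linarith⟩

end UnitTriangle

/-- The integral over the edge opposite to the vertex `m`, with respect to the parameter. -/
noncomputable def edgeInt (w : Fin 3 → Plane) (m : Fin 3) (f : Plane → ℝ) : ℝ :=
  ∫ s in (0 : ℝ)..1, f (edgePt w m s)

theorem continuous_partialD {f : Plane → ℝ} (hf : ContDiff ℝ 1 f) (b : Fin 2) :
    Continuous (partialD b f) :=
  (hf.continuous_fderiv one_ne_zero).clm_apply continuous_const

theorem hasDerivAt_line {f : Plane → ℝ} (hf : ContDiff ℝ 1 f) (z : Plane) (b : Fin 2) (t : ℝ) :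
    HasDerivAt (fun t : ℝ => f (z + t • EuclideanSpace.single b 1))
      (partialD b f (z + t • EuclideanSpace.single b 1)) t := by
  have h1 : HasDerivAt (fun t : ℝ => z + t • (EuclideanSpace.single b 1 : Plane))
      (EuclideanSpace.single b 1) t := by
    simpa using ((hasDerivAt_id t).smul_const (EuclideanSpace.single b 1 : Plane)).const_add z
  exact (hf.differentiable one_ne_zero _).hasFDerivAt.comp_hasDerivAt t h1

theorem integral_partialD_line {f : Plane → ℝ} (hf : ContDiff ℝ 1 f) (z : Plane) (b : Fin 2)
    (T : ℝ) : ∫ t in (0 : ℝ)..T, partialD b f (z + t • EuclideanSpace.single b 1) =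
      f (z + T • EuclideanSpace.single b 1) - f z := by
  rw [intervalIntegral.integral_eq_sub_of_hasDerivAt (fun t _ => hasDerivAt_line hf z b t)]
  · simp
  · exact ((continuous_partialD hf b).comp (by fun_prop)).intervalIntegrable _ _

/-- Fubini with the inner integration in the direction of the derivative, then the fundamental
theorem of calculus. Reflections of the parameter account for the direction in which the edges are
run through. -/
theorem integral_partialD_unitV {f : Plane → ℝ} (hf : ContDiff ℝ 1 f) :
    ∫ x in triangle unitV, partialD 0 f x = edgeInt unitV 0 f - edgeInt unitV 1 f ∧
    ∫ x in triangle unitV, partialD 1 f x = edgeInt unitV 0 f - edgeInt unitV 2 f := by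
  have hcp : Continuous fun p : ℝ × ℝ => (!₂[p.1, p.2] : Plane) := by fun_prop
  have hfc := hf.continuous
  have hint : ∀ g : ℝ → Plane, Continuous g →
      IntervalIntegrable (fun s => f (g s)) volume 0 1 := fun g hg =>
    (hfc.comp hg).intervalIntegrable _ _
  have e0 : ∀ s : ℝ, edgePt unitV 0 s = !₂[1 - s, s] := fun s => by
    ext i; fin_cases i <;> simp [edgePt, unitV]
  have e1 : ∀ s : ℝ, edgePt unitV 1 s = !₂[0, 1 - s] := fun s => by
    ext i; fin_cases i <;> simp [edgePt, unitV]
  have e2 : ∀ s : ℝ, edgePt unitV 2 s = !₂[s, 0] := fun s => by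
    ext i; fin_cases i <;> simp [edgePt, unitV]
  have hrev : ∀ g : ℝ → ℝ, ∫ s in (0 : ℝ)..1, g (1 - s) = ∫ s in (0 : ℝ)..1, g s := fun g => by
    rw [intervalIntegral.integral_comp_sub_left g 1]; simp
  constructor
  · rw [integral_triangle_unitV,
      integral_unitT_symm (g := fun p => partialD 0 f !₂[p.1, p.2])
        ((continuous_partialD hf 0).comp hcp)]
    have h : ∀ y : ℝ, ∫ x in (0 : ℝ)..(1 - y), partialD 0 f !₂[x, y] =
        f !₂[1 - y, y] - f !₂[0, y] := by
      intro y
      have hl : ∀ t : ℝ, (!₂[0, y] : Plane) + t • EuclideanSpace.single 0 1 = !₂[t, y] := by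
        intro t; ext i; fin_cases i <;> simp
      have := integral_partialD_line hf !₂[0, y] 0 (1 - y)
      simpa only [hl] using this
    simp only [h]
    rw [intervalIntegral.integral_sub (hint _ (by fun_prop)) (hint _ (by fun_prop))]
    simp only [edgeInt, e0, e1]
    rw [hrev fun s => f !₂[0, s]]
  · rw [integral_triangle_unitV,
      integral_unitT (g := fun p => partialD 1 f !₂[p.1, p.2])
        ((continuous_partialD hf 1).comp hcp)]
    have h : ∀ x : ℝ, ∫ y in (0 : ℝ)..(1 - x), partialD 1 f !₂[x, y] =
        f !₂[x, 1 - x] - f !₂[x, 0] := by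
      intro x
      have hl : ∀ t : ℝ, (!₂[x, 0] : Plane) + t • EuclideanSpace.single 1 1 = !₂[x, t] := by
        intro t; ext i; fin_cases i <;> simp
      have := integral_partialD_line hf !₂[x, 0] 1 (1 - x)
      simpa only [hl] using this
    simp only [h]
    rw [intervalIntegral.integral_sub (hint _ (by fun_prop)) (hint _ (by fun_prop))]
    simp only [edgeInt, e0, e2]
    rw [← hrev fun s => f !₂[s, 1 - s]]
    simp only [sub_sub_cancel]

/-- The matrix of the affine map from the unit triangle. -/
noncomputable def unitMat (w : Fin 3 → Plane) : Matrix (Fin 2) (Fin 2) ℝ :=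
  fun i j => w j.succ i - w 0 i

theorem affMap_unitV (w : Fin 3 → Plane) (c : Fin 3) :
    affMap (w 0) (unitMat w) (unitV c) = w c := by
  ext i
  rw [affMap_apply]
  fin_cases c <;> simp [unitMat, unitV]

theorem det_unitMat (w : Fin 3 → Plane) : (unitMat w).det = cross3 w := by
  rw [Matrix.det_fin_two]
  simp [unitMat, cross3, cross]
  ring

theorem partialD_comp_affMap {f : Plane → ℝ} (hf : ContDiff ℝ 1 f) (z : Plane)
    (B : Matrix (Fin 2) (Fin 2) ℝ) (k : Fin 2) (y : Plane) :
    partialD k (fun y => f (affMap z B y)) y =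
      ∑ b, B b k * partialD b f (affMap z B y) := by
  have h := (hf.differentiable one_ne_zero (affMap z B y)).hasFDerivAt.comp y
    (hasFDerivAt_affMap z B y)
  have e : Matrix.toLpLin 2 2 B (EuclideanSpace.single k 1) =
      ∑ b, B b k • (EuclideanSpace.single b 1 : Plane) := by
    ext i
    fin_cases i <;> fin_cases k <;> simp [Matrix.toLpLin_apply]
  rw [partialD, show (fun y => f (affMap z B y)) = f ∘ affMap z B from rfl, h.fderiv]
  simp [partialD, e]

/-- Green's formula on a triangle. -/
theorem integral_partialD_triangle {w : Fin 3 → Plane} (hw : cross3 w ≠ 0) {f : Plane → ℝ}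
    (hf : ContDiff ℝ 1 f) (b : Fin 2) :
    ∫ x in triangle w, partialD b f x =
      SignType.sign (cross3 w) * ∑ m, edgeN w m b * edgeInt w m f := by
  set B := unitMat w with hB
  have hdet : B.det = cross3 w := det_unitMat w
  have hd0 : B.det ≠ 0 := by rwa [hdet]
  have hA := affMap_unitV w
  set F := affMap (w 0) B with hF
  have hFc : ContDiff ℝ 1 F :=
    contDiff_const.add (LinearMap.toContinuousLinearMap (Matrix.toLpLin 2 2 B)).contDiff
  have hfF : ContDiff ℝ 1 (fun y => f (F y)) := hf.comp hFc
  obtain ⟨g0, g1⟩ := integral_partialD_unitV hfF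
  have hE : ∀ m, edgeInt unitV m (fun y => f (F y)) = edgeInt w m f := fun m => by
    simp only [edgeInt, hF, affMap_edgePt hA]
  rw [hE, hE] at g0 g1
  have hi : ∀ c, IntegrableOn (fun y => partialD c f (F y)) (triangle unitV) := fun c =>
    ((continuous_partialD hf c).comp hFc.continuous).continuousOn.integrableOn_compact
      (isCompact_triangle _)
  simp only [hF, partialD_comp_affMap hf, Fin.sum_univ_two] at g0 g1
  rw [integral_add ((hi 0).const_mul _) ((hi 1).const_mul _), integral_const_mul,
    integral_const_mul] at g0 g1
  -- The Jacobian |det B| is the sign times det B, and the entries of the adjugate of B are the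
  -- components of the scaled edge normals.
  rw [← affMap_image_triangle hA, integral_affMap_image hd0
    (isCompact_triangle _).isClosed.measurableSet, hdet, ← sign_mul_self (cross3 w),
    mul_assoc, ← hdet, Matrix.det_fin_two, Fin.sum_univ_three]
  congr 1
  simp only [edgeN, Fin.isValue, zero_add, Fin.reduceAdd]
  have hB' : ∀ i (j : Fin 2), B i j = w j.succ i - w 0 i := fun i j => rfl
  simp only [hB', Fin.isValue, Fin.succ_zero_eq_one, Fin.succ_one_eq_two] at g0 g1 ⊢
  fin_cases b <;> simp
  · linear_combination (w 2 1 - w 0 1) * g0 - (w 1 1 - w 0 1) * g1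
  · linear_combination (-(w 2 0 - w 0 0)) * g0 + (w 1 0 - w 0 0) * g1

end Elast

/-! ### Weak divergence and continuity of normal traces. -/

namespace Elast

open MvPolynomial MeasureTheory

theorem fin3_add (m : Fin 3) : m + 2 + 1 = m ∧ m + 2 + 2 = m + 1 ∧ m + 1 + 1 = m + 2 ∧
    m + 1 + 2 = m ∧ m + 1 ≠ m ∧ m + 2 ≠ m ∧ m + 1 ≠ m + 2 := by
  revert m
  decide

section Segments

/-- The integral over the segment from `p` to `q`, with respect to the parameter. -/
noncomputable def segInt (p q : Plane) (f : Plane → ℝ) : ℝ :=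
  ∫ s in (0 : ℝ)..1, f ((1 - s) • p + s • q)

theorem segInt_swap (p q : Plane) (f : Plane → ℝ) : segInt p q f = segInt q p f := by
  have h := intervalIntegral.integral_comp_sub_left (a := 0) (b := 1)
    (fun s : ℝ => f ((1 - s) • q + s • p)) 1
  simp only [sub_zero, sub_self, sub_sub_cancel] at h
  rw [segInt, segInt, ← h]
  congr 1
  funext s
  rw [add_comm]

theorem segInt_congr {p q p' q' : Plane} (h : s(p, q) = s(p', q')) (f : Plane → ℝ) :
    segInt p q f = segInt p' q' f := by
  rcases Sym2.eq_iff.1 h with ⟨rfl, rfl⟩ | ⟨rfl, rfl⟩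
  · rfl
  · exact segInt_swap _ _ _

theorem intervalIntegrable_seg (p q : Plane) {f : Plane → ℝ} (hf : Continuous f) :
    IntervalIntegrable (fun s : ℝ => f ((1 - s) • p + s • q)) volume 0 1 :=
  (hf.comp (by fun_prop)).intervalIntegrable _ _

theorem segInt_add {p q : Plane} {f g : Plane → ℝ} (hf : Continuous f) (hg : Continuous g) :
    segInt p q (fun x => f x + g x) = segInt p q f + segInt p q g :=
  intervalIntegral.integral_add (intervalIntegrable_seg p q hf) (intervalIntegrable_seg p q hg)

theorem segInt_sum {ι : Type*} (E : Finset ι) (p q : Plane) {f : ι → Plane → ℝ}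
    (hf : ∀ i ∈ E, Continuous (f i)) :
    ∑ i ∈ E, segInt p q (f i) = segInt p q fun x => ∑ i ∈ E, f i x :=
  (intervalIntegral.integral_finsetSum fun i hi => intervalIntegrable_seg p q (hf i hi)).symm

theorem segInt_eq_zero {p q : Plane} {f : Plane → ℝ}
    (h : ∀ s ∈ Set.Ioo (0 : ℝ) 1, f ((1 - s) • p + s • q) = 0) : segInt p q f = 0 := by
  rw [segInt, intervalIntegral.integral_of_le zero_le_one, integral_Ioc_eq_integral_Ioo]
  exact setIntegral_eq_zero_of_forall_eq_zero h

theorem mem_segment_iff_param {p q x : Plane} :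
    x ∈ segment ℝ p q ↔ ∃ s ∈ Set.Icc (0 : ℝ) 1, (1 - s) • p + s • q = x := by
  rw [segment_eq_image]; rfl

/-- Localization: if the integrals of densities on finitely many segments against all test
functions add up to zero, then so do the densities at every inner point of a segment that meets
no segment with other end points. -/
theorem sum_density_eq_zero {ι : Type*} [Fintype ι] {p q : ι → Plane} {f : ι → Plane → ℝ}
    (hf : ∀ i, Continuous (f i))
    (h : ∀ η : Plane → ℝ, ContDiff ℝ ∞ η → HasCompactSupport η →
      ∑ i, segInt (p i) (q i) (fun x => f i x * η x) = 0)
    {p₀ q₀ : Plane} {s₀ : ℝ} (hs₀ : s₀ ∈ Set.Ioo (0 : ℝ) 1) {E : Finset ι}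
    (hE : ∀ i ∈ E, s(p i, q i) = s(p₀, q₀))
    (hE' : ∀ i ∉ E, (1 - s₀) • p₀ + s₀ • q₀ ∉ segment ℝ (p i) (q i)) :
    ∑ i ∈ E, f i ((1 - s₀) • p₀ + s₀ • q₀) = 0 := by
  classical
  set x₀ := (1 - s₀) • p₀ + s₀ • q₀ with hx₀
  set F : Plane → ℝ := fun x => ∑ i ∈ E, f i x with hF
  have hFc : Continuous F := continuous_finsetSum _ fun i _ => hf i
  by_contra hne
  -- A neighbourhood of x₀ where the density keeps its sign and which avoids all segments outside E;
  -- a nonnegative bump supported in it isolates the contribution of E.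
  set U : Set Plane := {x | 0 < F x * F x₀} ∩ ⋂ i ∈ Eᶜ, (segment ℝ (p i) (q i))ᶜ with hU
  have hUo : IsOpen U := by
    refine (isOpen_lt continuous_const (hFc.mul continuous_const)).inter
      (isOpen_biInter_finset fun i _ => ?_)
    rw [segment_eq_image]
    exact ((isCompact_Icc.image (by fun_prop)).isClosed).isOpen_compl
  have hx : x₀ ∈ U := ⟨mul_self_pos.2 hne, by simpa using hE'⟩
  obtain ⟨η, hη1, hη2, hη3, hη4, hη5⟩ :=
    exists_contDiff_tsupport_subset (n := ⊤) (hUo.mem_nhds hx)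
  have hz : ∀ x ∉ U, η x = 0 := fun x hx => by
    by_contra h0
    exact hx (hη1 (subset_tsupport _ h0))
  have h1 := h η hη3 hη2
  rw [← Finset.sum_add_sum_compl E] at h1
  have h2 : ∑ i ∈ Eᶜ, segInt (p i) (q i) (fun x => f i x * η x) = 0 := by
    refine Finset.sum_eq_zero fun i hi => segInt_eq_zero fun s hs => ?_
    rw [hz, mul_zero]
    intro hmem
    have := Set.mem_iInter₂.1 hmem.2 i hi
    exact this (mem_segment_iff_param.2 ⟨s, Set.Ioo_subset_Icc_self hs, rfl⟩)
  have h3 : ∑ i ∈ E, segInt (p i) (q i) (fun x => f i x * η x) =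
      segInt p₀ q₀ fun x => F x * η x := by
    rw [Finset.sum_congr rfl fun i hi => segInt_congr (hE i hi) (fun x => f i x * η x),
      segInt_sum (f := fun i x => f i x * η x) _ _ _ fun i _ => (hf i).mul hη3.continuous]
    simp only [hF, Finset.sum_mul]
  rw [h2, h3, add_zero] at h1
  have h4 : 0 < ∫ s in (0 : ℝ)..1, F x₀ * (F ((1 - s) • p₀ + s • q₀) *
      η ((1 - s) • p₀ + s • q₀)) := by
    refine intervalIntegral.integral_pos one_pos ?_ ?_ ?_
    · have hηc := hη3.continuous
      exact Continuous.continuousOn (by fun_prop)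
    · intro s _
      by_cases hm : (1 - s) • p₀ + s • q₀ ∈ U
      · have h5 : 0 < F ((1 - s) • p₀ + s • q₀) * F x₀ := hm.1
        have h6 := (hη4 (Set.mem_range_self ((1 - s) • p₀ + s • q₀))).1
        calc 0 ≤ (F ((1 - s) • p₀ + s • q₀) * F x₀) * η ((1 - s) • p₀ + s • q₀) :=
              mul_nonneg h5.le h6
          _ = _ := by ring
      · rw [hz _ hm]; simp
    · refine ⟨s₀, Set.Ioo_subset_Icc_self hs₀, ?_⟩
      rw [← hx₀, hη5, mul_one]
      exact mul_self_pos.2 hne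
  rw [intervalIntegral.integral_const_mul] at h4
  rw [segInt] at h1
  rw [h1, mul_zero] at h4
  exact lt_irrefl _ h4

end Segments

section SubEdges

variable {v : Fin 3 → Plane}

/-- For n ≠ c this edge of the part c joins the barycenter to the third vertex, so the coordinates n
and c agree along it and the third stays positive. -/
theorem bc_spoke (hv : cross3 v ≠ 0) {c n : Fin 3} (hn : n ≠ c) {x : Plane}
    (hx : x ∈ segment ℝ (subV v c (n + 1)) (subV v c (n + 2))) :
    bc v n x = bc v c x ∧ ∀ m, m ≠ n → m ≠ c → 0 < bc v m x := by
  obtain ⟨s, hs, rfl⟩ := mem_segment_iff_param.1 hx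
  have hs0 := hs.1
  have hs1 := hs.2
  simp only [bc_comb]
  have hc : ∀ a b, bc v a (subV v c b) = if b = c then 1 / 3 else if a = b then 1 else 0 := by
    intro a b
    by_cases hb : b = c
    · subst hb; simp [subV, bc_centroid hv]
    · simp [subV, hb, bc_vertex hv]
  simp only [hc]
  constructor
  · fin_cases n <;> fin_cases c <;> simp at hn ⊢
  · intro m h1 h2
    fin_cases n <;> fin_cases c <;> simp at hn <;> fin_cases m <;> simp at h1 h2 ⊢ <;> linarith

theorem bc_outer (hv : cross3 v ≠ 0) (c : Fin 3) {x : Plane}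
    (hx : x ∈ segment ℝ (v (c + 1)) (v (c + 2))) : bc v c x = 0 := by
  obtain ⟨s, hs, rfl⟩ := mem_segment_iff_param.1 hx
  rw [bc_comb, bc_vertex hv, bc_vertex hv]
  fin_cases c <;> simp

theorem subV_outer (v : Fin 3 → Plane) (c : Fin 3) :
    subV v c (c + 1) = v (c + 1) ∧ subV v c (c + 2) = v (c + 2) := by
  fin_cases c <;> simp [subV]

theorem edgeN_subV_outer (v : Fin 3 → Plane) (c : Fin 3) : edgeN (subV v c) c = edgeN v c := by
  rw [edgeN, edgeN, (subV_outer v c).1, (subV_outer v c).2]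

theorem segment_subV_subset (v : Fin 3 → Plane) (c n : Fin 3) :
    segment ℝ (subV v c (n + 1)) (subV v c (n + 2)) ⊆ triangle (subV v c) :=
  (convex_triangle _).segment_subset (vertex_mem_triangle _ _) (vertex_mem_triangle _ _)

theorem subV_subset (hv : cross3 v ≠ 0) (c : Fin 3) : triangle (subV v c) ⊆ triangle v := by
  rw [triangle_eq_iUnion_subV hv]
  exact Set.subset_iUnion (fun c => triangle (subV v c)) c

/-- An inner point of an outer edge lies on no other edge of the parts of the triangle. -/
theorem eq_of_mem_segment_of_bc (hv : cross3 v ≠ 0) {e c n : Fin 3} {x : Plane}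
    (h0 : bc v e x = 0) (hpos : ∀ a, a ≠ e → 0 < bc v a x)
    (hx : x ∈ segment ℝ (subV v c (n + 1)) (subV v c (n + 2))) : c = e ∧ n = e := by
  by_cases hn : n = c
  · subst hn
    rw [(subV_outer v n).1, (subV_outer v n).2] at hx
    have h1 := bc_outer hv n hx
    by_contra hne
    have := hpos n (fun h => hne ⟨h, h⟩)
    linarith
  · exfalso
    obtain ⟨h1, h2⟩ := bc_spoke hv hn hx
    by_cases hne : n = e
    · have := hpos c (fun h => hn (hne.trans h.symm))
      rw [hne] at h1
      linarith
    · by_cases hce : c = e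
      · have := hpos n hne
        rw [hce] at h1
        linarith
      · have := h2 e (Ne.symm hne) (Ne.symm hce)
        linarith

/-- An inner point of a spoke lies on this spoke only. -/
theorem eq_of_mem_segment_spoke (hv : cross3 v ≠ 0) {m c n : Fin 3} {s : ℝ}
    (hs : s ∈ Set.Ioo (0 : ℝ) 1)
    (hx : (1 - s) • v m + s • centroid v ∈ segment ℝ (subV v c (n + 1)) (subV v c (n + 2))) :
    (c = m + 1 ∧ n = m + 2) ∨ (c = m + 2 ∧ n = m + 1) := by
  have hb : ∀ a, bc v a ((1 - s) • v m + s • centroid v) =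
      (1 - s) * (if a = m then 1 else 0) + s * (1 / 3) := fun a => by
    rw [bc_comb, bc_vertex hv, bc_centroid hv]
  have hs0 := hs.1
  have hs1 := hs.2
  by_cases hn : n = c
  · subst hn
    rw [(subV_outer v n).1, (subV_outer v n).2] at hx
    have h1 := bc_outer hv n hx
    rw [hb] at h1
    split_ifs at h1 <;> linarith
  · have h1 := (bc_spoke hv hn hx).1
    rw [hb, hb] at h1
    have h2 : n ≠ m := fun h => by
      rw [if_pos h, if_neg (fun h' => hn (h.trans h'.symm))] at h1; linarith
    have h3 : c ≠ m := fun h => by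
      rw [if_pos h, if_neg h2] at h1; linarith
    revert h2 h3 hn
    clear * -
    revert c n m
    decide

theorem mem_interior_of_spoke (hv : cross3 v ≠ 0) (m : Fin 3) {s : ℝ}
    (hs : s ∈ Set.Ioo (0 : ℝ) 1) :
    (1 - s) • v m + s • centroid v ∈ interior (triangle v) := by
  rw [mem_interior_triangle_iff hv]
  intro a
  have hs0 := hs.1
  have hs1 := hs.2
  rw [bc_comb, bc_vertex hv, bc_centroid hv]
  split_ifs <;> linarith

theorem bc_edgePt (hv : cross3 v ≠ 0) (e a : Fin 3) (s : ℝ) :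
    bc v a (edgePt v e s) = edgeW e s a := by
  rw [edgePt, bc_comb, bc_vertex hv, bc_vertex hv]
  fin_cases e <;> fin_cases a <;> simp [edgeW]

theorem edgeW_pos {e a : Fin 3} (ha : a ≠ e) {s : ℝ} (hs : s ∈ Set.Ioo (0 : ℝ) 1) :
    0 < edgeW e s a := by
  have hs0 := hs.1
  have hs1 := hs.2
  fin_cases e <;> fin_cases a <;> simp [edgeW] at ha ⊢ <;> linarith

theorem mem_segment_edgePt (v : Fin 3 → Plane) (e : Fin 3) {s : ℝ} (hs : s ∈ Set.Ioo (0 : ℝ) 1) :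
    edgePt v e s ∈ segment ℝ (v (e + 1)) (v (e + 2)) :=
  mem_segment_iff_param.2 ⟨s, Set.Ioo_subset_Icc_self hs, rfl⟩

end SubEdges

/-- A convex set with inner points lies in the closure of its interior, and an open set disjoint
from a set is disjoint from its closure. -/
theorem disjoint_interior_of_convex {A B : Set Plane} (hB : Convex ℝ B)
    (hne : (interior B).Nonempty) (h : Disjoint (interior A) (interior B)) :
    Disjoint (interior A) B :=
  (h.closure_right isOpen_interior).mono_right
    ((hB.closure_interior_eq_closure_of_nonempty_interior hne).symm ▸ subset_closure)

namespace TwoScaleMesh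

variable (M : TwoScaleMesh)

/-- The end points of the edge opposite to the vertex `i.2` of the fine triangle `i.1`. -/
def edgeKey (i : Fin M.Nh × Fin 3) : Sym2 Plane :=
  s(M.tri i.1 (i.2 + 1), M.tri i.1 (i.2 + 2))

/-- The sign of the orientation of a fine triangle. -/
noncomputable def orient (t : Fin M.Nh) : ℝ := SignType.sign (cross3 (M.tri t))

/-- The normal traces from both sides of every edge of the fine mesh cancel, and vanish on the
boundary. -/
def EdgeCond (P : Fin M.Nh → TriField) : Prop :=
  ∀ t e a, ∀ s ∈ Set.Ioo (0 : ℝ) 1, ∑ i with M.edgeKey i = M.edgeKey (t, e),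
    M.orient i.1 * pev (edgePt (M.tri t) e s) (trace (M.tri i.1) (P i.1) i.2 a) = 0

/-- The weak form of the equation that defines the divergence of a piecewise polynomial field. -/
def WeakDiv (P : Fin M.Nh → TriField) : Prop :=
  ∀ a, ∀ η : Plane → ℝ, ContDiff ℝ ∞ η → HasCompactSupport η →
    ∑ t, ∑ c, ∑ b, ∫ x in triangle (subV (M.tri t) c),
      partialD b (fun x => pev x (P t c a b) * η x) x = 0

variable {M} {γ : ℝ} (hM : M.IsRegular γ)
include hM

theorem IsRegular.cross3_ne (t : Fin M.Nh) : cross3 (M.tri t) ≠ 0 := hM.fine_nondegenerate t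

theorem IsRegular.disjoint_interior {t u : Fin M.Nh} (h : t ≠ u) :
    Disjoint (interior (triangle (M.tri t))) (triangle (M.tri u)) :=
  disjoint_interior_of_convex (convex_triangle _)
    (interior_triangle_nonempty (hM.cross3_ne u)) (hM.fine_disjoint t u h)

/-- By conformity x lies in the hull of the common vertices, and on this hull the coordinate of any
other vertex vanishes. -/
theorem IsRegular.mem_range_of_bc_ne {t u : Fin M.Nh} {x : Plane} (ht : x ∈ triangle (M.tri t))
    (hu : x ∈ triangle (M.tri u)) {a : Fin 3} (ha : bc (M.tri t) a x ≠ 0) :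
    M.tri t a ∈ Set.range (M.tri u) := by
  by_cases htu : t = u
  · subst htu; exact Set.mem_range_self a
  by_contra hn
  have h1 : x ∈ M.T t ∩ M.T u := ⟨ht, hu⟩
  rw [hM.fine_conforming t u htu] at h1
  refine ha (convexHull_min ?_ (convex_bc_eq_zero (M.tri t) a) h1)
  rintro _ ⟨⟨b, rfl⟩, hb⟩
  have : a ≠ b := fun h => hn (h ▸ hb)
  simp [bc_vertex (hM.cross3_ne t), this]

/-- An inner point of an edge of the fine mesh lies on no other edge. -/
theorem IsRegular.edgeKey_eq {t u : Fin M.Nh} {e c n : Fin 3} {s : ℝ}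
    (hs : s ∈ Set.Ioo (0 : ℝ) 1)
    (hx : edgePt (M.tri t) e s ∈ segment ℝ (subV (M.tri u) c (n + 1)) (subV (M.tri u) c (n + 2))) :
    n = c ∧ M.edgeKey (u, c) = M.edgeKey (t, e) := by
  have hu := hM.cross3_ne u
  have ht := hM.cross3_ne t
  have hmu : edgePt (M.tri t) e s ∈ triangle (M.tri u) :=
    subV_subset hu c (segment_subV_subset _ _ _ hx)
  have hmt : edgePt (M.tri t) e s ∈ triangle (M.tri t) :=
    (convex_triangle _).segment_subset (vertex_mem_triangle _ _) (vertex_mem_triangle _ _)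
      (mem_segment_edgePt _ _ hs)
  -- An inner point of the edge has positive coordinates at both end points, so these are vertices
  -- of the other triangle as well.
  have hr : ∀ a, a ≠ e → M.tri t a ∈ Set.range (M.tri u) := fun a ha =>
    hM.mem_range_of_bc_ne hmt hmu (by rw [bc_edgePt ht]; exact (edgeW_pos ha hs).ne')
  obtain ⟨α, hα⟩ := hr (e + 1) (fin3_add e).2.2.2.2.1
  obtain ⟨β, hβ⟩ := hr (e + 2) (fin3_add e).2.2.2.2.2.1
  have hαβ : α ≠ β := by
    intro h
    rw [h, hβ] at hα
    have h1 := bc_vertex ht (e + 2) (e + 1)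
    rw [← hα, bc_vertex ht, if_pos rfl, if_neg (fin3_add e).2.2.2.2.2.2.symm] at h1
    exact one_ne_zero h1
  have hb : ∀ a, bc (M.tri u) a (edgePt (M.tri t) e s) =
      (1 - s) * (if a = α then 1 else 0) + s * (if a = β then 1 else 0) := by
    intro a
    rw [edgePt, ← hα, ← hβ, bc_comb, bc_vertex hu, bc_vertex hu]
  -- The remaining vertex of the triangle u; the point lies inside the edge opposite to it.
  obtain ⟨δ, hδα, hδβ⟩ : ∃ δ, δ ≠ α ∧ δ ≠ β := by
    clear * -
    revert α β
    decide
  have hpos : ∀ a, a ≠ δ → 0 < bc (M.tri u) a (edgePt (M.tri t) e s) := by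
    intro a ha
    have hs0 := hs.1
    have hs1 := hs.2
    have : a = α ∨ a = β := by
      revert hδα hδβ hαβ ha
      clear * -
      revert α β δ a
      decide
    rw [hb]
    rcases this with rfl | rfl
    · rw [if_pos rfl, if_neg hαβ]; linarith
    · rw [if_pos rfl, if_neg hαβ.symm]; linarith
  obtain ⟨h1, h2⟩ := eq_of_mem_segment_of_bc hu
    (by rw [hb, if_neg hδα, if_neg hδβ]; simp) hpos hx
  refine ⟨h2.trans h1.symm, ?_⟩
  subst h1
  have h3 : (α = c + 1 ∧ β = c + 2) ∨ (α = c + 2 ∧ β = c + 1) := by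
    revert hδα hδβ hαβ
    clear * -
    revert α β c
    decide
  simp only [edgeKey]
  rcases h3 with ⟨rfl, rfl⟩ | ⟨rfl, rfl⟩
  · rw [hα, hβ]
  · rw [hα, hβ, Sym2.eq_swap]

/-- Green's formula on every part. The parts inherit the orientation sign of their triangle, because
their signed area is one third of the whole. -/
theorem IsRegular.sum_integral_partialD (P : Fin M.Nh → TriField) (a : Fin 2) {η : Plane → ℝ}
    (hη : ContDiff ℝ ∞ η) :
    ∑ t, ∑ c, ∑ b, ∫ x in triangle (subV (M.tri t) c),
      partialD b (fun x => pev x (P t c a b) * η x) x =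
    ∑ i : Fin M.Nh × Fin 3 × Fin 3,
      segInt (subV (M.tri i.1) i.2.1 (i.2.2 + 1)) (subV (M.tri i.1) i.2.1 (i.2.2 + 2))
        (fun x => M.orient i.1 * pev x (trace (subV (M.tri i.1) i.2.1) (fun _ => P i.1 i.2.1)
          i.2.2 a) * η x) := by
  rw [Fintype.sum_prod_type]
  refine Finset.sum_congr rfl fun t _ => ?_
  rw [Fintype.sum_prod_type]
  refine Finset.sum_congr rfl fun c _ => ?_
  have hsg : (SignType.sign (cross3 (subV (M.tri t) c)) : ℝ) = M.orient t := by
    rw [cross3_subV, orient]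
    have : (3 : ℝ)⁻¹ > 0 := by norm_num
    rw [div_eq_mul_inv, sign_mul, sign_pos this, mul_one]
  have hc : ∀ b, ContDiff ℝ 1 (fun x => pev x (P t c a b) * η x) := fun b =>
    ((contDiff_pev _).mul hη).of_le (by exact_mod_cast le_top)
  simp only [integral_partialD_triangle (cross3_subV_ne (hM.cross3_ne t) c) (hc _), hsg]
  rw [← Finset.mul_sum, Finset.sum_comm, Finset.mul_sum]
  refine Finset.sum_congr rfl fun n _ => ?_
  have hi : ∀ b, IntervalIntegrable (fun s : ℝ =>
      pev (edgePt (subV (M.tri t) c) n s) (P t c a b) * η (edgePt (subV (M.tri t) c) n s))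
      volume 0 1 := fun b => intervalIntegrable_seg _ _ (hc b).continuous
  simp only [edgeInt, segInt, Fin.sum_univ_two]
  rw [← intervalIntegral.integral_const_mul, ← intervalIntegral.integral_const_mul,
    ← intervalIntegral.integral_add ((hi 0).const_mul _) ((hi 1).const_mul _),
    ← intervalIntegral.integral_const_mul]
  congr 1
  funext s
  simp only [trace, Fin.sum_univ_two, map_add, map_mul, pev_C, edgePt]
  ring

theorem IsRegular.orient_ne (t : Fin M.Nh) : M.orient t ≠ 0 := by
  rw [orient]
  rcases (hM.cross3_ne t).lt_or_gt with h | h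
  · rw [sign_neg h]; simp
  · rw [sign_pos h]; simp

/-- An inner point of a spoke lies on no other edge, and the spoke belongs to exactly two parts.
Localization gives the condition on the open spoke, continuity on the closed one. -/
theorem IsRegular.inner_of_weakDiv {P : Fin M.Nh → TriField} (h : M.WeakDiv P) (t : Fin M.Nh)
    (m : Fin 3) (a : Fin 2) {s : ℝ} (hs : s ∈ Set.Icc (0 : ℝ) 1) :
    ∑ b, pev (centroid (M.tri t) + s • (M.tri t m - centroid (M.tri t)))
      (P t (m + 1) a b - P t (m + 2) a b) * rotv (M.tri t m - centroid (M.tri t)) b = 0 := by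
  classical
  set v := M.tri t with hv
  have ht := hM.cross3_ne t
  have hmem : ∀ (c : Fin 3), subV v c c = centroid v := fun c => by simp [subV]
  have hsub : ∀ (c : Fin 3), c ≠ m → subV v c m = v m := fun c hc => by
    simp [subV, hc.symm]
  obtain ⟨e1, e2, e3, e4, e5, e6, e7⟩ := fin3_add m
  have key : ∀ s ∈ Set.Ioo (0 : ℝ) 1, ∑ b, pev ((1 - s) • v m + s • centroid v)
      (P t (m + 1) a b - P t (m + 2) a b) * rotv (v m - centroid v) b = 0 := by
    intro s hs
    have h1 := sum_density_eq_zero (ι := Fin M.Nh × Fin 3 × Fin 3)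
      (p := fun i => subV (M.tri i.1) i.2.1 (i.2.2 + 1))
      (q := fun i => subV (M.tri i.1) i.2.1 (i.2.2 + 2))
      (f := fun i x => M.orient i.1 * pev x (trace (subV (M.tri i.1) i.2.1)
        (fun _ => P i.1 i.2.1) i.2.2 a))
      (p₀ := v m) (q₀ := centroid v) (E := {(t, m + 1, m + 2), (t, m + 2, m + 1)})
      (fun i => continuous_const.mul (continuous_pev _))
      (fun η h1 h2 => by rw [← hM.sum_integral_partialD P a h1]; exact h a η h1 h2) hs ?_ ?_
    · rw [Finset.sum_pair (fun h => e7 (Prod.mk.inj (Prod.mk.inj h).2).1)] at h1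
      simp only [trace, edgeN, ← hv, e1, e2, e3, e4, hmem, hsub _ e5, hsub _ e6,
        Fin.sum_univ_two, map_add, map_mul, pev_C] at h1
      have h2 := hM.orient_ne t
      refine (mul_eq_zero_iff_left h2).1 ?_
      simp only [Fin.sum_univ_two, map_sub, rotv_zero, rotv_one, PiLp.sub_apply] at h1 ⊢
      linear_combination -h1
    · intro i hi
      simp only [Finset.mem_insert, Finset.mem_singleton] at hi
      rcases hi with rfl | rfl
      · simp only [← hv, e1, e2, hmem, hsub _ e5]
      · simp only [← hv, e3, e4, hmem, hsub _ e6, Sym2.eq_swap]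
    · rintro ⟨u, c, n⟩ hi hx
      by_cases hut : u = t
      · subst hut
        rcases eq_of_mem_segment_spoke ht hs hx with ⟨rfl, rfl⟩ | ⟨rfl, rfl⟩ <;> simp at hi
      · exact Set.disjoint_left.1 (hM.disjoint_interior (Ne.symm hut))
          (mem_interior_of_spoke ht m hs)
          (subV_subset (hM.cross3_ne u) c (segment_subV_subset _ _ _ hx))
  have hcont : Continuous fun s : ℝ => ∑ b, pev ((1 - s) • v m + s • centroid v)
      (P t (m + 1) a b - P t (m + 2) a b) * rotv (v m - centroid v) b :=
    continuous_finsetSum _ fun b _ =>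
      ((continuous_pev _).comp (by fun_prop)).mul continuous_const
  have hall : Set.EqOn (fun s : ℝ => ∑ b, pev ((1 - s) • v m + s • centroid v)
      (P t (m + 1) a b - P t (m + 2) a b) * rotv (v m - centroid v) b) 0 (Set.Icc 0 1) := by
    rw [← closure_Ioo zero_ne_one]
    exact Set.EqOn.closure key hcont continuous_const
  have := hall (x := 1 - s) ⟨by linarith [hs.2], by linarith [hs.1]⟩
  simp only [sub_sub_cancel, Pi.zero_apply] at this
  rw [← this]
  have e : centroid v + s • (v m - centroid v) = s • v m + (1 - s) • centroid v := by module
  rw [e]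

/-- Localization at inner points of an edge of the fine mesh. On ∂Ω only one triangle contributes
and the same identity says τn = 0, because the test functions need not vanish there. -/
theorem IsRegular.edgeCond_of_weakDiv {P : Fin M.Nh → TriField} (h : M.WeakDiv P) :
    M.EdgeCond P := by
  classical
  intro t e a s hs
  have h1 := sum_density_eq_zero (ι := Fin M.Nh × Fin 3 × Fin 3)
    (p := fun i => subV (M.tri i.1) i.2.1 (i.2.2 + 1))
    (q := fun i => subV (M.tri i.1) i.2.1 (i.2.2 + 2))
    (f := fun i x => M.orient i.1 * pev x (trace (subV (M.tri i.1) i.2.1)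
      (fun _ => P i.1 i.2.1) i.2.2 a))
    (p₀ := M.tri t (e + 1)) (q₀ := M.tri t (e + 2))
    (E := (Finset.univ.filter fun i => M.edgeKey i = M.edgeKey (t, e)).image
      fun i => (i.1, i.2, i.2))
    (fun i => continuous_const.mul (continuous_pev _))
    (fun η h1 h2 => by rw [← hM.sum_integral_partialD P a h1]; exact h a η h1 h2) hs ?_ ?_
  · rw [Finset.sum_image (by
      rintro ⟨u, c⟩ _ ⟨u', c'⟩ _ h
      simpa using h)] at h1
    refine Eq.trans (Finset.sum_congr rfl fun i _ => ?_) h1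
    simp only [trace, edgeN_subV_outer]
    rfl
  · intro i hi
    simp only [Finset.mem_image, Finset.mem_filter, Finset.mem_univ, true_and] at hi
    obtain ⟨⟨u, c⟩, h1, rfl⟩ := hi
    simp only [(subV_outer _ c).1, (subV_outer _ c).2]
    exact h1
  · rintro ⟨u, c, n⟩ hi hx
    obtain ⟨h1, h2⟩ := hM.edgeKey_eq hs hx
    change n = c at h1
    subst h1
    exact hi (Finset.mem_image.2 ⟨(u, n), by simpa using h2, rfl⟩)

/-- Each spoke occurs twice, with opposite directions, and cancels by normal continuity. The outer
edges are grouped by their unordered end points, and each group vanishes by the edge condition. -/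
theorem IsRegular.weakDiv_of_edgeCond {P : Fin M.Nh → TriField}
    (hin : ∀ t m a, ∀ s ∈ Set.Icc (0 : ℝ) 1,
      ∑ b, pev (centroid (M.tri t) + s • (M.tri t m - centroid (M.tri t)))
        (P t (m + 1) a b - P t (m + 2) a b) * rotv (M.tri t m - centroid (M.tri t)) b = 0)
    (hP : M.EdgeCond P) : M.WeakDiv P := by
  classical
  intro a η hη _
  rw [hM.sum_integral_partialD P a hη]
  set I : Fin M.Nh × Fin 3 × Fin 3 → ℝ := fun i =>
    segInt (subV (M.tri i.1) i.2.1 (i.2.2 + 1)) (subV (M.tri i.1) i.2.1 (i.2.2 + 2))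
      (fun x => M.orient i.1 * pev x (trace (subV (M.tri i.1) i.2.1) (fun _ => P i.1 i.2.1)
        i.2.2 a) * η x) with hI
  have hc : ∀ (k : ℝ) (p : Poly2), Continuous fun x => k * pev x p * η x := fun k p =>
    (continuous_const.mul (continuous_pev p)).mul hη.continuous
  have hinner : ∀ t m, I (t, m + 1, m + 2) + I (t, m + 2, m + 1) = 0 := by
    intro t m
    set v := M.tri t with hv
    have hmem : ∀ (c : Fin 3), subV v c c = centroid v := fun c => by simp [subV]
    have hsub : ∀ (c : Fin 3), c ≠ m → subV v c m = v m := fun c hc => by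
      simp [subV, hc.symm]
    obtain ⟨e1, e2, e3, e4, e5, e6, e7⟩ := fin3_add m
    simp only [hI, ← hv, e1, e2, e3, e4, hmem, hsub _ e5, hsub _ e6]
    rw [segInt_swap (centroid v), ← segInt_add (hc _ _) (hc _ _)]
    refine segInt_eq_zero fun s hs => ?_
    have h1 := hin t m a (1 - s) ⟨by linarith [hs.2], by linarith [hs.1]⟩
    have e : centroid v + (1 - s) • (v m - centroid v) = (1 - s) • v m + s • centroid v := by
      module
    rw [← hv, e] at h1
    simp only [trace, edgeN, e1, e2, e3, e4, hmem, hsub _ e5, hsub _ e6, Fin.sum_univ_two,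
      map_add, map_mul, pev_C, map_sub, rotv_zero, rotv_one, PiLp.sub_apply] at h1 ⊢
    linear_combination -(M.orient t * η ((1 - s) • v m + s • centroid v)) * h1
  have houter : ∑ i : Fin M.Nh × Fin 3, I (i.1, i.2, i.2) = 0 := by
    have h1 := Finset.sum_image' (s := (Finset.univ : Finset (Fin M.Nh × Fin 3)))
      (g := M.edgeKey) (f := fun _ => (0 : ℝ)) (fun i => I (i.1, i.2, i.2)) ?_
    · rw [← h1, Finset.sum_const_zero]
    rintro ⟨t, e⟩ _
    have h2 : ∀ i ∈ Finset.univ.filter (fun i => M.edgeKey i = M.edgeKey (t, e)),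
        I (i.1, i.2, i.2) = segInt (M.tri t (e + 1)) (M.tri t (e + 2)) (fun x =>
          M.orient i.1 * pev x (trace (M.tri i.1) (P i.1) i.2 a) * η x) := by
      rintro ⟨u, c⟩ hi
      rw [Finset.mem_filter] at hi
      rw [← segInt_congr hi.2]
      simp only [hI, trace, edgeN_subV_outer, (subV_outer _ c).1, (subV_outer _ c).2]
    rw [Finset.sum_congr rfl h2,
      segInt_sum _ _ _ fun i _ => hc _ _]
    refine (segInt_eq_zero fun s hs => ?_).symm
    rw [← Finset.sum_mul]
    have := hP t e a s hs
    rw [edgePt] at this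
    rw [this, zero_mul]
  calc ∑ i, I i = ∑ t, ((∑ c, I (t, c, c)) +
        ∑ m, (I (t, m + 1, m + 2) + I (t, m + 2, m + 1))) := by
        rw [Fintype.sum_prod_type]
        refine Finset.sum_congr rfl fun t _ => ?_
        rw [Fintype.sum_prod_type]
        simp only [Fin.sum_univ_three, Fin.isValue, Fin.reduceAdd, zero_add]
        ring
    _ = 0 := by
        simp only [hinner, Finset.sum_const_zero, add_zero]
        rw [← houter, Fintype.sum_prod_type]

end TwoScaleMesh

end Elast

/-! ### Cutoff functions on the coarse quadrilateral mesh. -/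

namespace Elast

section Quad

/-- The continuous function with given values at the vertices of a convex quadrilateral that is
affine on both sides of the diagonal from the vertex `0` to the vertex `2`. -/
noncomputable def quadFun (p : Fin 4 → Plane) (c : Fin 4 → ℝ) (x : Plane) : ℝ :=
  let ℓ : Plane → ℝ := fun x => ∑ j : Fin 3, c j.castSucc * bc ![p 0, p 1, p 2] j x
  ℓ x + (c 3 - ℓ (p 3)) / cross (p 0) (p 2) (p 3) * max 0 (cross (p 0) (p 2) x)

theorem cross_comb (a b x y : Plane) (s : ℝ) :
    cross a b ((1 - s) • x + s • y) = (1 - s) * cross a b x + s * cross a b y := by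
  simp only [cross, PiLp.add_apply, PiLp.smul_apply, smul_eq_mul]; ring

theorem abs_cross_sub_le (a b x y : Plane) :
    |cross a b x - cross a b y| ≤ 2 * dist a b * dist x y := by
  have h0 := norm_coord_le (b - a) 0
  have h1 := norm_coord_le (b - a) 1
  have k0 := norm_coord_le (x - y) 0
  have k1 := norm_coord_le (x - y) 1
  rw [← dist_eq_norm, dist_comm] at h0 h1
  rw [← dist_eq_norm] at k0 k1
  have e : cross a b x - cross a b y = (b - a) 0 * (x - y) 1 - (b - a) 1 * (x - y) 0 := by
    simp only [cross, PiLp.sub_apply]; ring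
  rw [e]
  refine (abs_sub _ _).trans ?_
  rw [abs_mul, abs_mul]
  have := mul_le_mul h0 k1 (abs_nonneg _) dist_nonneg
  have := mul_le_mul h1 k0 (abs_nonneg _) dist_nonneg
  linarith

variable {p : Fin 4 → Plane} (hp : ∀ a, 0 < cross (p a) (p (a + 1)) (p (a + 2)))
include hp

theorem cross3_quad_ne : cross3 ![p 0, p 1, p 2] ≠ 0 := (hp 0).ne'

/-- The fold along the diagonal vanishes on the two edges at the vertex 1 and is linear on the two
edges at the vertex 3. The edge values thus depend only on the end values, so that neighbours match.
-/
theorem quadFun_edge (c : Fin 4 → ℝ) (a : Fin 4) {s : ℝ} (hs : s ∈ Set.Icc (0 : ℝ) 1) :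
    quadFun p c ((1 - s) • p a + s • p (a + 1)) = (1 - s) * c a + s * c (a + 1) := by
  have hv := cross3_quad_ne hp
  have hs0 := hs.1
  have hs1 : 0 ≤ 1 - s := by linarith [hs.2]
  have hb : ∀ i j : Fin 3, bc ![p 0, p 1, p 2] i ((![p 0, p 1, p 2] : Fin 3 → Plane) j) =
      if i = j then 1 else 0 := bc_vertex hv
  have b0 : ∀ i, bc ![p 0, p 1, p 2] i (p 0) = if i = 0 then 1 else 0 := fun i => hb i 0
  have b1 : ∀ i, bc ![p 0, p 1, p 2] i (p 1) = if i = 1 then 1 else 0 := fun i => hb i 1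
  have b2 : ∀ i, bc ![p 0, p 1, p 2] i (p 2) = if i = 2 then 1 else 0 := fun i => hb i 2
  have h0 := hp 0
  have h2 := hp 2
  simp only [Fin.isValue, zero_add, Fin.reduceAdd] at h0 h2
  have c0 : cross (p 0) (p 2) (p 0) = 0 := by simp [cross]
  have c1 : cross (p 0) (p 2) (p 1) ≤ 0 := by
    have : cross (p 0) (p 2) (p 1) = -cross (p 0) (p 1) (p 2) := by simp only [cross]; ring
    linarith
  have c2 : cross (p 0) (p 2) (p 2) = 0 := by simp only [cross]; ring
  have c3 : 0 < cross (p 0) (p 2) (p 3) := by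
    have : cross (p 0) (p 2) (p 3) = cross (p 2) (p 3) (p 0) := by simp only [cross]; ring
    linarith
  have c3' := c3.ne'
  fin_cases a
  · have : max 0 (cross (p 0) (p 2) ((1 - s) • p 0 + s • p 1)) = 0 := by
      rw [cross_comb, c0]
      exact max_eq_left (by nlinarith)
    simp [quadFun, this, Fin.sum_univ_three, bc_comb, b0, b1]; ring
  · have : max 0 (cross (p 0) (p 2) ((1 - s) • p 1 + s • p 2)) = 0 := by
      rw [cross_comb, c2]
      exact max_eq_left (by nlinarith)
    simp [quadFun, this, Fin.sum_univ_three, bc_comb, b1, b2]; ring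
  · have : max 0 (cross (p 0) (p 2) ((1 - s) • p 2 + s • p 3)) =
        s * cross (p 0) (p 2) (p 3) := by
      rw [cross_comb, c2, mul_zero, zero_add]
      exact max_eq_right (by positivity)
    simp [quadFun, this, Fin.sum_univ_three, bc_comb, b2]; field_simp; ring
  · have : max 0 (cross (p 0) (p 2) ((1 - s) • p 3 + s • p 0)) =
        (1 - s) * cross (p 0) (p 2) (p 3) := by
      rw [cross_comb, c0, mul_zero, add_zero]
      exact max_eq_right (by positivity)
    simp [quadFun, this, Fin.sum_univ_three, bc_comb, b0]; field_simp; ring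

theorem quadFun_vertex (c : Fin 4 → ℝ) (a : Fin 4) : quadFun p c (p a) = c a := by
  simpa using quadFun_edge hp c a (s := 0) ⟨le_rfl, zero_le_one⟩

/-- Near the midpoint of a diagonal the coordinates of its end points stay positive in both
triangles cut off by it, and the sign of the third coordinate decides in which of them a point lies.
-/
theorem midpoint_mem_interior (a : Fin 4) :
    (1 / 2 : ℝ) • p a + (1 / 2 : ℝ) • p (a + 2) ∈ interior (convexHull ℝ (Set.range p)) := by
  set v : Fin 3 → Plane := ![p a, p (a + 1), p (a + 2)] with hv
  set w : Fin 3 → Plane := ![p (a + 2), p (a + 3), p a] with hw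
  have h1 : 0 < cross3 v := hp a
  have h2 : 0 < cross3 w := by
    have := hp (a + 2)
    have e1 : a + 2 + 1 = a + 3 := by clear * -; revert a; decide
    have e2 : a + 2 + 2 = a := by clear * -; revert a; decide
    rw [e1, e2] at this
    exact this
  have e : (1 / 2 : ℝ) • p a + (1 / 2 : ℝ) • p (a + 2) =
      (1 - 1 / 2 : ℝ) • p a + (1 / 2 : ℝ) • p (a + 2) := by norm_num
  have b1 : ∀ i j, bc v i (v j) = if i = j then 1 else 0 := bc_vertex h1.ne'
  have b2 : ∀ i j, bc w i (w j) = if i = j then 1 else 0 := bc_vertex h2.ne'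
  have hsub : ∀ u : Fin 3 → Plane, Set.range u ⊆ Set.range p →
      triangle u ⊆ convexHull ℝ (Set.range p) := fun u hu => convexHull_mono hu
  refine mem_interior.2 ⟨{x | 0 < bc v 0 x} ∩ {x | 0 < bc v 2 x} ∩ ({x | 0 < bc w 0 x} ∩
    {x | 0 < bc w 2 x}), ?_, ?_, ?_⟩
  · rintro x ⟨⟨x1, x2⟩, x3, x4⟩
    simp only [Set.mem_ofPred_eq] at x1 x2 x3 x4
    rcases le_total 0 (bc v 1 x) with h | h
    · refine hsub v ?_ ((mem_triangle_iff h1.ne').2 fun i => ?_)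
      · rintro _ ⟨i, rfl⟩
        fin_cases i <;> simp [hv]
      · fin_cases i
        · exact x1.le
        · exact h
        · exact x2.le
    · refine hsub w ?_ ((mem_triangle_iff h2.ne').2 fun i => ?_)
      · rintro _ ⟨i, rfl⟩
        fin_cases i <;> simp [hw]
      · fin_cases i
        · exact x3.le
        · rw [bc_one, div_le_iff₀ h1, zero_mul] at h
          change 0 ≤ bc w 1 x
          rw [bc_one]
          refine div_nonneg ?_ h2.le
          simp only [hv, hw, cross, Matrix.cons_val] at h ⊢
          linarith
        · exact x4.le
  · exact ((isOpen_lt continuous_const (continuous_bc v 0)).inter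
      (isOpen_lt continuous_const (continuous_bc v 2))).inter
      ((isOpen_lt continuous_const (continuous_bc w 0)).inter
      (isOpen_lt continuous_const (continuous_bc w 2)))
  · have v0 : ∀ i, bc v i (p a) = if i = 0 then 1 else 0 := fun i => b1 i 0
    have v2 : ∀ i, bc v i (p (a + 2)) = if i = 2 then 1 else 0 := fun i => b1 i 2
    have w0 : ∀ i, bc w i (p (a + 2)) = if i = 0 then 1 else 0 := fun i => b2 i 0
    have w2 : ∀ i, bc w i (p a) = if i = 2 then 1 else 0 := fun i => b2 i 2
    rw [e]
    refine ⟨⟨?_, ?_⟩, ?_, ?_⟩ <;> simp only [Set.mem_ofPred_eq, bc_comb, v0, v2, w0, w2] <;>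
      simp <;> norm_num

omit hp in
theorem abs_bc_sub_le {v : Fin 3 → Plane} {δ h : ℝ} (hδ : 0 < δ) (hv : δ ≤ |cross3 v|)
    (hd : ∀ a b, dist (v a) (v b) ≤ h) (i : Fin 3) (x y : Plane) :
    |bc v i x - bc v i y| ≤ 2 * h / δ * dist x y := by
  have h0 : 0 ≤ h := dist_nonneg.trans (hd 0 0)
  have key : ∀ a b, |cross (v a) (v b) x - cross (v a) (v b) y| / |cross3 v| ≤
      2 * h / δ * dist x y := by
    intro a b
    calc _ ≤ 2 * h * dist x y / δ := by
          refine div_le_div₀ (by positivity) ((abs_cross_sub_le _ _ _ _).trans ?_) hδ hv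
          gcongr
          exact hd a b
      _ = _ := by ring
  have c0 : ∀ z, cross z (v 1) (v 2) = cross (v 1) (v 2) z := fun z => by
    simp only [cross]; ring
  have c1 : ∀ z, cross (v 0) z (v 2) = cross (v 2) (v 0) z := fun z => by
    simp only [cross]; ring
  fin_cases i
  · simp only [Fin.zero_eta, bc_zero, c0, ← sub_div, abs_div]; exact key 1 2
  · simp only [Fin.mk_one, bc_one, c1, ← sub_div, abs_div]; exact key 2 0
  · simp only [Fin.reduceFinMk, bc_two, ← sub_div, abs_div]; exact key 0 1

omit hp in
-- The affine part has the slope 4D/(γh). It misses c 3 by at most (4/γ + 1)D, and the fold that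
-- repairs this has the slope 2h divided by a cross product of at least γh².
theorem abs_quadFun_sub_le {γ h D : ℝ} (hγ : 0 < γ) (hh : 0 < h)
    (hp : ∀ a, γ * h ^ 2 ≤ cross (p a) (p (a + 1)) (p (a + 2)))
    (hd : ∀ a b, dist (p a) (p b) ≤ h) {c : Fin 4 → ℝ} (hc : ∀ a b, |c a - c b| ≤ D) (x y : Plane) :
    |quadFun p c x - quadFun p c y| ≤
      (4 / γ + (4 / γ + 1) * (2 / γ)) * D / h * dist x y := by
  have hδ : 0 < γ * h ^ 2 := by positivity
  have hp' : ∀ a, 0 < cross (p a) (p (a + 1)) (p (a + 2)) := fun a => hδ.trans_le (hp a)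
  have hv := cross3_quad_ne hp'
  have hD : 0 ≤ D := (abs_nonneg _).trans (hc 0 0)
  set v : Fin 3 → Plane := ![p 0, p 1, p 2] with hv'
  have hb := abs_bc_sub_le (v := v) hδ (h := h) ((hp 0).trans (le_abs_self _))
    (fun a b => by fin_cases a <;> fin_cases b <;> exact hd _ _)
  have e1 : 2 * h / (γ * h ^ 2) = 2 / (γ * h) := by field_simp
  rw [e1] at hb
  set ℓ : Plane → ℝ := fun x => ∑ j : Fin 3, c j.castSucc * bc v j x with hℓ
  have hl : ∀ x y, |ℓ x - ℓ y| ≤ 4 / γ * D / h * dist x y := by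
    intro x y
    have s1 := sum_bc hv x
    have s2 := sum_bc hv y
    rw [Fin.sum_univ_three] at s1 s2
    have e : ℓ x - ℓ y = (c 1 - c 0) * (bc v 1 x - bc v 1 y) +
        (c 2 - c 0) * (bc v 2 x - bc v 2 y) := by
      simp only [hℓ, Fin.sum_univ_three]
      have : (Fin.castSucc (0 : Fin 3) : Fin 4) = 0 ∧ (Fin.castSucc (1 : Fin 3) : Fin 4) = 1 ∧
        (Fin.castSucc (2 : Fin 3) : Fin 4) = 2 := by decide
      rw [this.1, this.2.1, this.2.2]
      linear_combination c 0 * s1 - c 0 * s2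
    rw [e]
    refine (abs_add_le _ _).trans ?_
    rw [abs_mul, abs_mul]
    have k1 := mul_le_mul (hc 1 0) (hb 1 x y) (abs_nonneg _) hD
    have k2 := mul_le_mul (hc 2 0) (hb 2 x y) (abs_nonneg _) hD
    calc _ ≤ D * (2 / (γ * h) * dist x y) + D * (2 / (γ * h) * dist x y) := add_le_add k1 k2
      _ = _ := by field_simp; ring
  have hl0 : ℓ (p 0) = c 0 := by
    have hb' : ∀ i, bc v i (p 0) = if i = 0 then 1 else 0 := fun i => bc_vertex hv i 0
    simp [hℓ, Fin.sum_univ_three, hb']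
  have h3 : |c 3 - ℓ (p 3)| ≤ (4 / γ + 1) * D := by
    have k1 := hl (p 0) (p 3)
    rw [hl0] at k1
    have k2 : 4 / γ * D / h * dist (p 0) (p 3) ≤ 4 / γ * D / h * h := by gcongr; exact hd 0 3
    have k3 : 4 / γ * D / h * h = 4 / γ * D := by field_simp
    have k4 := abs_sub_le (c 3) (c 0) (ℓ (p 3))
    have k5 := hc 3 0
    linarith
  have hcr : γ * h ^ 2 ≤ cross (p 0) (p 2) (p 3) := by
    have : cross (p 0) (p 2) (p 3) = cross (p 2) (p 3) (p 0) := by simp only [cross]; ring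
    rw [this]
    exact hp 2
  have hm : |max 0 (cross (p 0) (p 2) x) - max 0 (cross (p 0) (p 2) y)| ≤ 2 * h * dist x y := by
    refine (abs_max_sub_max_le_max 0 _ 0 _).trans ?_
    rw [sub_self, abs_zero, max_eq_right (abs_nonneg _)]
    refine (abs_cross_sub_le _ _ _ _).trans ?_
    gcongr
    exact hd 0 2
  have hk : |(c 3 - ℓ (p 3)) / cross (p 0) (p 2) (p 3)| ≤ (4 / γ + 1) * D / (γ * h ^ 2) := by
    rw [abs_div, abs_of_pos (hδ.trans_le hcr)]
    exact div_le_div₀ (by positivity) h3 hδ hcr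
  have e : quadFun p c x - quadFun p c y = (ℓ x - ℓ y) +
      (c 3 - ℓ (p 3)) / cross (p 0) (p 2) (p 3) *
        (max 0 (cross (p 0) (p 2) x) - max 0 (cross (p 0) (p 2) y)) := by
    simp only [quadFun, hℓ]; ring
  rw [e]
  refine (abs_add_le _ _).trans ?_
  rw [abs_mul]
  calc _ ≤ 4 / γ * D / h * dist x y + (4 / γ + 1) * D / (γ * h ^ 2) * (2 * h * dist x y) :=
        add_le_add (hl x y) (mul_le_mul hk hm (abs_nonneg _) (by positivity))
    _ = _ := by field_simp

end Quad

namespace TwoScaleMesh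

variable {M : TwoScaleMesh} {γ : ℝ}

theorem isCompact_K (k : Fin M.N) : IsCompact (M.K k) :=
  (Set.finite_range _).isCompact_convexHull ℝ

theorem diam_K_le (k : Fin M.N) : Metric.diam (M.K k) ≤ M.H :=
  le_ciSup (Set.finite_range fun i => Metric.diam (M.K i)).bddAbove k

theorem dist_le_H {k : Fin M.N} {x y : Plane} (hx : x ∈ M.K k) (hy : y ∈ M.K k) :
    dist x y ≤ M.H :=
  (Metric.dist_le_diam_of_mem (isCompact_K k).isBounded hx hy).trans (diam_K_le k)

theorem quad_mem_K (k : Fin M.N) (a : Fin 4) : M.quad k a ∈ M.K k :=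
  subset_convexHull ℝ _ (Set.mem_range_self a)

/-- A vertex of K_k is covered by a fine triangle, which is nondegenerate and lies in some coarse
element. -/
theorem IsRegular.H_pos (hM : M.IsRegular γ) (k : Fin M.N) : 0 < M.H := by
  have h1 : M.quad k 0 ∈ ⋃ t, M.T t := by
    rw [hM.fine_covers]
    exact Set.mem_iUnion.2 ⟨k, quad_mem_K k 0⟩
  obtain ⟨t, _⟩ := Set.mem_iUnion.1 h1
  obtain ⟨i, hi⟩ := hM.fine_refines t
  have h2 : 0 < Metric.diam (triangle (M.tri t)) := diam_triangle_pos (hM.cross3_ne t)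
  exact h2.trans_le ((Metric.diam_mono hi (isCompact_K i).isBounded).trans (diam_K_le i))

theorem IsRegular.quad_cross_pos (hM : M.IsRegular γ) (hγ : 0 < γ) (k : Fin M.N) (a : Fin 4) :
    0 < cross (M.quad k a) (M.quad k (a + 1)) (M.quad k (a + 2)) := by
  have := hM.H_pos k
  exact lt_of_lt_of_le (by positivity) (hM.coarse_quasiUniform k a)

theorem IsRegular.disjoint_interior_K (hM : M.IsRegular γ) (hγ : 0 < γ) {k j : Fin M.N}
    (h : k ≠ j) : Disjoint (interior (M.K k)) (M.K j) :=
  disjoint_interior_of_convex (convex_convexHull ℝ _)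
    ⟨_, midpoint_mem_interior (hM.quad_cross_pos hγ j) 0⟩ (hM.coarse_disjoint k j h)

/-- The intersection is the hull of the common vertices. Opposite vertices of one element cannot
both be common, since the midpoint of the diagonal would be an inner point of that element lying in
the other. So there are at most two common vertices, adjacent in both elements, and both functions
interpolate linearly between them. -/
theorem IsRegular.quadFun_eq (hM : M.IsRegular γ) (hγ : 0 < γ) (χ : Plane → ℝ) {k j : Fin M.N}
    {x : Plane} (hk : x ∈ M.K k) (hj : x ∈ M.K j) :
    quadFun (M.quad k) (fun a => χ (M.quad k a)) x =
      quadFun (M.quad j) (fun a => χ (M.quad j a)) x := by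
  by_cases hkj : k = j
  · rw [hkj]
  have hx : x ∈ M.K k ∩ M.K j := ⟨hk, hj⟩
  rw [hM.coarse_conforming k j hkj] at hx
  set S := Set.range (M.quad k) ∩ Set.range (M.quad j) with hS
  have hopp : ∀ {i i' : Fin M.N} (a : Fin 4), i ≠ i' →
      Set.range (M.quad k) ∩ Set.range (M.quad j) ⊆ M.K i' →
      M.quad i a ∈ S → M.quad i (a + 2) ∈ S → False := by
    intro i i' a hii hsub h1 h2
    refine Set.disjoint_left.1 (hM.disjoint_interior_K hγ hii)
      (midpoint_mem_interior (hM.quad_cross_pos hγ i) a) ?_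
    exact (convex_convexHull ℝ _) (hsub h1) (hsub h2) (by norm_num) (by norm_num) (by norm_num)
  have hSk : S ⊆ M.K k := Set.inter_subset_left.trans (subset_convexHull ℝ _)
  have hSj : S ⊆ M.K j := Set.inter_subset_right.trans (subset_convexHull ℝ _)
  have hadj : ∀ {i i' : Fin M.N}, i ≠ i' → S ⊆ M.K i' → ∀ a b, M.quad i a ∈ S →
      M.quad i b ∈ S → b = a ∨ b = a + 1 ∨ a = b + 1 := by
    intro i i' hii hsub a b ha hb
    have h1 : b ≠ a + 2 := fun h => hopp a hii hsub ha (h ▸ hb)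
    revert h1
    clear * -
    revert a b
    decide
  have heval : ∀ {i i' : Fin M.N}, i ≠ i' → S ⊆ M.K i' → S ⊆ Set.range (M.quad i) →
      ∀ P ∈ S, ∀ Q ∈ S, ∀ s ∈ Set.Icc (0 : ℝ) 1,
        quadFun (M.quad i) (fun a => χ (M.quad i a)) ((1 - s) • P + s • Q) =
          (1 - s) * χ P + s * χ Q := by
    intro i i' hii hsub hr P hP Q hQ s hs
    obtain ⟨a, rfl⟩ := hr hP
    obtain ⟨b, rfl⟩ := hr hQ
    rcases hadj hii hsub a b hP hQ with rfl | rfl | rfl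
    · rw [← add_smul, sub_add_cancel, one_smul, quadFun_vertex (hM.quad_cross_pos hγ i)]; ring
    · exact quadFun_edge (hM.quad_cross_pos hγ i) _ a hs
    · have := quadFun_edge (hM.quad_cross_pos hγ i) (fun a => χ (M.quad i a)) b
        (s := 1 - s) ⟨by linarith [hs.2], by linarith [hs.1]⟩
      rw [sub_sub_cancel, add_comm] at this
      rw [this]; ring
  obtain ⟨P, hP⟩ : S.Nonempty := convexHull_nonempty_iff.1 ⟨x, hx⟩
  obtain ⟨Q, hQ, hPQ⟩ : ∃ Q ∈ S, S ⊆ {P, Q} := by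
    by_cases hne : ∃ Q ∈ S, Q ≠ P
    · obtain ⟨Q, hQ, hQP⟩ := hne
      refine ⟨Q, hQ, fun R hR => ?_⟩
      obtain ⟨a, rfl⟩ := hP.1
      obtain ⟨b, rfl⟩ := hQ.1
      obtain ⟨c, rfl⟩ := hR.1
      have h1 := hadj hkj hSj a b hP hQ
      have h2 := hadj hkj hSj a c hP hR
      have h3 := hadj hkj hSj b c hQ hR
      have h4 : b ≠ a := fun h => hQP (h ▸ rfl)
      have h5 : c = a ∨ c = b := by
        revert h1 h2 h3 h4
        clear * -
        revert a b c
        decide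
      rcases h5 with rfl | rfl <;> simp
    · push Not at hne
      exact ⟨P, hP, fun R hR => by simp [hne R hR]⟩
  have hx' : x ∈ segment ℝ P Q := by
    rw [← convexHull_pair]
    exact convexHull_mono hPQ hx
  obtain ⟨s, hs, rfl⟩ := mem_segment_iff_param.1 hx'
  rw [heval hkj hSj Set.inter_subset_left P hP Q hQ s hs,
    heval (Ne.symm hkj) hSk Set.inter_subset_right P hP Q hQ s hs]

/-- A cutoff function on the coarse mesh: for a function `d` on the coarse elements that changes at
most by one between neighbours there is a continuous function that is close to `f (d k)` on `K_k`
and has a Lipschitz constant of the order of `1 / H`. -/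
theorem exists_coarseFun (γ : ℝ) (hγ : 0 < γ) : ∃ C : ℝ, 0 ≤ C ∧ ∀ M : TwoScaleMesh,
    M.IsRegular γ → ∀ d : Fin M.N → ℕ,
      (∀ k j, (M.K k ∩ M.K j).Nonempty → d k ≤ d j + 1) → ∀ f : ℕ → ℝ,
      ∃ g : Plane → ℝ, ∀ k,
        (∀ x ∈ M.K k, |g x - f (d k)| ≤ C * |f (d k) - f (d k - 1)|) ∧
        ∀ x ∈ M.K k, ∀ y ∈ M.K k,
          |g x - g y| ≤ C * |f (d k) - f (d k - 1)| / M.H * dist x y := by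
  classical
  set C₁ := 4 / γ + (4 / γ + 1) * (2 / γ) with hC₁
  have hC₁0 : 0 ≤ C₁ := by positivity
  -- Vertex values lie within one increment of f (d k), so they differ by at most two: the slope is
  -- 2C₁/H times the increment, and over a distance H this adds 2C₁ to the 1 at a vertex.
  refine ⟨2 * C₁ + 1, by positivity, fun M hM d hd f => ?_⟩
  -- At a point the smallest d among the elements containing it is used. Since d changes by at most
  -- one between neighbours, on K_k this is d k or d k - 1, so that only the backward increment of f
  -- appears.
  set χ : Plane → ℝ := fun x => f (sInf {n | ∃ k, x ∈ M.K k ∧ n = d k}) with hχ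
  have hχd : ∀ k x, x ∈ M.K k → |χ x - f (d k)| ≤ |f (d k) - f (d k - 1)| := by
    intro k x hx
    have h1 : sInf {n | ∃ k, x ∈ M.K k ∧ n = d k} ≤ d k := Nat.sInf_le ⟨k, hx, rfl⟩
    obtain ⟨j, hj, hj'⟩ := Nat.sInf_mem (s := {n | ∃ k, x ∈ M.K k ∧ n = d k}) ⟨_, k, hx, rfl⟩
    have h2 := hd k j ⟨x, hx, hj⟩
    have h3 : sInf {n | ∃ k, x ∈ M.K k ∧ n = d k} = d k ∨
        sInf {n | ∃ k, x ∈ M.K k ∧ n = d k} = d k - 1 := by omega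
    simp only [hχ]
    rcases h3 with h | h
    · rw [h, sub_self, abs_zero]; exact abs_nonneg _
    · rw [h, abs_sub_comm]
  -- The interpolants are glued by an arbitrary choice of the element, harmless by `quadFun_eq`.
  set g : Plane → ℝ := fun x => if h : ∃ k, x ∈ M.K k then
    quadFun (M.quad h.choose) (fun a => χ (M.quad h.choose a)) x else 0 with hg
  have hgk : ∀ k x, x ∈ M.K k → g x = quadFun (M.quad k) (fun a => χ (M.quad k a)) x := by
    intro k x hx
    have h : ∃ k, x ∈ M.K k := ⟨k, hx⟩
    simp only [hg, dif_pos h]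
    exact hM.quadFun_eq hγ χ h.choose_spec hx
  have hlip : ∀ k, ∀ x ∈ M.K k, ∀ y ∈ M.K k,
      |g x - g y| ≤ C₁ * (2 * |f (d k) - f (d k - 1)|) / M.H * dist x y := by
    intro k x hx y hy
    rw [hgk k x hx, hgk k y hy]
    refine abs_quadFun_sub_le hγ (hM.H_pos k) (hM.coarse_quasiUniform k)
      (fun a b => dist_le_H (quad_mem_K k a) (quad_mem_K k b)) (fun a b => ?_) x y
    have h1 := hχd k _ (quad_mem_K k a)
    have h2 := hχd k _ (quad_mem_K k b)
    rw [abs_sub_comm] at h2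
    have h3 := abs_sub_le (χ (M.quad k a)) (f (d k)) (χ (M.quad k b))
    linarith
  refine ⟨g, fun k => ⟨fun x hx => ?_, fun x hx y hy => (hlip k x hx y hy).trans ?_⟩⟩
  · have hH := hM.H_pos k
    set Δ := |f (d k) - f (d k - 1)| with hΔ
    have h1 := hlip k x hx _ (quad_mem_K k 0)
    have h2 : g (M.quad k 0) = χ (M.quad k 0) := by
      rw [hgk k _ (quad_mem_K k 0), quadFun_vertex (hM.quad_cross_pos hγ k)]
    have h3 := hχd k _ (quad_mem_K k 0)
    have h4 : C₁ * (2 * Δ) / M.H * dist x (M.quad k 0) ≤ C₁ * (2 * Δ) / M.H * M.H := by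
      gcongr
      exact dist_le_H hx (quad_mem_K k 0)
    have h5 : C₁ * (2 * Δ) / M.H * M.H = C₁ * (2 * Δ) := by field_simp
    have h6 := abs_sub_le (g x) (g (M.quad k 0)) (f (d k))
    rw [h2] at h6 h1
    linarith
  · have hH := hM.H_pos k
    have h := abs_nonneg (f (d k) - f (d k - 1))
    exact mul_le_mul_of_nonneg_right (div_le_div_of_nonneg_right (by linarith) hH.le) dist_nonneg

end TwoScaleMesh

end Elast

/-! ### Energy norms on one triangle and the local cutoff. -/

namespace Elast

open MvPolynomial MeasureTheory

section Element

variable {v : Fin 3 → Plane}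

/-- The deviatoric part as a linear map. -/
noncomputable def devL : TriField →ₗ[ℝ] TriField where
  toFun := devF
  map_add' := devF_add
  map_smul' := devF_smul

/-- Half of the trace as a linear map. -/
noncomputable def halfTrL (c : Fin 3) : TriField →ₗ[ℝ] Poly2 where
  toFun P := halfTr P c
  map_add' P Q := by simp only [halfTr, Pi.add_apply]; ring
  map_smul' t P := by
    simp only [halfTr, Pi.smul_apply, RingHom.id_apply, smul_eq_C_mul]; ring

/-- The divergence as a linear map. -/
noncomputable def dvgL (c : Fin 3) (a : Fin 2) : TriField →ₗ[ℝ] Poly2 where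
  toFun P := ∑ b, pderiv b (P c a b)
  map_add' P Q := by simp only [Pi.add_apply, map_add, Finset.sum_add_distrib]
  map_smul' t P := by
    simp only [Pi.smul_apply, Derivation.map_smul, RingHom.id_apply, Finset.smul_sum]

theorem dvgL_apply (c : Fin 3) (a : Fin 2) (P : TriField) :
    dvgL c a P = ∑ b, pderiv b (P c a b) := rfl

/-- The squared norm of the divergence. -/
noncomputable def nrmDvg (v : Fin 3 → Plane) (P : TriField) : ℝ :=
  ∑ c, ∑ a, sqI v c (dvgL c a P)

theorem nrmDvg_nonneg (v : Fin 3 → Plane) (P : TriField) : 0 ≤ nrmDvg v P :=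
  Finset.sum_nonneg fun _ _ => Finset.sum_nonneg fun _ _ => sqI_nonneg _ _ _

theorem nrmDvg_add_le (P Q : TriField) :
    nrmDvg v (P + Q) ≤ 2 * nrmDvg v P + 2 * nrmDvg v Q := by
  simp only [nrmDvg, Finset.mul_sum, ← Finset.sum_add_distrib, map_add]
  exact Finset.sum_le_sum fun c _ => Finset.sum_le_sum fun a _ => sqI_add_le v c _ _

theorem nrmDvg_smul (t : ℝ) (P : TriField) : nrmDvg v (t • P) = t ^ 2 * nrmDvg v P := by
  simp only [nrmDvg, map_smul, sqI_smul, Finset.mul_sum]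

/-- The squared norm of the trace. -/
noncomputable def nrmTr (v : Fin 3 → Plane) (P : TriField) : ℝ := ∑ c, sqI v c (halfTr P c)

theorem nrmTr_nonneg (v : Fin 3 → Plane) (P : TriField) : 0 ≤ nrmTr v P :=
  Finset.sum_nonneg fun _ _ => sqI_nonneg _ _ _

theorem nrmTr_le (P : TriField) : nrmTr v P ≤ nrm v P := by
  refine Finset.sum_le_sum fun c _ => ?_
  have h := sqI_add_le v c (P c 0 0) (P c 1 1)
  have h01 := sqI_nonneg v c (P c 0 1)
  have h10 := sqI_nonneg v c (P c 1 0)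
  have h00 := sqI_nonneg v c (P c 0 0)
  have h11 := sqI_nonneg v c (P c 1 1)
  rw [halfTr, sqI_C_mul]
  simp only [Fin.sum_univ_two]
  linarith

theorem nrm_le_dev_add_tr (P : TriField) :
    nrm v P ≤ 2 * nrm v (devF P) + 4 * nrmTr v P := by
  have e : P = devF P + fun c a b => if a = b then halfTr P c else 0 := by
    funext c a b
    simp [devF]
  have hz : ∀ c, sqI v c (0 : Poly2) = 0 := fun c => by simp [sqI]
  have e2 : nrm v (fun c a b => if a = b then halfTr P c else 0) = 2 * nrmTr v P := by
    rw [nrm, nrmTr, Finset.mul_sum]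
    refine Finset.sum_congr rfl fun c _ => ?_
    simp [Fin.sum_univ_two, hz]; ring
  calc nrm v P = nrm v (devF P + fun c a b => if a = b then halfTr P c else 0) := by rw [← e]
    _ ≤ _ := nrm_add_le _ _ _
    _ = _ := by rw [e2]; ring

/-- The energy form of the stresses on one triangle, with the weights `al` and `be` of the
deviatoric part and of the trace. -/
noncomputable def elemForm (v : Fin 3 → Plane) (al be : ℝ) : TriField →ₗ[ℝ] TriField →ₗ[ℝ] ℝ :=
  al • (nrmForm v).compl₁₂ devL devL +
    be • ∑ c, (polyForm (isCompact_triangle (subV v c))).compl₁₂ (halfTrL c) (halfTrL c)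

theorem elemForm_self (al be : ℝ) (P : TriField) :
    elemForm v al be P P = al * nrm v (devF P) + be * nrmTr v P := by
  have : nrmForm v (devF P) (devF P) = _ := nrmForm_self v _
  simp [elemForm, LinearMap.sum_apply, nrmTr, sqI_eq_polyForm, devL, halfTrL, this]

theorem elemForm_nonneg {al be : ℝ} (hal : 0 ≤ al) (hbe : 0 ≤ be) (P : TriField) :
    0 ≤ elemForm v al be P P := by
  rw [elemForm_self]
  have := nrm_nonneg v (devF P)
  have := nrmTr_nonneg v P
  positivity

/-- The energy controls the full stress norm with the smaller of its two weights. It is used with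
1/(λ + 2μ), which is what k̃⁻¹H⁻² provides. -/
theorem nrm_le_elemForm {al be k : ℝ} (hk : 0 ≤ k) (hal : k ≤ al) (hbe : k ≤ be)
    (P : TriField) : k * nrm v P ≤ 4 * elemForm v al be P P := by
  rw [elemForm_self]
  have h1 := nrm_nonneg v (devF P)
  have h2 := nrmTr_nonneg v P
  have h4 := mul_le_mul_of_nonneg_left (nrm_le_dev_add_tr (v := v) P) hk
  have h5 := mul_le_mul_of_nonneg_right hal h1
  have h6 := mul_le_mul_of_nonneg_right hbe h2
  have h7 := mul_nonneg (hk.trans hal) h1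
  linarith

theorem nrm_comb_le {X : Fin 3 → TriField} {η : Fin 3 → ℝ} {D B : ℝ} (hη : ∀ c, |η c| ≤ D)
    (hX : ∀ c, nrm v (X c) ≤ B) : nrm v (∑ c, η c • X c) ≤ 12 * D ^ 2 * B := by
  have h : ∀ c, nrm v (η c • X c) ≤ D ^ 2 * B := fun c => by
    rw [nrm_smul]
    exact mul_le_mul (sq_le_sq' (abs_le.1 (hη c)).1 (abs_le.1 (hη c)).2) (hX c) (nrm_nonneg _ _)
      (sq_nonneg _)
  rw [Fin.sum_univ_three]
  have h1 := nrm_add_le v (η 0 • X 0 + η 1 • X 1) (η 2 • X 2)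
  have h2 := nrm_add_le v (η 0 • X 0) (η 1 • X 1)
  have := h 0
  have := h 1
  have := h 2
  have := nrm_nonneg v (η 2 • X 2)
  linarith

end Element

/-- Local cutoff: combinations of the vertex parts of a composite stress are bounded in the energy
norm, and their divergence is controlled by the oscillation of the coefficients. -/
theorem exists_comb_le {r : ℕ} (hr : 2 ≤ r) {γ : ℝ} (hγ : 0 < γ) :
    ∃ K : ℝ, 0 ≤ K ∧ ∀ v, IsShapeRegular γ v → ∀ P, MemLoc r v P → ∃ Q : Fin 3 → TriField,
      (∀ c, MemLoc r v (Q c)) ∧ ∑ c, Q c = P ∧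
      (∀ c n a s, pev (edgePt v n s) (trace v (Q c) n a) =
        pev (edgePt v n s) (locJ r v c (trace v P n a))) ∧
      ∀ (η : Fin 3 → ℝ) (D δ : ℝ), (∀ c, |η c| ≤ D) → (∀ c c', |η c - η c'| ≤ δ) →
        (∀ al be : ℝ, 0 ≤ be → be ≤ 2 * al →
          elemForm v al be (∑ c, η c • Q c) (∑ c, η c • Q c) ≤ K * D ^ 2 * elemForm v al be P P) ∧
        nrmDvg v (∑ c, η c • Q c) ≤ K * (D ^ 2 * nrmDvg v P +
          δ ^ 2 * (Metric.diam (triangle v) ^ 2)⁻¹ * nrm v P) := by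
  obtain ⟨κ, hκ, H⟩ := exists_bounds r hγ
  obtain ⟨K, hK, HK⟩ := exists_localParts hr hγ
  have hκ0 : 0 ≤ κ := by linarith
  refine ⟨2 + 60 * K + 16 * (κ * K), by positivity, fun v hv P hP => ?_⟩
  obtain ⟨Q, hQ, hsum, htr, hb, hd⟩ := HK v hv P hP
  refine ⟨Q, hQ, hsum, htr, fun η D δ hD hδ => ⟨fun al be hbe hba => ?_, ?_⟩⟩
  · have hal : 0 ≤ al := by linarith
    have h1 := nrm_comb_le hD hb
    have h2 := nrm_comb_le (X := fun c => devF (Q c)) hD hd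
    have e : devF (∑ c, η c • Q c) = ∑ c, η c • devF (Q c) := by
      simp only [Fin.sum_univ_three, devF_add, devF_smul]
    rw [elemForm_self, elemForm_self, e]
    have h3 := nrmTr_le (v := v) (∑ c, η c • Q c)
    have h4 := nrm_le_dev_add_tr (v := v) P
    set N := nrm v (devF P)
    set T := nrmTr v P
    have hN : 0 ≤ N := nrm_nonneg _ _
    have hT : 0 ≤ T := nrmTr_nonneg _ _
    have h5 : nrmTr v (∑ c, η c • Q c) ≤ 12 * D ^ 2 * (K * (2 * N + 4 * T)) :=
      h3.trans (h1.trans (by gcongr))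
    -- The trace of the combination is bounded by the full norm of P. Its deviatoric share has the
    -- weight be, which be ≤ 2 al absorbs; the deviator of the combination is bounded by N alone, so
    -- no large ratio of the weights appears.
    calc _ ≤ al * (12 * D ^ 2 * (K * N)) + be * (12 * D ^ 2 * (K * (2 * N + 4 * T))) := by gcongr
      _ = D ^ 2 * K * (12 * (al * N) + 24 * (be * N) + 48 * (be * T)) := by ring
      _ ≤ D ^ 2 * K * (12 * (al * N) + 24 * (2 * al * N) + 48 * (be * T)) := by gcongr
      _ ≤ D ^ 2 * K * (60 * (al * N + be * T)) := by
          have := mul_nonneg hbe hT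
          gcongr
          linarith
      _ = 60 * K * (D ^ 2 * (al * N + be * T)) := by ring
      _ ≤ (2 + 60 * K + 16 * (κ * K)) * (D ^ 2 * (al * N + be * T)) := by
          have : 0 ≤ κ * K := by positivity
          gcongr
          linarith
      _ = _ := by ring
  · set h := Metric.diam (triangle v)
    -- The divergence of a single vertex part is bounded only through the inverse inequality.
    have hQd : ∀ c, nrmDvg v (Q c) ≤ 2 * κ * K * (h ^ 2)⁻¹ * nrm v P := by
      intro c
      have h1 : nrmDvg v (Q c) ≤ 2 * κ * (h ^ 2)⁻¹ * nrm v (Q c) := by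
        rw [nrmDvg, nrm, Finset.mul_sum]
        refine Finset.sum_le_sum fun i _ => ?_
        rw [Finset.mul_sum]
        refine Finset.sum_le_sum fun a _ => ?_
        rw [dvgL_apply, Fin.sum_univ_two, Fin.sum_univ_two]
        have k0 := (H v hv _ ((hQ c).deg i a 0)).2.1 i 0
        have k1 := (H v hv _ ((hQ c).deg i a 1)).2.1 i 1
        have k2 := sqI_add_le v i (pderiv 0 (Q c i a 0)) (pderiv 1 (Q c i a 1))
        linarith
      calc _ ≤ 2 * κ * (h ^ 2)⁻¹ * nrm v (Q c) := h1
        _ ≤ 2 * κ * (h ^ 2)⁻¹ * (K * nrm v P) := by gcongr; exact hb c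
        _ = _ := by ring
    -- Since the parts add up to P, only differences of the coefficients multiply single parts; the
    -- factor h⁻¹ of the inverse inequality then meets the oscillation δ.
    have e : ∑ c, η c • Q c = η 0 • P + ((η 1 - η 0) • Q 1 + (η 2 - η 0) • Q 2) := by
      rw [← hsum]
      simp only [Fin.sum_univ_three]
      module
    have hsq : ∀ {x y : ℝ}, |x| ≤ y → x ^ 2 ≤ y ^ 2 := fun h =>
      sq_le_sq' (abs_le.1 h).1 (abs_le.1 h).2
    rw [e]
    have k1 := nrmDvg_add_le (v := v) (η 0 • P) ((η 1 - η 0) • Q 1 + (η 2 - η 0) • Q 2)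
    have k2 := nrmDvg_add_le (v := v) ((η 1 - η 0) • Q 1) ((η 2 - η 0) • Q 2)
    rw [nrmDvg_smul] at k1
    rw [nrmDvg_smul, nrmDvg_smul] at k2
    have j0 := mul_le_mul (hsq (hD 0)) le_rfl (nrmDvg_nonneg v P) (sq_nonneg D)
    have j1 := mul_le_mul (hsq (hδ 1 0)) (hQd 1) (nrmDvg_nonneg v _) (sq_nonneg δ)
    have j2 := mul_le_mul (hsq (hδ 2 0)) (hQd 2) (nrmDvg_nonneg v _) (sq_nonneg δ)
    have i1 : 0 ≤ δ ^ 2 * (h ^ 2)⁻¹ * nrm v P := by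
      have := nrm_nonneg v P
      positivity
    have i2 : 0 ≤ D ^ 2 * nrmDvg v P := mul_nonneg (sq_nonneg _) (nrmDvg_nonneg v P)
    have i3 : 0 ≤ κ * K := by positivity
    calc _ ≤ 2 * (D ^ 2 * nrmDvg v P) + 16 * (κ * K) * (δ ^ 2 * (h ^ 2)⁻¹ * nrm v P) := by
          linarith
      _ ≤ (2 + 60 * K + 16 * (κ * K)) * (D ^ 2 * nrmDvg v P) +
          (2 + 60 * K + 16 * (κ * K)) * (δ ^ 2 * (h ^ 2)⁻¹ * nrm v P) := by
          refine add_le_add (mul_le_mul_of_nonneg_right (by linarith) i2)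
            (mul_le_mul_of_nonneg_right (by linarith) i1)
      _ = _ := by ring

namespace TwoScaleMesh

variable {M : TwoScaleMesh}

theorem hasDerivAt_pev_edgePt (v : Fin 3 → Plane) (e : Fin 3) (G : Poly2) (s : ℝ) :
    HasDerivAt (fun s => pev (edgePt v e s) G)
      (∑ b, (v (e + 2) b - v (e + 1) b) * pev (edgePt v e s) (pderiv b G)) s := by
  have h1 : HasDerivAt (fun s => edgePt v e s) (v (e + 2) - v (e + 1)) s := by
    have ha : HasDerivAt (fun s : ℝ => (1 - s) • v (e + 1)) ((-1 : ℝ) • v (e + 1)) s :=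
      ((hasDerivAt_id s).const_sub 1).smul_const _
    have hb : HasDerivAt (fun s : ℝ => s • v (e + 2)) ((1 : ℝ) • v (e + 2)) s :=
      (hasDerivAt_id s).smul_const _
    refine (ha.add hb).congr_deriv ?_
    module
  refine ((hasFDerivAt_pev G (edgePt v e s)).comp_hasDerivAt s h1).congr_deriv ?_
  simp [mul_comm]

/-- The continuity of normal traces is preserved by the localization to the vertices. -/
theorem EdgeCond.comb {r : ℕ} (hne : ∀ t, cross3 (M.tri t) ≠ 0) {P : Fin M.Nh → TriField}
    (hP : M.EdgeCond P) {Q : Fin M.Nh → Fin 3 → TriField}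
    (hQ : ∀ t c n a s, pev (edgePt (M.tri t) n s) (trace (M.tri t) (Q t c) n a) =
      pev (edgePt (M.tri t) n s) (locJ r (M.tri t) c (trace (M.tri t) (P t) n a)))
    (χ : Plane → ℝ) : M.EdgeCond fun t => ∑ c, χ (M.tri t c) • Q t c := by
  classical
  intro t e a s hs
  set x := edgePt (M.tri t) e s with hx
  set p := M.tri t (e + 1) with hp
  set q := M.tri t (e + 2) with hq
  set E := Finset.univ.filter fun i => M.edgeKey i = M.edgeKey (t, e) with hE
  set G : Fin M.Nh × Fin 3 → Poly2 := fun i => trace (M.tri i.1) (P i.1) i.2 a with hG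
  have hxb : ∀ b, x b = (1 - s) * p b + s * q b := fun b => by simp [hx, edgePt, hp, hq]
  set S : Poly2 := ∑ i ∈ E, C (M.orient i.1) * G i with hS
  have h0 : ∀ s ∈ Set.Ioo (0 : ℝ) 1, pev (edgePt (M.tri t) e s) S = 0 := by
    intro s hs
    rw [hS, map_sum]
    simp only [map_mul, pev_C]
    exact hP t e a s hs
  -- The signed sum of the traces vanishes along the open edge, hence so does its tangential
  -- derivative.
  have h1 : ∑ b, (q b - p b) * pev x (pderiv b S) = 0 := by
    have k1 := hasDerivAt_pev_edgePt (M.tri t) e S s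
    have k2 : HasDerivAt (fun s => pev (edgePt (M.tri t) e s) S) 0 s := by
      refine (hasDerivAt_const s (0 : ℝ)).congr_of_eventuallyEq ?_
      filter_upwards [isOpen_Ioo.mem_nhds hs] with s' hs' using h0 s' hs'
    exact k1.unique k2
  -- With p - x = -s(q - p) and q - x = (1 - s)(q - p) the new trace is a linear combination of the
  -- old trace and its tangential derivative. The coefficients are common to all triangles at the
  -- edge.
  have htr : ∀ i ∈ E, pev x (trace (M.tri i.1) (∑ c, χ (M.tri i.1 c) • Q i.1 c) i.2 a) =
      ((1 - s) * χ p + s * χ q) * pev x (G i) +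
        1 / r * ((1 - s) * s * (χ q - χ p)) * ∑ b, (q b - p b) * pev x (pderiv b (G i)) := by
    rintro ⟨u, c⟩ hi
    rw [hE, Finset.mem_filter] at hi
    have e1 : trace (M.tri u) (∑ d, χ (M.tri u d) • Q u d) c a =
        ∑ d, C (χ (M.tri u d)) * trace (M.tri u) (Q u d) c a := by
      simp only [trace, Fin.sum_univ_three, Fin.sum_univ_two, Pi.add_apply, Pi.smul_apply,
        smul_eq_C_mul]
      ring
    have e2 : ∀ s', edgePt (M.tri u) c s' = x → ∀ d, pev x (trace (M.tri u) (Q u d) c a) =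
        edgeW c s' d * (pev x (G (u, c)) +
          1 / r * ∑ b, (M.tri u d b - x b) * pev x (pderiv b (G (u, c)))) := by
      intro s' hs' d
      rw [← hs', hQ, pev_locJ_edgePt (hne u)]
    have e3 : ∀ (s' : ℝ) (f : Fin 3 → ℝ), ∑ d, edgeW c s' d * f d =
        (1 - s') * f (c + 1) + s' * f (c + 2) := by
      intro s' f
      clear * -
      fin_cases c <;> simp [Fin.sum_univ_three, edgeW]; ring
    have e4 : ∀ s', edgePt (M.tri u) c s' = x →
        pev x (trace (M.tri u) (∑ d, χ (M.tri u d) • Q u d) c a) =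
        (1 - s') * (χ (M.tri u (c + 1)) * (pev x (G (u, c)) +
          1 / r * ∑ b, (M.tri u (c + 1) b - x b) * pev x (pderiv b (G (u, c))))) +
        s' * (χ (M.tri u (c + 2)) * (pev x (G (u, c)) +
          1 / r * ∑ b, (M.tri u (c + 2) b - x b) * pev x (pderiv b (G (u, c))))) := by
      intro s' hs'
      rw [e1, map_sum, ← e3 s' fun d => χ (M.tri u d) * (pev x (G (u, c)) +
          1 / r * ∑ b, (M.tri u d b - x b) * pev x (pderiv b (G (u, c))))]
      refine Finset.sum_congr rfl fun d _ => ?_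
      rw [map_mul, pev_C, e2 s' hs']
      ring
    -- The neighbouring triangle may run through the edge in either direction; the parameter is s or
    -- 1 - s.
    rcases Sym2.eq_iff.1 hi.2 with ⟨h2, h3⟩ | ⟨h2, h3⟩
    · simp only at h2 h3
      rw [e4 s (by rw [edgePt, h2, h3]; rfl), h2, h3, ← hp, ← hq]
      simp only [Fin.sum_univ_two, hxb]
      ring
    · simp only at h2 h3
      rw [e4 (1 - s) (by rw [edgePt, h2, h3, sub_sub_cancel, add_comm]; rfl), h2, h3, ← hp, ← hq]
      simp only [Fin.sum_univ_two, hxb]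
      ring
  have h2 := h0 s hs
  rw [← hx, hS, map_sum] at h2
  simp only [hS, map_sum, Fin.sum_univ_two] at h1
  calc _ = ∑ i ∈ E, M.orient i.1 * (((1 - s) * χ p + s * χ q) * pev x (G i) +
        1 / r * ((1 - s) * s * (χ q - χ p)) * ∑ b, (q b - p b) * pev x (pderiv b (G i))) :=
        Finset.sum_congr rfl fun i hi => by rw [htr i hi]
    _ = ((1 - s) * χ p + s * χ q) * ∑ i ∈ E, pev x (C (M.orient i.1) * G i) +
        1 / r * ((1 - s) * s * (χ q - χ p)) *
          ((q 0 - p 0) * ∑ i ∈ E, pev x (pderiv 0 (C (M.orient i.1) * G i)) +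
           (q 1 - p 1) * ∑ i ∈ E, pev x (pderiv 1 (C (M.orient i.1) * G i))) := by
        simp only [Finset.mul_sum, ← Finset.sum_add_distrib, Fin.sum_univ_two, pderiv_C_mul,
          map_mul, pev_C]
        refine Finset.sum_congr rfl fun i _ => ?_
        ring
    _ = 0 := by rw [h1, h2]; ring

end TwoScaleMesh

end Elast

/-! ### Discrete spaces of polynomial families, their forms, and the global cutoff. -/

namespace Elast

open MvPolynomial MeasureTheory

/-- The integral of polynomials over a part of a triangle. -/
noncomputable def intL (v : Fin 3 → Plane) (c : Fin 3) : Poly2 →ₗ[ℝ] ℝ :=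
  (polyForm (isCompact_triangle (subV v c))).flip 1

theorem intL_apply (v : Fin 3 → Plane) (c : Fin 3) (p : Poly2) :
    intL v c p = ∫ x in triangle (subV v c), pev x p := by
  simp [intL, polyForm]

theorem polyForm_eq_intL (v : Fin 3 → Plane) (c : Fin 3) (p q : Poly2) :
    polyForm (isCompact_triangle (subV v c)) p q = intL v c (p * q) := by
  simp [intL, polyForm]

namespace TwoScaleMesh

variable (M : TwoScaleMesh) (r : ℕ)

/-- The discrete stresses, as families of polynomials on the parts of the fine triangles. -/
def sigmaSpace : Submodule ℝ (Fin M.Nh → TriField) where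
  carrier := {P | (∀ t, MemLoc r (M.tri t) (P t)) ∧ M.EdgeCond P}
  zero_mem' := ⟨fun t => (locSigma r (M.tri t)).zero_mem, fun t e a s _ => by simp [trace]⟩
  add_mem' := by
    rintro P Q ⟨hP, hP'⟩ ⟨hQ, hQ'⟩
    refine ⟨fun t => (locSigma r (M.tri t)).add_mem (hP t) (hQ t), fun t e a s hs => ?_⟩
    simp only [Pi.add_apply, trace_add, map_add, mul_add, Finset.sum_add_distrib]
    rw [hP' t e a s hs, hQ' t e a s hs, add_zero]
  smul_mem' := by
    rintro k P ⟨hP, hP'⟩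
    refine ⟨fun t => (locSigma r (M.tri t)).smul_mem k (hP t), fun t e a s hs => ?_⟩
    have e1 : ∀ i : Fin M.Nh × Fin 3, trace (M.tri i.1) ((k • P) i.1) i.2 a =
        k • trace (M.tri i.1) (P i.1) i.2 a := fun i => by
      simp only [trace, Pi.smul_apply, smul_eq_C_mul, Fin.sum_univ_two]; ring
    simp only [e1, pev_smul, mul_left_comm _ k, ← Finset.mul_sum]
    rw [hP' t e a s hs, mul_zero]

/-- The discrete displacements, as families of polynomials on the fine triangles. -/
abbrev DispSpace := Fin M.Nh → Fin 2 → restrictTotalDegree (Fin 2) ℝ (r - 1)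

variable {M r}

theorem dvg_mem (P : M.sigmaSpace r) (t : Fin M.Nh) (c : Fin 3) (a : Fin 2) :
    dvgL c a (P.1 t) ∈ restrictTotalDegree (Fin 2) ℝ (r - 1) := by
  rw [mem_restrictTotalDegree]
  exact totalDegree_finsetSum_le fun b _ => totalDegree_pderiv_le ((P.2.1 t).deg c a b) b

theorem dvgL_eq (P : M.sigmaSpace r) (t : Fin M.Nh) (c : Fin 3) (a : Fin 2) :
    dvgL c a (P.1 t) = dvgL 0 a (P.1 t) := (P.2.1 t).div c 0 a

variable (κ : Fin M.Nh → Fin M.N) (lam mu : Fin M.Nh → ℝ)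

/-- The energy form on a coarse element. -/
noncomputable def discA (k : Fin M.N) : M.sigmaSpace r →ₗ[ℝ] M.sigmaSpace r →ₗ[ℝ] ℝ :=
  ∑ t with κ t = k, (elemForm (M.tri t) (1 / (2 * mu t)) (1 / (lam t + mu t))).compl₁₂
    (LinearMap.proj t ∘ₗ (M.sigmaSpace r).subtype) (LinearMap.proj t ∘ₗ (M.sigmaSpace r).subtype)

theorem discA_apply (k : Fin M.N) (P Q : M.sigmaSpace r) : discA κ lam mu k P Q =
    ∑ t with κ t = k, elemForm (M.tri t) (1 / (2 * mu t)) (1 / (lam t + mu t)) (P.1 t) (Q.1 t) := by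
  simp [discA, LinearMap.sum_apply]

/-- The weight of the displacements on a fine triangle. -/
noncomputable def kT (t : Fin M.Nh) : ℝ := (lam t + 2 * mu t) / M.H ^ 2

/-- The weighted form of the displacements on a coarse element. -/
noncomputable def discS (k : Fin M.N) : DispSpace M r →ₗ[ℝ] DispSpace M r →ₗ[ℝ] ℝ :=
  ∑ t with κ t = k, kT lam mu t • ∑ c, ∑ a,
    (polyForm (isCompact_triangle (subV (M.tri t) c))).compl₁₂
      ((restrictTotalDegree (Fin 2) ℝ (r - 1)).subtype ∘ₗ LinearMap.proj a ∘ₗ LinearMap.proj t)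
      ((restrictTotalDegree (Fin 2) ℝ (r - 1)).subtype ∘ₗ LinearMap.proj a ∘ₗ LinearMap.proj t)

theorem discS_apply (k : Fin M.N) (V W : DispSpace M r) : discS κ lam mu k V W =
    ∑ t with κ t = k, kT lam mu t *
      ∑ c, ∑ a, intL (M.tri t) c ((V t a : Poly2) * (W t a : Poly2)) := by
  simp [discS, LinearMap.sum_apply, polyForm_eq_intL]

/-- The weighted divergence. -/
noncomputable def discD : M.sigmaSpace r →ₗ[ℝ] DispSpace M r where
  toFun P t a := (kT lam mu t)⁻¹ • ⟨dvgL 0 a (P.1 t), dvg_mem P t 0 a⟩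
  map_add' P Q := by
    funext t a
    ext1
    simp only [Submodule.coe_add, Pi.add_apply, map_add, Submodule.coe_smul, smul_add]
  map_smul' k P := by
    funext t a
    ext1
    simp only [Submodule.coe_smul, Pi.smul_apply, map_smul, RingHom.id_apply]
    rw [smul_comm]

theorem coe_discD (P : M.sigmaSpace r) (t : Fin M.Nh) (a : Fin 2) :
    (discD lam mu P t a : Poly2) = (kT lam mu t)⁻¹ • dvgL 0 a (P.1 t) := rfl

theorem discS_discD_self (hk : ∀ t, kT lam mu t ≠ 0) (k : Fin M.N) (P : M.sigmaSpace r) :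
    discS κ lam mu k (discD lam mu P) (discD lam mu P) =
      ∑ t with κ t = k, (kT lam mu t)⁻¹ * nrmDvg (M.tri t) (P.1 t) := by
  rw [discS_apply]
  refine Finset.sum_congr rfl fun t _ => ?_
  have e : ∀ c a, intL (M.tri t) c ((discD lam mu P t a : Poly2) * (discD lam mu P t a : Poly2)) =
      (kT lam mu t)⁻¹ ^ 2 * sqI (M.tri t) c (dvgL c a (P.1 t)) := fun c a => by
    rw [coe_discD, ← polyForm_eq_intL, ← sqI_eq_polyForm, sqI_smul, dvgL_eq P t c a]
  simp only [e, ← Finset.mul_sum]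
  rw [← mul_assoc, nrmDvg, sq, ← mul_assoc, mul_inv_cancel₀ (hk t), one_mul]

/-- Discrete stresses can be cut off along a function of the coarse elements. -/
theorem exists_cutoff {r : ℕ} (hr : 2 ≤ r) {γ : ℝ} (hγ : 0 < γ) : ∃ C₀ : ℝ, 0 ≤ C₀ ∧
    ∀ M : TwoScaleMesh, M.IsRegular γ → ∀ κ : Fin M.Nh → Fin M.N, (∀ t, M.T t ⊆ M.K (κ t)) →
      ∀ lam mu : Fin M.Nh → ℝ, (∀ t, 0 ≤ lam t) → (∀ t, 0 < mu t) → ∀ d : Fin M.N → ℕ,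
      (∀ k j, (M.K k ∩ M.K j).Nonempty → d k ≤ d j + 1) →
      ∀ (f : ℕ → ℝ) (τ : M.sigmaSpace r), ∃ τ' : M.sigmaSpace r, ∀ k,
        discA κ lam mu k (τ' - f (d k) • τ) (τ' - f (d k) • τ) ≤
          C₀ * (f (d k) - f (d k - 1)) ^ 2 * discA κ lam mu k τ τ ∧
        discS κ lam mu k (discD lam mu (τ' - f (d k) • τ)) (discD lam mu (τ' - f (d k) • τ)) ≤
          C₀ * (f (d k) - f (d k - 1)) ^ 2 * (discA κ lam mu k τ τ +
            discS κ lam mu k (discD lam mu τ) (discD lam mu τ)) := by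
  obtain ⟨K, hK, HK⟩ := exists_comb_le hr hγ
  obtain ⟨C, hC, HC⟩ := exists_coarseFun γ hγ
  refine ⟨4 * (K * C ^ 2), by positivity, fun M hM κ hκ lam mu hlam hmu d hd f τ => ?_⟩
  obtain ⟨g, hg⟩ := HC M hM d hd f
  have hreg : ∀ t, IsShapeRegular γ (M.tri t) := fun t =>
    ⟨hM.fine_nondegenerate t, hM.fine_shapeRegular t⟩
  choose Q hQm hQs hQt hQb using fun t => HK (M.tri t) (hreg t) (τ.1 t) (τ.2.1 t)
  -- Only the values of g at the fine vertices enter; they are shared by all triangles at a vertex.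
  have hmem : (fun t => ∑ c, g (M.tri t c) • Q t c) ∈ M.sigmaSpace r :=
    ⟨fun t => (locSigma r (M.tri t)).sum_mem fun c _ =>
      (locSigma r (M.tri t)).smul_mem _ (hQm t c),
      τ.2.2.comb hM.fine_nondegenerate hQt g⟩
  have hkT : ∀ t, 0 < kT lam mu t := fun t => by
    have := hM.H_pos (κ t)
    have := hlam t
    have := hmu t
    rw [kT]
    positivity
  refine ⟨⟨_, hmem⟩, fun k => ?_⟩
  set Δ := |f (d k) - f (d k - 1)| with hΔ
  have hΔ2 : Δ ^ 2 = (f (d k) - f (d k - 1)) ^ 2 := sq_abs _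
  set σ := (⟨_, hmem⟩ : M.sigmaSpace r) - f (d k) • τ with hσ
  have hel : ∀ t, κ t = k →
      (elemForm (M.tri t) (1 / (2 * mu t)) (1 / (lam t + mu t)) (σ.1 t) (σ.1 t) ≤
        K * C ^ 2 * Δ ^ 2 *
          elemForm (M.tri t) (1 / (2 * mu t)) (1 / (lam t + mu t)) (τ.1 t) (τ.1 t)) ∧
      (kT lam mu t)⁻¹ * nrmDvg (M.tri t) (σ.1 t) ≤ 4 * (K * C ^ 2) * Δ ^ 2 *
        (elemForm (M.tri t) (1 / (2 * mu t)) (1 / (lam t + mu t)) (τ.1 t) (τ.1 t) +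
          (kT lam mu t)⁻¹ * nrmDvg (M.tri t) (τ.1 t)) := by
    intro t ht
    have hl := hlam t
    have hm := hmu t
    have hv : ∀ c, M.tri t c ∈ M.K k := fun c => ht ▸ hκ t (vertex_mem_triangle (M.tri t) c)
    set h := Metric.diam (triangle (M.tri t)) with hh
    have hh0 : 0 < h := diam_triangle_pos (hreg t).ne
    have hH := hM.H_pos k
    -- The parts add up to τ, so the cutoff error is again a combination of vertex parts, now with
    -- small coefficients.
    have e : σ.1 t = ∑ c, (g (M.tri t c) - f (d k)) • Q t c := by
      have : σ.1 t = ∑ c, g (M.tri t c) • Q t c - f (d k) • τ.1 t := rfl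
      rw [this, ← hQs t]
      simp only [sub_smul, Finset.sum_sub_distrib, Finset.smul_sum]
    obtain ⟨h1, h2⟩ := hQb t (fun c => g (M.tri t c) - f (d k)) (C * Δ) (C * Δ / M.H * h)
      (fun c => (hg k).1 _ (hv c)) (fun c c' => by
        have h3 := (hg k).2 _ (hv c) _ (hv c')
        have h4 : dist (M.tri t c) (M.tri t c') ≤ h :=
          Metric.dist_le_diam_of_mem (isCompact_triangle _).isBounded
            (vertex_mem_triangle _ _) (vertex_mem_triangle _ _)
        rw [sub_sub_sub_cancel_right]
        refine h3.trans ?_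
        gcongr)
    rw [← e] at h1 h2
    have hbe : 1 / (lam t + mu t) ≤ 2 * (1 / (2 * mu t)) := by
      rw [show 2 * (1 / (2 * mu t)) = 1 / mu t by field_simp]
      exact one_div_le_one_div_of_le hm (by linarith)
    refine ⟨(h1 _ _ (by positivity) hbe).trans_eq (by ring), ?_⟩
    set A := elemForm (M.tri t) (1 / (2 * mu t)) (1 / (lam t + mu t)) (τ.1 t) (τ.1 t) with hA
    have hn : 1 / (lam t + 2 * mu t) * nrm (M.tri t) (τ.1 t) ≤ 4 * A :=
      nrm_le_elemForm (by positivity) (one_div_le_one_div_of_le (by positivity) (by linarith))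
        (one_div_le_one_div_of_le (by positivity) (by linarith)) _
    have hN := nrmDvg_nonneg (M.tri t) (τ.1 t)
    have hk0 := hkT t
    -- The oscillation of g on the triangle is its slope times h, so h² cancels, and (k̃H²)⁻¹ = 1/(λ
    -- + 2μ) is the weight controlled by the energy.
    calc _ ≤ (kT lam mu t)⁻¹ * (K * ((C * Δ) ^ 2 * nrmDvg (M.tri t) (τ.1 t) +
          (C * Δ / M.H * h) ^ 2 * (h ^ 2)⁻¹ * nrm (M.tri t) (τ.1 t))) := by gcongr
      _ = K * C ^ 2 * Δ ^ 2 * ((kT lam mu t)⁻¹ * nrmDvg (M.tri t) (τ.1 t) +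
          1 / (lam t + 2 * mu t) * nrm (M.tri t) (τ.1 t)) := by
          rw [kT]
          field_simp
      _ ≤ K * C ^ 2 * Δ ^ 2 * (4 * ((kT lam mu t)⁻¹ * nrmDvg (M.tri t) (τ.1 t)) + 4 * A) := by
          have : 0 ≤ (kT lam mu t)⁻¹ * nrmDvg (M.tri t) (τ.1 t) := by positivity
          refine mul_le_mul_of_nonneg_left ?_ (by positivity)
          linarith
      _ = _ := by ring
  have hA0 : ∀ t, 0 ≤ elemForm (M.tri t) (1 / (2 * mu t)) (1 / (lam t + mu t)) (τ.1 t) (τ.1 t) :=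
    fun t => elemForm_nonneg (by have := hmu t; positivity)
      (by have := hmu t; have := hlam t; positivity) _
  constructor
  · rw [discA_apply, discA_apply, Finset.mul_sum, ← hΔ2]
    refine Finset.sum_le_sum fun t ht => ((hel t (Finset.mem_filter.1 ht).2).1).trans ?_
    have h0 := mul_nonneg (by positivity : 0 ≤ K * C ^ 2 * Δ ^ 2) (hA0 t)
    linarith
  · rw [discS_discD_self _ _ _ (fun t => (hkT t).ne'),
      discS_discD_self _ _ _ (fun t => (hkT t).ne'), discA_apply, ← Finset.sum_add_distrib,
      Finset.mul_sum, ← hΔ2]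
    exact Finset.sum_le_sum fun t ht => (hel t (Finset.mem_filter.1 ht).2).2

end TwoScaleMesh

end Elast

/-! ### Correspondence between fields and families of polynomials. -/

namespace Elast

open MvPolynomial MeasureTheory

namespace TwoScaleMesh

variable (M : TwoScaleMesh)

/-- The open parts of the fine triangles. -/
def part (i : Fin M.Nh × Fin 3) : Set Plane := interior (triangle (subV (M.tri i.1) i.2))

/-- The polynomials `P` represent the tensor field `τ`. -/
def Rep (τ : Plane → Matrix (Fin 2) (Fin 2) ℝ) (P : Fin M.Nh → TriField) : Prop :=
  ∀ t c, ∀ x ∈ M.part (t, c), ∀ a b, τ x a b = pev x (P t c a b)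

/-- The polynomials `V` represent the vector field `v`. -/
def RepU {r : ℕ} (v : Plane → Plane) (V : DispSpace M r) : Prop :=
  ∀ t c, ∀ x ∈ M.part (t, c), ∀ a, v x a = pev x (V t a : Poly2)

variable {M} {γ : ℝ} {r : ℕ}

theorem isOpen_part (i : Fin M.Nh × Fin 3) : IsOpen (M.part i) := isOpen_interior

theorem part_ae_eq (i : Fin M.Nh × Fin 3) :
    M.part i =ᵐ[volume] triangle (subV (M.tri i.1) i.2) := interior_triangle_ae_eq _

section

variable (hM : M.IsRegular γ)
include hM

theorem IsRegular.part_nonempty (i : Fin M.Nh × Fin 3) : (M.part i).Nonempty :=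
  interior_triangle_nonempty (cross3_subV_ne (hM.cross3_ne i.1) i.2)

theorem IsRegular.part_subset (i : Fin M.Nh × Fin 3) : M.part i ⊆ interior (M.T i.1) :=
  interior_subV_subset (hM.cross3_ne i.1) i.2

theorem IsRegular.part_disjoint {i j : Fin M.Nh × Fin 3} (h : i ≠ j) :
    Disjoint (M.part i) (M.part j) := by
  obtain ⟨t, c⟩ := i
  obtain ⟨u, c'⟩ := j
  by_cases htu : t = u
  · subst htu
    exact disjoint_interior_subV (hM.cross3_ne t) fun hc : c = c' => h (by rw [hc])
  · exact (hM.fine_disjoint t u htu).mono (hM.part_subset (t, c)) (hM.part_subset (u, c'))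

/-- The open parts miss only boundaries of triangles, which are null sets. -/
theorem IsRegular.iUnion_part_ae : ⋃ i, M.part i =ᵐ[volume] M.Ω := by
  have h1 : (⋃ i, M.part i) =ᵐ[volume] ⋃ i : Fin M.Nh × Fin 3, triangle (subV (M.tri i.1) i.2) :=
    Filter.EventuallyEq.countable_iUnion fun i => part_ae_eq i
  have h2 : (⋃ i : Fin M.Nh × Fin 3, triangle (subV (M.tri i.1) i.2)) = ⋃ i, M.K i := by
    rw [← hM.fine_covers, Set.iUnion_prod']
    exact Set.iUnion_congr fun t => (triangle_eq_iUnion_subV (hM.cross3_ne t)).symm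
  refine Filter.EventuallyLE.antisymm (Filter.Eventually.of_forall ?_) ?_
  · refine Set.iUnion_subset fun i => interior_maximal ?_ (isOpen_part i)
    rw [← hM.fine_covers]
    exact ((hM.part_subset i).trans interior_subset).trans
      (Set.subset_iUnion (fun t => M.T t) i.1)
  · refine Filter.EventuallyLE.trans (Filter.Eventually.of_forall ?_) h1.symm.le
    rw [h2]
    exact interior_subset

theorem IsRegular.ae_mem_part : ∀ᵐ x ∂(volume.restrict M.Ω), ∃ i, x ∈ M.part i := by
  rw [← Measure.restrict_congr_set hM.iUnion_part_ae]
  filter_upwards [ae_restrict_mem (MeasurableSet.iUnion fun i => (isOpen_part i).measurableSet)]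
    with x hx
  exact Set.mem_iUnion.1 hx

end

section

variable (hM : M.IsRegular γ) (hγ : 0 < γ) {κ : Fin M.Nh → Fin M.N} (hκ : ∀ t, M.T t ⊆ M.K (κ t))
include hM hκ

theorem IsRegular.part_subset_K (i : Fin M.Nh × Fin 3) : M.part i ⊆ M.K (κ i.1) :=
  ((hM.part_subset i).trans interior_subset).trans (hκ i.1)

include hγ

/-- An open part lies in the interior of its coarse element, which no other coarse element meets. -/
theorem IsRegular.eq_of_mem_part {i : Fin M.Nh × Fin 3} {k : Fin M.N} {x : Plane}
    (hx : x ∈ M.part i) (hk : x ∈ M.K k) : κ i.1 = k := by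
  by_contra h
  exact Set.disjoint_left.1 (hM.disjoint_interior_K hγ h)
    (interior_maximal (hM.part_subset_K hκ i) (isOpen_part i) hx) hk

theorem IsRegular.biUnion_part_ae (k : Fin M.N) :
    ⋃ i ∈ Finset.univ.filter (fun i : Fin M.Nh × Fin 3 => κ i.1 = k), M.part i =ᵐ[volume]
      M.K k := by
  have h1 : (⋃ i, M.part i) =ᵐ[volume] ⋃ i : Fin M.Nh × Fin 3, triangle (subV (M.tri i.1) i.2) :=
    Filter.EventuallyEq.countable_iUnion fun i => part_ae_eq i
  have h2 : (⋃ i : Fin M.Nh × Fin 3, triangle (subV (M.tri i.1) i.2)) = ⋃ i, M.K i := by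
    rw [← hM.fine_covers, Set.iUnion_prod']
    exact Set.iUnion_congr fun t => (triangle_eq_iUnion_subV (hM.cross3_ne t)).symm
  refine Filter.EventuallyLE.antisymm (Filter.Eventually.of_forall ?_) ?_
  · refine Set.iUnion₂_subset fun i hi => ?_
    rw [← (Finset.mem_filter.1 hi).2]
    exact hM.part_subset_K hκ i
  · filter_upwards [h1.symm.le] with x hx hk
    rw [h2] at hx
    obtain ⟨i, hi⟩ := Set.mem_iUnion.1 (hx (Set.mem_iUnion.2 ⟨k, hk⟩))
    exact Set.mem_iUnion₂.2 ⟨i, by simp [hM.eq_of_mem_part hγ hκ hi hk], hi⟩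

end

section

variable (hM : M.IsRegular γ)
include hM

theorem IsRegular.setIntegral_eq_sum {J : Finset (Fin M.Nh × Fin 3)} {A : Set Plane}
    (hA : ⋃ i ∈ J, M.part i =ᵐ[volume] A) {f : Plane → ℝ} {g : Fin M.Nh × Fin 3 → Plane → ℝ}
    (hg : ∀ i, Continuous (g i)) (hf : ∀ i ∈ J, ∀ x ∈ M.part i, f x = g i x) :
    ∫ x in A, f x = ∑ i ∈ J, ∫ x in triangle (subV (M.tri i.1) i.2), g i x := by
  have hint : ∀ i, IntegrableOn (g i) (M.part i) := fun i =>
    ((hg i).continuousOn.integrableOn_compact (isCompact_triangle _)).mono_set interior_subset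
  rw [← setIntegral_congr_set hA, integral_biUnion_finset J
    (fun i _ => (isOpen_part i).measurableSet) (fun i _ j _ h => hM.part_disjoint h)
    (fun i hi => (hint i).congr_fun (fun x hx => (hf i hi x hx).symm)
      (isOpen_part i).measurableSet)]
  refine Finset.sum_congr rfl fun i hi => ?_
  rw [setIntegral_congr_fun (isOpen_part i).measurableSet (fun x hx => hf i hi x hx)]
  exact setIntegral_congr_set (part_ae_eq i)

theorem IsRegular.setIntegral_Ω {f : Plane → ℝ} {g : Fin M.Nh × Fin 3 → Plane → ℝ}
    (hg : ∀ i, Continuous (g i)) (hf : ∀ i, ∀ x ∈ M.part i, f x = g i x) :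
    ∫ x in M.Ω, f x = ∑ t, ∑ c, ∫ x in triangle (subV (M.tri t) c), g (t, c) x := by
  rw [hM.setIntegral_eq_sum (J := Finset.univ) (g := g) (by simpa using hM.iUnion_part_ae) hg
    (fun i _ => hf i), Fintype.sum_prod_type]

theorem IsRegular.setIntegral_Ω_pev {f : Plane → ℝ} {e : Fin M.Nh → Fin 3 → Poly2}
    (hf : ∀ t c, ∀ x ∈ M.part (t, c), f x = pev x (e t c)) :
    ∫ x in M.Ω, f x = ∑ t, ∑ c, intL (M.tri t) c (e t c) := by
  simp only [intL_apply]
  exact hM.setIntegral_Ω (g := fun i x => pev x (e i.1 i.2)) (fun i => continuous_pev _)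
    fun i => hf i.1 i.2

theorem IsRegular.setIntegral_K_pev (hγ : 0 < γ) {κ : Fin M.Nh → Fin M.N}
    (hκ : ∀ t, M.T t ⊆ M.K (κ t)) (k : Fin M.N) {f : Plane → ℝ} {e : Fin M.Nh → Fin 3 → Poly2}
    (hf : ∀ t c, ∀ x ∈ M.part (t, c), f x = pev x (e t c)) :
    ∫ x in M.K k, f x = ∑ t with κ t = k, ∑ c, intL (M.tri t) c (e t c) := by
  rw [hM.setIntegral_eq_sum (hM.biUnion_part_ae hγ hκ k) (g := fun i x => pev x (e i.1 i.2))
    (fun i => continuous_pev _) fun i _ => hf i.1 i.2]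
  simp only [intL_apply, Finset.sum_filter, Fintype.sum_prod_type]
  refine Finset.sum_congr rfl fun t _ => ?_
  split_ifs <;> simp

end

theorem Rep.divT_eq {τ : Plane → Matrix (Fin 2) (Fin 2) ℝ} {P : Fin M.Nh → TriField}
    (h : M.Rep τ P) (t : Fin M.Nh) (c : Fin 3) {x : Plane} (hx : x ∈ M.part (t, c)) (a : Fin 2) :
    divT τ x a = pev x (dvgL c a (P t)) := by
  simp only [divT, dvgL_apply, map_sum]
  refine Finset.sum_congr rfl fun b _ => ?_
  rw [← partialD_pev, partialD, partialD]
  congr 1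
  refine Filter.EventuallyEq.fderiv_eq ?_
  filter_upwards [(isOpen_part (t, c)).mem_nhds hx] with y hy
  exact h t c y hy a b

theorem partialD_mul {f g : Plane → ℝ} {x : Plane} (hf : DifferentiableAt ℝ f x)
    (hg : DifferentiableAt ℝ g x) (b : Fin 2) :
    partialD b (fun y => f y * g y) x = partialD b f x * g x + f x * partialD b g x := by
  simp only [partialD]
  rw [fderiv_fun_mul hf hg]
  simp only [_root_.add_apply, _root_.smul_apply, smul_eq_mul]
  ring

theorem continuous_partialD {f : Plane → ℝ} (hf : ContDiff ℝ ∞ f) (b : Fin 2) :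
    Continuous (partialD b f) :=
  (hf.continuous_fderiv (by simp)).clm_apply continuous_const

theorem contDiff_comp {φ : Plane → Plane} (hφ : ContDiff ℝ ∞ φ) (a : Fin 2) :
    ContDiff ℝ ∞ (fun x => φ x a) := (contDiff_piLp_apply 2).comp hφ

/-- Product rule on each open part. What separates the piecewise divergence from the distributional
one is the integral of the total derivative, the quantity tested in `WeakDiv`. -/
theorem IsRegular.hdiv_identity (hM : M.IsRegular γ) {τ : Plane → Matrix (Fin 2) (Fin 2) ℝ}
    {P : Fin M.Nh → TriField} (h : M.Rep τ P) {φ : Plane → Plane} (hφ : ContDiff ℝ ∞ φ) :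
    ∫ x in M.Ω, ∑ a, ∑ b, τ x a b * partialD b (fun y => φ y a) x =
      ∑ a, (∑ t, ∑ c, ∑ b, ∫ x in triangle (subV (M.tri t) c),
        partialD b (fun x => pev x (P t c a b) * φ x a) x) -
      ∫ x in M.Ω, inner ℝ (divT τ x) (φ x) := by
  have hc : ∀ a b, Continuous (fun x => partialD b (fun y => φ y a) x) := fun a b =>
    continuous_partialD (contDiff_comp hφ a) b
  have hφc : ∀ a, Continuous (fun x => φ x a) := fun a => (contDiff_comp hφ a).continuous
  rw [hM.setIntegral_Ω (g := fun i x => ∑ a, ∑ b, pev x (P i.1 i.2 a b) *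
      partialD b (fun y => φ y a) x)
    (fun i => continuous_finsetSum _ fun a _ => continuous_finsetSum _ fun b _ =>
      (continuous_pev _).mul (hc a b))
    (fun i x hx => Finset.sum_congr rfl fun a _ => Finset.sum_congr rfl fun b _ => by
      rw [h i.1 i.2 x hx]),
    hM.setIntegral_Ω (f := fun x => inner ℝ (divT τ x) (φ x))
    (g := fun i x => ∑ a, pev x (dvgL i.2 a (P i.1)) * φ x a)
    (fun i => continuous_finsetSum _ fun a _ => (continuous_pev _).mul (hφc a))
    (fun i x hx => by
      simp only [PiLp.inner_apply, RCLike.inner_apply, conj_trivial]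
      exact Finset.sum_congr rfl fun a _ => by rw [h.divT_eq i.1 i.2 hx, mul_comm]),
    eq_sub_iff_add_eq, ← Finset.sum_add_distrib, Finset.sum_comm]
  refine Finset.sum_congr rfl fun t _ => ?_
  rw [← Finset.sum_add_distrib, Finset.sum_comm]
  refine Finset.sum_congr rfl fun c _ => ?_
  have hi : ∀ {g : Plane → ℝ}, Continuous g → IntegrableOn g (triangle (subV (M.tri t) c)) :=
    fun hg => hg.continuousOn.integrableOn_compact (isCompact_triangle _)
  have e : ∀ a b x, partialD b (fun x => pev x (P t c a b) * φ x a) x =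
      pev x (pderiv b (P t c a b)) * φ x a +
        pev x (P t c a b) * partialD b (fun y => φ y a) x := fun a b x => by
    rw [partialD_mul (differentiable_pev _ _)
      ((contDiff_comp hφ a).differentiable (by simp) x), partialD_pev]
  have hc' : ∀ a b, Continuous fun x => partialD b (fun x => pev x (P t c a b) * φ x a) x :=
    fun a b => by
      simp only [e]
      exact ((continuous_pev _).mul (hφc a)).add ((continuous_pev _).mul (hc a b))
  simp only [← integral_finsetSum _ fun b _ => hi (hc' _ b)]
  rw [← integral_finsetSum _ fun a _ => hi (continuous_finsetSum _ fun b _ => hc' a b),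
    ← integral_add (f := fun x => ∑ a, ∑ b, pev x (P t c a b) * partialD b (fun y => φ y a) x)
      (g := fun x => ∑ a, pev x (dvgL c a (P t)) * φ x a)
      (hi (continuous_finsetSum _ fun a _ => continuous_finsetSum _ fun b _ =>
        (continuous_pev _).mul (hc a b)))
      (hi (continuous_finsetSum _ fun a _ => (continuous_pev _).mul (hφc a)))]
  congr 1
  funext x
  simp only [e, dvgL_apply, map_sum, Finset.sum_add_distrib, Finset.sum_mul]
  ring

theorem IsRegular.hdiv_iff (hM : M.IsRegular γ) {τ : Plane → Matrix (Fin 2) (Fin 2) ℝ}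
    {P : Fin M.Nh → TriField} (h : M.Rep τ P) : IsHdivNeumann M τ ↔ M.WeakDiv P := by
  constructor
  · intro hd a η hη hηc
    have hφ : ContDiff ℝ ∞ (fun x : Plane => (EuclideanSpace.single a (η x) : Plane)) := by
      rw [contDiff_piLp]
      intro b
      by_cases hb : b = a
      · subst hb; simpa using hη
      · simpa [PiLp.single_apply, hb] using contDiff_const
    have h1 := hd _ hφ (hηc.comp_left (g := fun s => (EuclideanSpace.single a s : Plane))
      (by simp))
    rw [hM.hdiv_identity h hφ, sub_eq_neg_self] at h1
    rw [Finset.sum_eq_single a] at h1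
    · simpa using h1
    · intro b _ hb
      simp [hb, partialD]
    · simp
  · intro hw φ hφ hφc
    rw [hM.hdiv_identity h hφ, Finset.sum_eq_zero, zero_sub]
    exact fun a _ => hw a _ (contDiff_comp hφ a)
      (hφc.comp_left (g := fun y : Plane => y a) (by simp))

section

variable (hM : M.IsRegular γ)
include hM

/-- Polynomials are determined on the open parts, which transfers symmetry and the common
divergence; the continuity conditions come from the weak form by localization. -/
theorem IsRegular.exists_rep {τ : Plane → Matrix (Fin 2) (Fin 2) ℝ} (h : MemSigma M r τ) :
    ∃ P : M.sigmaSpace r, M.Rep τ P := by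
  choose P hPd hP using h.poly
  have hrep : M.Rep τ P := fun t c x hx a b => hP t c a b x hx
  have hw := (hM.hdiv_iff hrep).1 h.hdiv
  refine ⟨⟨P, fun t => ⟨fun c a b => hPd t c a b, fun c a b => ?_, fun c c' a => ?_,
    fun m a s hs => hM.inner_of_weakDiv hw t m a hs⟩, hM.edgeCond_of_weakDiv hw⟩, hrep⟩
  · refine poly_ext_of_isOpen (isOpen_part (t, c)) (hM.part_nonempty _) fun x hx => ?_
    rw [← hrep t c x hx, ← hrep t c x hx]
    exact (h.symm t c x hx).apply b a
  · obtain ⟨Q, _, hQ⟩ := h.div_poly t a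
    have : ∀ c, dvgL c a (P t) = Q := fun c =>
      poly_ext_of_isOpen (isOpen_part (t, c)) (hM.part_nonempty _) fun x hx => by
        rw [← hrep.divT_eq t c hx]
        exact hQ x (Set.mem_iUnion.2 ⟨c, hx⟩)
    exact (this c).trans (this c').symm

theorem IsRegular.memSigma {τ : Plane → Matrix (Fin 2) (Fin 2) ℝ} {P : M.sigmaSpace r}
    (h : M.Rep τ P) : MemSigma M r τ where
  symm t c x hx := by
    ext a b
    rw [Matrix.transpose_apply, h t c x hx, h t c x hx, (P.2.1 t).symm]
  poly t c a b := ⟨P.1 t c a b, (P.2.1 t).deg c a b, fun x hx => h t c x hx a b⟩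
  div_poly t a := ⟨dvgL 0 a (P.1 t), (mem_restrictTotalDegree _ _ _).1 (dvg_mem P t 0 a),
    fun x hx => by
      obtain ⟨c, hc⟩ := Set.mem_iUnion.1 hx
      exact (h.divT_eq t c hc a).trans (by rw [dvgL_eq]; rfl)⟩
  hdiv := (hM.hdiv_iff h).2 (hM.weakDiv_of_edgeCond (fun t => (P.2.1 t).inner) P.2.2)

theorem IsRegular.exists_repU {v : Plane → Plane} (h : MemU M r v) :
    ∃ V : DispSpace M r, M.RepU v V := by
  choose V hVd hV using h
  exact ⟨fun t a => ⟨V t a, (mem_restrictTotalDegree _ _ _).2 (hVd t a)⟩,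
    fun t c x hx a => hV t a x (hM.part_subset (t, c) hx)⟩

/-- Values off the open parts are irrelevant, so the field is set to zero there. -/
theorem IsRegular.exists_memSigma (P : M.sigmaSpace r) :
    ∃ τ, MemSigma M r τ ∧ M.Rep τ P := by
  classical
  set F : Fin M.Nh × Fin 3 → Plane → Matrix (Fin 2) (Fin 2) ℝ :=
    fun i x a b => pev x (P.1 i.1 i.2 a b) with hF
  have h0 : ∀ i, ∀ x ∈ M.part i, ∑ i, (M.part i).indicator (F i) x = F i x := fun i x hx => by
    rw [Finset.sum_eq_single i]
    · exact Set.indicator_of_mem hx _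
    · exact fun j _ hj => Set.indicator_of_notMem
        (fun h' => Set.disjoint_left.1 (hM.part_disjoint hj) h' hx) _
    · simp
  have h : M.Rep (fun x => ∑ i, (M.part i).indicator (F i) x) P := fun t c x hx a b =>
    congrFun (congrFun (h0 (t, c) x hx) a) b
  exact ⟨_, hM.memSigma h, h⟩

theorem IsRegular.exists_memU (V : DispSpace M r) : ∃ v, MemU M r v ∧ M.RepU v V := by
  classical
  have h : ∀ t, ∀ x ∈ interior (M.T t), ∀ a, (∑ t, (interior (M.T t)).indicator
      (fun x => (WithLp.toLp 2 fun a => pev x (V t a : Poly2) : Plane)) x) a =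
        pev x (V t a : Poly2) := fun t x hx a => by
    rw [Finset.sum_eq_single t]
    · rw [Set.indicator_of_mem hx]
    · exact fun u _ hu => Set.indicator_of_notMem
        (fun h' => Set.disjoint_left.1 (hM.fine_disjoint u t hu) h' hx) _
    · simp
  exact ⟨_, fun t a => ⟨V t a, (mem_restrictTotalDegree _ _ _).1 (V t a).2, fun x hx => h t x hx a⟩,
    fun t c x hx a => h t x (hM.part_subset (t, c) hx) a⟩

end

end TwoScaleMesh

end Elast

/-! ### Forms, norms and supports in terms of polynomial families. -/

namespace Elast

open MvPolynomial MeasureTheory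

theorem sqI_eq_zero {v : Fin 3 → Plane} (hv : cross3 v ≠ 0) {c : Fin 3} {p : Poly2}
    (h : sqI v c p = 0) : p = 0 := by
  by_contra hp
  rw [sqI_eq_polyForm] at h
  exact (polyForm_pos (isCompact_triangle (subV v c))
    (interior_triangle_nonempty (cross3_subV_ne hv c)) hp).ne' h

theorem nrm_eq_zero {v : Fin 3 → Plane} (hv : cross3 v ≠ 0) {P : TriField}
    (h : nrm v P = 0) : P = 0 := by
  funext c a b
  refine sqI_eq_zero hv (c := c) (le_antisymm ?_ (sqI_nonneg _ _ _))
  exact h ▸ sqI_le_nrm v P c a b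

theorem elemForm_apply (v : Fin 3 → Plane) (al be : ℝ) (P Q : TriField) :
    elemForm v al be P Q = ∑ c, intL v c (al • (∑ a, ∑ b, devF P c a b * devF Q c a b) +
      be • (halfTr P c * halfTr Q c)) := by
  simp [elemForm, nrmForm, LinearMap.sum_apply, polyForm_eq_intL, devL, halfTrL,
    Finset.sum_add_distrib, Finset.mul_sum, mul_add]

theorem elemForm_symm (v : Fin 3 → Plane) (al be : ℝ) (P Q : TriField) :
    elemForm v al be P Q = elemForm v al be Q P := by
  rw [elemForm_apply, elemForm_apply]
  refine Finset.sum_congr rfl fun c _ => ?_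
  have e : ∑ a, ∑ b, devF P c a b * devF Q c a b = ∑ a, ∑ b, devF Q c a b * devF P c a b :=
    Finset.sum_congr rfl fun a _ => Finset.sum_congr rfl fun b _ => mul_comm _ _
  rw [mul_comm (halfTr P c), e]

namespace TwoScaleMesh

variable {M : TwoScaleMesh} {γ : ℝ} {r : ℕ}

section

variable (κ : Fin M.Nh → Fin M.N) (lam mu : Fin M.Nh → ℝ)

theorem sum_discA (P Q : M.sigmaSpace r) : ∑ k, discA κ lam mu k P Q =
    ∑ t, elemForm (M.tri t) (1 / (2 * mu t)) (1 / (lam t + mu t)) (P.1 t) (Q.1 t) := by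
  simp only [discA_apply]
  exact Finset.sum_fiberwise _ _ _

theorem sum_discS (V W : DispSpace M r) : ∑ k, discS κ lam mu k V W =
    ∑ t, kT lam mu t * ∑ c, ∑ a, intL (M.tri t) c ((V t a : Poly2) * (W t a : Poly2)) := by
  simp only [discS_apply]
  exact Finset.sum_fiberwise _ _ _

theorem discA_symm (k : Fin M.N) (P Q : M.sigmaSpace r) :
    discA κ lam mu k P Q = discA κ lam mu k Q P := by
  rw [discA_apply, discA_apply]
  exact Finset.sum_congr rfl fun t _ => elemForm_symm _ _ _ _ _

theorem discS_symm (k : Fin M.N) (V W : DispSpace M r) :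
    discS κ lam mu k V W = discS κ lam mu k W V := by
  rw [discS_apply, discS_apply]
  refine Finset.sum_congr rfl fun t _ => ?_
  congr 1
  exact Finset.sum_congr rfl fun c _ => Finset.sum_congr rfl fun a _ => by rw [mul_comm]

variable {κ lam mu}

theorem discA_nonneg (hl : ∀ t, 0 ≤ lam t) (hm : ∀ t, 0 < mu t) (k : Fin M.N)
    (P : M.sigmaSpace r) : 0 ≤ discA κ lam mu k P P := by
  rw [discA_apply]
  exact Finset.sum_nonneg fun t _ => elemForm_nonneg (by have := hm t; positivity)
      (by have := hm t; have := hl t; positivity) _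

theorem intL_sq (v : Fin 3 → Plane) (c : Fin 3) (p : Poly2) : intL v c (p * p) = sqI v c p := by
  rw [sqI_eq_polyForm, polyForm_eq_intL]

theorem discS_nonneg (hk : ∀ t, 0 < kT lam mu t) (k : Fin M.N) (V : DispSpace M r) :
    0 ≤ discS κ lam mu k V V := by
  rw [discS_apply]
  refine Finset.sum_nonneg fun t _ => mul_nonneg (hk t).le
    (Finset.sum_nonneg fun c _ => Finset.sum_nonneg fun a _ => ?_)
  rw [intL_sq]
  exact sqI_nonneg _ _ _

theorem discA_self_eq_zero (hne : ∀ t, cross3 (M.tri t) ≠ 0) (hl : ∀ t, 0 ≤ lam t)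
    (hm : ∀ t, 0 < mu t) {k : Fin M.N} {P : M.sigmaSpace r} :
    discA κ lam mu k P P = 0 ↔ ∀ t, κ t = k → P.1 t = 0 := by
  rw [discA_apply, Finset.sum_eq_zero_iff_of_nonneg fun t _ => elemForm_nonneg
    (by have := hm t; positivity) (by have := hm t; have := hl t; positivity) _]
  simp only [Finset.mem_filter, Finset.mem_univ, true_and]
  refine forall₂_congr fun t _ => ⟨fun h => ?_, fun h => by simp [h]⟩
  have h1 := hl t
  have h2 := hm t
  have h3 : 1 / (lam t + 2 * mu t) * nrm (M.tri t) (P.1 t) ≤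
      4 * elemForm (M.tri t) (1 / (2 * mu t)) (1 / (lam t + mu t)) (P.1 t) (P.1 t) :=
    nrm_le_elemForm (by positivity) (one_div_le_one_div_of_le (by positivity) (by linarith))
      (one_div_le_one_div_of_le (by positivity) (by linarith)) _
  rw [h, mul_zero] at h3
  refine nrm_eq_zero (hne t) (le_antisymm ?_ (nrm_nonneg _ _))
  exact nonpos_of_mul_nonpos_right h3 (by positivity)

theorem discS_self_eq_zero (hne : ∀ t, cross3 (M.tri t) ≠ 0) (hk : ∀ t, 0 < kT lam mu t)
    {k : Fin M.N} {V : DispSpace M r} :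
    discS κ lam mu k V V = 0 ↔ ∀ t, κ t = k → V t = 0 := by
  have h0 : ∀ t c, 0 ≤ ∑ a, sqI (M.tri t) c (V t a : Poly2) := fun t c =>
    Finset.sum_nonneg fun a _ => sqI_nonneg _ _ _
  simp only [discS_apply, intL_sq]
  rw [Finset.sum_eq_zero_iff_of_nonneg fun t _ => mul_nonneg (hk t).le
    (Finset.sum_nonneg fun c _ => h0 t c)]
  simp only [Finset.mem_filter, Finset.mem_univ, true_and]
  refine forall₂_congr fun t _ => ⟨fun h => ?_, fun h => by simp [h, sqI]⟩
  have h1 := (mul_eq_zero.1 h).resolve_left (hk t).ne'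
  have h2 := (Finset.sum_eq_zero_iff_of_nonneg fun c _ => h0 t c).1 h1 0 (Finset.mem_univ _)
  funext a
  exact Subtype.ext (sqI_eq_zero (hne t) ((Finset.sum_eq_zero_iff_of_nonneg
    fun a _ => sqI_nonneg _ _ _).1 h2 a (Finset.mem_univ _)))

theorem exists_restrict (hne : ∀ t, cross3 (M.tri t) ≠ 0) (hk : ∀ t, 0 < kT lam mu t)
    (k : Fin M.N) (V : DispSpace M r) : ∃ V' : DispSpace M r,
      (∀ m, m ≠ k → discS κ lam mu m V' V' = 0) ∧ discS κ lam mu k (V - V') (V - V') = 0 := by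
  refine ⟨fun t => if κ t = k then V t else 0, fun m hm => ?_, ?_⟩
  · exact (discS_self_eq_zero hne hk).2 fun t ht => if_neg fun h => hm (ht.symm.trans h)
  · refine (discS_self_eq_zero hne hk).2 fun t ht => ?_
    rw [Pi.sub_apply, if_pos ht, sub_self]

end

section

variable (hM : M.IsRegular γ) {κ : Fin M.Nh → Fin M.N} (hκ : ∀ t, M.T t ⊆ M.K (κ t))
  {lam mu : Plane → ℝ} {lt mt : Fin M.Nh → ℝ}
  (hl : ∀ t, ∀ x ∈ interior (M.T t), lam x = lt t) (hm : ∀ t, ∀ x ∈ interior (M.T t), mu x = mt t)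

include hM hl hm

/-- Deviator and half trace diagonalize 𝒜. The weights are 1/(2μ) and 1/(λ + μ), since the trace
part of 𝒜τ : τ is (tr τ)²/(4(λ + μ)). -/
theorem IsRegular.formA_eq (hl0 : ∀ t, 0 ≤ lt t) (hm0 : ∀ t, 0 < mt t)
    {σ τ : Plane → Matrix (Fin 2) (Fin 2) ℝ} {P Q : M.sigmaSpace r}
    (hP : M.Rep σ P) (hQ : M.Rep τ Q) :
    formA M lam mu σ τ = ∑ k, discA κ lt mt k P Q := by
  rw [sum_discA, formA]
  simp only [elemForm_apply]
  refine hM.setIntegral_Ω_pev fun t c x hx => ?_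
  have hx' := hM.part_subset (t, c) hx
  have h1 := hl0 t
  have h2 := hm0 t
  have h3 : lt t + mt t ≠ 0 := by positivity
  rw [hl t x hx', hm t x hx']
  simp only [ddot, compliance, Matrix.add_apply, Matrix.smul_apply, Matrix.sub_apply,
    Matrix.trace_fin_two, Fin.sum_univ_two, hP t c x hx, hQ t c x hx, devF, halfTr, smul_eq_mul,
    pev_smul, map_add, map_mul, map_sub, pev_C, Matrix.one_apply]
  simp
  field_simp
  ring

theorem IsRegular.sLoc_eq (hγ : 0 < γ) (hκ : ∀ t, M.T t ⊆ M.K (κ t))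
    {u v : Plane → Plane} {U V : DispSpace M r} (hU : M.RepU u U) (hV : M.RepU v V)
    (k : Fin M.N) : sLoc M lam mu k u v = discS κ lt mt k U V := by
  rw [discS_apply, sLoc, hM.setIntegral_K_pev hγ hκ k
    (e := fun t _ => kT lt mt t • ∑ a, (U t a : Poly2) * (V t a : Poly2)) fun t c x hx => ?_]
  · simp only [map_smul, map_sum, smul_eq_mul, Finset.mul_sum]
  · have hx' := hM.part_subset (t, c) hx
    simp only [ktilde, kT, hl t x hx', hm t x hx', PiLp.inner_apply, RCLike.inner_apply,
      conj_trivial, hU t c x hx, hV t c x hx, pev_smul, map_sum, map_mul]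
    simp only [mul_comm (pev x (U t _ : Poly2))]

theorem IsRegular.sForm_eq (hγ : 0 < γ) (hκ : ∀ t, M.T t ⊆ M.K (κ t))
    {u v : Plane → Plane} {U V : DispSpace M r} (hU : M.RepU u U) (hV : M.RepU v V) :
    sForm M lam mu u v = ∑ k, discS κ lt mt k U V :=
  Finset.sum_congr rfl fun k _ => hM.sLoc_eq hl hm hγ hκ hU hV k

theorem IsRegular.integral_divT_sq (hk : ∀ t, kT lt mt t ≠ 0)
    {τ : Plane → Matrix (Fin 2) (Fin 2) ℝ} {P : M.sigmaSpace r} (hP : M.Rep τ P) :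
    ∫ x in M.Ω, (ktilde M lam mu x)⁻¹ * inner ℝ (divT τ x) (divT τ x) =
      ∑ k, discS κ lt mt k (discD lt mt P) (discD lt mt P) := by
  rw [sum_discS, hM.setIntegral_Ω_pev
    (e := fun t _ => (kT lt mt t)⁻¹ • ∑ a, dvgL 0 a (P.1 t) * dvgL 0 a (P.1 t)) fun t c x hx => ?_]
  · refine Finset.sum_congr rfl fun t _ => ?_
    simp only [coe_discD, map_smul, map_sum, smul_eq_mul, Finset.mul_sum, smul_mul_assoc,
      mul_smul_comm]
    refine Finset.sum_congr rfl fun c _ => Finset.sum_congr rfl fun a _ => ?_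
    rw [← mul_assoc, mul_inv_cancel₀ (hk t), one_mul]
  · have hx' := hM.part_subset (t, c) hx
    simp only [ktilde, kT, hl t x hx', hm t x hx', PiLp.inner_apply, RCLike.inner_apply,
      conj_trivial, hP.divT_eq t c hx, dvgL_eq P t c, pev_smul, map_sum, map_mul]

omit hl hm in
-- The weight of s cancels the k̃⁻¹ in the discrete divergence.
theorem IsRegular.formL2_divT (hk : ∀ t, kT lt mt t ≠ 0)
    {τ : Plane → Matrix (Fin 2) (Fin 2) ℝ} {P : M.sigmaSpace r} (hP : M.Rep τ P)
    {v : Plane → Plane} {V : DispSpace M r} (hV : M.RepU v V) :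
    formL2 M (divT τ) v = ∑ k, discS κ lt mt k (discD lt mt P) V := by
  rw [sum_discS, formL2, hM.setIntegral_Ω_pev
    (e := fun t _ => ∑ a, dvgL 0 a (P.1 t) * (V t a : Poly2)) fun t c x hx => ?_]
  · refine Finset.sum_congr rfl fun t _ => ?_
    simp only [coe_discD, map_smul, map_sum, smul_eq_mul, Finset.mul_sum, smul_mul_assoc]
    refine Finset.sum_congr rfl fun c _ => Finset.sum_congr rfl fun a _ => ?_
    rw [← mul_assoc, mul_inv_cancel₀ (hk t), one_mul]
  · simp only [PiLp.inner_apply, RCLike.inner_apply, conj_trivial, hP.divT_eq t c hx,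
      dvgL_eq P t c, hV t c x hx, map_sum, map_mul]
    exact Finset.sum_congr rfl fun a _ => mul_comm _ _

theorem IsRegular.sigmaNormSq_eq (hl0 : ∀ t, 0 ≤ lt t) (hm0 : ∀ t, 0 < mt t)
    (hk : ∀ t, kT lt mt t ≠ 0)
    {τ : Plane → Matrix (Fin 2) (Fin 2) ℝ} {P : M.sigmaSpace r} (hP : M.Rep τ P) :
    sigmaNormSq M lam mu τ = ∑ k, (discA κ lt mt k P P +
      discS κ lt mt k (discD lt mt P) (discD lt mt P)) := by
  rw [sigmaNormSq, hM.formA_eq (κ := κ) hl hm hl0 hm0 hP hP,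
    hM.integral_divT_sq (κ := κ) hl hm hk hP, Finset.sum_add_distrib]

end

section

variable (hM : M.IsRegular γ)
include hM

/-- A field that vanishes almost everywhere on a part of a triangle has zero polynomial there. -/
theorem IsRegular.eq_zero_of_ae {t : Fin M.Nh} {c : Fin 3} {p : Poly2}
    (h : ∀ᵐ x ∂(volume.restrict M.Ω), x ∈ M.part (t, c) → pev x p = 0) : p = 0 := by
  refine sqI_eq_zero (hM.cross3_ne t) (c := c) ?_
  rw [sqI, ← setIntegral_congr_set (part_ae_eq (t, c))]
  have hsub : M.part (t, c) ⊆ M.Ω := interior_maximal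
    (((hM.part_subset (t, c)).trans interior_subset).trans
      ((Set.subset_iUnion (fun t => M.T t) t).trans hM.fine_covers.le)) (isOpen_part _)
  refine (integral_congr_ae ?_).trans (integral_zero _ _)
  filter_upwards [ae_restrict_of_ae_restrict_of_subset hsub h,
    ae_restrict_mem (isOpen_part (t, c)).measurableSet] with x h1 h2
  simp [h1 h2]

variable (hγ : 0 < γ) {κ : Fin M.Nh → Fin M.N} (hκ : ∀ t, M.T t ⊆ M.K (κ t))
include hγ hκ

/-- Vanishing almost everywhere becomes exact vanishing, since a nonzero polynomial cannot vanish
almost everywhere on an open part. -/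
theorem IsRegular.rep_supp_iff {τ : Plane → Matrix (Fin 2) (Fin 2) ℝ} {P : Fin M.Nh → TriField}
    (hP : M.Rep τ P) (I : Set (Fin M.N)) :
    (∀ᵐ x ∂(volume.restrict M.Ω), x ∉ (⋃ k ∈ I, M.K k) → τ x = 0) ↔
      ∀ t, κ t ∉ I → P t = 0 := by
  constructor
  · intro h t ht
    funext c a b
    refine hM.eq_zero_of_ae (t := t) (c := c) ?_
    filter_upwards [h] with x hx hx'
    rw [← hP t c x hx', hx]
    · rfl
    · simp only [Set.mem_iUnion, not_exists]
      intro k hk hxk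
      exact ht (hM.eq_of_mem_part hγ hκ hx' hxk ▸ hk)
  · intro h
    filter_upwards [hM.ae_mem_part] with x ⟨⟨t, c⟩, hx⟩ hx'
    have ht : κ t ∉ I := fun hk => hx' (Set.mem_iUnion₂.2 ⟨_, hk, hM.part_subset_K hκ _ hx⟩)
    ext a b
    rw [hP t c x hx, h t ht]
    simp

theorem IsRegular.repU_supp_iff {v : Plane → Plane} {V : DispSpace M r}
    (hV : M.RepU v V) (I : Set (Fin M.N)) :
    (∀ᵐ x ∂(volume.restrict M.Ω), x ∉ (⋃ k ∈ I, M.K k) → v x = 0) ↔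
      ∀ t, κ t ∉ I → V t = 0 := by
  constructor
  · intro h t ht
    funext a
    refine Subtype.ext (hM.eq_zero_of_ae (t := t) (c := 0) ?_)
    filter_upwards [h] with x hx hx'
    rw [← hV t 0 x hx', hx]
    · rfl
    · simp only [Set.mem_iUnion, not_exists]
      intro k hk hxk
      exact ht (hM.eq_of_mem_part hγ hκ hx' hxk ▸ hk)
  · intro h
    filter_upwards [hM.ae_mem_part] with x ⟨⟨t, c⟩, hx⟩ hx'
    have ht : κ t ∉ I := fun hk => hx' (Set.mem_iUnion₂.2 ⟨_, hk, hM.part_subset_K hκ _ hx⟩)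
    ext a
    rw [hV t c x hx, h t ht]
    simp

end

end TwoScaleMesh

end Elast

/-! ### Layers, and the mixed system of the discrete spaces. -/

namespace Elast

open MvPolynomial MeasureTheory

namespace MixedSystem

variable {S U : Type*} [AddCommGroup S] [Module ℝ S] [AddCommGroup U] [Module ℝ U] {N : ℕ}
  (X : MixedSystem S U N)

/-- The form of two combinations of eigenfunctions. -/
theorem sum_s_comb {ℓ : Fin N → ℕ} (hℓ : ∀ k, ℓ k < X.L k) (c e : Fin N → ℕ → ℝ) :
    ∑ m, X.s m (∑ k, ∑ j ∈ Finset.range (ℓ k), c k j • X.p k j)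
      (∑ k, ∑ j ∈ Finset.range (ℓ k), e k j • X.p k j) =
    ∑ k, ∑ j ∈ Finset.range (ℓ k), c k j * e k j := by
  have hL : ∀ {k j}, j ∈ Finset.range (ℓ k) → j < X.L k := fun {k j} hj =>
    (Finset.mem_range.1 hj).trans (hℓ k)
  have h1 : ∀ (c : Fin N → ℕ → ℝ) m y,
      X.s m (∑ k, ∑ j ∈ Finset.range (ℓ k), c k j • X.p k j) y =
        ∑ j ∈ Finset.range (ℓ m), c m j * X.s m (X.p m j) y := fun c m y => by
    simp only [map_sum, map_smul, LinearMap.sum_apply, LinearMap.smul_apply, smul_eq_mul]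
    refine Fintype.sum_eq_single m fun k hk => Finset.sum_eq_zero fun j hj => ?_
    rw [form_eq_zero (X.s_symm m) (X.s_nonneg m) (X.p_supp k j (hL hj) m hk.symm), mul_zero]
  refine Finset.sum_congr rfl fun m _ => ?_
  rw [h1]
  refine Finset.sum_congr rfl fun j hj => ?_
  rw [X.s_symm, h1, Finset.sum_eq_single j]
  · rw [X.orthonormal m j (hL hj) j (hL hj), if_pos rfl, mul_one]
  · intro j' hj' h
    rw [X.orthonormal m j' (hL hj') j (hL hj), if_neg h, mul_zero]
  · exact fun h => absurd hj h

end MixedSystem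

namespace TwoScaleMesh

variable {M : TwoScaleMesh} {γ : ℝ} {r : ℕ}

section Layers

variable (M) in
open Classical in
/-- The number of the layer around `K_i` that contains `K_k`, and `l + 1` beyond the `l`-th. -/
noncomputable def layerDist (i : Fin M.N) (l : ℕ) (k : Fin M.N) : ℕ :=
  ((Finset.range (l + 1)).filter fun m => k ∉ M.layer i m).card

theorem layer_mono (i : Fin M.N) : Monotone (M.layer i) :=
  monotone_nat_of_le_succ fun _ k hk => ⟨k, hk, _, quad_mem_K k 0, quad_mem_K k 0⟩

theorem mem_layer_self (i : Fin M.N) (m : ℕ) : i ∈ M.layer i m :=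
  layer_mono i (Nat.zero_le m) rfl

theorem layerDist_self (i : Fin M.N) (l : ℕ) : M.layerDist i l i = 0 := by
  simp [layerDist, mem_layer_self]

theorem layerDist_of_notMem {i : Fin M.N} {l : ℕ} {k : Fin M.N} (h : k ∉ M.layer i l) :
    M.layerDist i l k = l + 1 := by
  classical
  rw [layerDist, Finset.filter_true_of_mem, Finset.card_range]
  exact fun m hm hk => h (layer_mono i (Nat.lt_succ_iff.1 (Finset.mem_range.1 hm)) hk)

/-- If K_j lies in layer m, its neighbour K_k lies in layer m + 1. So an index missing for k is 0 or
the successor of an index missing for j. -/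
theorem layerDist_le (i : Fin M.N) (l : ℕ) {k j : Fin M.N} (h : (M.K k ∩ M.K j).Nonempty) :
    M.layerDist i l k ≤ M.layerDist i l j + 1 := by
  classical
  rw [layerDist, layerDist]
  refine (Finset.card_le_card (t := insert 0 (((Finset.range (l + 1)).filter
    fun m => j ∉ M.layer i m).image Nat.succ)) fun m hm => ?_).trans
    ((Finset.card_insert_le _ _).trans (Nat.add_le_add_right Finset.card_image_le 1))
  rw [Finset.mem_filter, Finset.mem_range] at hm
  rw [Finset.mem_insert]
  rcases m with _ | m
  · exact Or.inl rfl
  · refine Or.inr (Finset.mem_image.2 ⟨m, Finset.mem_filter.2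
      ⟨Finset.mem_range.2 (by omega), fun hj => hm.2 ⟨j, hj, h⟩⟩, rfl⟩)

end Layers

section RepLinear

theorem Rep.sub {σ τ : Plane → Matrix (Fin 2) (Fin 2) ℝ} {P Q : M.sigmaSpace r}
    (h : M.Rep σ P) (h' : M.Rep τ Q) : M.Rep (σ - τ) ((P - Q : M.sigmaSpace r)) :=
  fun t c x hx a b => by
    change σ x a b - τ x a b = pev x (P.1 t c a b - Q.1 t c a b)
    rw [h t c x hx, h' t c x hx, map_sub]

theorem RepU.sub {u v : Plane → Plane} {U V : DispSpace M r} (h : M.RepU u U) (h' : M.RepU v V) :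
    M.RepU (u - v) (U - V) := fun t c x hx a => by
  change u x a - v x a = pev x ((U t a : Poly2) - (V t a : Poly2))
  rw [h t c x hx, h' t c x hx, map_sub]

theorem RepU.smul {u : Plane → Plane} {U : DispSpace M r} (h : M.RepU u U) (e : ℝ) :
    M.RepU (fun x => e • u x) (e • U) := fun t c x hx a => by
  change e * u x a = pev x (e • (U t a : Poly2))
  rw [h t c x hx, pev_smul]

theorem RepU.sum {ι : Type*} {J : Finset ι} {u : ι → Plane → Plane} {U : ι → DispSpace M r}
    (h : ∀ j ∈ J, M.RepU (u j) (U j)) : M.RepU (fun x => ∑ j ∈ J, u j x) (∑ j ∈ J, U j) := by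
  classical
  induction J using Finset.induction_on with
  | empty => intro t c x hx a; simp
  | insert j J hj ih =>
    intro t c x hx a
    simp only [Finset.sum_insert hj]
    have h1 := ih (fun j hj => h j (Finset.mem_insert_of_mem hj)) t c x hx a
    have h2 := h j (Finset.mem_insert_self j J) t c x hx a
    change u j x a + (∑ j ∈ J, u j x) a =
      pev x ((U j t a : Poly2) + ((∑ j ∈ J, U j) t a : Poly2))
    rw [h1, h2, map_add]

end RepLinear

section

variable (hM : M.IsRegular γ) (hγ : 0 < γ) {κ : Fin M.Nh → Fin M.N} (hκ : ∀ t, M.T t ⊆ M.K (κ t))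
  {lam mu : Plane → ℝ} {lt mt : Fin M.Nh → ℝ}
  (hl : ∀ t, ∀ x ∈ interior (M.T t), lam x = lt t) (hm : ∀ t, ∀ x ∈ interior (M.T t), mu x = mt t)
  (hl0 : ∀ t, 0 ≤ lt t) (hm0 : ∀ t, 0 < mt t)

include hM hγ hκ

theorem IsRegular.memSigmaOn_iff {τ : Plane → Matrix (Fin 2) (Fin 2) ℝ} {P : M.sigmaSpace r}
    (hP : M.Rep τ P) (I : Set (Fin M.N)) :
    MemSigmaOn M r (⋃ k ∈ I, M.K k) τ ↔ ∀ t, κ t ∉ I → P.1 t = 0 := by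
  rw [MemSigmaOn, hM.rep_supp_iff hγ hκ hP]
  exact and_iff_right (hM.memSigma hP)

theorem IsRegular.memSigmaOn_K_iff {τ : Plane → Matrix (Fin 2) (Fin 2) ℝ} {P : M.sigmaSpace r}
    (hP : M.Rep τ P) (k : Fin M.N) :
    MemSigmaOn M r (M.K k) τ ↔ ∀ t, κ t ≠ k → P.1 t = 0 := by
  simpa using hM.memSigmaOn_iff hγ hκ hP {k}

theorem IsRegular.memUOn_K_iff {v : Plane → Plane} (hv : MemU M r v) {V : DispSpace M r}
    (hV : M.RepU v V) (k : Fin M.N) :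
    MemUOn M r (M.K k) v ↔ ∀ t, κ t ≠ k → V t = 0 := by
  rw [MemUOn]
  rw [and_iff_right hv]
  simpa using hM.repU_supp_iff hγ hκ hV {k}

include hl hm hl0 hm0

/-- The abstract mixed system of the discrete spaces with given spectral bases. -/
theorem IsRegular.exists_mixedSystem {L : Fin M.N → ℕ}
    {φ : Fin M.N → ℕ → Plane → Matrix (Fin 2) (Fin 2) ℝ} {p : Fin M.N → ℕ → Plane → Plane}
    {ev : Fin M.N → ℕ → ℝ}
    (hsp : ∀ i, IsSpectralBasis M r lam mu i (L i) (φ i) (p i) (ev i)) :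
    ∃ X : MixedSystem (M.sigmaSpace r) (DispSpace M r) M.N, X.a = discA κ lt mt ∧
      X.s = discS κ lt mt ∧ X.D = discD lt mt ∧ X.L = L ∧ X.ev = ev ∧
      ∀ k, ∀ j < L k, M.RepU (p k j) (X.p k j) := by
  have hkT : ∀ t, 0 < kT lt mt t := fun t => by
    have := hM.H_pos (κ t)
    have := hl0 t
    have := hm0 t
    rw [kT]
    positivity
  have hk0 : ∀ t, kT lt mt t ≠ 0 := fun t => (hkT t).ne'
  -- Only indices below L k carry data; zero is used beyond.
  have h1 : ∀ k j, ∃ P : M.sigmaSpace r, j < L k → M.Rep (φ k j) P := fun k j => by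
    by_cases h : j < L k
    · obtain ⟨P, hP⟩ := hM.exists_rep ((hsp k).memSigma j h).1
      exact ⟨P, fun _ => hP⟩
    · exact ⟨0, fun h' => absurd h' h⟩
  have h2 : ∀ k j, ∃ V : DispSpace M r, j < L k → M.RepU (p k j) V := fun k j => by
    by_cases h : j < L k
    · obtain ⟨P, hP⟩ := hM.exists_repU ((hsp k).memU j h).1
      exact ⟨P, fun _ => hP⟩
    · exact ⟨0, fun h' => absurd h' h⟩
  choose Φ hΦ using h1
  choose Q hQ using h2
  have hΦ0 : ∀ k, ∀ j < L k, ∀ m, m ≠ k → ∀ t, κ t = m → (Φ k j).1 t = 0 :=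
    fun k j hj m hm t ht => (hM.memSigmaOn_K_iff hγ hκ (hΦ k j hj) k).1 ((hsp k).memSigma j hj) t
      (ht ▸ hm)
  have hne := hM.cross3_ne
  have hA := @discA_self_eq_zero M r κ lt mt hne hl0 hm0
  have hS := @discS_self_eq_zero M r κ lt mt hne hkT
  refine ⟨{ a := discA κ lt mt, s := discS κ lt mt, D := discD lt mt
            a_symm := discA_symm κ lt mt
            a_nonneg := discA_nonneg hl0 hm0
            s_symm := discS_symm κ lt mt
            s_nonneg := discS_nonneg hkT
            restrict := exists_restrict hne hkT
            L := L, φ := Φ, p := Q, ev := ev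
            φ_supp := fun k j hj m hm => hA.2 (hΦ0 k j hj m hm)
            Dφ_supp := fun k j hj m hm => hS.2 fun t ht => ?_
            p_supp := fun k j hj m hm => hS.2 fun t ht =>
              (hM.memUOn_K_iff hγ hκ ((hsp k).memU j hj).1 (hQ k j hj) k).1
                ((hsp k).memU j hj) t (ht ▸ hm)
            eq_stress := fun k j hj τ hτ => ?_
            eq_disp := fun k j hj V hV => ?_
            orthonormal := fun k j hj m hm' => ?_
            spans := fun k V hV => ?_ }, rfl, rfl, rfl, rfl, rfl, hQ⟩
  · funext a
    refine Subtype.ext ?_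
    rw [coe_discD, hΦ0 k j hj m hm t ht, map_zero, smul_zero]
    rfl
  · obtain ⟨f, hf, hfr⟩ := hM.exists_memSigma τ
    have h3 := (hsp k).eq_stress j hj f ((hM.memSigmaOn_K_iff hγ hκ hfr k).2 fun t ht =>
      hA.1 (hτ _ ht).1 t rfl)
    rwa [hM.formA_eq (κ := κ) hl hm hl0 hm0 (hΦ k j hj) hfr,
      hM.formL2_divT (κ := κ) hk0 hfr (hQ k j hj)] at h3
  · obtain ⟨f, hf, hfr⟩ := hM.exists_memU V
    have h3 := (hsp k).eq_disp j hj f ((hM.memUOn_K_iff hγ hκ hf hfr k).2 fun t ht =>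
      hS.1 (hV _ ht) t rfl)
    rwa [hM.sLoc_eq hl hm hγ hκ (hQ k j hj) hfr,
      hM.formL2_divT (κ := κ) hk0 (hΦ k j hj) hfr] at h3
  · rw [← hM.sLoc_eq hl hm hγ hκ (hQ k j hj) (hQ k m hm')]
    exact (hsp k).orthonormal j hj m hm'
  · obtain ⟨f, hf, hfr⟩ := hM.exists_memU V
    obtain ⟨c, hc⟩ := (hsp k).spans f ((hM.memUOn_K_iff hγ hκ hf hfr k).2 fun t ht =>
      hS.1 (hV _ ht) t rfl)
    refine ⟨c, hS.2 fun t _ => ?_⟩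
    have h3 := hfr.sub (RepU.sum (J := Finset.range (L k)) fun j hj =>
      (hQ k j (Finset.mem_range.1 hj)).smul (c j))
    -- With an empty set of elements the support criterion says that a field vanishing almost
    -- everywhere has zero polynomials.
    refine (hM.repU_supp_iff hγ hκ h3 ∅).1 ?_ t (Set.notMem_empty _)
    filter_upwards [hc] with x hx _
    simp [hx]

/-- The basis problem in the discrete spaces. -/
theorem IsRegular.solves {L ℓ : Fin M.N → ℕ} {p : Fin M.N → ℕ → Plane → Plane}
    {X : MixedSystem (M.sigmaSpace r) (DispSpace M r) M.N} (ha : X.a = discA κ lt mt)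
    (hs : X.s = discS κ lt mt) (hD : X.D = discD lt mt) (hL : X.L = L)
    (hp : ∀ k, ∀ j < L k, M.RepU (p k j) (X.p k j)) (hℓ : ∀ k, ℓ k < L k) {I : Set (Fin M.N)}
    {R : Set Plane} (hRI : ∀ᵐ x ∂(volume.restrict M.Ω), x ∈ R ↔ x ∈ ⋃ k ∈ I, M.K k)
    {i : Fin M.N} {j : ℕ} (hj : j < ℓ i) {ψ : Plane → Matrix (Fin 2) (Fin 2) ℝ}
    {q : Plane → Plane} (h : SolvesBasis M r lam mu ℓ p R (p i j) ψ q) {Ψ : M.sigmaSpace r}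
    (hΨ : M.Rep ψ Ψ) {Q : DispSpace M r} (hQ : M.RepU q Q) :
    X.Solves ℓ I (X.p i j) Ψ Q := by
  have hkT : ∀ t, 0 < kT lt mt t := fun t => by
    have := hM.H_pos (κ t)
    have := hl0 t
    have := hm0 t
    rw [kT]
    positivity
  have hk0 : ∀ t, kT lt mt t ≠ 0 := fun t => (hkT t).ne'
  have hne := hM.cross3_ne
  -- On one element vanishing of the stress entails vanishing of its divergence, so the support in
  -- energy is the support of the polynomials.
  have hBB : ∀ {k} {P : M.sigmaSpace r}, X.BB k P P = 0 ↔ ∀ t, κ t = k → P.1 t = 0 := by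
    intro k P
    rw [MixedSystem.BB_eq_zero_iff, ha, hs, hD, discA_self_eq_zero hne hl0 hm0,
      discS_self_eq_zero hne hkT]
    refine and_iff_left_of_imp fun h t ht => ?_
    funext a
    refine Subtype.ext ?_
    rw [coe_discD, h t ht, map_zero, smul_zero]
    rfl
  have hss : ∀ {k} {V : DispSpace M r}, X.s k V V = 0 ↔ ∀ t, κ t = k → V t = 0 := by
    intro k V
    rw [hs, discS_self_eq_zero hne hkT]
  have hσ : ∀ {τ : Plane → Matrix (Fin 2) (Fin 2) ℝ} {P : M.sigmaSpace r}, M.Rep τ P →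
      (MemSigmaOn M r R τ ↔ ∀ k ∉ I, X.BB k P P = 0) := by
    intro τ P hP
    -- The region matters only up to null sets of Ω, which covers both the whole plane and a union
    -- of elements.
    have h1 : MemSigmaOn M r R τ ↔ MemSigmaOn M r (⋃ k ∈ I, M.K k) τ :=
      and_congr_right fun _ => Filter.eventually_congr (hRI.mono fun x hx => by rw [hx])
    rw [h1, hM.memSigmaOn_iff hγ hκ hP]
    simp only [hBB]
    exact ⟨fun h k hk t ht => h t (ht ▸ hk), fun h t ht => h _ ht t rfl⟩
  have hu : ∀ {v : Plane → Plane} {V : DispSpace M r}, MemU M r v → M.RepU v V →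
      (MemUOn M r R v ↔ ∀ k ∉ I, X.s k V V = 0) := by
    intro v V hv hV
    have h1 : MemUOn M r R v ↔ ∀ᵐ x ∂(volume.restrict M.Ω), x ∉ (⋃ k ∈ I, M.K k) → v x = 0 :=
      (and_iff_right hv).trans (Filter.eventually_congr (hRI.mono fun x hx => by rw [hx]))
    rw [h1, hM.repU_supp_iff hγ hκ hV]
    simp only [hss]
    exact ⟨fun h k hk t ht => h t (ht ▸ hk), fun h t ht => h _ ht t rfl⟩
  have hpr : ∀ {v : Plane → Plane} {V : DispSpace M r}, M.RepU v V →
      M.RepU (auxProj M lam mu ℓ p v)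
        (∑ k, ∑ j ∈ Finset.range (ℓ k), X.s k V (X.p k j) • X.p k j) := by
    intro v V hV
    refine RepU.sum fun k _ => RepU.sum fun j hj => ?_
    have hj' := (Finset.mem_range.1 hj).trans (hℓ k)
    rw [hs, ← hM.sLoc_eq hl hm hγ hκ hV (hp k j hj')]
    exact (hp k j hj').smul _
  constructor
  · exact fun k hk => ⟨(hσ hΨ).1 h.memSigma k hk, (hu h.memU.1 hQ).1 h.memU k hk⟩
  · intro τ hτ
    obtain ⟨f, hf, hfr⟩ := hM.exists_memSigma τ
    have h3 := h.eq_stress f ((hσ hfr).2 hτ)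
    rwa [hM.formA_eq (κ := κ) hl hm hl0 hm0 hΨ hfr, hM.formL2_divT (κ := κ) hk0 hfr hQ,
      ← ha, ← hs, ← hD] at h3
  · intro V hV
    obtain ⟨f, hf, hfr⟩ := hM.exists_memU V
    have h3 := h.eq_disp f ((hu hf hfr).2 hV)
    rwa [hM.sForm_eq hl hm hγ hκ (hpr hQ) (hpr hfr), hM.formL2_divT (κ := κ) hk0 hΨ hfr,
      hM.sForm_eq hl hm hγ hκ (hp i j (hj.trans (hℓ i))) hfr, ← hs, ← hD,
      X.sum_s_comb (fun k => hL ▸ hℓ k)] at h3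

end

end TwoScaleMesh

end Elast

/-! ### Assembly and choice of the constants. -/

theorem mainTheorem3 (r : ℕ) (hr : 2 ≤ r) (γ : ℝ) (hγ : 0 < γ) :
    ∃ C : ℝ, 0 < C ∧
      ∀ (M : Elast.TwoScaleMesh), M.IsRegular γ →
      ∀ (lam mu : Plane → ℝ), M.IsPiecewiseConst lam → M.IsPiecewiseConst mu →
        (∀ x, 0 ≤ lam x) → (∀ x, 0 < mu x) →
      ∀ (L ℓ : Fin M.N → ℕ) (φ : Fin M.N → ℕ → Plane → Matrix (Fin 2) (Fin 2) ℝ)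
        (p : Fin M.N → ℕ → Plane → Plane) (ev : Fin M.N → ℕ → ℝ),
        (∀ i, Elast.IsSpectralBasis M r lam mu i (L i) (φ i) (p i) (ev i)) →
        (∀ i, 1 ≤ ℓ i ∧ ℓ i < L i) →
      ∀ Λ : ℝ, Λ = ⨅ i, ev i (ℓ i) → 0 < Λ →
      ∀ (i : Fin M.N) (j : ℕ), j < ℓ i →
      ∀ (l : ℕ), 2 ≤ l →
      ∀ (ψ ψms : Plane → Matrix (Fin 2) (Fin 2) ℝ) (q qms : Plane → Plane),
        Elast.SolvesBasis M r lam mu ℓ p Set.univ (p i j) ψ q →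
        Elast.SolvesBasis M r lam mu ℓ p (M.region i l) (p i j) ψms qms →
        Elast.sigmaNormSq M lam mu (ψ - ψms) + Elast.sNormSq M lam mu (q - qms) ≤
          C * (1 + 1 / Λ) * (1 + C⁻¹ * (1 + 1 / Λ) ^ (-(1 / 2) : ℝ)) ^ (1 - (l : ℝ)) *
            Elast.sNormSq M lam mu (p i j) := by
  obtain ⟨C₀, hC₀, hcut⟩ := Elast.TwoScaleMesh.exists_cutoff hr hγ
  -- With w = (1 + 1/Λ)^(-1/2) and α = w/A the smallness condition becomes 6C₀/A² ≤ 1/4, which holds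
  -- because A² ≥ A ≥ 24C₀.
  set A : ℝ := 24 * C₀ + 1 with hA
  have hA1 : 1 ≤ A := by linarith
  -- One constant for two purposes: it dominates the prefactor 20 of the abstract estimate, and its
  -- inverse is below 1/A in the rate.
  refine ⟨20 + A, by linarith, ?_⟩
  intro M hM lam mu hlam hmu hlam0 hmu0 L ℓ φ p ev hsp hℓ Λ hΛ hΛ0 i j hj l _ ψ ψms q qms h hms
  choose κ hκ using hM.fine_refines
  choose lt hlt using hlam
  choose mt hmt using hmu
  have hint : ∀ t, (interior (M.T t)).Nonempty := fun t =>
    Elast.interior_triangle_nonempty (hM.cross3_ne t)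
  have hlt0 : ∀ t, 0 ≤ lt t := fun t => by
    obtain ⟨x, hx⟩ := hint t
    exact hlt t x hx ▸ hlam0 x
  have hmt0 : ∀ t, 0 < mt t := fun t => by
    obtain ⟨x, hx⟩ := hint t
    exact hmt t x hx ▸ hmu0 x
  have hkT : ∀ t, Elast.TwoScaleMesh.kT lt mt t ≠ 0 := fun t => by
    have := hM.H_pos (κ t)
    have := hlt0 t
    have := hmt0 t
    rw [Elast.TwoScaleMesh.kT]
    positivity
  obtain ⟨X, ha, hs, hD, hL, hev, hp⟩ :=
    hM.exists_mixedSystem hγ hκ hlt hmt hlt0 hmt0 hsp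
  obtain ⟨Ψ, hΨ⟩ := hM.exists_rep h.memSigma.1
  obtain ⟨Ψ', hΨ'⟩ := hM.exists_rep hms.memSigma.1
  obtain ⟨Q, hQ⟩ := hM.exists_repU h.memU.1
  obtain ⟨Q', hQ'⟩ := hM.exists_repU hms.memU.1
  have hS : X.Solves ℓ Set.univ (X.p i j) Ψ Q := by
    refine hM.solves hγ hκ hlt hmt hlt0 hmt0 ha hs hD hL hp (fun k => (hℓ k).2) ?_ hj h hΨ hQ
    -- The global problem is the one posed on all coarse elements, which cover Ω up to a null set.
    filter_upwards [hM.ae_mem_part] with x ⟨a, hx⟩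
    exact iff_of_true (Set.mem_univ x)
      (Set.mem_iUnion₂.2 ⟨_, Set.mem_univ _, hM.part_subset_K hκ a hx⟩)
  have hS' : X.Solves ℓ (M.layer i l) (X.p i j) Ψ' Q' :=
    hM.solves hγ hκ hlt hmt hlt0 hmt0 ha hs hD hL hp (fun k => (hℓ k).2)
      (Filter.Eventually.of_forall fun x => Iff.rfl) hj hms hΨ' hQ'
  have hcut' : X.HasCutoff C₀ (M.layerDist i l) := by
    intro f τ
    obtain ⟨τ', hτ'⟩ := hcut M hM κ hκ lt mt hlt0 hmt0 (M.layerDist i l)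
      (fun k k' => Elast.TwoScaleMesh.layerDist_le i l) f τ
    refine ⟨τ', fun k => ?_⟩
    rw [Elast.MixedSystem.BB_apply, ha, hs, hD]
    exact hτ' k
  set w : ℝ := (1 + 1 / Λ) ^ (-(1 / 2) : ℝ) with hw
  have hΛ1 : 0 < 1 + 1 / Λ := by positivity
  have hw0 : 0 < w := Real.rpow_pos_of_pos hΛ1 _
  have hw2 : (1 + 1 / Λ) * w ^ 2 = 1 := by
    rw [hw, ← Real.rpow_natCast, ← Real.rpow_mul hΛ1.le]
    norm_num [Real.rpow_neg_one]
    field_simp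
  have herr := hS.error_le (α := w / A) (Λ := Λ) hC₀ hcut'
    (fun k hk => Elast.TwoScaleMesh.layerDist_of_notMem hk) hS'
    (Elast.TwoScaleMesh.mem_layer_self i l) (Elast.TwoScaleMesh.layerDist_self i l)
    (fun k => hL ▸ (hℓ k).2) hj hΛ0
    -- Eigenvalues are numbered from 0, so ev k (ℓ k) is the first one not used in π; sortedness
    -- extends the bound to all later ones.
    (fun k j' h1 h2 => by
      rw [hev]
      exact (hΛ ▸ ciInf_le (Set.finite_range _).bddBelow k).trans
        ((hsp k).sorted _ _ h1 (hL ▸ h2)))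
    (by positivity)
    (by
      have e : 6 * C₀ * (1 + 1 / Λ) * (w / A) ^ 2 = 6 * C₀ * ((1 + 1 / Λ) * w ^ 2) / A ^ 2 := by
        rw [div_pow, mul_div_assoc', mul_assoc]
      rw [e, hw2, div_le_div_iff₀ (by positivity) (by norm_num)]
      nlinarith)
  have e1 : Elast.sigmaNormSq M lam mu (ψ - ψms) = ∑ k, X.BB k (Ψ - Ψ') (Ψ - Ψ') := by
    rw [hM.sigmaNormSq_eq (κ := κ) hlt hmt hlt0 hmt0 hkT (hΨ.sub hΨ')]
    simp only [Elast.MixedSystem.BB_apply, ha, hs, hD]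
  have e2 : Elast.sNormSq M lam mu (q - qms) = ∑ k, X.s k (Q - Q') (Q - Q') := by
    rw [Elast.sNormSq, hM.sForm_eq hlt hmt hγ hκ (hQ.sub hQ') (hQ.sub hQ'), hs]
  have hjL : j < L i := hj.trans (hℓ i).2
  have e3 : Elast.sNormSq M lam mu (p i j) = X.s i (X.p i j) (X.p i j) := by
    rw [Elast.sNormSq, hM.sForm_eq hlt hmt hγ hκ (hp i j hjL) (hp i j hjL), ← hs,
      X.sum_s_of_supp (X.p_supp i j (hL ▸ hjL))]
  rw [e1, e2, e3]
  refine herr.trans (mul_le_mul_of_nonneg_right ?_ (X.s_nonneg _ _))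
  have hβ : (20 + A)⁻¹ * w ≤ w / A := by
    rw [mul_comm, ← div_eq_mul_inv]
    exact div_le_div_of_nonneg_left hw0.le (by linarith) (by linarith)
  have hβ0 : 0 ≤ (20 + A)⁻¹ * w := by positivity
  -- First the base is decreased, then the exponent -l is raised to 1 - l, which is allowed because
  -- the base is at least 1.
  have h1 : ((1 + w / A) ^ l)⁻¹ ≤ (1 + (20 + A)⁻¹ * w) ^ (1 - (l : ℝ)) :=
    calc ((1 + w / A) ^ l)⁻¹ ≤ ((1 + (20 + A)⁻¹ * w) ^ l)⁻¹ := by gcongr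
      _ = (1 + (20 + A)⁻¹ * w) ^ (-(l : ℝ)) := by
        rw [Real.rpow_neg (by linarith), Real.rpow_natCast]
      _ ≤ _ := Real.rpow_le_rpow_of_exponent_le (by linarith) (by linarith)
  have h2 : 0 ≤ ((1 + w / A) ^ l)⁻¹ := by positivity
  gcongr
  linarith
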